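/- **Setting.** Let $p$ be a prime and let $A_p=\mathbb Z[\frac1p,e^{2\pi i/p}]\subseteq\mathbb C$. Let $Q$ be a commutative Noetherian $A_p$-algebra. For $f\in Q$, a *matrix factorization* of $f$ is a finitely generated projective $\mathbb Z/2$-graded $Q$-module $P=P_0\oplus P_1$ with an odd $Q$-linear endomorphism $d$ such that $d^2=f\cdot\mathrm{id}_P$; it is also written $(\alpha\colon P_1\to P_0,\ \beta\colon P_0\to P_1)$. Morphisms are the degree-zero $Q$-linear maps that commute with $d$. A homotopy between $g_1,g_2\colon P\to P'$ is an odd $Q$-linear map $h\colon P\to P'$ with $d_{P'}h+hd_P=g_1-g_2$. The support of $P$ is the set of primes $\mathfrak p$ such that $P_{\mathfrak p}$ is not homotopy equivalent to $0$. For a closed subset $Z\subseteq\operatorname{Spec}Q$, $\mathrm{mf}^Z(Q,f)$ is the category of matrix factorizations of $f$ with support contained in $Z$. Its Grothendieck group $K_0(\mathrm{mf}^Z(Q,f))$ is generated by the classes $[P]$, subject to $[P]=[P']+[P'']$ for every short exact sequence $0\to P'\to P\to P''\to0$ and $[P]=[P']$ whenever $P$ and $P'$ are homotopy equivalent. The tensor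 product of $P$ and $P'$ is graded by $|x\otimes y|=|x|+|y|$ and has differential $d(x\otimes y)=dx\otimes y+(-1)^{|x|}x\otimes dy$. **The operation.** Let the cycle $\sigma=(1\,2\cdots p)$ act on the $p$-fold tensor power $T^p(P)$ by permuting the factors with the Koszul sign, $\sigma(x_1\otimes\cdots\otimes x_p)=(-1)^{|x_p|(|x_1|+\cdots+|x_{p-1}|)}\,x_p\otimes x_1\otimes\cdots\otimes x_{p-1}$. For a $p$-th root of unity $\zeta$, with image in $Q$ also written $\zeta$, let $T^p(P)^{(\zeta)}=\ker(\sigma-\zeta)$, a matrix factorization of $pf$. Let $\mathrm{mult}_{1/p}$ be the functor $(\alpha,\beta)\mapsto(\alpha,\frac1p\beta)$ from factorizations of $pf$ to factorizations of $f$. The cyclic Adams operation is $$\psi^p_{cyc}=\sum_{\zeta}\zeta\,t^p_\zeta,\qquad t^p_\zeta([P])=\bigl[\mathrm{mult}_{1/p}\bigl(T^p(P)^{(\zeta)}\bigr)\bigr],$$ where $\zeta$ runs over all $p$-th roots of unity. The sum is formed in $\mathbb Z[e^{2\pi i/p}]\otimes_{\mathbb Z}K_0(\mathrm{mf}^Z(Q,f))$.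 **Theorem.** For every $f\in Q$ and every closed $Z\subseteq\operatorname{Spec}Q$, every element of $K_0(\mathrm{mf}^Z(Q,f))$ is the class of an object, the maps $t^p_\zeta\colon K_0(\mathrm{mf}^Z(Q,f))\to K_0(\mathrm{mf}^Z(Q,f))$ are well defined, the map $y\mapsto1\otimes y$ from $K_0(\mathrm{mf}^Z(Q,f))$ to $\mathbb Z[e^{2\pi i/p}]\otimes K_0(\mathrm{mf}^Z(Q,f))$ is injective, and $\sum_\zeta\zeta\,t^p_\zeta$ takes values in its image. So $\psi^p_{cyc}$ is a well-defined map from $K_0(\mathrm{mf}^Z(Q,f))$ to itself. Moreover: 1. $\psi^p_{cyc}$ is a group endomorphism of $K_0(\mathrm{mf}^Z(Q,f))$. 2. For $f_1,f_2\in Q$ and closed $Z,W\subseteq\operatorname{Spec}Q$, the tensor product induces a biadditive map $\cup\colon K_0(\mathrm{mf}^Z(Q,f_1))\times K_0(\mathrm{mf}^W(Q,f_2))\to K_0(\mathrm{mf}^{Z\cap W}(Q,f_1+f_2))$, and $\psi^p_{cyc}(a\cup b)=\psi^p_{cyc}(a)\cup\psi^p_{cyc}(b)$ for all $a,b$. 3.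 Let $\rho\colon Q\to Q'$ be a map of commutative Noetherian $A_p$-algebras, $\tilde\rho\colon\operatorname{Spec}Q'\to\operatorname{Spec}Q$ the induced map, and $Z\subseteq\operatorname{Spec}Q$, $Z'\subseteq\operatorname{Spec}Q'$ closed subsets with $\tilde\rho^{-1}(Z)\subseteq Z'$. Then extension of scalars along $\rho$ induces a homomorphism $K_0(\mathrm{mf}^Z(Q,f))\to K_0(\mathrm{mf}^{Z'}(Q',\rho(f)))$, and it commutes with $\psi^p_{cyc}$. 4. If $f=gh$ with $g,h\in Q$, then the matrix factorization $(g,h)=(Q\xrightarrow{g}Q,\ Q\xrightarrow{h}Q)$ is an object of $\mathrm{mf}^{V(g,h)}(Q,f)$, and $\psi^p_{cyc}[(g,h)]=p\,[(g,h)]$ in $K_0(\mathrm{mf}^{V(g,h)}(Q,f))$. -/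

import Mathlib

open scoped TensorProduct

universe u

noncomputable section

namespace AdamsMF

/-- A matrix factorization of `f`: a finitely generated projective `ℤ/2`-graded `Q`-module
`P = P₀ ⊕ P₁` with an odd endomorphism `d` such that `d² = f`. The grading is recorded by the
idempotent `even`, the projection onto `P₀` along `P₁`. -/
structure MF (Q : Type u) [CommRing Q] (f : Q) : Type (u + 1) where
  carrier : Type u
  [instAddCommGroup : AddCommGroup carrier]
  [instModule : Module Q carrier]
  [instFinite : Module.Finite Q carrier]
  [instProjective : Module.Projective Q carrier]
  even : Module.End Q carrier
  d : Module.End Q carrier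
  even_mul_even : even * even = even
  d_mul_even : d * even = (1 - even) * d
  d_mul_d : d * d = f • (1 : Module.End Q carrier)

attribute [instance] MF.instAddCommGroup MF.instModule MF.instFinite MF.instProjective

namespace MF

section Basic

variable {Q : Type u} [CommRing Q] {f f₁ f₂ : Q}

/-- The projection onto the odd part. -/
def odd (P : MF Q f) : Module.End Q P.carrier := 1 - P.even

/-- The sign operator `x ↦ (-1)^{|x|} x`. -/
def sgn (P : MF Q f) : Module.End Q P.carrier := P.even - P.odd

/-- Morphisms: degree-zero linear maps that commute with the differentials. -/
structure IsHom {P P' : MF Q f} (g : P.carrier →ₗ[Q] P'.carrier) : Prop where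
  comm_even : g ∘ₗ P.even = P'.even ∘ₗ g
  comm_d : g ∘ₗ P.d = P'.d ∘ₗ g

/-- Linear maps of odd degree. -/
def IsOdd {P P' : MF Q f} (h : P.carrier →ₗ[Q] P'.carrier) : Prop :=
  h ∘ₗ P.even = P'.odd ∘ₗ h

/-- Homotopy of morphisms. -/
def Homotopic {P P' : MF Q f} (g₁ g₂ : P.carrier →ₗ[Q] P'.carrier) : Prop :=
  ∃ h : P.carrier →ₗ[Q] P'.carrier, IsOdd h ∧ P'.d ∘ₗ h + h ∘ₗ P.d = g₁ - g₂

/-- Homotopy equivalence of matrix factorizations. -/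
def HtpyEquiv (P P' : MF Q f) : Prop :=
  ∃ (g : P.carrier →ₗ[Q] P'.carrier) (g' : P'.carrier →ₗ[Q] P.carrier),
    IsHom g ∧ IsHom g' ∧
    Homotopic (P := P) (P' := P) (g' ∘ₗ g) LinearMap.id ∧
    Homotopic (P := P') (P' := P') (g ∘ₗ g') LinearMap.id

/-- `0 → P' → P → P'' → 0` is a short exact sequence of matrix factorizations. -/
structure IsShortExact {P' P P'' : MF Q f} (i : P'.carrier →ₗ[Q] P.carrier)
    (q : P.carrier →ₗ[Q] P''.carrier) : Prop where
  isHom_left : IsHom i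
  isHom_right : IsHom q
  injective : Function.Injective i
  exact : Function.Exact i q
  surjective : Function.Surjective q

/-- The zero matrix factorization. -/
def zero (f : Q) : MF Q f where
  carrier := PUnit.{u + 1}
  even := 0
  d := 0
  even_mul_even := by simp
  d_mul_even := by simp
  d_mul_d := by ext

/-- The unit matrix factorization of `0`: `Q` in even degree. -/
def unit (Q : Type u) [CommRing Q] : MF Q 0 where
  carrier := Q
  even := 1
  d := 0
  even_mul_even := by simp
  d_mul_even := by simp
  d_mul_d := by simp

/-- The same matrix factorization, for an element equal to `f`. -/
def ofEq (P : MF Q f₁) (h : f₁ = f₂) : MF Q f₂ where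
  carrier := P.carrier
  even := P.even
  d := P.d
  even_mul_even := P.even_mul_even
  d_mul_even := P.d_mul_even
  d_mul_d := h ▸ P.d_mul_d

/-- The rank-one factorization `(g : Q → Q, h : Q → Q)` of `g * h`: the odd summand (second
coordinate) maps to the even summand (first coordinate) by `g`, and back by `h`. -/
def rankOne (g h : Q) : MF Q (g * h) where
  carrier := Q × Q
  even := LinearMap.inl Q Q Q ∘ₗ LinearMap.fst Q Q Q
  d := (LinearMap.inl Q Q Q ∘ₗ (g • LinearMap.snd Q Q Q)) +
    (LinearMap.inr Q Q Q ∘ₗ (h • LinearMap.fst Q Q Q))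
  even_mul_even := by ext <;> simp
  d_mul_even := by ext <;> simp
  d_mul_d := by ext <;> simp [mul_comm]

lemma even_apply_even (P : MF Q f) (x : P.carrier) : P.even (P.even x) = P.even x :=
  LinearMap.congr_fun P.even_mul_even x

lemma odd_apply (P : MF Q f) (x : P.carrier) : P.odd x = x - P.even x := rfl

lemma sgn_apply (P : MF Q f) (x : P.carrier) : P.sgn x = P.even x - (x - P.even x) := rfl

lemma d_apply_even (P : MF Q f) (x : P.carrier) : P.d (P.even x) = P.d x - P.even (P.d x) :=
  LinearMap.congr_fun P.d_mul_even x

lemma even_apply_d (P : MF Q f) (x : P.carrier) : P.even (P.d x) = P.d x - P.d (P.even x) := by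
  rw [d_apply_even]; abel

lemma d_apply_d (P : MF Q f) (x : P.carrier) : P.d (P.d x) = f • x :=
  LinearMap.congr_fun P.d_mul_d x

/-- The tensor product, with `|x ⊗ y| = |x| + |y|` and
`d (x ⊗ y) = d x ⊗ y + (-1)^{|x|} x ⊗ d y`. -/
def tensor (P : MF Q f₁) (P' : MF Q f₂) : MF Q (f₁ + f₂) where
  carrier := P.carrier ⊗[Q] P'.carrier
  even := TensorProduct.map P.even P'.even + TensorProduct.map P.odd P'.odd
  d := TensorProduct.map P.d 1 + TensorProduct.map P.sgn P'.d
  even_mul_even := by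
    ext x y
    simp [odd_apply, even_apply_even]
  d_mul_even := by
    ext x y
    simp [odd_apply, sgn_apply, even_apply_even, even_apply_d, TensorProduct.tmul_sub,
      TensorProduct.sub_tmul]
    abel
  d_mul_d := by
    ext x y
    simp [sgn_apply, even_apply_even, even_apply_d, d_apply_d, TensorProduct.sub_tmul,
      ← TensorProduct.smul_tmul']
    module

/-- The functor `(α, β) ↦ (α, u β)`, from factorizations of `f` to factorizations of `u f`
(an equivalence when `u` is a unit). -/
def mult (u : Q) (P : MF Q f) : MF Q (u * f) where
  carrier := P.carrier
  even := P.even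
  d := P.d * (P.odd + u • P.even)
  even_mul_even := P.even_mul_even
  d_mul_even := by
    ext x
    simp [odd_apply, even_apply_even, even_apply_d]
  d_mul_d := by
    ext x
    simp [odd_apply, even_apply_even, even_apply_d, d_apply_d, mul_smul]
    module

/-- Extension of scalars. -/
def baseChange (Q' : Type u) [CommRing Q'] [Algebra Q Q'] (P : MF Q f) :
    MF Q' (algebraMap Q Q' f) where
  carrier := Q' ⊗[Q] P.carrier
  even := P.even.baseChange Q'
  d := P.d.baseChange Q'
  even_mul_even := by
    ext x; simp [even_apply_even]
  d_mul_even := by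
    ext x; simp [even_apply_d, TensorProduct.tmul_sub]
  d_mul_d := by
    ext x; simp [d_apply_d]

/-- The support: the primes `𝔭` such that `P_𝔭` is not homotopy equivalent to `0`. -/
def support (P : MF Q f) : Set (PrimeSpectrum Q) :=
  {𝔭 | ¬ HtpyEquiv (P.baseChange (Localization.AtPrime 𝔭.asIdeal)) (zero _)}

/-- For a module with projection `e` onto the even part and an odd endomorphism `d`: the
endomorphism `h` is odd and `d h + h d` is multiplication by `s`. -/
structure IsContr {M : Type u} [AddCommGroup M] [Module Q M] (e d : Module.End Q M) (s : Q)
    (h : Module.End Q M) : Prop where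
  isOdd : h * e = (1 - e) * h
  eq : d * h + h * d = s • (1 : Module.End Q M)

namespace IsContr

variable {M : Type u} [AddCommGroup M] [Module Q M] {e d h : Module.End Q M} {s : Q}

lemma apply_even (H : IsContr e d s h) (x : M) : h (e x) = h x - e (h x) :=
  LinearMap.congr_fun H.isOdd x

lemma even_apply (H : IsContr e d s h) (x : M) : e (h x) = h x - h (e x) := by
  rw [H.apply_even]; abel

lemma d_apply (H : IsContr e d s h) (x : M) : d (h x) = s • x - h (d x) :=
  eq_sub_of_add_eq (LinearMap.congr_fun H.eq x)

lemma baseChange (H : IsContr e d s h) (Q' : Type u) [CommRing Q'] [Algebra Q Q'] :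
    IsContr (e.baseChange Q') (d.baseChange Q') (algebraMap Q Q' s)
      (LinearMap.baseChange Q' h) where
  isOdd := by
    ext x
    simp [H.even_apply, TensorProduct.tmul_sub]
  eq := by
    ext x
    simp [H.d_apply, TensorProduct.tmul_sub]

lemma of_isUnit (H : IsContr e d s h) (hs : IsUnit s) :
    ∃ h' : Module.End Q M, IsContr e d 1 h' := by
  obtain ⟨u, rfl⟩ := hs
  refine ⟨(↑u⁻¹ : Q) • h, ⟨?_, ?_⟩⟩
  · rw [smul_mul_assoc, H.isOdd, mul_smul_comm]
  · rw [mul_smul_comm, smul_mul_assoc, ← smul_add, H.eq, smul_smul, Units.inv_mul]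

/-- A contraction over the local ring at a prime comes, up to a scalar outside the prime, from an
endomorphism over `Q`. -/
lemma exists_of_localization [Module.Finite Q M] [Module.Projective Q M]
    (𝔭 : PrimeSpectrum Q) (he : e * e = e)
    {H : Module.End (Localization.AtPrime 𝔭.asIdeal) (Localization.AtPrime 𝔭.asIdeal ⊗[Q] M)}
    (HC : IsContr (e.baseChange (Localization.AtPrime 𝔭.asIdeal))
      (d.baseChange (Localization.AtPrime 𝔭.asIdeal)) 1 H) :
    ∃ s ∉ 𝔭.asIdeal, ∃ h : Module.End Q M, IsContr e d s h := by
  set L := Localization.AtPrime 𝔭.asIdeal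
  let ι : M →ₗ[Q] L ⊗[Q] M := TensorProduct.mk Q L M 1
  have : Module.FinitePresentation Q M := Module.finitePresentation_of_projective _ _
  let l : M →ₗ[Q] L ⊗[Q] M := (H.restrictScalars Q) ∘ₗ ι
  obtain ⟨h, s, hs⟩ := Module.FinitePresentation.exists_lift_of_isLocalizedModule
    𝔭.asIdeal.primeCompl ι l
  have hs' : ∀ x, ι (h x) = (s : Q) • H (ι x) := fun x => LinearMap.congr_fun hs x
  have hd : ∀ x, d.baseChange L (ι x) = ι (d x) := fun x => rfl
  have hee : ∀ x, e.baseChange L (ι x) = ι (e x) := fun x => rfl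
  have he' : ∀ x, e (e x) = e x := fun x => LinearMap.congr_fun he x
  let k : Module.End Q M := e * h * (1 - e) + (1 - e) * h * e
  have hk : ∀ x, ι (k x) = (s : Q) • H (ι x) := by
    intro x
    have e1 : k x = e (h x) - e (h (e x)) + (h (e x) - e (h (e x))) := by
      simp [k]
    have e2 : ∀ y, ι (e (h y)) = (s : Q) • (H (ι y) - H (ι (e y))) := by
      intro y
      have h2 := HC.even_apply (ι y)
      rw [hee] at h2
      have h3 : e.baseChange L ((s : Q) • H (ι y)) = (s : Q) • e.baseChange L (H (ι y)) :=
        ((e.baseChange L).restrictScalars Q).map_smul _ _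
      rw [← hee, hs', h3, h2]
    rw [e1, map_add, map_sub, map_sub, e2, e2, hs', he']
    module
  obtain ⟨t, ht⟩ := Module.Finite.exists_smul_of_comp_eq_of_isLocalizedModule
    𝔭.asIdeal.primeCompl ι (d * k + k * d) ((s : Q) • (1 : Module.End Q M)) (by
      ext x
      have h4 : ι (d (k x)) = (s : Q) • d.baseChange L (H (ι x)) := by
        rw [← hd, hk]
        exact ((d.baseChange L).restrictScalars Q).map_smul _ _
      have h5 := HC.d_apply (ι x)
      rw [hd, one_smul] at h5
      simp only [LinearMap.comp_apply, LinearMap.add_apply, Module.End.mul_apply, map_add,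
        LinearMap.smul_apply, map_smul, Module.End.one_apply]
      rw [h4, hk, h5]
      module)
  refine ⟨t * s, (t * s).2, (t : Q) • k, ⟨?_, ?_⟩⟩
  · rw [smul_mul_assoc, mul_smul_comm]
    congr 1
    ext x
    simp [k, he']
  · rw [mul_smul_comm, smul_mul_assoc, ← smul_add]
    have ht' : (t : Q) • (d * k + k * d) = (t : Q) • ((s : Q) • (1 : Module.End Q M)) := ht
    rw [ht', smul_smul]

lemma tensor_left {P : MF Q f₁} {h : Module.End Q P.carrier} (H : IsContr P.even P.d s h)
    (P' : MF Q f₂) :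
    IsContr (TensorProduct.map P.even P'.even + TensorProduct.map P.odd P'.odd)
      (TensorProduct.map P.d 1 + TensorProduct.map P.sgn P'.d) s (TensorProduct.map h 1) where
  isOdd := by
    ext x y
    simp [odd_apply, H.even_apply, TensorProduct.sub_tmul, TensorProduct.tmul_sub]
    abel
  eq := by
    ext x y
    simp [sgn_apply, H.even_apply, H.d_apply, TensorProduct.sub_tmul, TensorProduct.smul_tmul']
    abel

lemma tensor_right {P' : MF Q f₂} {h : Module.End Q P'.carrier} (H : IsContr P'.even P'.d s h)
    (P : MF Q f₁) :
    IsContr (TensorProduct.map P.even P'.even + TensorProduct.map P.odd P'.odd)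
      (TensorProduct.map P.d 1 + TensorProduct.map P.sgn P'.d) s (TensorProduct.map P.sgn h) where
  isOdd := by
    ext x y
    simp [odd_apply, sgn_apply, H.even_apply, even_apply_even, TensorProduct.sub_tmul,
      TensorProduct.tmul_sub]
    abel
  eq := by
    ext x y
    simp [sgn_apply, even_apply_d, even_apply_even, H.d_apply, TensorProduct.sub_tmul,
      TensorProduct.tmul_sub]
    module

lemma mult {P : MF Q f} {h : Module.End Q P.carrier} (H : IsContr P.even P.d s h) (u : Q) :
    IsContr P.even (P.d * (P.odd + u • P.even)) (u * s) (h * (P.odd + u • P.even)) where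
  isOdd := by
    ext x
    simp [odd_apply, H.even_apply, even_apply_even]
  eq := by
    ext x
    simp [odd_apply, H.even_apply, even_apply_even, even_apply_d, H.d_apply, mul_smul]
    module

end IsContr

lemma htpyEquiv_zero_iff (P : MF Q f) :
    HtpyEquiv P (zero f) ↔ ∃ h : Module.End Q P.carrier, IsContr P.even P.d 1 h := by
  constructor
  · rintro ⟨g, g', -, -, ⟨h, hodd, hh⟩, -⟩
    have h0 : g' ∘ₗ g = 0 := by
      have : g = 0 := by
        ext x; exact Subsingleton.elim (α := PUnit) _ _
      rw [this, LinearMap.comp_zero]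
    rw [h0] at hh
    refine ⟨-h, ⟨?_, ?_⟩⟩
    · have : h * P.even = (1 - P.even) * h := hodd
      rw [neg_mul, this, mul_neg]
    · have : P.d * h + h * P.d = 0 - 1 := hh
      rw [mul_neg, neg_mul, ← neg_add, this, one_smul]; simp
  · rintro ⟨h, H⟩
    refine ⟨0, 0, ⟨by simp, by simp⟩, ⟨by simp, by simp⟩, ⟨-h, ?_, ?_⟩, ⟨0, ?_, ?_⟩⟩
    · change -h * P.even = (1 - P.even) * -h
      rw [neg_mul, H.isOdd, mul_neg]
    · change P.d * -h + -h * P.d = _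
      rw [mul_neg, neg_mul, ← neg_add, H.eq, one_smul]
      simp [Module.End.one_eq_id]
    · simp [IsOdd]
    · ext x; exact Subsingleton.elim (α := PUnit) _ _

lemma notMem_support_iff (P : MF Q f) (𝔭 : PrimeSpectrum Q) :
    𝔭 ∉ P.support ↔
      ∃ s ∉ 𝔭.asIdeal, ∃ h : Module.End Q P.carrier, IsContr P.even P.d s h := by
  have h1 : 𝔭 ∉ P.support ↔
      HtpyEquiv (P.baseChange (Localization.AtPrime 𝔭.asIdeal)) (zero _) := not_not
  rw [h1, htpyEquiv_zero_iff]
  constructor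
  · rintro ⟨H, HC⟩
    exact IsContr.exists_of_localization 𝔭 P.even_mul_even HC
  · rintro ⟨s, hs, h, H⟩
    exact (H.baseChange _).of_isUnit (IsLocalization.map_units
      (Localization.AtPrime 𝔭.asIdeal) (⟨s, hs⟩ : 𝔭.asIdeal.primeCompl))

lemma support_subset {P : MF Q f₁} {T : Set (PrimeSpectrum Q)}
    (h : ∀ 𝔭 ∉ T, ∃ s ∉ 𝔭.asIdeal, ∃ h : Module.End Q P.carrier, IsContr P.even P.d s h) :
    P.support ⊆ T := by
  intro 𝔭 h𝔭
  by_contra hn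
  exact (notMem_support_iff _ _).2 (h 𝔭 hn) h𝔭

lemma support_zero : (zero f).support ⊆ ∅ :=
  support_subset fun 𝔭 _ => ⟨1, 𝔭.2.one_notMem, 0,
    ⟨by simp, by ext x; exact Subsingleton.elim (α := PUnit) _ _⟩⟩

lemma support_tensor (P : MF Q f₁) (P' : MF Q f₂) :
    (P.tensor P').support ⊆ P.support ∩ P'.support := by
  refine support_subset fun 𝔭 h𝔭 => ?_
  rw [Set.mem_inter_iff, not_and_or] at h𝔭
  rcases h𝔭 with hn | hn
  · obtain ⟨s, hs, h, H⟩ := (notMem_support_iff _ _).1 hn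
    exact ⟨s, hs, _, H.tensor_left P'⟩
  · obtain ⟨s, hs, h, H⟩ := (notMem_support_iff _ _).1 hn
    exact ⟨s, hs, _, H.tensor_right P⟩

lemma support_baseChange (Q' : Type u) [CommRing Q'] [Algebra Q Q'] (P : MF Q f) :
    (P.baseChange Q').support ⊆ PrimeSpectrum.comap (algebraMap Q Q') ⁻¹' P.support := by
  refine support_subset fun 𝔮 hn => ?_
  obtain ⟨s, hs, h, H⟩ := (notMem_support_iff P _).1 hn
  exact ⟨_, hs, _, H.baseChange Q'⟩

lemma support_rankOne (g h : Q) :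
    (rankOne g h).support ⊆ PrimeSpectrum.zeroLocus {g, h} := by
  have h1 : IsContr (M := Q × Q) (LinearMap.inl Q Q Q ∘ₗ LinearMap.fst Q Q Q)
      ((LinearMap.inl Q Q Q ∘ₗ (g • LinearMap.snd Q Q Q)) +
        (LinearMap.inr Q Q Q ∘ₗ (h • LinearMap.fst Q Q Q))) g
      (LinearMap.inr Q Q Q ∘ₗ LinearMap.fst Q Q Q) :=
    ⟨by ext <;> simp, by ext <;> simp⟩
  have h2 : IsContr (M := Q × Q) (LinearMap.inl Q Q Q ∘ₗ LinearMap.fst Q Q Q)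
      ((LinearMap.inl Q Q Q ∘ₗ (g • LinearMap.snd Q Q Q)) +
        (LinearMap.inr Q Q Q ∘ₗ (h • LinearMap.fst Q Q Q))) h
      (LinearMap.inl Q Q Q ∘ₗ LinearMap.snd Q Q Q) :=
    ⟨by ext <;> simp, by ext <;> simp⟩
  refine support_subset fun 𝔭 hn => ?_
  rw [PrimeSpectrum.mem_zeroLocus, Set.pair_subset_iff, not_and_or] at hn
  rcases hn with hn | hn
  · exact ⟨g, hn, _, h1⟩
  · exact ⟨h, hn, _, h2⟩

/-! ### Tensor powers and the action of the `p`-cycle -/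

/-- The `n`-th tensor power `P ⊗ (P ⊗ (⋯ ⊗ Q))`, a factorization of `n f`. -/
def tpow (P : MF Q f) : (n : ℕ) → MF Q ((n : Q) * f)
  | 0 => (unit Q).ofEq (by simp)
  | n + 1 => (P.tensor (P.tpow n)).ofEq (by push_cast; ring)

/-- The signed transposition of the first two factors:
`x ⊗ (y ⊗ z) ↦ (-1)^{|x||y|} y ⊗ (x ⊗ z)`. -/
def swap (P : MF Q f) (N : Type u) [AddCommGroup N] [Module Q N] :
    Module.End Q (P.carrier ⊗[Q] (P.carrier ⊗[Q] N)) :=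
  (TensorProduct.leftComm Q P.carrier P.carrier N).toLinearMap ∘ₗ
    (1 - (2 : Q) • TensorProduct.map P.odd (TensorProduct.map P.odd 1))

/-- The signed cyclic permutation of the `n + 1` factors of `P ⊗ T^n P` that moves the last factor
to the front, as the product of the signed transpositions `(1 2) (2 3) ⋯ (n n+1)`. -/
def cyc (P : MF Q f) : (n : ℕ) → Module.End Q (P.carrier ⊗[Q] (P.tpow n).carrier)
  | 0 => 1
  | n + 1 => P.swap (P.tpow n).carrier * TensorProduct.map 1 (P.cyc n)

/-- The action of the cycle `σ = (1 2 ⋯ n)` on the `n`-th tensor power,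
`σ (x₁ ⊗ ⋯ ⊗ xₙ) = ± xₙ ⊗ x₁ ⊗ ⋯ ⊗ xₙ₋₁`. -/
def rot (P : MF Q f) : (n : ℕ) → Module.End Q (P.tpow n).carrier
  | 0 => 1
  | n + 1 => P.cyc n

/-! Commutation of the cycle with the grading and with derivations of the tensor power. -/

section Swap

variable (P : MF Q f) {N : Type u} [AddCommGroup N] [Module Q N]

/-- The even projection of `P ⊗ N`, if `b` is the one of `N`. -/
def tEven (b : Module.End Q N) : Module.End Q (P.carrier ⊗[Q] N) :=
  TensorProduct.map P.even b + TensorProduct.map P.odd (1 - b)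

/-- The odd endomorphism `a ⊗ 1 + 1 ⊗ b` of `P ⊗ N`, with the Koszul sign. -/
def tDer (a : Module.End Q P.carrier) (b : Module.End Q N) : Module.End Q (P.carrier ⊗[Q] N) :=
  TensorProduct.map a 1 + TensorProduct.map P.sgn b

variable {P}

lemma swap_tmul (x y : P.carrier) (z : N) :
    P.swap N (x ⊗ₜ (y ⊗ₜ z)) = y ⊗ₜ (x ⊗ₜ z) - (2 : Q) • (P.odd y ⊗ₜ (P.odd x ⊗ₜ z)) := by
  simp [swap]

lemma tEven_tmul (b : Module.End Q N) (x : P.carrier) (y : N) :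
    P.tEven b (x ⊗ₜ y) = P.even x ⊗ₜ b y + (x - P.even x) ⊗ₜ (y - b y) := rfl

lemma tDer_tmul (a : Module.End Q P.carrier) (b : Module.End Q N) (x : P.carrier) (y : N) :
    P.tDer a b (x ⊗ₜ y) = a x ⊗ₜ y + (P.even x - (x - P.even x)) ⊗ₜ b y := rfl

lemma swap_comm_even (b : Module.End Q N) :
    P.swap N * P.tEven (P.tEven b) = P.tEven (P.tEven b) * P.swap N := by
  ext x y z
  simp [swap_tmul, tEven_tmul, odd_apply, even_apply_even, TensorProduct.sub_tmul,
    TensorProduct.tmul_sub, TensorProduct.tmul_add]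
  module

lemma swap_comm_der {a : Module.End Q P.carrier} (ha : a * P.even = (1 - P.even) * a)
    (b : Module.End Q N) :
    P.swap N * P.tDer a (P.tDer a b) = P.tDer a (P.tDer a b) * P.swap N := by
  have h : ∀ x, P.even (a x) = a x - a (P.even x) := fun x => by
    have h1 : a (P.even x) = a x - P.even (a x) := LinearMap.congr_fun ha x
    rw [h1]; abel
  ext x y z
  simp [swap_tmul, tDer_tmul, odd_apply, even_apply_even, h, TensorProduct.sub_tmul,
    TensorProduct.tmul_sub, TensorProduct.tmul_add]
  module

lemma step_even {c : Module.End Q (P.carrier ⊗[Q] N)} {b : Module.End Q N}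
    (h : c * P.tEven b = P.tEven b * c) :
    (P.swap N * TensorProduct.map 1 c) * P.tEven (P.tEven b) =
      P.tEven (P.tEven b) * (P.swap N * TensorProduct.map 1 c) := by
  have h1 : TensorProduct.map 1 c * P.tEven (P.tEven b) =
      P.tEven (P.tEven b) * TensorProduct.map 1 c := by
    have h2 : ∀ y, c (P.tEven b y) = P.tEven b (c y) := fun y => LinearMap.congr_fun h y
    refine TensorProduct.ext' fun x y => ?_
    simp [tEven_tmul, h2]
  rw [mul_assoc, h1, ← mul_assoc, ← mul_assoc, swap_comm_even]

lemma step_der {c : Module.End Q (P.carrier ⊗[Q] N)} {a : Module.End Q P.carrier}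
    (ha : a * P.even = (1 - P.even) * a) {b : Module.End Q N}
    (h : c * P.tDer a b = P.tDer a b * c) :
    (P.swap N * TensorProduct.map 1 c) * P.tDer a (P.tDer a b) =
      P.tDer a (P.tDer a b) * (P.swap N * TensorProduct.map 1 c) := by
  have h1 : TensorProduct.map 1 c * P.tDer a (P.tDer a b) =
      P.tDer a (P.tDer a b) * TensorProduct.map 1 c := by
    have h2 : ∀ y, c (P.tDer a b y) = P.tDer a b (c y) := fun y => LinearMap.congr_fun h y
    refine TensorProduct.ext' fun x y => ?_
    simp [tDer_tmul, h2]
  rw [mul_assoc, h1, ← mul_assoc, ← mul_assoc, swap_comm_der ha]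

lemma contr_tDer {a : Module.End Q P.carrier} {e d b : Module.End Q N} {s t : Q}
    (ha : IsContr P.even P.d s a) (hb : IsContr e d t b) :
    IsContr (P.tEven e) (P.tDer P.d d) (s + t) (P.tDer a b) where
  isOdd := by
    ext x y
    simp [tEven_tmul, tDer_tmul, even_apply_even, ha.even_apply, hb.even_apply,
      TensorProduct.sub_tmul, TensorProduct.tmul_sub]
    abel
  eq := by
    ext x y
    simp [tDer_tmul, even_apply_even, even_apply_d, ha.even_apply, ha.d_apply, hb.d_apply,
      TensorProduct.sub_tmul, TensorProduct.tmul_sub, ← TensorProduct.smul_tmul']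
    module

end Swap

/-- The derivation of the tensor power that extends the odd endomorphism `a`. -/
def der (P : MF Q f) (a : Module.End Q P.carrier) : (n : ℕ) → Module.End Q (P.tpow n).carrier
  | 0 => 0
  | n + 1 => P.tDer a (P.der a n)

lemma d_tpow (P : MF Q f) : ∀ n, (P.tpow n).d = P.der P.d n
  | 0 => rfl
  | n + 1 => congrArg (P.tDer P.d) (P.d_tpow n)

lemma cyc_comm_even (P : MF Q f) :
    ∀ n, P.cyc n * P.tEven (P.tpow n).even = P.tEven (P.tpow n).even * P.cyc n
  | 0 => (one_mul _).trans (mul_one _).symm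
  | n + 1 => step_even (P.cyc_comm_even n)

lemma cyc_comm_der (P : MF Q f) {a : Module.End Q P.carrier}
    (ha : a * P.even = (1 - P.even) * a) :
    ∀ n, P.cyc n * P.tDer a (P.der a n) = P.tDer a (P.der a n) * P.cyc n
  | 0 => (one_mul _).trans (mul_one _).symm
  | n + 1 => step_der ha (P.cyc_comm_der ha n)

lemma rot_comm_even (P : MF Q f) :
    ∀ n, P.rot n * (P.tpow n).even = (P.tpow n).even * P.rot n
  | 0 => (one_mul _).trans (mul_one _).symm
  | n + 1 => P.cyc_comm_even n

lemma rot_comm_der (P : MF Q f) {a : Module.End Q P.carrier}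
    (ha : a * P.even = (1 - P.even) * a) :
    ∀ n, P.rot n * P.der a n = P.der a n * P.rot n
  | 0 => (one_mul _).trans (mul_one _).symm
  | n + 1 => P.cyc_comm_der ha n

lemma rot_comm_d (P : MF Q f) (n : ℕ) : P.rot n * (P.tpow n).d = (P.tpow n).d * P.rot n := by
  rw [d_tpow]
  exact P.rot_comm_der P.d_mul_even n

lemma contr_der (P : MF Q f) {a : Module.End Q P.carrier} {s : Q} (ha : IsContr P.even P.d s a) :
    ∀ (n : ℕ) (t : Q), t = n * s → IsContr (P.tpow n).even (P.tpow n).d t (P.der a n)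
  | 0, t, ht => ⟨(zero_mul _).trans (mul_zero _).symm, by
      obtain rfl : t = 0 := by rw [ht, Nat.cast_zero, zero_mul]
      exact ((congrArg₂ (· + ·) (mul_zero _) (zero_mul _)).trans (add_zero _)).trans
        (zero_smul _ _).symm⟩
  | n + 1, t, ht => by
      obtain rfl : t = s + n * s := by rw [ht]; push_cast; ring
      exact contr_tDer ha (P.contr_der ha n _ rfl)

/-! The cycle has order dividing `n`. -/

/-- The pure tensor `v 0 ⊗ (v 1 ⊗ (⋯ ⊗ 1))`. -/
def tprod (P : MF Q f) : (n : ℕ) → (ℕ → P.carrier) → (P.tpow n).carrier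
  | 0, _ => (1 : Q)
  | n + 1, v => (v 0 ⊗ₜ[Q] P.tprod n (fun i => v (i + 1)) :)

/-- `v i` is homogeneous of degree `b i`. -/
def Homog (P : MF Q f) (v : ℕ → P.carrier) (b : ℕ → Bool) : Prop :=
  ∀ i, P.odd (v i) = if b i then v i else 0

/-- The sign `(-1)^{a b}`. -/
def ksgn (Q : Type u) [CommRing Q] (a b : Bool) : Q := (-1) ^ (a.toNat * b.toNat)

lemma tprod_congr (P : MF Q f) : ∀ (n : ℕ) {v w : ℕ → P.carrier}, (∀ i < n, v i = w i) →
    P.tprod n v = P.tprod n w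
  | 0, _, _, _ => rfl
  | n + 1, v, w, h => by
      have h1 := P.tprod_congr n (v := fun i => v (i + 1)) (w := fun i => w (i + 1))
        (fun i hi => h (i + 1) (by omega))
      change v 0 ⊗ₜ[Q] P.tprod n (fun i => v (i + 1)) = w 0 ⊗ₜ[Q] P.tprod n (fun i => w (i + 1))
      rw [h1, h 0 (by omega)]

lemma swap_homog {P : MF Q f} {N : Type u} [AddCommGroup N] [Module Q N] {x y : P.carrier}
    {a b : Bool} (hx : P.odd x = if a then x else 0) (hy : P.odd y = if b then y else 0) (z : N) :
    P.swap N (x ⊗ₜ (y ⊗ₜ z)) = ksgn Q a b • (y ⊗ₜ (x ⊗ₜ z)) := by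
  rw [swap_tmul, hx, hy]
  cases a <;> cases b <;> simp [ksgn]
  module

lemma cyc_tprod (P : MF Q f) : ∀ (n : ℕ) (v : ℕ → P.carrier) (b : ℕ → Bool), P.Homog v b →
    P.cyc n (v 0 ⊗ₜ[Q] P.tprod n (fun i => v (i + 1))) =
      (∏ i ∈ Finset.range n, ksgn Q (b i) (b n)) • (v n ⊗ₜ[Q] P.tprod n v)
  | 0, v, b, h => (one_smul Q _).symm
  | n + 1, v, b, h => by
      have ih := P.cyc_tprod n (fun i => v (i + 1)) (fun i => b (i + 1)) (fun i => h (i + 1))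
      change P.swap (P.tpow n).carrier (v 0 ⊗ₜ[Q] P.cyc n (v 1 ⊗ₜ[Q]
          P.tprod n (fun i => v (i + 1 + 1)))) =
        (∏ i ∈ Finset.range (n + 1), ksgn Q (b i) (b (n + 1))) •
          (v (n + 1) ⊗ₜ[Q] (v 0 ⊗ₜ[Q] P.tprod n (fun i => v (i + 1))))
      rw [zero_add] at ih
      rw [ih, TensorProduct.tmul_smul, map_smul, swap_homog (h 0) (h (n + 1)), smul_smul,
        Finset.prod_range_succ']

lemma prod_periodic {R : Type*} [CommMonoid R] {m : ℕ} {g : ℕ → R} (hg : ∀ i, g (i + m) = g i)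
    (k : ℕ) : ∏ i ∈ Finset.range m, g (i + k) = ∏ i ∈ Finset.range m, g i := by
  induction k with
  | zero => rfl
  | succ k ih =>
    rw [← ih]
    cases m with
    | zero => rfl
    | succ m =>
      rw [Finset.prod_range_succ, Finset.prod_range_succ' (fun i => g (i + k))]
      congr 1
      · exact Finset.prod_congr rfl fun i _ => by congr 1; omega
      · rw [← hg (0 + k)]; congr 1; omega

lemma sign_total (n : ℕ) (b : ℕ → Bool) (hb : ∀ i, b (i + (n + 1)) = b i) :
    ∏ j ∈ Finset.range (n + 1), ∏ i ∈ Finset.range n, ksgn Q (b (i + j * n)) (b (n + j * n)) = 1 := by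
  have hb' : ∀ k i, b (i + k * (n + 1)) = b i := by
    intro k
    induction k with
    | zero => simp
    | succ k ih => intro i; rw [add_mul, ← add_assoc, one_mul, hb, ih]
  have hsq : ∀ x y : Bool, ksgn Q x y * ksgn Q x y = 1 := by
    intro x y; cases x <;> cases y <;> simp [ksgn]
  have h1 : ∀ j ∈ Finset.range (n + 1),
      ∏ i ∈ Finset.range n, ksgn Q (b (i + j * n)) (b (n + j * n)) =
      (∏ i ∈ Finset.range (n + 1), ksgn Q (b i) (b (n - j))) * ksgn Q (b (n - j)) (b (n - j)) := by
    intro j hj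
    have hj' : b (n + j * n) = b (n - j) := by
      rw [Finset.mem_range] at hj
      rw [← hb' j (n - j)]
      congr 1
      rw [mul_add]
      omega
    rw [hj', ← prod_periodic (m := n + 1) (g := fun i => ksgn Q (b i) (b (n - j)))
      (fun i => by rw [hb]) (j * n), Finset.prod_range_succ, hj', mul_assoc, hsq, mul_one]
  rw [Finset.prod_congr rfl h1]
  have h2 := Finset.prod_range_reflect (fun j =>
    (∏ i ∈ Finset.range (n + 1), ksgn Q (b i) (b j)) * ksgn Q (b j) (b j)) (n + 1)
  simp only [Nat.add_sub_cancel] at h2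
  rw [h2]
  have h3 : ∀ j, (∏ i ∈ Finset.range (n + 1), ksgn Q (b i) (b j)) * ksgn Q (b j) (b j) =
      ((-1 : Q) ^ ((∑ i ∈ Finset.range (n + 1), (b i).toNat) + 1)) ^ (b j).toNat := by
    intro j
    simp only [ksgn]
    rw [Finset.prod_pow_eq_pow_sum, ← Finset.sum_mul, ← pow_mul, ← pow_add, add_mul, one_mul]
    cases b j <;> simp
  rw [Finset.prod_congr rfl (fun j _ => h3 j), Finset.prod_pow_eq_pow_sum, ← pow_mul]
  exact (by rw [mul_comm]; exact Nat.even_mul_succ_self _ : Even _).neg_one_pow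

lemma ext_tprod (P : MF Q f) {M : Type u} [AddCommGroup M] [Module Q M] :
    ∀ (n : ℕ) {A B : (P.tpow n).carrier →ₗ[Q] M},
      (∀ v b, P.Homog v b → A (P.tprod n v) = B (P.tprod n v)) → A = B
  | 0, A, B, h => by
      have h1 := h 0 (fun _ => false) (fun i => by simp)
      refine LinearMap.ext fun (x : Q) => ?_
      have h2 : x = x • (1 : Q) := by simp
      have hA : A x = x • A (1 : Q) := by
        conv_lhs => rw [h2]
        exact A.map_smul x (1 : Q)
      have hB : B x = x • B (1 : Q) := by
        conv_lhs => rw [h2]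
        exact B.map_smul x (1 : Q)
      rw [hA, hB]
      exact congrArg (x • ·) h1
  | n + 1, A, B, h => by
      have key : ∀ (x : P.carrier) (c : Bool), (P.odd x = if c then x else 0) →
          ∀ y, A (x ⊗ₜ[Q] y) = B (x ⊗ₜ[Q] y) := by
        intro x c hx
        have := P.ext_tprod n (A := LinearMap.comp A (TensorProduct.mk Q _ _ x))
          (B := LinearMap.comp B (TensorProduct.mk Q _ _ x)) (fun v b hv => by
            let w : ℕ → P.carrier := fun i => match i with
              | 0 => x
              | i + 1 => v i
            let c' : ℕ → Bool := fun i => match i with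
              | 0 => c
              | i + 1 => b i
            exact h w c' (fun i => match i with
              | 0 => hx
              | i + 1 => hv i))
        exact fun y => LinearMap.congr_fun this y
      refine TensorProduct.ext' fun x y => ?_
      have hx : x = P.even x + P.odd x := by rw [odd_apply]; abel
      have hxy : x ⊗ₜ[Q] y = P.even x ⊗ₜ[Q] y + P.odd x ⊗ₜ[Q] y := by
        rw [← TensorProduct.add_tmul, ← hx]
      rw [hxy]
      refine (A.map_add (P.even x ⊗ₜ[Q] y) (P.odd x ⊗ₜ[Q] y)).trans (Eq.trans ?_
        (B.map_add (P.even x ⊗ₜ[Q] y) (P.odd x ⊗ₜ[Q] y)).symm)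
      rw [key (P.even x) false (by simp [odd_apply, even_apply_even]),
        key (P.odd x) true (by simp [odd_apply, even_apply_even])]

lemma rot_pow_tprod (P : MF Q f) (n : ℕ) (v : ℕ → P.carrier) (b : ℕ → Bool) (h : P.Homog v b)
    (hv : ∀ i, v (i + (n + 1)) = v i) (k : ℕ) :
    (P.rot (n + 1) ^ k) (P.tprod (n + 1) v) =
      (∏ j ∈ Finset.range k, ∏ i ∈ Finset.range n, ksgn Q (b (i + j * n)) (b (n + j * n))) •
        P.tprod (n + 1) (fun i => v (i + k * n)) := by
  induction k with
  | zero => simp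
  | succ k ih =>
    rw [pow_succ', Module.End.mul_apply, ih, map_smul, Finset.prod_range_succ, mul_smul]
    congr 1
    have h1 := P.cyc_tprod n (fun i => v (i + k * n)) (fun i => b (i + k * n)) (fun i => h _)
    refine h1.trans ?_
    congr 1
    have h2 : P.tprod n (fun i => v (i + k * n)) =
        P.tprod n (fun i => v (i + 1 + (k + 1) * n)) := by
      congr 1
      funext i
      rw [← hv]
      congr 1
      ring
    rw [h2, show n + k * n = 0 + (k + 1) * n by ring]
    rfl

/-- The cycle acts with order dividing `n`, so it defines an action of the cyclic group. -/
lemma rot_pow (P : MF Q f) : ∀ n, P.rot n ^ n = 1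
  | 0 => pow_zero _
  | n + 1 => by
      refine P.ext_tprod (n + 1) fun v b h => ?_
      have h1 : P.tprod (n + 1) v = P.tprod (n + 1) (fun i => v (i % (n + 1))) :=
        P.tprod_congr _ fun i hi => by rw [Nat.mod_eq_of_lt hi]
      rw [h1, P.rot_pow_tprod n (fun i => v (i % (n + 1))) (fun i => b (i % (n + 1)))
        (fun i => h _) (fun i => by simp) (n + 1),
        sign_total n (fun i => b (i % (n + 1))) (fun i => by simp), one_smul]
      change P.tprod (n + 1) (fun i => v ((i + (n + 1) * n) % (n + 1))) =
        P.tprod (n + 1) (fun i => v (i % (n + 1)))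
      refine congrArg (P.tprod (n + 1)) ?_
      funext i
      simp

/-! ### Eigenspaces -/

section Eigen

variable {p : ℕ} {M : Type u} [AddCommGroup M] [Module Q M] {σ : Module.End Q M} {u ζ : Q}

lemma mem_ker_iff {x : M} : x ∈ LinearMap.ker (σ - ζ • (1 : Module.End Q M)) ↔ σ x = ζ • x := by
  simp [sub_eq_zero]

lemma mapsTo_ker {a : Module.End Q M} (ha : σ * a = a * σ) :
    ∀ x ∈ LinearMap.ker (σ - ζ • (1 : Module.End Q M)),
      a x ∈ LinearMap.ker (σ - ζ • (1 : Module.End Q M)) := by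
  intro x hx
  rw [mem_ker_iff] at hx ⊢
  have h1 : σ (a x) = a (σ x) := LinearMap.congr_fun ha x
  rw [h1, hx, map_smul]

/-- If `σ ^ p = 1`, `ζ ^ p = 1` and `p` is invertible, then the `ζ`-eigenspace of `σ` is a direct
summand. -/
lemma exists_retraction (hp : 0 < p) (hσ : σ ^ p = 1) (hu : u * p = 1) (hζ : ζ ^ p = 1) :
    ∃ π : M →ₗ[Q] LinearMap.ker (σ - ζ • (1 : Module.End Q M)),
      π ∘ₗ (LinearMap.ker (σ - ζ • (1 : Module.End Q M))).subtype = LinearMap.id := by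
  have h0 : ζ * ζ ^ (p - 1) = 1 := by
    rw [← pow_succ', Nat.sub_add_cancel hp, hζ]
  set τ : Module.End Q M := ζ ^ (p - 1) • σ with hτ
  have hτp : τ ^ p = 1 := by
    rw [hτ, smul_pow, hσ, ← pow_mul, mul_comm, pow_mul, hζ, one_pow, one_smul]
  have hστ : σ = ζ • τ := by rw [hτ, smul_smul, h0, one_smul]
  let S : Module.End Q M := u • ∑ i ∈ Finset.range p, τ ^ i
  have hS : (τ - 1) * S = 0 := by
    simp only [S]
    rw [mul_smul_comm, mul_geom_sum, hτp, sub_self, smul_zero]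
  have hmem : ∀ x, S x ∈ LinearMap.ker (σ - ζ • (1 : Module.End Q M)) := by
    intro x
    have h1 : τ (S x) - S x = 0 := LinearMap.congr_fun hS x
    rw [mem_ker_iff, hστ, LinearMap.smul_apply, sub_eq_zero.1 h1]
  refine ⟨S.codRestrict _ hmem, ?_⟩
  ext ⟨x, hx⟩
  rw [mem_ker_iff] at hx
  have h2 : τ x = x := by
    rw [hτ, LinearMap.smul_apply, hx, smul_smul, mul_comm, h0, one_smul]
  have h3 : ∀ i, (τ ^ i) x = x := by
    intro i
    induction i with
    | zero => rfl
    | succ i ih => rw [pow_succ, Module.End.mul_apply, h2, ih]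
  change S x = x
  simp only [S, LinearMap.smul_apply, LinearMap.sum_apply, h3, Finset.sum_const, Finset.card_range]
  rw [← Nat.cast_smul_eq_nsmul Q, smul_smul, hu, one_smul]

/-- The eigenspace `P^(ζ) = ker (σ - ζ)` of an automorphism `σ` of a matrix factorization with
`σ ^ p = 1`, where `ζ ^ p = 1` and `p` has the inverse `u`. -/
def eigen (P : MF Q f) (σ : Module.End Q P.carrier) (he : σ * P.even = P.even * σ)
    (hd : σ * P.d = P.d * σ) (hp : 0 < p) (hσ : σ ^ p = 1) (hu : u * p = 1) (hζ : ζ ^ p = 1) :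
    MF Q f where
  carrier := LinearMap.ker (σ - ζ • (1 : Module.End Q P.carrier))
  instFinite := by
    obtain ⟨π, hπ⟩ := exists_retraction hp hσ hu hζ
    exact Module.Finite.of_surjective π fun x => ⟨x, LinearMap.congr_fun hπ x⟩
  instProjective := by
    obtain ⟨π, hπ⟩ := exists_retraction hp hσ hu hζ
    exact Module.Projective.of_split _ π hπ
  even := P.even.restrict (mapsTo_ker he)
  d := P.d.restrict (mapsTo_ker hd)
  even_mul_even := by
    ext x; exact P.even_apply_even x
  d_mul_even := by
    ext x; exact P.d_apply_even x
  d_mul_d := by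
    ext x; exact P.d_apply_d x

lemma IsContr.restrict {e d h : Module.End Q M} {s : Q} (H : IsContr e d s h)
    (he : σ * e = e * σ) (hd : σ * d = d * σ) (hh : σ * h = h * σ) :
    IsContr (e.restrict (mapsTo_ker (ζ := ζ) he)) (d.restrict (mapsTo_ker hd)) s
      (h.restrict (mapsTo_ker hh)) where
  isOdd := by
    ext x; exact H.apply_even x
  eq := by
    ext x; exact LinearMap.congr_fun H.eq x

/-- `(T^p P)^(ζ)`, turned into a factorization of `f` by means of the inverse `u` of `p`. -/
def tObj (hp : 0 < p) (hu : u * p = 1) (hζ : ζ ^ p = 1) (P : MF Q f) : MF Q f :=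
  (((P.tpow p).eigen (P.rot p) (P.rot_comm_even p) (P.rot_comm_d p) hp (P.rot_pow p)
    hu hζ).mult u).ofEq (by rw [← mul_assoc, hu, one_mul])

lemma support_tObj (hp : 0 < p) (hu : u * p = 1) (hζ : ζ ^ p = 1) (P : MF Q f) :
    (P.tObj hp hu hζ).support ⊆ P.support := by
  refine support_subset fun 𝔭 hn => ?_
  obtain ⟨s, hs, h, H⟩ := (notMem_support_iff _ _).1 hn
  have H1 := (P.contr_der H p (p * s) rfl).restrict (ζ := ζ) (P.rot_comm_even p)
    (P.rot_comm_d p) (P.rot_comm_der H.isOdd p)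
  have H2 := IsContr.mult (P := (P.tpow p).eigen (P.rot p) (P.rot_comm_even p) (P.rot_comm_d p) hp
    (P.rot_pow p) hu hζ) H1 u
  have h3 : u * (p * s) = s := by rw [← mul_assoc, hu, one_mul]
  rw [h3] at H2
  exact ⟨s, hs, _, H2⟩

end Eigen

end Basic
end MF

/-! ### Grothendieck groups with support -/

section K0

variable {Q : Type u} [CommRing Q]

/-- Matrix factorizations of `f` supported in `Z`. -/
def MFZ (Z : Set (PrimeSpectrum Q)) (f : Q) : Type (u + 1) := {P : MF Q f // P.support ⊆ Z}

/-- The relations `[P] = [P'] + [P'']` for short exact sequences `0 → P' → P → P'' → 0`, and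
`[P] = [P']` for homotopy equivalent `P` and `P'`. -/
inductive K0Rel (Z : Set (PrimeSpectrum Q)) (f : Q) : FreeAbelianGroup (MFZ Z f) → Prop
  | shortExact (P' P P'' : MFZ Z f) (i : P'.1.carrier →ₗ[Q] P.1.carrier)
      (q : P.1.carrier →ₗ[Q] P''.1.carrier) (h : MF.IsShortExact i q) :
      K0Rel Z f (FreeAbelianGroup.of P - (FreeAbelianGroup.of P' + FreeAbelianGroup.of P''))
  | htpyEquiv (P P' : MFZ Z f) (h : MF.HtpyEquiv P.1 P'.1) :
      K0Rel Z f (FreeAbelianGroup.of P - FreeAbelianGroup.of P')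

/-- The Grothendieck group `K₀(mf^Z(Q, f))`. -/
def K0 (Z : Set (PrimeSpectrum Q)) (f : Q) : Type (u + 1) :=
  FreeAbelianGroup (MFZ Z f) ⧸ AddSubgroup.closure {x | K0Rel Z f x}

instance (Z : Set (PrimeSpectrum Q)) (f : Q) : AddCommGroup (K0 Z f) :=
  inferInstanceAs (AddCommGroup (FreeAbelianGroup (MFZ Z f) ⧸ AddSubgroup.closure _))

/-- The class `[P]`. -/
def K0.mk {Z : Set (PrimeSpectrum Q)} {f : Q} (P : MFZ Z f) : K0 Z f :=
  QuotientAddGroup.mk (FreeAbelianGroup.of P)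

instance (Z : Set (PrimeSpectrum Q)) (f : Q) : Nonempty (MFZ Z f) :=
  ⟨⟨MF.zero f, MF.support_zero.trans (Set.empty_subset Z)⟩⟩

/-- The tensor product `mf^Z(Q, f₁) × mf^W(Q, f₂) → mf^{Z ∩ W}(Q, f₁ + f₂)`. -/
def MFZ.tensor {Z W : Set (PrimeSpectrum Q)} {f₁ f₂ : Q} (P : MFZ Z f₁) (P' : MFZ W f₂) :
    MFZ (Z ∩ W) (f₁ + f₂) :=
  ⟨P.1.tensor P'.1, (MF.support_tensor _ _).trans (Set.inter_subset_inter P.2 P'.2)⟩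

/-- Extension of scalars `mf^Z(Q, f) → mf^{Z'}(Q', f')`, where `Z'` contains the preimage of `Z`. -/
def MFZ.baseChange {Z : Set (PrimeSpectrum Q)} {f : Q} (Q' : Type u) [CommRing Q'] [Algebra Q Q']
    {Z' : Set (PrimeSpectrum Q')} (hZ : PrimeSpectrum.comap (algebraMap Q Q') ⁻¹' Z ⊆ Z')
    (P : MFZ Z f) : MFZ Z' (algebraMap Q Q' f) :=
  ⟨P.1.baseChange Q',
    (MF.support_baseChange Q' P.1).trans ((Set.preimage_mono P.2).trans hZ)⟩

/-- The rank-one factorization `(g, h)` as an object of `mf^{V(g, h)}(Q, g h)`. -/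
def MFZ.rankOne (g h : Q) : MFZ (PrimeSpectrum.zeroLocus {g, h}) (g * h) :=
  ⟨MF.rankOne g h, MF.support_rankOne g h⟩

end K0

/-! ### The cyclic Adams operation -/

/-- `e^{2πi/p}`. -/
def zetaC (p : ℕ) : ℂ := Complex.exp (2 * Real.pi * Complex.I / p)

/-- The subring `A_p = ℤ[1/p, e^{2πi/p}]` of `ℂ`. -/
def Ap (p : ℕ) : Subalgebra ℤ ℂ := Algebra.adjoin ℤ {(p : ℂ)⁻¹, zetaC p}

/-- The subring `ℤ[e^{2πi/p}]` of `ℂ`. -/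
def Zzeta (p : ℕ) : Subalgebra ℤ ℂ := Algebra.adjoin ℤ {zetaC p}

/-- `e^{2πi/p}` as an element of `ℤ[e^{2πi/p}]`. -/
def zetaZ (p : ℕ) : Zzeta p := ⟨zetaC p, Algebra.subset_adjoin rfl⟩

section Adams

variable (p : ℕ) (Q : Type u) [CommRing Q] [Algebra (Ap p) Q]

/-- The image of `e^{2πi/p}` in the `A_p`-algebra `Q`. -/
def zetaQ : Q := algebraMap (Ap p) Q ⟨zetaC p, Algebra.subset_adjoin (Or.inr rfl)⟩

/-- The image of `1/p` in the `A_p`-algebra `Q`. -/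
def invQ : Q := algebraMap (Ap p) Q ⟨(p : ℂ)⁻¹, Algebra.subset_adjoin (Or.inl rfl)⟩

variable {p}

lemma invQ_mul (hp : p.Prime) : invQ p Q * p = 1 := by
  have h : (⟨(p : ℂ)⁻¹, Algebra.subset_adjoin (Or.inl rfl)⟩ : Ap p) * (p : Ap p) = 1 := by
    apply Subtype.ext
    have : (p : ℂ) ≠ 0 := Nat.cast_ne_zero.2 hp.ne_zero
    simp [this]
  rw [invQ, ← map_natCast (algebraMap (Ap p) Q), ← map_mul, h, map_one]

lemma zetaQ_pow (hp : p.Prime) (k : ℕ) : (zetaQ p Q ^ k) ^ p = 1 := by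
  have h : (⟨zetaC p, Algebra.subset_adjoin (Or.inr rfl)⟩ : Ap p) ^ p = 1 := by
    apply Subtype.ext
    simpa [zetaC] using (Complex.isPrimitiveRoot_exp p hp.ne_zero).pow_eq_one
  rw [← pow_mul, mul_comm, pow_mul, zetaQ, ← map_pow, h, map_one, one_pow]

variable {Q} {Z : Set (PrimeSpectrum Q)} {f : Q}

/-- The factorization `mult_{1/p} ((T^p P)^(ζ))` of `f`, for `ζ = e^{2πik/p}`. -/
def MFZ.t (hp : p.Prime) (k : ℕ) (P : MFZ Z f) : MFZ Z f :=
  ⟨P.1.tObj hp.pos (invQ_mul Q hp) (zetaQ_pow Q hp k), (MF.support_tObj _ _ _ _).trans P.2⟩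

/-- The map `t^p_ζ` on the Grothendieck group, for `ζ = e^{2πik/p}`: the class `[P]` is sent to the
class of `mult_{1/p} ((T^p P)^(ζ))`, where a representative `P` is chosen. -/
def t (hp : p.Prime) (k : ℕ) (x : K0 Z f) : K0 Z f :=
  K0.mk (MFZ.t hp k (Classical.epsilon fun P : MFZ Z f => K0.mk P = x))

/-- The sum `∑_ζ ζ t^p_ζ` over all `p`-th roots of unity, in `ℤ[e^{2πi/p}] ⊗ K₀`. -/
def zetaSum (hp : p.Prime) (x : K0 Z f) : Zzeta p ⊗[ℤ] K0 Z f :=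
  ∑ k ∈ Finset.range p, (zetaZ p ^ k) ⊗ₜ[ℤ] t hp k x

/-- The cyclic Adams operation: `ψ x` is the element `y` of `K₀` such that `1 ⊗ y = ∑_ζ ζ t^p_ζ x`
in `ℤ[e^{2πi/p}] ⊗ K₀`. -/
def cPsi (hp : p.Prime) (x : K0 Z f) : K0 Z f :=
  Classical.epsilon fun y : K0 Z f => (1 : Zzeta p) ⊗ₜ[ℤ] y = zetaSum hp x

end Adams

end AdamsMF

end

open AdamsMF

/-! Write `ζ = e^{2πi/p}` and `t k` for the operation of the root of unity `ζ ^ k`. The ring `Q`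
contains `1/p`, and differences of distinct `p`-th roots of unity are units in it because `∏ (1 - ζ
^ k) = p`, the product over `0 < k < p`. Hence an operator of order `p` splits a module into
eigenspaces, cut out by the idempotents `eigProj`, and eigenspaces can be handled as direct summands
(`IsRetract`).

Additivity up to a cross term. An exact sequence `A → P → B` splits as graded modules, and the
differential of `P` becomes that of `A ⊕ B` plus a term `B → A`. On `T^p` this term raises the
number of factors in `A` by one, so filtering by that number shows that the eigenspaces of `T^p P`
and of `T^p (A ⊕ B)` have the same classes (`K0.mk_eigen_diag`). Now `T^p (A ⊕ B)` is a sum over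
words in two letters. As `p` is prime, the cycle permutes the nonconstant words freely, so they
contribute the same factorization to every eigenspace: one summand for each orbit
(`K0.mk_eigProj_mixed`). Therefore `t k [P] = t k [A] + t k [B] + c([A], [B])`, where `c` does not
depend on `k`. Such a `c` is a symmetric cocycle, and `P ↦ ([P], t k [P])` is additive with values
in the extension of `K₀` by `K₀` that it defines. So `t k` is well defined on classes
(`K0.eq_of_mk_eq`, `t_mk`).

Integrality. In the symmetric group the powers `σ ^ k` with `p ∤ k` are conjugate to `σ`, and the
symmetric group acts on `T^p P` with Koszul signs; hence `t k = t 1` for all these `k`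
(`MF.exists_conj_rot`, `t_eq`). Since the `p`-th roots of unity sum to zero, `∑ ζ ^ k t k = 1 ⊗ (t 0
- t 1)`, and `1 ⊗ -` is injective because `1` belongs to a basis of `ℤ[ζ]`. So `ψ = t 0 - t 1`
(`cPsi_eq`), and the cross terms cancel: `ψ` is additive.

Products and base change. The signed shuffle identifies `T^p (P ⊗ P')` with `T^p P ⊗ T^p P'`
compatibly with the cycles. This gives `t k (x y) = ∑ t a (x) t (k - a) (y)`, from which `(t 0 - t
1)(x y)` factors (`t_cup`, `cPsi_cup`). Tensor powers and the idempotents `eigProj` commute with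
extension of scalars.

Rank one. `T^p (g, h)` is an exterior algebra on `p` generators, with creation and annihilation
operators. Diagonalizing the cycle on the generators gives one pair of operators for each character
of the cyclic group. The pairs of the `p - 1` nontrivial characters anticommute with the
differential. Splitting off the pair of weight `ζ ^ j` writes each eigenspace as a summand and a
shifted, reweighted summand, which gives a factor `1 - ζ ^ j` in the sum `∑ ζ ^ k t k`
(`IsCliffordSystem.mk_step`). These factors multiply to `p`. What remains is the pair of the trivial
character: a rank-one factorization fixed by the cycle, which `mult_{1/p}` identifies with `(g, h)`
(`MF.isRetract_rankOne`). -/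

namespace AdamsMF

noncomputable section

/-! ### Exact sequences, homotopy and the Grothendieck group. -/

namespace MF

variable {Q : Type u} [CommRing Q] {f f₁ f₂ : Q}

/-! ### Morphisms -/

namespace IsHom

variable {P P' P'' : MF Q f} {g : P.carrier →ₗ[Q] P'.carrier} {g' : P'.carrier →ₗ[Q] P''.carrier}

lemma apply_even (h : IsHom g) (x : P.carrier) : g (P.even x) = P'.even (g x) :=
  LinearMap.congr_fun h.comm_even x

lemma apply_d (h : IsHom g) (x : P.carrier) : g (P.d x) = P'.d (g x) :=
  LinearMap.congr_fun h.comm_d x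

lemma of_apply (h1 : ∀ x, g (P.even x) = P'.even (g x)) (h2 : ∀ x, g (P.d x) = P'.d (g x)) :
    IsHom g :=
  ⟨LinearMap.ext h1, LinearMap.ext h2⟩

lemma id (P : MF Q f) : IsHom (P := P) (P' := P) LinearMap.id := of_apply (fun _ => rfl) fun _ => rfl

lemma comp (h' : IsHom g') (h : IsHom g) : IsHom (g' ∘ₗ g) :=
  of_apply (fun x => by simp [h.apply_even, h'.apply_even]) fun x => by
    simp [h.apply_d, h'.apply_d]

lemma zero (P P' : MF Q f) : IsHom (P := P) (P' := P') 0 :=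
  of_apply (fun x => by simp) fun x => by simp

lemma add {g₂ : P.carrier →ₗ[Q] P'.carrier} (h : IsHom g) (h₂ : IsHom g₂) : IsHom (g + g₂) :=
  of_apply (fun x => by simp [h.apply_even, h₂.apply_even]) fun x => by
    simp [h.apply_d, h₂.apply_d]

lemma smul (h : IsHom g) (c : Q) : IsHom (c • g) :=
  of_apply (fun x => by simp [h.apply_even]) fun x => by simp [h.apply_d]

lemma sub {g₂ : P.carrier →ₗ[Q] P'.carrier} (h : IsHom g) (h₂ : IsHom g₂) : IsHom (g - g₂) :=
  of_apply (fun x => by simp [h.apply_even, h₂.apply_even]) fun x => by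
    simp [h.apply_d, h₂.apply_d]

lemma sum {ι : Type*} {s : Finset ι} {g : ι → P.carrier →ₗ[Q] P'.carrier}
    (h : ∀ i ∈ s, IsHom (g i)) : IsHom (∑ i ∈ s, g i) :=
  of_apply
    (fun x => by
      simp only [LinearMap.sum_apply, map_sum]
      exact Finset.sum_congr rfl fun i hi => (h i hi).apply_even x)
    fun x => by
      simp only [LinearMap.sum_apply, map_sum]
      exact Finset.sum_congr rfl fun i hi => (h i hi).apply_d x

end IsHom

lemma isHom_one (P : MF Q f) : IsHom (P := P) (P' := P) 1 := IsHom.id P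

lemma IsHom.mul {P : MF Q f} {a b : Module.End Q P.carrier} (ha : IsHom a) (hb : IsHom b) :
    IsHom (P := P) (P' := P) (a * b) := IsHom.comp ha hb

lemma isHom_of_commute {P : MF Q f} {a : Module.End Q P.carrier} (he : a * P.even = P.even * a)
    (hd : a * P.d = P.d * a) : IsHom (P := P) (P' := P) a := ⟨he, hd⟩

lemma HtpyEquiv.of_inverse {P P' : MF Q f} {g : P.carrier →ₗ[Q] P'.carrier}
    {g' : P'.carrier →ₗ[Q] P.carrier} (hg : IsHom g) (hg' : IsHom g')
    (h : g' ∘ₗ g = LinearMap.id) (h' : g ∘ₗ g' = LinearMap.id) : HtpyEquiv P P' :=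
  ⟨g, g', hg, hg', ⟨0, by simp [IsOdd], by simp [h]⟩, ⟨0, by simp [IsOdd], by simp [h']⟩⟩

lemma IsContr.of_apply {M : Type u} [AddCommGroup M] [Module Q M] {e d h : Module.End Q M} {s : Q}
    (h1 : ∀ x, h (e x) = h x - e (h x)) (h2 : ∀ x, d (h x) + h (d x) = s • x) : IsContr e d s h :=
  ⟨LinearMap.ext h1, LinearMap.ext h2⟩

/-! ### Short exact sequences -/

/-- A splitting `(r, s)` of graded modules of a sequence `(i, q)`. -/
structure IsGradedSplitting {P' P P'' : MF Q f} (i : P'.carrier →ₗ[Q] P.carrier)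
    (q : P.carrier →ₗ[Q] P''.carrier) (r : P.carrier →ₗ[Q] P'.carrier)
    (s : P''.carrier →ₗ[Q] P.carrier) : Prop where
  r_i : ∀ x, r (i x) = x
  q_s : ∀ x, q (s x) = x
  q_i : ∀ x, q (i x) = 0
  add_eq : ∀ x, i (r x) + s (q x) = x
  r_even : ∀ x, r (P.even x) = P'.even (r x)
  s_even : ∀ x, s (P''.even x) = P.even (s x)

lemma IsGradedSplitting.r_s {P' P P'' : MF Q f} {i : P'.carrier →ₗ[Q] P.carrier}
    {q : P.carrier →ₗ[Q] P''.carrier} {r : P.carrier →ₗ[Q] P'.carrier}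
    {s : P''.carrier →ₗ[Q] P.carrier} (S : IsGradedSplitting i q r s) (x : P''.carrier) :
    r (s x) = 0 := by
  have h := congrArg r (S.add_eq (s x))
  rw [S.q_s, map_add, S.r_i] at h
  simpa using h

/-- Projectivity of `P''` gives a linear section of `q`, and its degree-preserving part is still a
section because `q` preserves degrees. The differentials need not be respected. -/
lemma IsShortExact.exists_splitting {P' P P'' : MF Q f} {i : P'.carrier →ₗ[Q] P.carrier}
    {q : P.carrier →ₗ[Q] P''.carrier} (h : IsShortExact i q) :
    ∃ r s, IsGradedSplitting i q r s := by
  obtain ⟨s₀, hs₀⟩ := Module.projective_lifting_property q LinearMap.id h.surjective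
  let s : P''.carrier →ₗ[Q] P.carrier :=
    P.even ∘ₗ s₀ ∘ₗ P''.even + P.odd ∘ₗ s₀ ∘ₗ P''.odd
  have hq₀ : ∀ x, q (s₀ x) = x := fun x => LinearMap.congr_fun hs₀ x
  have hq : ∀ x, q (s x) = x := by
    intro x
    simp [s, odd_apply, h.isHom_right.apply_even, hq₀, even_apply_even]
  have hse : ∀ x, s (P''.even x) = P.even (s x) := by
    intro x
    simp [s, odd_apply, even_apply_even]
  have hker : ∀ x, q (x - s (q x)) = 0 := fun x => by rw [map_sub, hq, sub_self]
  have hqi : ∀ x, q (i x) = 0 := fun x => (h.exact (i x)).2 ⟨x, rfl⟩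
  let e := LinearEquiv.ofInjective i h.injective
  have hmem : ∀ x, ((LinearMap.id - s ∘ₗ q : P.carrier →ₗ[Q] P.carrier)) x ∈ LinearMap.range i := by
    intro x
    exact (h.exact _).1 (hker x)
  let r : P.carrier →ₗ[Q] P'.carrier :=
    e.symm.toLinearMap ∘ₗ (LinearMap.codRestrict (LinearMap.range i) (LinearMap.id - s ∘ₗ q) hmem)
  have hr : ∀ x, i (r x) = x - s (q x) := by
    intro x
    have := LinearEquiv.apply_symm_apply e (⟨x - s (q x), hmem x⟩ : LinearMap.range i)
    exact congrArg Subtype.val this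
  refine ⟨r, s, ⟨?_, hq, hqi, ?_, ?_, hse⟩⟩
  · intro x
    apply h.injective
    rw [hr, hqi, map_zero, sub_zero]
  · intro x
    rw [hr]; abel
  · intro x
    apply h.injective
    rw [hr, h.isHom_left.apply_even, hr, h.isHom_right.apply_even, hse, map_sub]

lemma IsGradedSplitting.isShortExact {P' P P'' : MF Q f} {i : P'.carrier →ₗ[Q] P.carrier}
    {q : P.carrier →ₗ[Q] P''.carrier} {r : P.carrier →ₗ[Q] P'.carrier}
    {s : P''.carrier →ₗ[Q] P.carrier} (S : IsGradedSplitting i q r s) (hi : IsHom i)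
    (hq : IsHom q) : IsShortExact i q where
  isHom_left := hi
  isHom_right := hq
  injective := Function.LeftInverse.injective S.r_i
  exact := by
    intro x
    constructor
    · intro hx
      exact ⟨r x, by simpa [hx] using S.add_eq x⟩
    · rintro ⟨y, rfl⟩
      exact S.q_i y
  surjective := Function.RightInverse.surjective S.q_s

/-- The support of an extension is contained in the union of the supports. -/
lemma IsShortExact.support_subset {P' P P'' : MF Q f} {i : P'.carrier →ₗ[Q] P.carrier}
    {q : P.carrier →ₗ[Q] P''.carrier} (h : IsShortExact i q) {Z : Set (PrimeSpectrum Q)}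
    (h' : P'.support ⊆ Z) (h'' : P''.support ⊆ Z) : P.support ⊆ Z := by
  obtain ⟨r, s, S⟩ := h.exists_splitting
  refine MF.support_subset fun 𝔭 hn => ?_
  obtain ⟨c', hc', k', K'⟩ := (notMem_support_iff P' 𝔭).1 fun hm => hn (h' hm)
  obtain ⟨c'', hc'', k'', K''⟩ := (notMem_support_iff P'' 𝔭).1 fun hm => hn (h'' hm)
  set c : Q := c' * c'' with hc
  -- The two contractions, assembled along the graded splitting. The anticommutator `A` of `H` with
  -- `d` is multiplication by `c` on the image of `i` and modulo that image, so `(A - c)² = 0`.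
  -- Hence `A (2c - A) = c²`, and `H (2c - A)` is a contraction up to the scalar `c²`.
  let H : Module.End Q P.carrier := c'' • (i ∘ₗ k' ∘ₗ r) + c' • (s ∘ₗ k'' ∘ₗ q)
  let A : Module.End Q P.carrier := P.d * H + H * P.d
  have hHe : ∀ x, H (P.even x) = H x - P.even (H x) := by
    intro x
    simp [H, S.r_even, h.isHom_right.apply_even, K'.apply_even, K''.apply_even,
      h.isHom_left.apply_even, S.s_even]
    module
  have hHi : ∀ x, H (i x) = c'' • i (k' x) := by intro x; simp [H, S.r_i, S.q_i]
  have hqH : ∀ x, q (H x) = c' • k'' (q x) := by intro x; simp [H, S.q_i, S.q_s]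
  have hAi : ∀ x, A (i x) = c • i x := by
    intro x
    have h1 : P.d (i (k' x)) = i (P'.d (k' x)) := (h.isHom_left.apply_d _).symm
    simp only [A, LinearMap.add_apply, Module.End.mul_apply, hHi, map_smul, h1, K'.d_apply,
      ← h.isHom_left.apply_d, map_sub]
    rw [hc]
    module
  have hqA : ∀ x, q (A x) = c • q x := by
    intro x
    simp only [A, LinearMap.add_apply, Module.End.mul_apply, map_add, hqH, h.isHom_right.apply_d,
      map_smul, K''.d_apply]
    rw [hc]
    module
  have hAA : ∀ x, A (A x) = (2 * c) • A x - (c * c) • x := by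
    intro x
    obtain ⟨y, hy⟩ := (h.exact (A x - c • x)).1 (by rw [map_sub, hqA, map_smul, sub_self])
    have h1 : A x = c • x + i y := by rw [hy]; abel
    have h2 : A (A x) = c • A x + c • i y := by
      conv_lhs => rw [h1]
      rw [map_add, map_smul, hAi]
    have h3 : i y = A x - c • x := hy
    rw [h2, h3]
    module
  have hAe : ∀ x, A (P.even x) = P.even (A x) := by
    intro x
    simp only [A, LinearMap.add_apply, Module.End.mul_apply, map_add, hHe, map_sub, even_apply_d]
    rw [P.d_apply_even x, map_sub H, hHe]
    abel
  have hAd : ∀ x, A (P.d x) = P.d (A x) := by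
    intro x
    simp only [A, LinearMap.add_apply, Module.End.mul_apply, map_add, d_apply_d, map_smul]
    abel
  refine ⟨c * c, fun hm => ?_, H * ((2 * c) • 1 - A), IsContr.of_apply ?_ ?_⟩
  · rcases 𝔭.2.mem_or_mem hm with hm | hm <;> rcases 𝔭.2.mem_or_mem hm with hm | hm
    exacts [hc' hm, hc'' hm, hc' hm, hc'' hm]
  · intro x
    simp only [Module.End.mul_apply, LinearMap.sub_apply, LinearMap.smul_apply,
      Module.End.one_apply, hAe]
    rw [← map_smul, ← map_sub, hHe, ]
  · intro x
    have h1 : ∀ y, P.d (H y) + H (P.d y) = A y := fun y => rfl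
    simp only [Module.End.mul_apply, LinearMap.sub_apply, LinearMap.smul_apply,
      Module.End.one_apply, hAd]
    rw [← map_smul P.d, ← map_sub P.d, h1, map_sub, map_smul, hAA]
    module

/-! ### Shift, direct sum and cone -/

/-- The shift `P[1]`. -/
def shift (P : MF Q f) : MF Q f where
  carrier := P.carrier
  even := P.odd
  d := -P.d
  even_mul_even := by ext x; simp [odd_apply, even_apply_even]
  d_mul_even := by ext x; simp [odd_apply, even_apply_d]
  d_mul_d := by ext x; simp [d_apply_d]

/-- The direct sum. -/
def prod (P P' : MF Q f) : MF Q f where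
  carrier := P.carrier × P'.carrier
  even := LinearMap.prodMap P.even P'.even
  d := LinearMap.prodMap P.d P'.d
  even_mul_even := LinearMap.ext fun x => by simp [even_apply_even]
  d_mul_even := LinearMap.ext fun x => by simp [even_apply_d]
  d_mul_d := LinearMap.ext fun x => Prod.ext (P.d_apply_d x.1) (P'.d_apply_d x.2)

/-- The mapping cone of a morphism. -/
def cone {P P' : MF Q f} {g : P.carrier →ₗ[Q] P'.carrier} (hg : IsHom g) : MF Q f where
  carrier := P'.carrier × P.carrier
  even := LinearMap.prodMap P'.even P.odd
  d := LinearMap.prodMap P'.d (-P.d) + LinearMap.inl Q _ _ ∘ₗ g ∘ₗ LinearMap.snd Q _ _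
  even_mul_even := LinearMap.ext fun x => by simp [even_apply_even, odd_apply]
  d_mul_even := LinearMap.ext fun x => by
    simp [even_apply_d, odd_apply, hg.apply_even]; abel
  d_mul_d := LinearMap.ext fun x => Prod.ext (by simp [d_apply_d, hg.apply_d])
    (by simp [d_apply_d])

lemma cone_d_apply {P P' : MF Q f} {g : P.carrier →ₗ[Q] P'.carrier} (hg : IsHom g)
    (y : P'.carrier) (x : P.carrier) : (cone hg).d (y, x) = (P'.d y + g x, -P.d x) :=
  Prod.ext rfl (add_zero _)

lemma cone_even_apply {P P' : MF Q f} {g : P.carrier →ₗ[Q] P'.carrier} (hg : IsHom g)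
    (y : P'.carrier) (x : P.carrier) : (cone hg).even (y, x) = (P'.even y, x - P.even x) := rfl

lemma isShortExact_prod (P P' : MF Q f) :
    IsShortExact (P' := P) (P := P.prod P') (P'' := P') (LinearMap.inl Q P.carrier P'.carrier)
      (LinearMap.snd Q P.carrier P'.carrier) :=
  IsGradedSplitting.isShortExact (P' := P) (P := P.prod P') (P'' := P')
    (r := LinearMap.fst Q P.carrier P'.carrier) (s := LinearMap.inr Q P.carrier P'.carrier)
    ⟨fun _ => rfl, fun _ => rfl, fun _ => rfl,
      fun _ => Prod.ext (add_zero _) (zero_add _), fun _ => rfl,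
      fun _ => Prod.ext (map_zero P.even).symm rfl⟩
    (IsHom.of_apply (fun _ => Prod.ext rfl (map_zero P'.even).symm)
      fun _ => Prod.ext rfl (map_zero P'.d).symm)
    (IsHom.of_apply (fun _ => rfl) fun _ => rfl)

lemma isShortExact_prod' (P P' : MF Q f) :
    IsShortExact (P' := P') (P := P.prod P') (P'' := P) (LinearMap.inr Q P.carrier P'.carrier)
      (LinearMap.fst Q P.carrier P'.carrier) :=
  IsGradedSplitting.isShortExact (P' := P') (P := P.prod P') (P'' := P)
    (r := LinearMap.snd Q P.carrier P'.carrier) (s := LinearMap.inl Q P.carrier P'.carrier)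
    ⟨fun _ => rfl, fun _ => rfl, fun _ => rfl,
      fun _ => Prod.ext (zero_add _) (add_zero _), fun _ => rfl,
      fun _ => Prod.ext rfl (map_zero P'.even).symm⟩
    (IsHom.of_apply (fun _ => Prod.ext (map_zero P.even).symm rfl)
      fun _ => Prod.ext (map_zero P.d).symm rfl)
    (IsHom.of_apply (fun _ => rfl) fun _ => rfl)

lemma isShortExact_cone {P P' : MF Q f} {g : P.carrier →ₗ[Q] P'.carrier} (hg : IsHom g) :
    IsShortExact (P' := P') (P := cone hg) (P'' := P.shift) (LinearMap.inl Q P'.carrier P.carrier)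
      (LinearMap.snd Q P'.carrier P.carrier) :=
  IsGradedSplitting.isShortExact (P' := P') (P := cone hg) (P'' := P.shift)
    (r := LinearMap.fst Q P'.carrier P.carrier) (s := LinearMap.inr Q P'.carrier P.carrier)
    ⟨fun _ => rfl, fun _ => rfl, fun _ => rfl,
      fun _ => Prod.ext (add_zero _) (zero_add _), fun _ => rfl,
      fun _ => Prod.ext (map_zero P'.even).symm rfl⟩
    (IsHom.of_apply (fun _ => Prod.ext rfl (map_zero P.odd).symm)
      fun x => ((cone_d_apply hg x 0).trans (Prod.ext (show P'.d x + g 0 = P'.d x by simp)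
        (show -P.d 0 = 0 by simp))).symm)
    (IsHom.of_apply (fun _ => rfl) fun x : P'.carrier × P.carrier =>
      congrArg Prod.snd (cone_d_apply hg x.1 x.2))

lemma support_shift (P : MF Q f) : P.shift.support ⊆ P.support := by
  refine support_subset fun 𝔭 hn => ?_
  obtain ⟨s, hs, h, H⟩ := (notMem_support_iff _ _).1 hn
  refine ⟨s, hs, -h, IsContr.of_apply (fun x : P.carrier => ?_) (fun x : P.carrier => ?_)⟩
  · change -h (x - P.even x) = -h x - (-h x - P.even (-h x))
    rw [map_sub, H.apply_even, map_neg]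
    abel
  · change -P.d (-h x) + -h (-P.d x) = s • x
    simp [H.d_apply]

/-- The cone of a homotopy equivalence is contractible. -/
lemma exists_contr_cone {P P' : MF Q f} {g : P.carrier →ₗ[Q] P'.carrier}
    {g' : P'.carrier →ₗ[Q] P.carrier} (hg : IsHom g) (hg' : IsHom g')
    (h1 : Homotopic (P := P) (P' := P) (g' ∘ₗ g) LinearMap.id)
    (h2 : Homotopic (P := P') (P' := P') (g ∘ₗ g') LinearMap.id) :
    ∃ h, IsContr (cone hg).even (cone hg).d 1 h := by
  obtain ⟨h, hodd, hh⟩ := h1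
  obtain ⟨k, kodd, hk⟩ := h2
  have hodd' : ∀ x, h (P.even x) = h x - P.even (h x) := fun x => LinearMap.congr_fun hodd x
  have kodd' : ∀ x, k (P'.even x) = k x - P'.even (k x) := fun x => LinearMap.congr_fun kodd x
  have hh' : ∀ x, P.d (h x) = g' (g x) - x - h (P.d x) := fun x =>
    eq_sub_of_add_eq (LinearMap.congr_fun hh x)
  have hk' : ∀ x, P'.d (k x) = g (g' x) - x - k (P'.d x) := fun x =>
    eq_sub_of_add_eq (LinearMap.congr_fun hk x)
  let n : P.carrier →ₗ[Q] P'.carrier := g ∘ₗ h - k ∘ₗ g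
  have hnd : ∀ x, P'.d (n x) = -n (P.d x) := by
    intro x
    simp only [n, LinearMap.sub_apply, LinearMap.comp_apply, map_sub, hk', ← hg.apply_d, hh']
    abel
  have hne : ∀ x, n (P.even x) = n x - P'.even (n x) := by
    intro x
    simp only [n, LinearMap.sub_apply, LinearMap.comp_apply, map_sub, hodd', hg.apply_even, kodd']
    abel
  -- The candidate `(y, x) ↦ (-k y, g' y + h x)` contracts the cone up to the error `(y, x) ↦ (n x,
  -- 0)`, which has square zero. `H` is this candidate precomposed with `(y, x) ↦ (y - n x, x)`.
  let H : P'.carrier × P.carrier →ₗ[Q] P'.carrier × P.carrier :=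
    LinearMap.prod (-(k ∘ₗ LinearMap.fst Q _ _) + k ∘ₗ n ∘ₗ LinearMap.snd Q _ _)
      (g' ∘ₗ LinearMap.fst Q _ _ - g' ∘ₗ n ∘ₗ LinearMap.snd Q _ _ + h ∘ₗ LinearMap.snd Q _ _)
  have hH : ∀ y x, H (y, x) = (-k y + k (n x), g' y - g' (n x) + h x) := fun _ _ => rfl
  refine ⟨H, IsContr.of_apply (fun z : P'.carrier × P.carrier => ?_)
    (fun z : P'.carrier × P.carrier => ?_)⟩ <;> obtain ⟨y, x⟩ := z
  · have e1 := (congrArg (cone hg).even (hH y x)).trans (cone_even_apply hg _ _)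
    refine (congrArg H (cone_even_apply hg y x)).trans (Eq.trans ?_
      (congrArg (fun t : P'.carrier × P.carrier => H (y, x) - t) e1.symm))
    rw [hH, hH]
    refine Prod.ext ?_ ?_ <;>
    simp only [Prod.fst_sub, Prod.snd_sub, map_sub, map_add, map_neg, kodd', hne, hodd',
      hg'.apply_even] <;> abel
  · have e1 := (congrArg (cone hg).d (hH y x)).trans (cone_d_apply hg _ _)
    have e2 := (congrArg H (cone_d_apply hg y x)).trans (hH _ _)
    refine (congrArg₂ (fun t t' : P'.carrier × P.carrier => t + t') e1 e2).trans
      (Eq.trans ?_ (one_smul Q ((y, x) : P'.carrier × P.carrier)).symm)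
    refine Prod.ext ?_ ?_
    · simp only [Prod.mk_add_mk, map_sub, map_add, map_neg, hk', hnd]
      simp only [n, LinearMap.sub_apply, LinearMap.comp_apply, map_sub]
      abel
    · simp only [Prod.mk_add_mk, map_sub, map_add, map_neg, hh', ← hg'.apply_d, hnd]
      abel

end MF

/-! ### Generalities on Grothendieck groups -/

section K0

variable {Q : Type u} [CommRing Q] {Z : Set (PrimeSpectrum Q)} {f : Q}

lemma K0.mk_shortExact {P' P P'' : MFZ Z f} {i : P'.1.carrier →ₗ[Q] P.1.carrier}
    {q : P.1.carrier →ₗ[Q] P''.1.carrier} (h : MF.IsShortExact i q) :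
    K0.mk P = K0.mk P' + K0.mk P'' := by
  have h1 : (QuotientAddGroup.mk (FreeAbelianGroup.of P - (FreeAbelianGroup.of P' +
      FreeAbelianGroup.of P'')) : FreeAbelianGroup (MFZ Z f) ⧸
        AddSubgroup.closure {x | K0Rel Z f x}) = 0 :=
    (QuotientAddGroup.eq_zero_iff _).2
      (AddSubgroup.subset_closure (K0Rel.shortExact P' P P'' i q h))
  exact sub_eq_zero.1 h1

lemma K0.mk_eq_of_htpyEquiv {P P' : MFZ Z f} (h : MF.HtpyEquiv P.1 P'.1) : K0.mk P = K0.mk P' := by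
  have h1 : (QuotientAddGroup.mk (FreeAbelianGroup.of P - FreeAbelianGroup.of P') :
      FreeAbelianGroup (MFZ Z f) ⧸ AddSubgroup.closure {x | K0Rel Z f x}) = 0 :=
    (QuotientAddGroup.eq_zero_iff _).2
      (AddSubgroup.subset_closure (K0Rel.htpyEquiv P P' h))
  exact sub_eq_zero.1 h1

/-- The zero object. -/
def MFZ.zero (Z : Set (PrimeSpectrum Q)) (f : Q) : MFZ Z f :=
  ⟨MF.zero f, MF.support_zero.trans (Set.empty_subset Z)⟩

lemma MF.isShortExact_zero (P : MF Q f) :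
    MF.IsShortExact (P' := MF.zero f) (P := P) (P'' := P) 0 LinearMap.id :=
  MF.IsGradedSplitting.isShortExact (P' := MF.zero f) (P := P) (P'' := P) (r := 0)
    (s := LinearMap.id)
    ⟨fun _ => Subsingleton.elim (α := PUnit) _ _, fun _ => rfl, fun _ => rfl, fun x => by simp,
      fun x => by simp, fun x => rfl⟩ (MF.IsHom.zero _ _) (MF.IsHom.id _)

lemma K0.mk_zero : K0.mk (MFZ.zero Z f) = 0 := by
  have := K0.mk_shortExact (P' := MFZ.zero Z f) (P := MFZ.zero Z f) (P'' := MFZ.zero Z f)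
    (MF.isShortExact_zero _)
  simpa using this

lemma K0.mk_eq_zero_of_contr {P : MFZ Z f} {h : Module.End Q P.1.carrier}
    (H : MF.IsContr P.1.even P.1.d 1 h) : K0.mk P = 0 := by
  rw [K0.mk_eq_of_htpyEquiv (P' := MFZ.zero Z f) ((MF.htpyEquiv_zero_iff _).2 ⟨h, H⟩), K0.mk_zero]

/-- The direct sum in `mf^Z(Q, f)`. -/
def MFZ.prod (P P' : MFZ Z f) : MFZ Z f :=
  ⟨P.1.prod P'.1, (MF.isShortExact_prod P.1 P'.1).support_subset P.2 P'.2⟩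

/-- The shift in `mf^Z(Q, f)`. -/
def MFZ.shift (P : MFZ Z f) : MFZ Z f := ⟨P.1.shift, (MF.support_shift _).trans P.2⟩

/-- The cone in `mf^Z(Q, f)`. -/
def MFZ.cone {P P' : MFZ Z f} {g : P.1.carrier →ₗ[Q] P'.1.carrier} (hg : MF.IsHom g) : MFZ Z f :=
  ⟨MF.cone hg, (MF.isShortExact_cone hg).support_subset P'.2 P.shift.2⟩

lemma K0.mk_prod (P P' : MFZ Z f) : K0.mk (P.prod P') = K0.mk P + K0.mk P' :=
  K0.mk_shortExact (P' := P) (P := P.prod P') (P'' := P') (MF.isShortExact_prod P.1 P'.1)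

section Lift

variable {H : Type*} [AddCommGroup H] {F : MFZ Z f → H}
  (hs : ∀ (P' P P'' : MFZ Z f) (i : P'.1.carrier →ₗ[Q] P.1.carrier)
    (q : P.1.carrier →ₗ[Q] P''.1.carrier), MF.IsShortExact i q → F P = F P' + F P'')
  (hc : ∀ (P : MFZ Z f) (h : Module.End Q P.1.carrier), MF.IsContr P.1.even P.1.d 1 h → F P = 0)

include hs hc in
-- The cone of a homotopy equivalence is contractible, and it is an extension of `P.shift` by `P'`.
-- The identity gives `F P.shift = -F P`, and both together show that `F` is invariant under
-- homotopy equivalence. So a homomorphism out of `K0` only has to be checked on exact sequences and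
-- contractible objects.
lemma MFZ.map_add_map_shift_eq_zero {P P' : MFZ Z f} {g : P.1.carrier →ₗ[Q] P'.1.carrier}
    {g' : P'.1.carrier →ₗ[Q] P.1.carrier} (hg : MF.IsHom g) (hg' : MF.IsHom g')
    (h1 : MF.Homotopic (P := P.1) (P' := P.1) (g' ∘ₗ g) LinearMap.id)
    (h2 : MF.Homotopic (P := P'.1) (P' := P'.1) (g ∘ₗ g') LinearMap.id) :
    F P' + F P.shift = 0 := by
  obtain ⟨h, H⟩ := MF.exists_contr_cone hg hg' h1 h2
  rw [← hs P' (MFZ.cone hg) P.shift _ _ (MF.isShortExact_cone hg), hc (MFZ.cone hg) h H]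

include hs hc in
lemma MFZ.map_shift (P : MFZ Z f) : F P.shift = -F P := by
  have h0 : MF.Homotopic (P := P.1) (P' := P.1) (LinearMap.id ∘ₗ LinearMap.id) LinearMap.id :=
    ⟨0, by simp [MF.IsOdd], by simp⟩
  have := MFZ.map_add_map_shift_eq_zero hs hc (MF.IsHom.id P.1) (MF.IsHom.id P.1) h0 h0
  rw [add_comm] at this
  exact eq_neg_of_add_eq_zero_left this

include hs hc in
lemma MFZ.map_eq_of_htpyEquiv {P P' : MFZ Z f} (h : MF.HtpyEquiv P.1 P'.1) : F P = F P' := by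
  obtain ⟨g, g', hg, hg', h1, h2⟩ := h
  have := MFZ.map_add_map_shift_eq_zero hs hc hg hg' h1 h2
  rw [MFZ.map_shift hs hc, ← sub_eq_add_neg, sub_eq_zero] at this
  exact this.symm

/-- A function on matrix factorizations that is additive on short exact sequences and vanishes on
contractible objects induces a homomorphism on the Grothendieck group. -/
def K0.lift : K0 Z f →+ H :=
  QuotientAddGroup.lift _ (FreeAbelianGroup.lift F) ((AddSubgroup.closure_le _).2 (by
    rintro x (⟨P', P, P'', i, q, h⟩ | ⟨P, P', h⟩)
    · change FreeAbelianGroup.lift F _ = 0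
      rw [map_sub, map_add, FreeAbelianGroup.lift_apply_of, FreeAbelianGroup.lift_apply_of,
        FreeAbelianGroup.lift_apply_of, hs P' P P'' i q h, sub_self]
    · change FreeAbelianGroup.lift F _ = 0
      rw [map_sub, FreeAbelianGroup.lift_apply_of, FreeAbelianGroup.lift_apply_of,
        MFZ.map_eq_of_htpyEquiv hs hc h, sub_self]))

@[simp]
lemma K0.lift_mk (P : MFZ Z f) : K0.lift hs hc (K0.mk P) = F P :=
  FreeAbelianGroup.lift_apply_of F P

end Lift

lemma K0.mk_shift (P : MFZ Z f) : K0.mk P.shift = -K0.mk P :=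
  MFZ.map_shift (F := K0.mk) (fun _ _ _ _ _ h => K0.mk_shortExact h)
    (fun _ _ h => K0.mk_eq_zero_of_contr h) P

/-- Sums of classes are classes of direct sums, and negatives are classes of shifts. -/
lemma K0.mk_surjective : Function.Surjective (K0.mk : MFZ Z f → K0 Z f) := by
  intro x
  obtain ⟨x, rfl⟩ := QuotientAddGroup.mk_surjective x
  induction x using FreeAbelianGroup.induction_on with
  | zero => exact ⟨MFZ.zero Z f, K0.mk_zero⟩
  | of P => exact ⟨P, rfl⟩
  | neg P _ => exact ⟨P.shift, K0.mk_shift P⟩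
  | add x y hx hy =>
    obtain ⟨P, hP⟩ := hx
    obtain ⟨P', hP'⟩ := hy
    exact ⟨P.prod P', by rw [K0.mk_prod, hP, hP']; rfl⟩

lemma K0.hom_ext {H : Type*} [AddCommGroup H] {φ ψ : K0 Z f →+ H}
    (h : ∀ P, φ (K0.mk P) = ψ (K0.mk P)) : φ = ψ := by
  ext x
  obtain ⟨P, rfl⟩ := K0.mk_surjective x
  exact h P

end K0

end

end AdamsMF

/-! ### Direct summands, and the operations induced on Grothendieck groups. -/

namespace AdamsMF

noncomputable section

namespace MF

variable {Q : Type u} [CommRing Q] {f f₁ f₂ f' : Q}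

/-! ### Retracts -/

/-- `R` is a direct summand of `P`, cut out by the idempotent endomorphism `ε`. -/
def IsRetract (R P : MF Q f) (ε : Module.End Q P.carrier) : Prop :=
  ∃ (i : R.carrier →ₗ[Q] P.carrier) (r : P.carrier →ₗ[Q] R.carrier),
    IsHom i ∧ IsHom r ∧ (∀ x, r (i x) = x) ∧ ∀ x, i (r x) = ε x

lemma isRetract_one (P : MF Q f) : IsRetract P P 1 :=
  ⟨LinearMap.id, LinearMap.id, IsHom.id P, IsHom.id P, fun _ => rfl, fun _ => rfl⟩

/-- The image of an idempotent endomorphism. -/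
lemma exists_isRetract {P : MF Q f} {ε : Module.End Q P.carrier} (hε : IsHom ε)
    (h : ε * ε = ε) : ∃ R : MF Q f, IsRetract R P ε := by
  have hεε : ∀ x, ε (ε x) = ε x := fun x => LinearMap.congr_fun h x
  let N : Submodule Q P.carrier := LinearMap.range ε
  have hN : ∀ x ∈ N, ε x = x := by
    rintro _ ⟨y, rfl⟩
    exact hεε y
  have he : ∀ x ∈ N, P.even x ∈ N := by
    rintro _ ⟨y, rfl⟩
    exact ⟨P.even y, hε.apply_even y⟩
  have hd : ∀ x ∈ N, P.d x ∈ N := by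
    rintro _ ⟨y, rfl⟩
    exact ⟨P.d y, hε.apply_d y⟩
  let π : P.carrier →ₗ[Q] N := ε.rangeRestrict
  have hπ : π ∘ₗ N.subtype = LinearMap.id := LinearMap.ext fun x => Subtype.ext (hN x x.2)
  let R : MF Q f :=
    { carrier := N
      instFinite := Module.Finite.of_surjective π fun x => ⟨x, LinearMap.congr_fun hπ x⟩
      instProjective := Module.Projective.of_split _ π hπ
      even := P.even.restrict he
      d := P.d.restrict hd
      even_mul_even := LinearMap.ext fun x => Subtype.ext (P.even_apply_even x)
      d_mul_even := LinearMap.ext fun x => Subtype.ext (P.d_apply_even x)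
      d_mul_d := LinearMap.ext fun x => Subtype.ext (P.d_apply_d x) }
  exact ⟨R, N.subtype, π, ⟨rfl, rfl⟩,
    ⟨LinearMap.ext fun x => Subtype.ext (hε.apply_even x),
      LinearMap.ext fun x => Subtype.ext (hε.apply_d x)⟩,
    fun x => LinearMap.congr_fun hπ x, fun x => rfl⟩

namespace IsRetract

variable {R R' P P' : MF Q f} {ε : Module.End Q P.carrier} {ε' : Module.End Q P'.carrier}

lemma idem (h : IsRetract R P ε) (x : P.carrier) : ε (ε x) = ε x := by
  obtain ⟨i, r, -, -, h1, h2⟩ := h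
  rw [← h2, ← h2, h1]

lemma isHom (h : IsRetract R P ε) : IsHom (P := P) (P' := P) ε := by
  obtain ⟨i, r, hi, hr, h1, h2⟩ := h
  obtain rfl : i ∘ₗ r = ε := LinearMap.ext h2
  exact hi.comp hr

lemma support_subset (h : IsRetract R P ε) : R.support ⊆ P.support := by
  obtain ⟨i, r, hi, hr, h1, -⟩ := h
  refine MF.support_subset fun 𝔭 hn => ?_
  obtain ⟨s, hs, k, K⟩ := (notMem_support_iff _ _).1 hn
  refine ⟨s, hs, r ∘ₗ k ∘ₗ i, IsContr.of_apply (fun x => ?_) fun x => ?_⟩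
  · simp [hi.apply_even, K.apply_even, ← hr.apply_even]
  · simp [hi.apply_d, ← hr.apply_d, K.d_apply, h1]

/-- The compressions of `a` and `b` to the two images are mutually inverse. Neither `a` nor `b` has
to carry one image into the other, a freedom that the comparison of an eigenspace with a set of
orbit representatives uses. -/
lemma htpyEquiv (h : IsRetract R P ε) (h' : IsRetract R' P' ε') {a : P.carrier →ₗ[Q] P'.carrier}
    {b : P'.carrier →ₗ[Q] P.carrier} (ha : IsHom a) (hb : IsHom b)
    (hba : ∀ x, ε (b (ε' (a (ε x)))) = ε x) (hab : ∀ x, ε' (a (ε (b (ε' x)))) = ε' x) :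
    HtpyEquiv R R' := by
  obtain ⟨i, r, hi, hr, h1, h2⟩ := h
  obtain ⟨i', r', hi', hr', h1', h2'⟩ := h'
  refine HtpyEquiv.of_inverse (g := r' ∘ₗ a ∘ₗ i) (g' := r ∘ₗ b ∘ₗ i') (hr'.comp (ha.comp hi))
    (hr.comp (hb.comp hi')) (LinearMap.ext fun x => ?_) (LinearMap.ext fun x => ?_)
  · have := congrArg r (hba (i x))
    simpa [← h2, ← h2', h1] using this
  · have := congrArg r' (hab (i' x))
    simpa [← h2, ← h2', h1'] using this

lemma congr (h : IsRetract R P ε) {η : Module.End Q P.carrier} (hη : ε = η) :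
    IsRetract R P η := hη ▸ h

end IsRetract

end MF

section K0

variable {Q : Type u} [CommRing Q] {Z : Set (PrimeSpectrum Q)} {f : Q}

namespace K0

lemma mk_eq_of_isRetract {R R' : MFZ Z f} {P P' : MF Q f} {ε : Module.End Q P.carrier}
    {ε' : Module.End Q P'.carrier} (h : MF.IsRetract R.1 P ε) (h' : MF.IsRetract R'.1 P' ε')
    {a : P.carrier →ₗ[Q] P'.carrier} {b : P'.carrier →ₗ[Q] P.carrier} (ha : MF.IsHom a)
    (hb : MF.IsHom b) (hba : ∀ x, ε (b (ε' (a (ε x)))) = ε x)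
    (hab : ∀ x, ε' (a (ε (b (ε' x)))) = ε' x) : mk R = mk R' :=
  mk_eq_of_htpyEquiv (h.htpyEquiv h' ha hb hba hab)

lemma mk_eq_of_isRetract_same {R R' : MFZ Z f} {P : MF Q f} {ε : Module.End Q P.carrier}
    (h : MF.IsRetract R.1 P ε) (h' : MF.IsRetract R'.1 P ε) : mk R = mk R' :=
  mk_eq_of_isRetract h h' (MF.IsHom.id P) (MF.IsHom.id P) (fun x => by simp [h.idem])
    fun x => by simp [h.idem]

lemma mk_eq_of_iso {P P' : MFZ Z f} {a : P.1.carrier →ₗ[Q] P'.1.carrier}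
    {b : P'.1.carrier →ₗ[Q] P.1.carrier} (ha : MF.IsHom a) (hb : MF.IsHom b)
    (hba : ∀ x, b (a x) = x) (hab : ∀ x, a (b x) = x) : mk P = mk P' :=
  mk_eq_of_htpyEquiv (MF.HtpyEquiv.of_inverse ha hb (LinearMap.ext hba) (LinearMap.ext hab))

lemma mk_eq_zero_of_isRetract {R : MFZ Z f} {P : MF Q f} (h : MF.IsRetract R.1 P 0) :
    mk R = 0 := by
  obtain ⟨i, r, hi, hr, h1, h2⟩ := h
  have h3 : ∀ x, x = (0 : R.1.carrier) := fun x => by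
    have h3 : i x = 0 := by rw [← h1 x, h2, LinearMap.zero_apply]
    rw [← h1 x, h3, map_zero]
  exact mk_eq_zero_of_contr (h := 0) (MF.IsContr.of_apply (fun x => by simp) fun x => by
    rw [h3 x]; simp)

lemma mk_isRetract_add {R R₁ R₂ : MFZ Z f} {P : MF Q f} {ε₁ ε₂ : Module.End Q P.carrier}
    (h : MF.IsRetract R.1 P (ε₁ + ε₂)) (h₁ : MF.IsRetract R₁.1 P ε₁)
    (h₂ : MF.IsRetract R₂.1 P ε₂) (h12 : ε₁ * ε₂ = 0) (h21 : ε₂ * ε₁ = 0) :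
    mk R = mk R₁ + mk R₂ := by
  have k1 := h₁.idem
  have k2 := h₂.idem
  have h12' : ∀ x, ε₁ (ε₂ x) = 0 := fun x => LinearMap.congr_fun h12 x
  have h21' : ∀ x, ε₂ (ε₁ x) = 0 := fun x => LinearMap.congr_fun h21 x
  have hom1 := h₁.isHom
  have hom2 := h₂.isHom
  obtain ⟨i, r, hi, hr, hri, hir⟩ := h
  obtain ⟨i₁, r₁, hi₁, hr₁, hri₁, hir₁⟩ := h₁
  obtain ⟨i₂, r₂, hi₂, hr₂, hri₂, hir₂⟩ := h₂
  have e1 : ∀ x, i₁ x = ε₁ (i₁ x) := fun x => by rw [← hir₁, hri₁]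
  have e2 : ∀ x, i₂ x = ε₂ (i₂ x) := fun x => by rw [← hir₂, hri₂]
  refine mk_shortExact (i := r ∘ₗ i₁) (q := r₂ ∘ₗ i) (MF.IsGradedSplitting.isShortExact
    (r := r₁ ∘ₗ i) (s := r ∘ₗ i₂) ⟨fun x => ?_, fun x => ?_, fun x => ?_, fun x => ?_, fun x => ?_,
      fun x => ?_⟩ (hr.comp hi₁) (hr₂.comp hi))
  · change r₁ (i (r (i₁ x))) = x
    rw [hir, e1, LinearMap.add_apply, k1, h21', add_zero, ← e1, hri₁]
  · change r₂ (i (r (i₂ x))) = x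
    rw [hir, e2, LinearMap.add_apply, k2, h12', zero_add, ← e2, hri₂]
  · change r₂ (i (r (i₁ x))) = 0
    rw [hir, e1, LinearMap.add_apply, k1, h21', add_zero, ← hri₂ (r₂ _), hir₂, h21', map_zero]
  · change r (i₁ (r₁ (i x))) + r (i₂ (r₂ (i x))) = x
    rw [hir₁, hir₂, ← map_add, ← LinearMap.add_apply, ← hir, hri, hri]
  · simp [hi.apply_even, hr₁.apply_even]
  · simp [hi₂.apply_even, hr.apply_even]

lemma mk_isRetract_sum {ι : Type*} [DecidableEq ι] (s : Finset ι) {P : MF Q f}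
    {ε : ι → Module.End Q P.carrier} (R : ι → MFZ Z f)
    (hR : ∀ j ∈ s, MF.IsRetract (R j).1 P (ε j))
    (horth : ∀ j ∈ s, ∀ k ∈ s, j ≠ k → ε j * ε k = 0) {S : MFZ Z f}
    (hS : MF.IsRetract S.1 P (∑ j ∈ s, ε j)) : mk S = ∑ j ∈ s, mk (R j) := by
  induction s using Finset.induction_on generalizing S with
  | empty => simpa using mk_eq_zero_of_isRetract (by simpa using hS)
  | insert a s ha ih =>
    have horth' : ∀ j ∈ s, ∀ k ∈ s, j ≠ k → ε j * ε k = 0 := fun j hj k hk =>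
      horth j (Finset.mem_insert_of_mem hj) k (Finset.mem_insert_of_mem hk)
    have h1 : ε a * ∑ j ∈ s, ε j = 0 := by
      rw [Finset.mul_sum]
      exact Finset.sum_eq_zero fun j hj => horth a (Finset.mem_insert_self _ _) j
        (Finset.mem_insert_of_mem hj) (by rintro rfl; exact ha hj)
    have h2 : (∑ j ∈ s, ε j) * ε a = 0 := by
      rw [Finset.sum_mul]
      exact Finset.sum_eq_zero fun j hj => horth j (Finset.mem_insert_of_mem hj) a
        (Finset.mem_insert_self _ _) (by rintro rfl; exact ha hj)
    have hidem : ∀ j ∈ s, ε j * ε j = ε j := fun j hj =>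
      LinearMap.ext (hR j (Finset.mem_insert_of_mem hj)).idem
    have h3 : (∑ j ∈ s, ε j) * ∑ j ∈ s, ε j = ∑ j ∈ s, ε j := by
      rw [Finset.sum_mul_sum]
      refine Finset.sum_congr rfl fun j hj => ?_
      rw [Finset.sum_eq_single j (fun k hk hjk => horth' j hj k hk hjk.symm)
        (fun h => absurd hj h), hidem j hj]
    have h4 : MF.IsHom (P := P) (P' := P) (∑ j ∈ s, ε j) :=
      MF.IsHom.sum fun j hj => (hR j (Finset.mem_insert_of_mem hj)).isHom
    obtain ⟨T, hT⟩ := MF.exists_isRetract h4 h3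
    rw [Finset.sum_insert ha] at hS ⊢
    -- The ambient `P` is not assumed to be supported in `Z`, so the partial sum inherits its
    -- support condition as a direct summand of `S`.
    have hTS : T.support ⊆ S.1.support := by
      obtain ⟨i, r, hi, hr, hri, hir⟩ := hS
      obtain ⟨j, t, hj, ht, htj, hjt⟩ := hT
      have : MF.IsRetract T S.1 ((r ∘ₗ j) ∘ₗ (t ∘ₗ i)) :=
        ⟨r ∘ₗ j, t ∘ₗ i, hr.comp hj, ht.comp hi, fun x => by
          have e1 : j x = (∑ j ∈ s, ε j) (j x) := by rw [← hjt, htj]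
          have e2 : ε a (j x) = 0 := by
            rw [e1]
            exact LinearMap.congr_fun h1 (j x)
          simp only [LinearMap.comp_apply]
          rw [hir, LinearMap.add_apply, e2, zero_add, ← e1, htj], fun x => rfl⟩
      exact this.support_subset
    let T' : MFZ Z f := ⟨T, hTS.trans S.2⟩
    rw [mk_isRetract_add (R₂ := T') hS (hR a (Finset.mem_insert_self _ _)) hT h1 h2,
      ih (fun j hj => hR j (Finset.mem_insert_of_mem hj)) horth' (S := T') hT]

end K0

end K0

/-! ### Functoriality -/

namespace MF

variable {Q : Type u} [CommRing Q] {f f₁ f₂ f' : Q}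

lemma IsHom.tensor {P R : MF Q f₁} {P' R' : MF Q f₂} {g : P.carrier →ₗ[Q] R.carrier}
    {g' : P'.carrier →ₗ[Q] R'.carrier} (h : IsHom g) (h' : IsHom g') :
    IsHom (P := P.tensor P') (P' := R.tensor R') (TensorProduct.map g g') := by
  refine ⟨TensorProduct.ext' fun x y => ?_, TensorProduct.ext' fun x y => ?_⟩
  · change TensorProduct.map g g' (P.even x ⊗ₜ P'.even y + P.odd x ⊗ₜ P'.odd y) =
      R.even (g x) ⊗ₜ R'.even (g' y) + R.odd (g x) ⊗ₜ R'.odd (g' y)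
    simp [odd_apply, h.apply_even, h'.apply_even]
  · change TensorProduct.map g g' (P.d x ⊗ₜ y + P.sgn x ⊗ₜ P'.d y) =
      R.d (g x) ⊗ₜ g' y + R.sgn (g x) ⊗ₜ R'.d (g' y)
    simp [sgn_apply, h.apply_even, h.apply_d, h'.apply_d]

lemma IsHom.mult {P R : MF Q f} {g : P.carrier →ₗ[Q] R.carrier} (h : IsHom g) (u : Q) :
    IsHom (P := P.mult u) (P' := R.mult u) g := by
  refine ⟨h.comm_even, LinearMap.ext fun x : P.carrier => ?_⟩
  change g (P.d (P.odd x + u • P.even x)) = R.d (R.odd (g x) + u • R.even (g x))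
  simp [odd_apply, h.apply_even, h.apply_d]

lemma IsHom.ofEq {P R : MF Q f} {g : P.carrier →ₗ[Q] R.carrier} (h : IsHom g) (h' : f = f') :
    IsHom (P := P.ofEq h') (P' := R.ofEq h') g := ⟨h.1, h.2⟩

lemma IsHom.baseChange {P R : MF Q f} {g : P.carrier →ₗ[Q] R.carrier} (h : IsHom g)
    (Q' : Type u) [CommRing Q'] [Algebra Q Q'] :
    IsHom (P := P.baseChange Q') (P' := R.baseChange Q') (g.baseChange Q') := by
  refine ⟨?_, ?_⟩
  · change g.baseChange Q' ∘ₗ P.even.baseChange Q' = R.even.baseChange Q' ∘ₗ g.baseChange Q'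
    rw [← LinearMap.baseChange_comp, ← LinearMap.baseChange_comp, h.comm_even]
  · change g.baseChange Q' ∘ₗ P.d.baseChange Q' = R.d.baseChange Q' ∘ₗ g.baseChange Q'
    rw [← LinearMap.baseChange_comp, ← LinearMap.baseChange_comp, h.comm_d]

lemma IsRetract.tensor {P R : MF Q f₁} {P' R' : MF Q f₂} {ε : Module.End Q P.carrier}
    {ε' : Module.End Q P'.carrier} (h : IsRetract R P ε) (h' : IsRetract R' P' ε') :
    IsRetract (R.tensor R') (P.tensor P') (TensorProduct.map ε ε') := by
  obtain ⟨i, r, hi, hr, h1, h2⟩ := h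
  obtain ⟨i', r', hi', hr', h1', h2'⟩ := h'
  have e1 : r ∘ₗ i = LinearMap.id := LinearMap.ext h1
  have e1' : r' ∘ₗ i' = LinearMap.id := LinearMap.ext h1'
  have e2 : i ∘ₗ r = ε := LinearMap.ext h2
  have e2' : i' ∘ₗ r' = ε' := LinearMap.ext h2'
  refine ⟨TensorProduct.map i i', TensorProduct.map r r', hi.tensor hi', hr.tensor hr',
    fun x => ?_, fun x => ?_⟩
  · refine LinearMap.congr_fun
      (?_ : TensorProduct.map r r' ∘ₗ TensorProduct.map i i' = LinearMap.id) x
    rw [← TensorProduct.map_comp, e1, e1', TensorProduct.map_id]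
  · refine LinearMap.congr_fun (?_ : TensorProduct.map i i' ∘ₗ TensorProduct.map r r' = _) x
    rw [← TensorProduct.map_comp, e2, e2']

lemma IsRetract.ofEq {R P : MF Q f} {ε : Module.End Q P.carrier} (h : IsRetract R P ε)
    (h' : f = f') : IsRetract (R.ofEq h') (P.ofEq h') ε := by
  obtain ⟨i, r, hi, hr, h1, h2⟩ := h
  exact ⟨i, r, hi.ofEq h', hr.ofEq h', h1, h2⟩

lemma IsRetract.mult {R P : MF Q f} {ε : Module.End Q P.carrier} (h : IsRetract R P ε) (u : Q) :
    IsRetract (R.mult u) (P.mult u) ε := by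
  obtain ⟨i, r, hi, hr, h1, h2⟩ := h
  exact ⟨i, r, hi.mult u, hr.mult u, h1, h2⟩

lemma IsRetract.baseChange {R P : MF Q f} {ε : Module.End Q P.carrier} (h : IsRetract R P ε)
    (Q' : Type u) [CommRing Q'] [Algebra Q Q'] :
    IsRetract (R.baseChange Q') (P.baseChange Q') (LinearMap.baseChange Q' ε) := by
  obtain ⟨i, r, hi, hr, h1, h2⟩ := h
  have e1 : r ∘ₗ i = LinearMap.id := LinearMap.ext h1
  have e2 : i ∘ₗ r = ε := LinearMap.ext h2
  refine ⟨i.baseChange Q', r.baseChange Q', hi.baseChange Q', hr.baseChange Q', fun x => ?_,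
    fun x => ?_⟩
  · refine LinearMap.congr_fun (?_ : r.baseChange Q' ∘ₗ i.baseChange Q' = LinearMap.id) x
    rw [← LinearMap.baseChange_comp, e1, LinearMap.baseChange_id]
  · refine LinearMap.congr_fun (?_ : i.baseChange Q' ∘ₗ r.baseChange Q' = _) x
    rw [← LinearMap.baseChange_comp, e2]

lemma IsShortExact.tensor_left {P' P P'' : MF Q f₁} {i : P'.carrier →ₗ[Q] P.carrier}
    {q : P.carrier →ₗ[Q] P''.carrier} (h : IsShortExact i q) (N : MF Q f₂) :
    IsShortExact (P' := P'.tensor N) (P := P.tensor N) (P'' := P''.tensor N)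
      (TensorProduct.map i LinearMap.id) (TensorProduct.map q LinearMap.id) where
  isHom_left := h.isHom_left.tensor (IsHom.id N)
  isHom_right := h.isHom_right.tensor (IsHom.id N)
  injective := by
    obtain ⟨r, s, S⟩ := h.exists_splitting
    refine Function.LeftInverse.injective (g := TensorProduct.map r LinearMap.id) fun x => ?_
    refine LinearMap.congr_fun (?_ : TensorProduct.map r LinearMap.id ∘ₗ
      TensorProduct.map i (LinearMap.id : N.carrier →ₗ[Q] N.carrier) = LinearMap.id) x
    rw [← TensorProduct.map_comp, (LinearMap.ext S.r_i : r ∘ₗ i = LinearMap.id), LinearMap.comp_id,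
      TensorProduct.map_id]
  exact := rTensor_exact N.carrier h.exact h.surjective
  surjective := LinearMap.rTensor_surjective N.carrier h.surjective

lemma IsShortExact.tensor_right {P' P P'' : MF Q f₁} {i : P'.carrier →ₗ[Q] P.carrier}
    {q : P.carrier →ₗ[Q] P''.carrier} (h : IsShortExact i q) (N : MF Q f₂) :
    IsShortExact (P' := N.tensor P') (P := N.tensor P) (P'' := N.tensor P'')
      (TensorProduct.map LinearMap.id i) (TensorProduct.map LinearMap.id q) where
  isHom_left := (IsHom.id N).tensor h.isHom_left
  isHom_right := (IsHom.id N).tensor h.isHom_right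
  injective := by
    obtain ⟨r, s, S⟩ := h.exists_splitting
    refine Function.LeftInverse.injective (g := TensorProduct.map LinearMap.id r) fun x => ?_
    refine LinearMap.congr_fun (?_ : TensorProduct.map LinearMap.id r ∘ₗ
      TensorProduct.map (LinearMap.id : N.carrier →ₗ[Q] N.carrier) i = LinearMap.id) x
    rw [← TensorProduct.map_comp, (LinearMap.ext S.r_i : r ∘ₗ i = LinearMap.id), LinearMap.comp_id,
      TensorProduct.map_id]
  exact := lTensor_exact N.carrier h.exact h.surjective
  surjective := LinearMap.lTensor_surjective N.carrier h.surjective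

lemma IsShortExact.baseChange {P' P P'' : MF Q f} {i : P'.carrier →ₗ[Q] P.carrier}
    {q : P.carrier →ₗ[Q] P''.carrier} (h : IsShortExact i q) (Q' : Type u) [CommRing Q']
    [Algebra Q Q'] :
    IsShortExact (P' := P'.baseChange Q') (P := P.baseChange Q') (P'' := P''.baseChange Q')
      (i.baseChange Q') (q.baseChange Q') where
  isHom_left := h.isHom_left.baseChange Q'
  isHom_right := h.isHom_right.baseChange Q'
  injective := by
    obtain ⟨r, s, S⟩ := h.exists_splitting
    refine Function.LeftInverse.injective (g := r.baseChange Q') fun x => ?_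
    refine LinearMap.congr_fun (?_ : r.baseChange Q' ∘ₗ i.baseChange Q' = LinearMap.id) x
    rw [← LinearMap.baseChange_comp, (LinearMap.ext S.r_i : r ∘ₗ i = LinearMap.id),
      LinearMap.baseChange_id]
  exact := lTensor_exact Q' h.exact h.surjective
  surjective := LinearMap.lTensor_surjective Q' h.surjective

lemma IsShortExact.mult {P' P P'' : MF Q f} {i : P'.carrier →ₗ[Q] P.carrier}
    {q : P.carrier →ₗ[Q] P''.carrier} (h : IsShortExact i q) (u : Q) :
    IsShortExact (P' := P'.mult u) (P := P.mult u) (P'' := P''.mult u) i q :=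
  ⟨h.isHom_left.mult u, h.isHom_right.mult u, h.injective, h.exact, h.surjective⟩

lemma IsShortExact.ofEq {P' P P'' : MF Q f} {i : P'.carrier →ₗ[Q] P.carrier}
    {q : P.carrier →ₗ[Q] P''.carrier} (h : IsShortExact i q) (h' : f = f') :
    IsShortExact (P' := P'.ofEq h') (P := P.ofEq h') (P'' := P''.ofEq h') i q :=
  ⟨h.isHom_left.ofEq h', h.isHom_right.ofEq h', h.injective, h.exact, h.surjective⟩

lemma support_ofEq (P : MF Q f) (h : f = f') : (P.ofEq h).support = P.support := by
  subst h; rfl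

lemma support_mult (P : MF Q f) {u : Q} (hu : IsUnit u) : (P.mult u).support ⊆ P.support := by
  refine support_subset fun 𝔭 hn => ?_
  obtain ⟨s, hs, h, H⟩ := (notMem_support_iff _ _).1 hn
  exact ⟨u * s, fun hm => (𝔭.2.mem_or_mem hm).elim
    (fun h => 𝔭.2.ne_top (Ideal.eq_top_of_isUnit_mem _ h hu)) hs, _, H.mult u⟩

end MF

section K0

variable {Q : Type u} [CommRing Q] {Z W V : Set (PrimeSpectrum Q)} {f f' f₁ f₂ : Q}

/-- The tensor product as an object of `mf^V(Q, f)`, where `V` contains `Z ∩ W` and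
`f = f₁ + f₂`. -/
def MFZ.tensorTo (hV : Z ∩ W ⊆ V) (h : f₁ + f₂ = f) (P : MFZ Z f₁) (P' : MFZ W f₂) : MFZ V f :=
  ⟨(P.1.tensor P'.1).ofEq h, by
    rw [MF.support_ofEq]
    exact (P.tensor P').2.trans hV⟩

/-- The product `K₀(mf^Z(Q, f₁)) × K₀(mf^W(Q, f₂)) → K₀(mf^V(Q, f₁ + f₂))`. -/
def K0.cup (hV : Z ∩ W ⊆ V) (h : f₁ + f₂ = f) : K0 Z f₁ →+ K0 W f₂ →+ K0 V f :=
  K0.lift (F := fun P => K0.lift (F := fun P' => K0.mk (MFZ.tensorTo hV h P P'))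
      (fun _ _ _ _ _ e => K0.mk_shortExact ((e.tensor_right P.1).ofEq h))
      (fun P' _ H => K0.mk_eq_zero_of_contr (P := MFZ.tensorTo hV h P P') (H.tensor_right P.1)))
    (fun P' P P'' i q e => K0.hom_ext fun N => by
      rw [AddMonoidHom.add_apply, K0.lift_mk, K0.lift_mk, K0.lift_mk]
      exact K0.mk_shortExact ((e.tensor_left N.1).ofEq h))
    (fun P _ H => K0.hom_ext fun N => by
      rw [AddMonoidHom.zero_apply, K0.lift_mk]
      exact K0.mk_eq_zero_of_contr (P := MFZ.tensorTo hV h P N) (H.tensor_left N.1))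

lemma K0.cup_mk (hV : Z ∩ W ⊆ V) (h : f₁ + f₂ = f) (P : MFZ Z f₁) (P' : MFZ W f₂) :
    K0.cup hV h (K0.mk P) (K0.mk P') = K0.mk (MFZ.tensorTo hV h P P') := by
  rw [K0.cup, K0.lift_mk, K0.lift_mk]

/-- The map on Grothendieck groups induced by extension of scalars. -/
def K0.baseChange (Q' : Type u) [CommRing Q'] [Algebra Q Q'] {Z' : Set (PrimeSpectrum Q')}
    (hZ : PrimeSpectrum.comap (algebraMap Q Q') ⁻¹' Z ⊆ Z') :
    K0 Z f →+ K0 Z' (algebraMap Q Q' f) :=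
  K0.lift (F := fun P => K0.mk (P.baseChange Q' hZ))
    (fun _ _ _ _ _ e => K0.mk_shortExact (e.baseChange Q'))
    (fun P _ H => K0.mk_eq_zero_of_contr (P := P.baseChange Q' hZ)
      (by have := H.baseChange Q'; rw [map_one] at this; exact this))

lemma K0.baseChange_mk (Q' : Type u) [CommRing Q'] [Algebra Q Q'] {Z' : Set (PrimeSpectrum Q')}
    (hZ : PrimeSpectrum.comap (algebraMap Q Q') ⁻¹' Z ⊆ Z') (P : MFZ Z f) :
    K0.baseChange Q' hZ (K0.mk P) = K0.mk (P.baseChange Q' hZ) := by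
  rw [K0.baseChange, K0.lift_mk]

/-- The functor `mult u`, for a unit `u`, as a functor `mf^Z(Q, f) → mf^Z(Q, u f)`. -/
def MFZ.multTo {u : Q} (hu : IsUnit u) (h : u * f = f') (P : MFZ Z f) : MFZ Z f' :=
  ⟨(P.1.mult u).ofEq h, by
    rw [MF.support_ofEq]
    exact (MF.support_mult _ hu).trans P.2⟩

/-- The map on Grothendieck groups induced by `mult u`, for a unit `u`. -/
def K0.mult {u : Q} (hu : IsUnit u) (h : u * f = f') : K0 Z f →+ K0 Z f' :=
  K0.lift (F := fun P => K0.mk (P.multTo hu h))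
    (fun _ _ _ _ _ e => K0.mk_shortExact ((e.mult u).ofEq h))
    (fun P _ H => by
      obtain ⟨k, K⟩ := MF.IsContr.of_isUnit (H.mult u) (by simpa using hu)
      exact K0.mk_eq_zero_of_contr (P := P.multTo hu h) K)

lemma K0.mult_mk {u : Q} (hu : IsUnit u) (h : u * f = f') (P : MFZ Z f) :
    K0.mult hu h (K0.mk P) = K0.mk (P.multTo hu h) := by
  rw [K0.mult, K0.lift_mk]

end K0

end

end AdamsMF

/-! ### Eigenspaces of operators of order `p` as direct summands. -/

namespace AdamsMF

noncomputable section

/-! ### Projections onto eigenspaces -/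

/-- `z` is a `p`-th root of unity that is primitive in every residue field, and `u` is the inverse
of `p`. -/
structure IsStrongRoot {Q : Type u} [CommRing Q] (p : ℕ) (u z : Q) : Prop where
  pos : 0 < p
  inv_mul : u * p = 1
  pow_eq_one : z ^ p = 1
  isUnit : ∀ k, 0 < k → k < p → IsUnit (z ^ k - 1)

namespace IsStrongRoot

variable {Q : Type u} [CommRing Q] {p : ℕ} {u z : Q}

lemma pow_mod (h : IsStrongRoot p u z) (k : ℕ) : z ^ (k % p) = z ^ k := by
  conv_rhs => rw [← Nat.mod_add_div k p, pow_add, pow_mul, h.pow_eq_one, one_pow, mul_one]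

lemma pow_pow_eq_one (h : IsStrongRoot p u z) (k : ℕ) : (z ^ k) ^ p = 1 := by
  rw [← pow_mul, mul_comm, pow_mul, h.pow_eq_one, one_pow]

lemma isUnit_pow (h : IsStrongRoot p u z) (k : ℕ) : IsUnit (z ^ k) :=
  IsUnit.of_mul_eq_one ((z ^ k) ^ (p - 1)) (by
    rw [← pow_succ', Nat.sub_add_cancel h.pos, h.pow_pow_eq_one])

/-- Up to a power of `z`, which is a unit, the difference is `±(z ^ i - 1)` with `0 < i < p`. -/
lemma isUnit_pow_sub_pow (h : IsStrongRoot p u z) {j k : ℕ} (hjk : j % p ≠ k % p) :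
    IsUnit (z ^ j - z ^ k) := by
  have key : ∀ a b : ℕ, a < b → b < p → IsUnit (z ^ b - z ^ a) := by
    intro a b hab hb
    have h1 : z ^ b - z ^ a = z ^ a * (z ^ (b - a) - 1) := by
      rw [mul_sub, ← pow_add, Nat.add_sub_cancel' hab.le, mul_one]
    rw [h1]
    exact (h.isUnit_pow a).mul (h.isUnit _ (Nat.sub_pos_of_lt hab) (by omega))
  rw [← h.pow_mod j, ← h.pow_mod k]
  rcases lt_or_gt_of_ne hjk with h1 | h1
  · rw [← neg_sub]
    exact (key _ _ h1 (Nat.mod_lt _ h.pos)).neg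
  · exact key _ _ h1 (Nat.mod_lt _ h.pos)

lemma sum_pow (h : IsStrongRoot p u z) {k : ℕ} (hk : k % p ≠ 0) :
    ∑ i ∈ Finset.range p, (z ^ k) ^ i = 0 := by
  have h1 : IsUnit (z ^ k - 1) := by
    have := h.isUnit_pow_sub_pow (j := k) (k := 0) (by simpa using hk)
    simpa using this
  have h2 := mul_geom_sum (z ^ k) p
  rw [h.pow_pow_eq_one, sub_self] at h2
  exact h1.mul_right_eq_zero.1 h2

end IsStrongRoot

section EigProj

variable {Q : Type u} [CommRing Q] {p : ℕ} {u z ζ : Q} {M M' : Type u} [AddCommGroup M]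
  [Module Q M] [AddCommGroup M'] [Module Q M'] {σ : Module.End Q M} {σ' : Module.End Q M'}

/-- The projection onto the `ζ`-eigenspace of an operator of order `p`, where `u = 1 / p`. -/
def eigProj (p : ℕ) (u ζ : Q) (σ : Module.End Q M) : Module.End Q M :=
  u • ∑ i ∈ Finset.range p, (ζ ^ (p - 1) • σ) ^ i

lemma eigProj_intertwine {a : M →ₗ[Q] M'} (h : ∀ x, a (σ x) = σ' (a x)) (x : M) :
    a (eigProj p u ζ σ x) = eigProj p u ζ σ' (a x) := by
  have h1 : ∀ i, a (((ζ ^ (p - 1) • σ) ^ i) x) = ((ζ ^ (p - 1) • σ') ^ i) (a x) := by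
    intro i
    induction i with
    | zero => rfl
    | succ i ih => rw [pow_succ', pow_succ', Module.End.mul_apply, Module.End.mul_apply,
        LinearMap.smul_apply, LinearMap.smul_apply, map_smul, h, ih]
  simp only [eigProj, LinearMap.smul_apply, LinearMap.sum_apply, map_smul, map_sum, h1]

lemma eigProj_comm {a : Module.End Q M} (h : a * σ = σ * a) :
    a * eigProj p u ζ σ = eigProj p u ζ σ * a :=
  LinearMap.ext (eigProj_intertwine (fun x => LinearMap.congr_fun h x))

lemma isHom_eigProj {f : Q} {P : MF Q f} {σ : Module.End Q P.carrier} (hσ : MF.IsHom σ) :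
    MF.IsHom (P := P) (P' := P) (eigProj p u ζ σ) :=
  MF.isHom_of_commute (eigProj_comm hσ.comm_even.symm).symm (eigProj_comm hσ.comm_d.symm).symm

lemma eigProj_apply_of_mem (hp : 0 < p) (hu : u * p = 1) (hζ : ζ ^ p = 1) {x : M}
    (hx : σ x = ζ • x) : eigProj p u ζ σ x = x := by
  have h0 : ζ ^ (p - 1) * ζ = 1 := by rw [← pow_succ, Nat.sub_add_cancel hp, hζ]
  have h2 : (ζ ^ (p - 1) • σ) x = x := by rw [LinearMap.smul_apply, hx, smul_smul, h0, one_smul]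
  have h3 : ∀ i, ((ζ ^ (p - 1) • σ) ^ i) x = x := by
    intro i
    induction i with
    | zero => rfl
    | succ i ih => rw [pow_succ, Module.End.mul_apply, h2, ih]
  simp only [eigProj, LinearMap.smul_apply, LinearMap.sum_apply, h3, Finset.sum_const,
    Finset.card_range]
  rw [← Nat.cast_smul_eq_nsmul Q, smul_smul, hu, one_smul]

lemma apply_eigProj (hp : 0 < p) (hσ : σ ^ p = 1) (hζ : ζ ^ p = 1) (x : M) :
    σ (eigProj p u ζ σ x) = ζ • eigProj p u ζ σ x := by
  have h0 : ζ * ζ ^ (p - 1) = 1 := by rw [← pow_succ', Nat.sub_add_cancel hp, hζ]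
  have hτp : (ζ ^ (p - 1) • σ) ^ p = 1 := by
    rw [smul_pow, hσ, ← pow_mul, mul_comm, pow_mul, hζ, one_pow, one_smul]
  have hστ : σ = ζ • (ζ ^ (p - 1) • σ) := by rw [smul_smul, h0, one_smul]
  have hS : ((ζ ^ (p - 1) • σ) - 1) * eigProj p u ζ σ = 0 := by
    rw [eigProj, mul_smul_comm, mul_geom_sum, hτp, sub_self, smul_zero]
  have h1 : (ζ ^ (p - 1) • σ) (eigProj p u ζ σ x) - eigProj p u ζ σ x = 0 :=
    LinearMap.congr_fun hS x
  refine (LinearMap.congr_fun hστ (eigProj p u ζ σ x)).trans ?_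
  rw [LinearMap.smul_apply, sub_eq_zero.1 h1]

lemma mul_eigProj (hp : 0 < p) (hσ : σ ^ p = 1) (hζ : ζ ^ p = 1) :
    σ * eigProj p u ζ σ = ζ • eigProj p u ζ σ :=
  LinearMap.ext (apply_eigProj hp hσ hζ)

lemma eigProj_mul (hp : 0 < p) (hσ : σ ^ p = 1) (hζ : ζ ^ p = 1) :
    eigProj p u ζ σ * σ = ζ • eigProj p u ζ σ := by
  rw [← eigProj_comm rfl, mul_eigProj hp hσ hζ]

lemma eigProj_idem (hp : 0 < p) (hu : u * p = 1) (hσ : σ ^ p = 1) (hζ : ζ ^ p = 1) :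
    eigProj p u ζ σ * eigProj p u ζ σ = eigProj p u ζ σ :=
  LinearMap.ext fun x => eigProj_apply_of_mem hp hu hζ (apply_eigProj hp hσ hζ x)

/-- The value is an eigenvector both for `ζ` and for `ζ'`, so the unit `ζ' - ζ` kills it. Over a
ring it would not suffice that the eigenvalues differ. -/
lemma eigProj_apply_eq_zero (hp : 0 < p) (hσ : σ ^ p = 1) (hζ : ζ ^ p = 1) {ζ' : Q} {x : M}
    (hx : σ x = ζ' • x) (h : IsUnit (ζ' - ζ)) : eigProj p u ζ σ x = 0 := by
  have h1 := apply_eigProj (u := u) hp hσ hζ x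
  have h2 : eigProj p u ζ σ (σ x) = σ (eigProj p u ζ σ x) :=
    (eigProj_intertwine (a := σ) (fun _ => rfl) x).symm
  rw [hx, map_smul, h1, ← sub_eq_zero, ← sub_smul] at h2
  exact (h.smul_eq_zero).1 h2

namespace IsStrongRoot

lemma eigProj_mul_eigProj (h : IsStrongRoot p u z) (hσ : σ ^ p = 1) {j k : ℕ}
    (hjk : j % p ≠ k % p) : eigProj p u (z ^ j) σ * eigProj p u (z ^ k) σ = 0 :=
  LinearMap.ext fun x => eigProj_apply_eq_zero h.pos hσ (h.pow_pow_eq_one j)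
    (apply_eigProj h.pos hσ (h.pow_pow_eq_one k) x) (h.isUnit_pow_sub_pow hjk.symm)

/-- Orthogonality of characters: the coefficient of `σ ^ i` in the sum is `u ∑ₖ z ^ (-k i)`, which
is `1` for `i = 0` and vanishes for `0 < i < p`. -/
lemma sum_eigProj (h : IsStrongRoot p u z) :
    ∑ k ∈ Finset.range p, eigProj p u (z ^ k) σ = 1 := by
  simp only [eigProj]
  rw [← Finset.smul_sum, Finset.sum_comm]
  have h1 : ∀ i ∈ Finset.range p, ∑ k ∈ Finset.range p, ((z ^ k) ^ (p - 1) • σ) ^ i =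
      if i = 0 then (p : Q) • (1 : Module.End Q M) else 0 := by
    intro i hi
    rw [Finset.mem_range] at hi
    simp only [smul_pow]
    rw [← Finset.sum_smul]
    split_ifs with h0
    · simp [h0]
    · have h2 : ∑ k ∈ Finset.range p, ((z ^ k) ^ (p - 1)) ^ i =
          ∑ k ∈ Finset.range p, (z ^ ((p - 1) * i)) ^ k :=
        Finset.sum_congr rfl fun k _ => by rw [← pow_mul, ← pow_mul, ← pow_mul]; ring_nf
      rw [h2, h.sum_pow, zero_smul]
      intro h3
      -- If `(p - 1) i` were divisible by `p`, then `p i = (p - 1) i + i` would leave the remainder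
      -- `i`, which forces `i = 0`.
      have h4 : ((p - 1) * i + i) % p = i := by
        rw [Nat.add_mod, h3, zero_add, Nat.mod_mod, Nat.mod_eq_of_lt hi]
      rw [← Nat.succ_mul, Nat.succ_eq_add_one, Nat.sub_add_cancel h.pos, Nat.mul_mod_right] at h4
      exact h0 h4.symm
  rw [Finset.sum_congr rfl h1, Finset.sum_ite_eq' (Finset.range p) 0,
    if_pos (Finset.mem_range.2 h.pos), smul_smul, h.inv_mul, one_smul]

end IsStrongRoot

lemma MF.isRetract_eigen {f : Q} (P : MF Q f) (σ : Module.End Q P.carrier)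
    (he : σ * P.even = P.even * σ) (hd : σ * P.d = P.d * σ) (hp : 0 < p) (hσ : σ ^ p = 1)
    (hu : u * p = 1) (hζ : ζ ^ p = 1) :
    IsRetract (P.eigen σ he hd hp hσ hu hζ) P (eigProj p u ζ σ) := by
  have hmem : ∀ x, eigProj p u ζ σ x ∈ LinearMap.ker (σ - ζ • (1 : Module.End Q P.carrier)) :=
    fun x => mem_ker_iff.2 (apply_eigProj hp hσ hζ x)
  have hom : IsHom (P := P) (P' := P) (eigProj p u ζ σ) := isHom_eigProj ⟨he, hd⟩
  refine ⟨(LinearMap.ker (σ - ζ • (1 : Module.End Q P.carrier))).subtype,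
    (eigProj p u ζ σ).codRestrict _ hmem, ⟨rfl, rfl⟩, ⟨?_, ?_⟩, fun x => ?_, fun x => rfl⟩
  · exact LinearMap.ext fun x => Subtype.ext (hom.apply_even x)
  · exact LinearMap.ext fun x => Subtype.ext (hom.apply_d x)
  · exact Subtype.ext (eigProj_apply_of_mem hp hu hζ (mem_ker_iff.1 x.2))

end EigProj

/-! ### The maps `t` in terms of eigenspaces -/

section Adams

variable {p : ℕ} (Q : Type u) [CommRing Q] [Algebra (Ap p) Q]

lemma isUnit_invQ (hp : p.Prime) : IsUnit (invQ p Q) := IsUnit.of_mul_eq_one _ (invQ_mul Q hp)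

lemma prod_one_sub_zetaC (hp : p.Prime) :
    ∏ k ∈ Finset.range (p - 1), (1 - zetaC p ^ (k + 1)) = p := by
  have h := Complex.isPrimitiveRoot_exp p hp.ne_zero
  obtain ⟨n, rfl⟩ : ∃ n, p = n + 1 := ⟨p - 1, (Nat.sub_add_cancel hp.one_le).symm⟩
  have := h.prod_one_sub_pow_eq_order
  rw [Nat.add_sub_cancel]
  simpa [zetaC] using this

/-- The factors `1 - ζ ^ k`, `0 < k < p`, have the product `p`, which is a unit of `Q`; so each
factor is a unit. -/
lemma isStrongRoot_zetaQ (hp : p.Prime) : IsStrongRoot p (invQ p Q) (zetaQ p Q) where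
  pos := hp.pos
  inv_mul := invQ_mul Q hp
  pow_eq_one := by simpa using zetaQ_pow Q hp 1
  isUnit := by
    intro k hk hkp
    let z : Ap p := ⟨zetaC p, Algebra.subset_adjoin (Or.inr rfl)⟩
    have h1 : ∏ k ∈ Finset.range (p - 1), (1 - z ^ (k + 1)) = p := by
      apply Subtype.ext
      have := prod_one_sub_zetaC hp
      push_cast
      exact this
    have h2 : IsUnit (p : Q) := IsUnit.of_mul_eq_one_right _ (invQ_mul Q hp)
    have h3 := congrArg (algebraMap (Ap p) Q) h1
    rw [map_prod, map_natCast] at h3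
    rw [← h3] at h2
    have h4 := (IsUnit.prod_iff.1 h2) (k - 1) (Finset.mem_range.2 (by omega))
    rw [Nat.sub_add_cancel hk, map_sub, map_one, map_pow] at h4
    have h5 : IsUnit (1 - zetaQ p Q ^ k) := h4
    rw [← neg_sub]
    exact h5.neg

variable {Q} {Z : Set (PrimeSpectrum Q)} {f : Q}

/-- The eigenspace `(T^p P)^(ζ)`, as an object of `mf^Z(Q, p f)`. -/
def MFZ.eig (hp : p.Prime) (k : ℕ) (P : MFZ Z f) : MFZ Z ((p : Q) * f) :=
  ⟨(P.1.tpow p).eigen (P.1.rot p) (P.1.rot_comm_even p) (P.1.rot_comm_d p) hp.pos (P.1.rot_pow p)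
    (invQ_mul Q hp) (zetaQ_pow Q hp k), by
    refine MF.support_subset fun 𝔭 hn => ?_
    obtain ⟨s, hs, h, H⟩ := (MF.notMem_support_iff P.1 𝔭).1 fun hm => hn (P.2 hm)
    refine ⟨p * s, fun hm => (𝔭.2.mem_or_mem hm).elim (fun h => 𝔭.2.ne_top ?_) hs, _,
      (P.1.contr_der H p (p * s) rfl).restrict (ζ := zetaQ p Q ^ k) (P.1.rot_comm_even p)
        (P.1.rot_comm_d p) (P.1.rot_comm_der H.isOdd p)⟩
    exact Ideal.eq_top_of_isUnit_mem _ h (IsUnit.of_mul_eq_one_right _ (invQ_mul Q hp))⟩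

lemma MFZ.isRetract_eig (hp : p.Prime) (k : ℕ) (P : MFZ Z f) :
    MF.IsRetract (P.eig hp k).1 (P.1.tpow p)
      (eigProj p (invQ p Q) (zetaQ p Q ^ k) (P.1.rot p)) :=
  MF.isRetract_eigen (P.1.tpow p) (P.1.rot p) (P.1.rot_comm_even p) (P.1.rot_comm_d p) hp.pos
    (P.1.rot_pow p) (invQ_mul Q hp) (zetaQ_pow Q hp k)

lemma MF.rot_isHom {f : Q} (P : MF Q f) (n : ℕ) :
    IsHom (P := P.tpow n) (P' := P.tpow n) (P.rot n) := ⟨P.rot_comm_even n, P.rot_comm_d n⟩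

lemma invQ_mul_mul (hp : p.Prime) (f : Q) : invQ p Q * (p * f) = f := by
  rw [← mul_assoc, invQ_mul Q hp, one_mul]

/-- The passage from factorizations of `p f` to factorizations of `f` is a homomorphism of
Grothendieck groups. Relations between eigenspaces can therefore be proved for `p f`, where they are
direct summands of the tensor power, and transported. -/
lemma K0.mk_t (hp : p.Prime) (k : ℕ) (P : MFZ Z f) :
    K0.mk (MFZ.t hp k P) =
      K0.mult (isUnit_invQ Q hp) (invQ_mul_mul hp f) (K0.mk (P.eig hp k)) := by
  rw [K0.mult_mk]
  rfl

end Adams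

end

end AdamsMF

/-! ### Additivity of the eigenspaces up to a cross term. -/

namespace AdamsMF

noncomputable section

namespace MF

variable {Q : Type u} [CommRing Q] {f f' f'' : Q}

/-! ### Tensor powers of linear maps -/

/-- Linear maps of degree zero. -/
def IsGraded {P : MF Q f} {P' : MF Q f'} (g : P.carrier →ₗ[Q] P'.carrier) : Prop :=
  ∀ x, g (P.even x) = P'.even (g x)

lemma IsGraded.apply_odd {P : MF Q f} {P' : MF Q f'} {g : P.carrier →ₗ[Q] P'.carrier}
    (h : IsGraded g) (x : P.carrier) : g (P.odd x) = P'.odd (g x) := by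
  rw [odd_apply, odd_apply, map_sub, h]

/-- The tensor product `g 0 ⊗ ⋯ ⊗ g (n - 1) : T^n P → T^n P'`. -/
def tmap {P : MF Q f} {P' : MF Q f'} : (ℕ → P.carrier →ₗ[Q] P'.carrier) → (n : ℕ) →
    (P.tpow n).carrier →ₗ[Q] (P'.tpow n).carrier
  | _, 0 => (LinearMap.id : Q →ₗ[Q] Q)
  | g, n + 1 => TensorProduct.map (g 0) (tmap (fun i => g (i + 1)) n)

section

variable {P : MF Q f} {P' : MF Q f'} {P'' : MF Q f''}

lemma tmap_congr : ∀ (n : ℕ) {g h : ℕ → P.carrier →ₗ[Q] P'.carrier}, (∀ i < n, g i = h i) →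
    tmap g n = tmap h n
  | 0, _, _, _ => rfl
  | n + 1, g, h, e => by
    have h1 := tmap_congr n (g := fun i => g (i + 1)) (h := fun i => h (i + 1))
      fun i hi => e (i + 1) (by omega)
    change TensorProduct.map (g 0) _ = TensorProduct.map (h 0) _
    rw [e 0 n.succ_pos, h1]

lemma tmap_comp (g : ℕ → P.carrier →ₗ[Q] P'.carrier) (g' : ℕ → P'.carrier →ₗ[Q] P''.carrier) :
    ∀ n, tmap g' n ∘ₗ tmap g n = tmap (fun i => g' i ∘ₗ g i) n := by
  intro n
  induction n generalizing g g' with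
  | zero => rfl
  | succ n ih =>
    refine (TensorProduct.map_comp _ _ _ _).symm.trans ?_
    rw [ih]
    rfl

lemma tmap_id (P : MF Q f) : ∀ n, tmap (P := P) (P' := P) (fun _ => LinearMap.id) n = LinearMap.id
  | 0 => rfl
  | n + 1 => by
    change TensorProduct.map LinearMap.id (tmap (P := P) (P' := P) (fun _ => LinearMap.id) n) = _
    rw [tmap_id P n, TensorProduct.map_id]
    rfl

lemma tmap_tprod (g : ℕ → P.carrier →ₗ[Q] P'.carrier) (n : ℕ) (v : ℕ → P.carrier) :
    tmap g n (P.tprod n v) = P'.tprod n (fun i => g i (v i)) := by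
  induction n generalizing g v with
  | zero => rfl
  | succ n ih =>
    change g 0 (v 0) ⊗ₜ[Q] tmap (fun i => g (i + 1)) n (P.tprod n fun i => v (i + 1)) = _
    rw [ih]
    rfl

lemma map_comp_tEven {N N' : Type u} [AddCommGroup N] [Module Q N] [AddCommGroup N'] [Module Q N']
    {g : P.carrier →ₗ[Q] P'.carrier} (hg : IsGraded g) {h : N →ₗ[Q] N'} {b : Module.End Q N}
    {b' : Module.End Q N'} (hb : ∀ x, h (b x) = b' (h x)) :
    TensorProduct.map g h ∘ₗ P.tEven b = P'.tEven b' ∘ₗ TensorProduct.map g h :=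
  TensorProduct.ext' fun x y => by simp [tEven_tmul, hg x, hb]

lemma map_comp_tDer {N N' : Type u} [AddCommGroup N] [Module Q N] [AddCommGroup N'] [Module Q N']
    {g : P.carrier →ₗ[Q] P'.carrier} (hg : IsGraded g) {h : N →ₗ[Q] N'}
    {a : Module.End Q P.carrier} {a' : Module.End Q P'.carrier} (ha : ∀ x, g (a x) = a' (g x))
    {b : Module.End Q N} {b' : Module.End Q N'} (hb : ∀ x, h (b x) = b' (h x)) :
    TensorProduct.map g h ∘ₗ P.tDer a b = P'.tDer a' b' ∘ₗ TensorProduct.map g h :=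
  TensorProduct.ext' fun x y => by simp [tDer_tmul, hg x, hb, ha]

lemma tmap_even {g : ℕ → P.carrier →ₗ[Q] P'.carrier} (hg : ∀ i, IsGraded (g i)) (n : ℕ)
    (x : (P.tpow n).carrier) : tmap g n ((P.tpow n).even x) = (P'.tpow n).even (tmap g n x) := by
  induction n generalizing g with
  | zero => rfl
  | succ n ih => exact LinearMap.congr_fun (map_comp_tEven (hg 0) (ih fun i => hg (i + 1))) x

lemma tmap_der {g : ℕ → P.carrier →ₗ[Q] P'.carrier} (hg : ∀ i, IsGraded (g i))
    {a : Module.End Q P.carrier} {a' : Module.End Q P'.carrier}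
    (ha : ∀ i x, g i (a x) = a' (g i x)) (n : ℕ) (x : (P.tpow n).carrier) :
    tmap g n (P.der a n x) = P'.der a' n (tmap g n x) := by
  induction n generalizing g with
  | zero => exact map_zero (tmap g 0)
  | succ n ih =>
    exact LinearMap.congr_fun (map_comp_tDer (hg 0) (ha 0)
      (ih (fun i => hg (i + 1)) fun i => ha (i + 1))) x

lemma Homog.map {v : ℕ → P.carrier} {b : ℕ → Bool} (h : P.Homog v b)
    {g : ℕ → P.carrier →ₗ[Q] P'.carrier} (hg : ∀ i, IsGraded (g i)) :
    P'.Homog (fun i => g i (v i)) b := by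
  intro i
  rw [← (hg i).apply_odd, h i]
  split_ifs
  · rfl
  · exact map_zero _

/-- The cycle permutes the factors of a tensor product of maps. -/
lemma rot_tmap {g : ℕ → P.carrier →ₗ[Q] P'.carrier} (hg : ∀ i, IsGraded (g i)) (n : ℕ)
    {g' : ℕ → P.carrier →ₗ[Q] P'.carrier} (h0 : g' 0 = g n) (hs : ∀ i < n, g' (i + 1) = g i) :
    P'.rot (n + 1) ∘ₗ tmap g (n + 1) = tmap g' (n + 1) ∘ₗ P.rot (n + 1) := by
  refine P.ext_tprod (n + 1) fun v b hv => ?_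
  have e1 : P.rot (n + 1) (P.tprod (n + 1) v) =
      (∏ i ∈ Finset.range n, ksgn Q (b i) (b n)) • (v n ⊗ₜ[Q] P.tprod n v) := P.cyc_tprod n v b hv
  have e2 : P'.rot (n + 1) (P'.tprod (n + 1) fun i => g i (v i)) =
      (∏ i ∈ Finset.range n, ksgn Q (b i) (b n)) •
        (g n (v n) ⊗ₜ[Q] P'.tprod n fun i => g i (v i)) := P'.cyc_tprod n _ b (hv.map hg)
  have e3 : tmap g' (n + 1) (v n ⊗ₜ[Q] P.tprod n v) =
      g n (v n) ⊗ₜ[Q] P'.tprod n fun i => g i (v i) := by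
    change g' 0 (v n) ⊗ₜ[Q] tmap (fun i => g' (i + 1)) n (P.tprod n v) = _
    rw [tmap_tprod, h0, P'.tprod_congr n fun i hi => by rw [hs i hi]]
  rw [LinearMap.comp_apply, LinearMap.comp_apply, tmap_tprod, e1, e2, ← e3]
  exact ((tmap g' (n + 1)).map_smul _ _).symm

lemma rot_tmap_const {g : P.carrier →ₗ[Q] P'.carrier} (hg : IsGraded g) (n : ℕ)
    (x : (P.tpow n).carrier) :
    P'.rot n (tmap (fun _ => g) n x) = tmap (fun _ => g) n (P.rot n x) := by
  cases n with
  | zero => rfl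
  | succ n => exact LinearMap.congr_fun (rot_tmap (g := fun _ => g) (g' := fun _ => g) (fun _ => hg) n rfl
      fun _ _ => rfl) x

end

lemma IsHom.isGraded {P P' : MF Q f} {g : P.carrier →ₗ[Q] P'.carrier} (h : IsHom g) :
    IsGraded g := h.apply_even

lemma IsHom.tmap {P P' : MF Q f} {g : ℕ → P.carrier →ₗ[Q] P'.carrier} (h : ∀ i, IsHom (g i))
    (n : ℕ) : IsHom (P := P.tpow n) (P' := P'.tpow n) (tmap g n) :=
  IsHom.of_apply (tmap_even (fun i => (h i).isGraded) n) fun x => by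
    rw [d_tpow, d_tpow]
    exact tmap_der (fun i => (h i).isGraded) (fun i => (h i).apply_d) n x

/-! ### Replacing a differential by its diagonal part -/

/-- `P` with another differential. -/
def withD (P : MF Q f) (D : Module.End Q P.carrier) (h1 : D * P.even = (1 - P.even) * D)
    (h2 : D * D = f • (1 : Module.End Q P.carrier)) : MF Q f where
  carrier := P.carrier
  even := P.even
  d := D
  even_mul_even := P.even_mul_even
  d_mul_even := h1
  d_mul_d := h2

section Diag

variable (P : MF Q f) {e : Module.End Q P.carrier}

/-- The diagonal part of the differential, with respect to an idempotent `e`. -/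
def diagD (e : Module.End Q P.carrier) : Module.End Q P.carrier :=
  e * P.d * e + (1 - e) * P.d * (1 - e)

lemma diagD_odd (he : e * P.even = P.even * e) :
    P.diagD e * P.even = (1 - P.even) * P.diagD e := by
  have he' : ∀ x, e (P.even x) = P.even (e x) := fun x => LinearMap.congr_fun he x
  ext x
  simp only [diagD, LinearMap.add_apply, Module.End.mul_apply, LinearMap.sub_apply,
    Module.End.one_apply, map_sub, he', d_apply_even, map_add]
  abel

/-- By `hs` the image of `e` is stable, so the differential is block triangular, and the diagonal
blocks of its square are the squares of its diagonal blocks. -/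
lemma diagD_sq (hee : e * e = e) (hs : P.d * e = e * P.d * e) :
    P.diagD e * P.diagD e = f • (1 : Module.End Q P.carrier) := by
  have hs' : ∀ x, e (P.d (e x)) = P.d (e x) := fun x => (LinearMap.congr_fun hs x).symm
  have hee' : ∀ x, e (e x) = e x := fun x => LinearMap.congr_fun hee x
  have h1 : ∀ x, e (P.d (P.d x)) = f • e x := fun x => by rw [d_apply_d, map_smul]
  have h2 : ∀ x, e (P.d (e (P.d x))) = P.d (e (P.d x)) := fun x => hs' _
  ext x
  simp only [diagD, LinearMap.add_apply, Module.End.mul_apply, LinearMap.sub_apply,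
    Module.End.one_apply, map_sub, hs', hee', d_apply_d, map_add, map_smul, LinearMap.smul_apply,
    sub_self, map_zero, smul_sub]
  abel

/-- `P` with the diagonal part of its differential. -/
def diag (hee : e * e = e) (he : e * P.even = P.even * e) (hs : P.d * e = e * P.d * e) : MF Q f :=
  P.withD (P.diagD e) (P.diagD_odd he) (P.diagD_sq hee hs)

variable {P}

lemma diag_isHom (hee : e * e = e) (he : e * P.even = P.even * e) (hs : P.d * e = e * P.d * e) :
    IsHom (P := P.diag hee he hs) (P' := P.diag hee he hs) e := by
  refine ⟨he, ?_⟩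
  change e * P.diagD e = P.diagD e * e
  have h0 : e * (1 - e) = 0 := by rw [mul_sub, hee, mul_one, sub_self]
  have h0' : (1 - e) * e = 0 := by rw [sub_mul, hee, one_mul, sub_self]
  rw [diagD, mul_add, add_mul, ← mul_assoc, ← mul_assoc, ← mul_assoc, ← mul_assoc, hee, h0, zero_mul,
    zero_mul, mul_assoc ((1 - e) * P.d), h0', mul_zero, mul_assoc (e * P.d), hee]

lemma IsRetract.exists_of_withD {R : MF Q f} {D : Module.End Q P.carrier}
    {h1 : D * P.even = (1 - P.even) * D} {h2 : D * D = f • (1 : Module.End Q P.carrier)}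
    (h : IsRetract R (P.withD D h1 h2) e) :
    ∃ (i : R.carrier →ₗ[Q] P.carrier) (r : P.carrier →ₗ[Q] R.carrier),
      (∀ x, i (R.even x) = P.even (i x)) ∧ (∀ x, i (R.d x) = D (i x)) ∧
      (∀ x, r (P.even x) = R.even (r x)) ∧ (∀ x, r (D x) = R.d (r x)) ∧
      (∀ x, r (i x) = x) ∧ ∀ x, i (r x) = e x := by
  obtain ⟨i, r, hi, hr, h1, h2⟩ := h
  exact ⟨i, r, hi.apply_even, hi.apply_d, hr.apply_even, hr.apply_d, h1, h2⟩

/-- A stable graded direct summand and its complement give a short exact sequence. -/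
lemma isShortExact_of_diag (hee : e * e = e) (he : e * P.even = P.even * e)
    (hs : P.d * e = e * P.d * e) {A B : MF Q f} (hA : IsRetract A (P.diag hee he hs) e)
    (hB : IsRetract B (P.diag hee he hs) (1 - e : Module.End Q P.carrier)) :
    ∃ (i : A.carrier →ₗ[Q] P.carrier) (q : P.carrier →ₗ[Q] B.carrier),
      IsShortExact (P' := A) (P := P) (P'' := B) i q := by
  have hs' : ∀ x, e (P.d (e x)) = P.d (e x) := fun x => (LinearMap.congr_fun hs x).symm
  have hee' : ∀ x, e (e x) = e x := fun x => LinearMap.congr_fun hee x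
  obtain ⟨i, r, hie, hid, hre, hrd, h1, h2⟩ := hA.exists_of_withD
  obtain ⟨s, q, hse, hsd, hqe, hqd, k1, k2⟩ := hB.exists_of_withD
  have k2' : ∀ x : P.carrier, s (q x) = x - e x := k2
  have h3 : ∀ x, e (i x) = i x := fun x => by rw [← h2, h1]
  have k3 : ∀ x : P.carrier, q (e x) = 0 := fun x => by
    rw [← k1 (q (e x)), k2', hee', sub_self, map_zero]
  have hd0 : ∀ x : P.carrier, P.diagD e x =
      e (P.d (e x)) + (P.d (x - e x) - e (P.d (x - e x))) := fun x => rfl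
  refine ⟨i, q, IsGradedSplitting.isShortExact (P := P) (r := r) (s := s)
    ⟨h1, k1, fun x => ?_, fun x => ?_, hre, hse⟩
    (IsHom.of_apply hie fun x => ?_) (IsHom.of_apply hqe fun x => ?_)⟩
  · rw [← h3]
    exact k3 _
  · rw [h2, k2', add_sub_cancel]
  · rw [hid, hd0, h3, sub_self, map_zero, map_zero, sub_zero, add_zero]
    conv_lhs => rw [← h3 x]
    rw [hs', h3]
  · rw [← hqd, hd0, map_add, map_sub, k3, k3, sub_zero, zero_add, map_sub, map_sub, ← hs', k3,
      sub_zero]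

end Diag

end MF

section K0

variable {Q : Type u} [CommRing Q] {Z : Set (PrimeSpectrum Q)} {f : Q}

lemma MF.diag_isRetract {P : MF Q f} {e : Module.End Q P.carrier} (hee : e * e = e)
    (he : e * P.even = P.even * e) (hs : P.d * e = e * P.d * e) :
    ∃ A B : MF Q f, IsRetract A (P.diag hee he hs) e ∧ IsRetract B (P.diag hee he hs) (1 - e : Module.End Q P.carrier) := by
  obtain ⟨A, hA⟩ := exists_isRetract (diag_isHom hee he hs) hee
  obtain ⟨B, hB⟩ := exists_isRetract (P := P.diag hee he hs) (ε := (1 - e : Module.End Q P.carrier))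
    (IsHom.sub (P := P.diag hee he hs) (P' := P.diag hee he hs) (isHom_one _) (diag_isHom hee he hs)) ((IsIdempotentElem.one_sub hee : _))
  exact ⟨A, B, hA, hB⟩

/-- `P` is an extension of the quotient by the stable summand, and `P.diag` is the direct sum of the
two pieces. The support condition is imposed on the direct sum: it passes to the pieces, and from
them to the extension `P`. -/
lemma K0.mk_diag {P : MF Q f} {e : Module.End Q P.carrier} (hee : e * e = e)
    (he : e * P.even = P.even * e) (hs : P.d * e = e * P.d * e)
    (hZ : (P.diag hee he hs).support ⊆ Z) :
    ∃ h : P.support ⊆ Z, (K0.mk ⟨P, h⟩ : K0 Z f) = K0.mk ⟨P.diag hee he hs, hZ⟩ := by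
  obtain ⟨A, B, hA, hB⟩ := MF.diag_isRetract hee he hs
  obtain ⟨i, q, hiq⟩ := MF.isShortExact_of_diag hee he hs hA hB
  let A' : MFZ Z f := ⟨A, hA.support_subset.trans hZ⟩
  let B' : MFZ Z f := ⟨B, hB.support_subset.trans hZ⟩
  have h0 : e * (1 - e) = 0 := by rw [mul_sub, hee, mul_one, sub_self]
  have h0' : (1 - e) * e = 0 := by rw [sub_mul, hee, one_mul, sub_self]
  have hP : P.support ⊆ Z := hiq.support_subset A'.2 B'.2
  refine ⟨hP, (K0.mk_shortExact (P' := A') (P := ⟨P, hP⟩) (P'' := B') hiq).trans ?_⟩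
  refine (K0.mk_isRetract_add (R₁ := A') (R₂ := B') (P := P.diag hee he hs) (ε₁ := e)
    (ε₂ := (1 - e : Module.End Q P.carrier)) ?_ hA hB h0 h0').symm
  exact (MF.isRetract_one _).congr (add_sub_cancel e 1).symm

end K0

end

end AdamsMF

namespace AdamsMF

noncomputable section

variable {Q : Type u} [CommRing Q] {Z : Set (PrimeSpectrum Q)} {f : Q}

namespace MF

/-! ### Perturbations of a differential that raise a weight -/

lemma withD_eq_self {M : MF Q f} {D : Module.End Q M.carrier} {h1 : D * M.even = (1 - M.even) * D}
    {h2 : D * D = f • (1 : Module.End Q M.carrier)} (h : D = M.d) : M.withD D h1 h2 = M := by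
  subst h; rfl

lemma withD_congr {M : MF Q f} {D D' : Module.End Q M.carrier}
    {h1 : D * M.even = (1 - M.even) * D} {h2 : D * D = f • (1 : Module.End Q M.carrier)}
    (h : D = D') : M.withD D h1 h2 = M.withD D' (h ▸ h1) (h ▸ h2) := by
  subst h; rfl

/-- The data of a perturbation `δ` of the differential that raises the weight by one, for the
weight grading given by the orthogonal idempotents `ε 0, …, ε (N - 1)`. -/
structure RaisesWeight (M : MF Q f) (δ : Module.End Q M.carrier) (ε : ℕ → Module.End Q M.carrier)
    (N : ℕ) : Prop where
  sum_eq : ∑ j ∈ Finset.range N, ε j = 1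
  orth : ∀ i j, i ≠ j → ε i * ε j = 0
  comm_even : ∀ j, ε j * M.even = M.even * ε j
  comm_d : ∀ j, ε j * M.d = M.d * ε j
  raise : ∀ j, δ * ε j = ε (j + 1) * δ
  odd : δ * M.even = (1 - M.even) * δ
  sq : δ * δ = 0
  anti : M.d * δ + δ * M.d = 0

namespace RaisesWeight

variable {M : MF Q f} {δ : Module.End Q M.carrier} {ε : ℕ → Module.End Q M.carrier} {N : ℕ}

lemma eq_zero (h : RaisesWeight M δ ε N) {j : ℕ} (hj : N ≤ j) : ε j = 0 := by
  rw [← mul_one (ε j), ← h.sum_eq, Finset.mul_sum]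
  exact Finset.sum_eq_zero fun i hi => h.orth _ _ (by have := Finset.mem_range.1 hi; omega)

lemma idem (h : RaisesWeight M δ ε N) (j : ℕ) : ε j * ε j = ε j := by
  by_cases hj : j < N
  · conv_rhs => rw [← mul_one (ε j), ← h.sum_eq, Finset.mul_sum]
    rw [Finset.sum_eq_single j (fun i _ hi => h.orth _ _ hi.symm)
      (fun h => absurd (Finset.mem_range.2 hj) h)]
  · rw [h.eq_zero (not_lt.1 hj), mul_zero]

/-- An image under `δ` has weight at most `m` exactly in so far as it comes from weights below `m`.
In particular the image of `δ` has no component of weight `0`. -/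
lemma sum_mul (h : RaisesWeight M δ ε N) (m : ℕ) :
    (∑ j ∈ Finset.range (m + 1), ε j) * δ = δ * ∑ j ∈ Finset.range m, ε j := by
  have h0 : ε 0 * δ = 0 := by
    rw [← mul_one (ε 0 * δ), ← h.sum_eq, Finset.mul_sum]
    refine Finset.sum_eq_zero fun j _ => ?_
    rw [mul_assoc, h.raise, ← mul_assoc, h.orth _ _ (Nat.succ_ne_zero j).symm, zero_mul]
  rw [Finset.sum_range_succ', add_mul, h0, add_zero, Finset.sum_mul, Finset.mul_sum]
  exact Finset.sum_congr rfl fun j _ => (h.raise j).symm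

lemma sum_mul_sum (h : RaisesWeight M δ ε N) {m n : ℕ} (hmn : m ≤ n) :
    (∑ j ∈ Finset.range m, ε j) * ∑ j ∈ Finset.range n, ε j = ∑ j ∈ Finset.range m, ε j := by
  rw [Finset.sum_mul]
  refine Finset.sum_congr rfl fun j hj => ?_
  rw [Finset.mul_sum, Finset.sum_eq_single j (fun i _ hi => h.orth _ _ hi.symm)
    (fun h' => absurd (Finset.mem_range.2 ((Finset.mem_range.1 hj).trans_le hmn)) h'), h.idem]

lemma sum_comm_even (h : RaisesWeight M δ ε N) (m : ℕ) :
    (∑ j ∈ Finset.range m, ε j) * M.even = M.even * ∑ j ∈ Finset.range m, ε j := by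
  rw [Finset.sum_mul, Finset.mul_sum]
  exact Finset.sum_congr rfl fun j _ => h.comm_even j

lemma sum_comm_d (h : RaisesWeight M δ ε N) (m : ℕ) :
    (∑ j ∈ Finset.range m, ε j) * M.d = M.d * ∑ j ∈ Finset.range m, ε j := by
  rw [Finset.sum_mul, Finset.mul_sum]
  exact Finset.sum_congr rfl fun j _ => h.comm_d j

lemma partial_odd (h : RaisesWeight M δ ε N) (m : ℕ) :
    (M.d + δ * ∑ j ∈ Finset.range m, ε j) * M.even =
      (1 - M.even) * (M.d + δ * ∑ j ∈ Finset.range m, ε j) := by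
  rw [add_mul, mul_add, M.d_mul_even, mul_assoc, h.sum_comm_even, ← mul_assoc, h.odd, mul_assoc]

lemma partial_sq (h : RaisesWeight M δ ε N) (m : ℕ) :
    (M.d + δ * ∑ j ∈ Finset.range m, ε j) * (M.d + δ * ∑ j ∈ Finset.range m, ε j) =
      f • (1 : Module.End Q M.carrier) := by
  have h1 : δ * (∑ j ∈ Finset.range m, ε j) * (δ * ∑ j ∈ Finset.range m, ε j) = 0 := by
    cases m with
    | zero => simp
    | succ m => rw [mul_assoc, ← mul_assoc _ δ, h.sum_mul, ← mul_assoc, ← mul_assoc, h.sq, zero_mul,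
        zero_mul]
  rw [add_mul, mul_add, mul_add, h1, add_zero, M.d_mul_d, mul_assoc δ, h.sum_comm_d, ← mul_assoc,
    ← mul_assoc, add_assoc, ← add_mul, h.anti, zero_mul, add_zero]

/-- The perturbation is switched on one weight at a time: the `m`-th differential is `d + δ` on the
weights below `m` and `d` on the others. Passing from `m` to `m + 1` only adds the component of `δ`
from weight `m` to weight `m + 1`. For the decomposition into weights `≤ m` and `> m` this component
is off-diagonal, so the previous differential is the diagonal part of the next one. -/
lemma mk_partial (h : RaisesWeight M δ ε N) (hZ : M.support ⊆ Z) (m : ℕ) :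
    ∃ h' : (M.withD _ (h.partial_odd m) (h.partial_sq m)).support ⊆ Z,
      (K0.mk ⟨_, h'⟩ : K0 Z f) = K0.mk ⟨M, hZ⟩ := by
  induction m with
  | zero =>
    rw [withD_eq_self (by simp)]
    exact ⟨hZ, rfl⟩
  | succ m ih =>
    set e := ∑ j ∈ Finset.range (m + 1), ε j with he
    have hee : e * e = e := h.sum_mul_sum le_rfl
    have hee' : e * (1 - e) = 0 := by rw [mul_sub, mul_one, hee, sub_self]
    have hηη : (1 - e) * (1 - e) = 1 - e := by rw [sub_mul, one_mul, hee', sub_zero]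
    have hηe : (1 - e) * M.even = M.even * (1 - e) := by
      rw [sub_mul, mul_sub, one_mul, mul_one, h.sum_comm_even]
    have hηd : (1 - e) * M.d = M.d * (1 - e) := by
      rw [sub_mul, mul_sub, one_mul, mul_one, h.sum_comm_d]
    have hD : (M.d + δ * e) * (1 - e) = M.d * (1 - e) := by
      rw [add_mul, mul_assoc, hee', mul_zero, add_zero]
    have hs : (M.d + δ * e) * (1 - e) = (1 - e) * (M.d + δ * e) * (1 - e) := by
      rw [mul_assoc (1 - e), hD, ← mul_assoc, hηd, mul_assoc, hηη]
    let M' := M.withD _ (h.partial_odd (m + 1)) (h.partial_sq (m + 1))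
    have hdiag : M'.diagD (1 - e : Module.End Q M.carrier) =
        M.d + δ * ∑ j ∈ Finset.range m, ε j := by
      change (1 - e) * (M.d + δ * e) * (1 - e) + (1 - (1 - e)) * (M.d + δ * e) * (1 - (1 - e)) = _
      rw [← hs, hD, sub_sub_cancel, mul_add, add_mul, h.sum_comm_d, mul_assoc M.d, hee, ← mul_assoc,
        h.sum_mul, mul_assoc, mul_assoc, hee, h.sum_mul_sum (Nat.le_succ m), ← add_assoc,
        ← mul_add, sub_add_cancel, mul_one]
    have hM : M'.diag (e := (1 - e : Module.End Q M.carrier)) hηη hηe hs =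
        M.withD _ (h.partial_odd m) (h.partial_sq m) := withD_congr (M := M) hdiag
    obtain ⟨h1, h2⟩ := ih
    obtain ⟨h3, h4⟩ := K0.mk_diag (P := M') (Z := Z) (e := (1 - e : Module.End Q M.carrier)) hηη hηe
      hs (by rw [hM]; exact h1)
    refine ⟨h3, h4.trans ?_⟩
    rw [← h2]
    congr 2

lemma total_odd (h : RaisesWeight M δ ε N) : (M.d + δ) * M.even = (1 - M.even) * (M.d + δ) := by
  simpa [h.sum_eq] using h.partial_odd N

lemma total_sq (h : RaisesWeight M δ ε N) :
    (M.d + δ) * (M.d + δ) = f • (1 : Module.End Q M.carrier) := by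
  simpa [h.sum_eq] using h.partial_sq N

lemma mk_total (h : RaisesWeight M δ ε N) (hZ : M.support ⊆ Z) :
    ∃ h' : (M.withD _ h.total_odd h.total_sq).support ⊆ Z,
      (K0.mk ⟨_, h'⟩ : K0 Z f) = K0.mk ⟨M, hZ⟩ := by
  have h1 := h.mk_partial hZ N
  rwa [withD_congr (D' := M.d + δ) (by rw [h.sum_eq, mul_one])] at h1

/-- A retract, with the induced perturbation and weights. -/
lemma retract (h : RaisesWeight M δ ε N) {R : MF Q f} {π : Module.End Q M.carrier}
    {i : R.carrier →ₗ[Q] M.carrier} {r : M.carrier →ₗ[Q] R.carrier} (hi : IsHom i) (hr : IsHom r)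
    (hri : ∀ x, r (i x) = x) (hir : ∀ x, i (r x) = π x) (hπδ : π * δ = δ * π)
    (hπε : ∀ j, π * ε j = ε j * π) :
    RaisesWeight R (r ∘ₗ δ ∘ₗ i) (fun j => r ∘ₗ ε j ∘ₗ i) N := by
  have hπi : ∀ x, π (i x) = i x := fun x => by rw [← hir, hri]
  have hδ : ∀ x, i (r (δ (i x))) = δ (i x) := fun x => by
    rw [hir]
    exact (LinearMap.congr_fun hπδ _).trans (congrArg δ (hπi x))
  have hε : ∀ j x, i (r (ε j (i x))) = ε j (i x) := fun j x => by
    rw [hir]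
    exact (LinearMap.congr_fun (hπε j) _).trans (congrArg (ε j) (hπi x))
  refine ⟨?_, fun j k hjk => ?_, fun j => ?_, fun j => ?_, fun j => ?_, ?_, ?_, ?_⟩ <;>
    refine LinearMap.ext fun x => ?_
  · have := congrArg r (LinearMap.congr_fun h.sum_eq (i x))
    simpa [hri] using this
  · have := congrArg r (LinearMap.congr_fun (h.orth j k hjk) (i x))
    simpa [hε] using this
  · have := congrArg r (LinearMap.congr_fun (h.comm_even j) (i x))
    simpa [hi.apply_even, ← hr.apply_even] using this
  · have := congrArg r (LinearMap.congr_fun (h.comm_d j) (i x))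
    simpa [hi.apply_d, ← hr.apply_d] using this
  · have := congrArg r (LinearMap.congr_fun (h.raise j) (i x))
    simpa [hε, hδ] using this
  · have := congrArg r (LinearMap.congr_fun h.odd (i x))
    simpa [hi.apply_even, ← hr.apply_even] using this
  · have := congrArg r (LinearMap.congr_fun h.sq (i x))
    simpa [hδ] using this
  · have := congrArg r (LinearMap.congr_fun h.anti (i x))
    simpa [hi.apply_d, ← hr.apply_d] using this

end RaisesWeight

/-! ### Weights on tensor powers -/

section Weight

variable {P : MF Q f}

/-- The projection of `T^n P` onto the part with `j` factors in the image of the idempotent `e`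
and `n - j` factors in its kernel. -/
def wt (e : Module.End Q P.carrier) : (n : ℕ) → ℤ → Module.End Q (P.tpow n).carrier
  | 0, j => if j = 0 then 1 else 0
  | n + 1, j => TensorProduct.map (1 - e) (wt e n j) + TensorProduct.map e (wt e n (j - 1))

variable {e : Module.End Q P.carrier}

lemma wt_succ (n : ℕ) (j : ℤ) :
    wt e (n + 1) j = TensorProduct.map (1 - e) (wt e n j) + TensorProduct.map e (wt e n (j - 1)) :=
  rfl

/-- Weights are indexed by integers so that the term `j - 1` of the recursion is a true difference.
This vanishing replaces the boundary cases. -/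
lemma wt_eq_zero : ∀ (n : ℕ) (j : ℤ), j < 0 ∨ n < j → wt e n j = 0
  | 0, j, hj => if_neg (by omega)
  | n + 1, j, hj => by
    have h : (TensorProduct.map (1 - e) (wt e n j) + TensorProduct.map e (wt e n (j - 1)) :
        Module.End Q (P.carrier ⊗[Q] (P.tpow n).carrier)) = 0 := by
      rw [wt_eq_zero n j (by push_cast at hj; omega),
        wt_eq_zero n (j - 1) (by push_cast at hj; omega), TensorProduct.map_zero_right,
        TensorProduct.map_zero_right, add_zero]
    exact h

lemma sum_wt : ∀ n : ℕ, ∑ j ∈ Finset.range (n + 1), wt e n (j : ℤ) = 1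
  | 0 => by simp [wt]
  | n + 1 => by
    have h1 : ∑ j ∈ Finset.range (n + 2), wt e n (j : ℤ) = 1 := by
      rw [Finset.sum_range_succ, wt_eq_zero n ((n + 1 : ℕ) : ℤ) (by push_cast; omega), add_zero,
        sum_wt n]
    have h2 : ∑ j ∈ Finset.range (n + 2), wt e n ((j : ℤ) - 1) = 1 := by
      rw [Finset.sum_range_succ', wt_eq_zero n _ (by simp), add_zero, ← sum_wt n]
      exact Finset.sum_congr rfl fun j _ => by congr 1; push_cast; ring
    have h3 : ∀ A : Module.End Q P.carrier, ∀ g : ℕ → Module.End Q (P.tpow n).carrier,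
        ∑ j ∈ Finset.range (n + 2), TensorProduct.map A (g j) =
          TensorProduct.map A (∑ j ∈ Finset.range (n + 2), g j) := fun A g =>
      (map_sum (TensorProduct.mapBilinear (RingHom.id Q) P.carrier (P.tpow n).carrier P.carrier
        (P.tpow n).carrier A) _ _).symm
    refine (Finset.sum_add_distrib (M := Module.End Q (P.carrier ⊗[Q] (P.tpow n).carrier))).trans ?_
    rw [h3, h3, h1, h2, ← TensorProduct.map_add_left, sub_add_cancel]
    exact TensorProduct.map_id

lemma wt_mul_wt (hee : e * e = e) : ∀ (n : ℕ) (i j : ℤ), i ≠ j → wt e n i * wt e n j = 0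
  | 0, i, j, hij => by
    have : i ≠ 0 ∨ j ≠ 0 := by omega
    rcases this with h | h <;> simp [wt, h]
  | n + 1, i, j, hij => by
    have h0 : e * (1 - e) = 0 := by rw [mul_sub, hee, mul_one, sub_self]
    have h0' : (1 - e) * e = 0 := by rw [sub_mul, hee, one_mul, sub_self]
    have h : ((TensorProduct.map (1 - e) (wt e n i) + TensorProduct.map e (wt e n (i - 1))) *
        (TensorProduct.map (1 - e) (wt e n j) + TensorProduct.map e (wt e n (j - 1))) :
        Module.End Q (P.carrier ⊗[Q] (P.tpow n).carrier)) = 0 := by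
      rw [add_mul, mul_add, mul_add, ← TensorProduct.map_mul, ← TensorProduct.map_mul,
        ← TensorProduct.map_mul, ← TensorProduct.map_mul, h0, h0', wt_mul_wt hee n i j hij,
        wt_mul_wt hee n (i - 1) (j - 1) (by omega)]
      simp
    exact h

lemma wt_even (he : IsGraded (P := P) (P' := P) e) (n : ℕ) (j : ℤ) (x : (P.tpow n).carrier) :
    wt e n j ((P.tpow n).even x) = (P.tpow n).even (wt e n j x) := by
  induction n generalizing j with
  | zero =>
    change (if j = 0 then (1 : Module.End Q Q) else 0) ((1 : Module.End Q Q) x) = _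
    rfl
  | succ n ih =>
    have he' : IsGraded (P := P) (P' := P) (1 - e) := fun x => by simp [he x]
    have h1 := map_comp_tEven he' (ih j)
    have h2 := map_comp_tEven he (ih (j - 1))
    refine LinearMap.congr_fun (?_ : (TensorProduct.map (1 - e) (wt e n j) +
      TensorProduct.map e (wt e n (j - 1))) ∘ₗ P.tEven (P.tpow n).even = P.tEven (P.tpow n).even ∘ₗ
        (TensorProduct.map (1 - e) (wt e n j) + TensorProduct.map e (wt e n (j - 1)))) x
    rw [LinearMap.add_comp, LinearMap.comp_add, h1, h2]

lemma wt_der (he : IsGraded (P := P) (P' := P) e) {a : Module.End Q P.carrier}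
    (ha : ∀ x, e (a x) = a (e x)) (n : ℕ) (j : ℤ) (x : (P.tpow n).carrier) :
    wt e n j (P.der a n x) = P.der a n (wt e n j x) := by
  induction n generalizing j with
  | zero => exact map_zero _
  | succ n ih =>
    have he' : IsGraded (P := P) (P' := P) (1 - e) := fun x => by simp [he x]
    have h1 := map_comp_tDer he' (a := a) (a' := a) (fun x => by simp [ha]) (ih j)
    have h2 := map_comp_tDer he (a := a) (a' := a) (fun x => by simp [ha]) (ih (j - 1))
    refine LinearMap.congr_fun (?_ : (TensorProduct.map (1 - e) (wt e n j) +
      TensorProduct.map e (wt e n (j - 1))) ∘ₗ P.tDer a (P.der a n) = P.tDer a (P.der a n) ∘ₗ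
        (TensorProduct.map (1 - e) (wt e n j) + TensorProduct.map e (wt e n (j - 1)))) x
    rw [LinearMap.add_comp, LinearMap.comp_add, h1, h2]

/-- `δ` kills the image of `e` and takes its values there. So each term of the derivation either
vanishes or moves exactly one factor from the kernel of `e` to its image. -/
lemma der_wt (he : IsGraded (P := P) (P' := P) e) {δ : Module.End Q P.carrier}
    (h1 : ∀ x, e (δ x) = δ x) (h2 : ∀ x, δ (e x) = 0) (n : ℕ) (j : ℤ) (x : (P.tpow n).carrier) :
    P.der δ n (wt e n j x) = wt e n (j + 1) (P.der δ n x) := by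
  induction n generalizing j with
  | zero => exact (map_zero _).symm
  | succ n ih =>
    refine LinearMap.congr_fun (?_ : P.tDer δ (P.der δ n) ∘ₗ (TensorProduct.map (1 - e) (wt e n j) +
      TensorProduct.map e (wt e n (j - 1))) = (TensorProduct.map (1 - e) (wt e n (j + 1)) +
        TensorProduct.map e (wt e n (j + 1 - 1))) ∘ₗ P.tDer δ (P.der δ n)) x
    refine TensorProduct.ext' fun x y => ?_
    rw [add_sub_cancel_right]
    simp only [LinearMap.comp_apply, LinearMap.add_apply, TensorProduct.map_tmul, map_add,
      tDer_tmul, ih, LinearMap.sub_apply, Module.End.one_apply, map_sub, h1, h2, he x,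
      sub_self, TensorProduct.zero_tmul, zero_add, TensorProduct.sub_tmul,
      sub_add_cancel]
    abel

lemma swap_map {P' : MF Q f} {N N' : Type u} [AddCommGroup N] [Module Q N] [AddCommGroup N']
    [Module Q N'] {g h : P.carrier →ₗ[Q] P'.carrier} (hg : IsGraded g) (hh : IsGraded h)
    (k : N →ₗ[Q] N') (x : P.carrier ⊗[Q] (P.carrier ⊗[Q] N)) :
    P'.swap N' (TensorProduct.map g (TensorProduct.map h k) x) =
      TensorProduct.map h (TensorProduct.map g k) (P.swap N x) := by
  refine LinearMap.congr_fun (f := P'.swap N' ∘ₗ TensorProduct.map g (TensorProduct.map h k))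
    (g := TensorProduct.map h (TensorProduct.map g k) ∘ₗ P.swap N) ?_ x
  ext x y z
  simp [swap_tmul, hg.apply_odd, hh.apply_odd]

/-- The weight counts factors without regard to their positions. In the induction, the transposition
of the first two factors exchanges the two mixed terms of the weight projection and preserves the
two others. -/
lemma cyc_wt (he : IsGraded (P := P) (P' := P) e) :
    ∀ (n : ℕ) (j : ℤ) (x : P.carrier ⊗[Q] (P.tpow n).carrier),
      P.cyc n (wt e (n + 1) j x) = wt e (n + 1) j (P.cyc n x)
  | 0, _, _ => rfl
  | n + 1, j, x => by
    have he' : IsGraded (P := P) (P' := P) (1 - e) := fun x => by simp [he x]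
    let T : Module.End Q P.carrier → ℤ →
        Module.End Q (P.carrier ⊗[Q] (P.carrier ⊗[Q] (P.tpow n).carrier)) := fun A j =>
      TensorProduct.map A (wt e (n + 1) j)
    have h1 : ∀ A j, TensorProduct.map 1 (P.cyc n) ∘ₗ T A j =
        T A j ∘ₗ TensorProduct.map 1 (P.cyc n) := fun A j => by
      exact TensorProduct.ext' fun x y => congrArg (fun t => A x ⊗ₜ[Q] t) (cyc_wt he n j y)
    have h2 : P.swap (P.tpow n).carrier ∘ₗ (T (1 - e) j + T e (j - 1)) =
        (T (1 - e) j + T e (j - 1)) ∘ₗ P.swap (P.tpow n).carrier := by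
      have h3 : T (1 - e) j + T e (j - 1) =
          TensorProduct.map (1 - e) (TensorProduct.map (1 - e) (wt e n j)) +
          TensorProduct.map (1 - e) (TensorProduct.map e (wt e n (j - 1))) +
          (TensorProduct.map e (TensorProduct.map (1 - e) (wt e n (j - 1))) +
          TensorProduct.map e (TensorProduct.map e (wt e n (j - 1 - 1)))) := by
        simp only [T, wt_succ]
        rw [← TensorProduct.map_add_right, ← TensorProduct.map_add_right]
        rfl
      rw [h3]
      refine LinearMap.ext fun y => ?_
      simp only [LinearMap.comp_apply, LinearMap.add_apply, map_add, swap_map he he, swap_map he' he',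
        swap_map he he', swap_map he' he]
      abel
    refine LinearMap.congr_fun (f := (P.swap (P.tpow n).carrier ∘ₗ TensorProduct.map 1 (P.cyc n)) ∘ₗ
      (T (1 - e) j + T e (j - 1))) (g := (T (1 - e) j + T e (j - 1)) ∘ₗ
        (P.swap (P.tpow n).carrier ∘ₗ TensorProduct.map 1 (P.cyc n))) ?_ x
    rw [LinearMap.comp_assoc, LinearMap.comp_add, h1, h1, ← LinearMap.add_comp, ← LinearMap.comp_assoc,
      h2, LinearMap.comp_assoc]

lemma rot_wt (he : IsGraded (P := P) (P' := P) e) :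
    ∀ (n : ℕ) (j : ℤ) (x : (P.tpow n).carrier), P.rot n (wt e n j x) = wt e n j (P.rot n x)
  | 0, _, _ => rfl
  | n + 1, j, x => cyc_wt he n j x

lemma der_add (a b : Module.End Q P.carrier) : ∀ n, P.der (a + b) n = P.der a n + P.der b n
  | 0 => (add_zero _).symm
  | n + 1 => by
    change P.tDer (a + b) (P.der (a + b) n) = P.tDer a (P.der a n) + P.tDer b (P.der b n)
    rw [der_add a b n, tDer, tDer, tDer, TensorProduct.map_add_left, TensorProduct.map_add_right]
    abel

lemma der_sq {a : Module.End Q P.carrier} (ha : ∀ x, a (P.even x) = a x - P.even (a x))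
    (haa : ∀ x, a (a x) = 0) : ∀ (n : ℕ) (x : (P.tpow n).carrier), P.der a n (P.der a n x) = 0
  | 0, _ => rfl
  | n + 1, x => by
    have ih := der_sq ha haa n
    refine LinearMap.congr_fun (f := P.tDer a (P.der a n) ∘ₗ P.tDer a (P.der a n)) (g := 0) ?_ x
    refine TensorProduct.ext' fun x y => ?_
    have h1 : P.even (a x) = a x - a (P.even x) := by rw [ha]; abel
    simp only [LinearMap.comp_apply, tDer_tmul, map_add, haa, ih, TensorProduct.zero_tmul, zero_add,
      TensorProduct.tmul_zero, add_zero, LinearMap.zero_apply, map_sub, h1,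
      TensorProduct.sub_tmul]
    abel

end Weight

end MF

end

end AdamsMF

/-! ### Eigenspaces for an extension and for its split form. -/

namespace AdamsMF

noncomputable section

variable {Q : Type u} [CommRing Q] {Z : Set (PrimeSpectrum Q)} {f : Q}

namespace MF

/-- The derivation of an off-diagonal odd endomorphism raises the weight on tensor powers. -/
lemma raisesWeight_der {P : MF Q f} {e δ : Module.End Q P.carrier} (hee : ∀ x, e (e x) = e x)
    (he : IsHom (P := P) (P' := P) e) (h1 : ∀ x, e (δ x) = δ x) (h2 : ∀ x, δ (e x) = 0)
    (hδ : IsContr P.even P.d 0 δ) (n : ℕ) :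
    RaisesWeight (P.tpow n) (P.der δ n) (fun j => wt (P := P) e n (j : ℤ)) (n + 1) := by
  have hC := P.contr_der hδ n 0 (by rw [mul_zero])
  refine ⟨sum_wt n, fun i j hij => wt_mul_wt (LinearMap.ext hee) n _ _ (by exact_mod_cast hij),
    fun j => LinearMap.ext fun x => wt_even he.isGraded n j x, fun j => ?_, fun j => ?_, hC.isOdd,
    ?_, ?_⟩
  · rw [d_tpow]
    exact LinearMap.ext fun x => wt_der he.isGraded he.apply_d n j x
  · refine LinearMap.ext fun x => (der_wt he.isGraded h1 h2 n j x).trans ?_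
    push_cast
    rfl
  · refine LinearMap.ext fun x => der_sq (fun y => hδ.apply_even y) (fun y => ?_) n x
    rw [← h1 y, h2]
  · rw [hC.eq, zero_smul]

lemma support_tpow_succ (P : MF Q f) (n : ℕ) : (P.tpow (n + 1)).support ⊆ P.support := by
  have : (P.tpow (n + 1)).support = (P.tensor (P.tpow n)).support := support_ofEq _ _
  rw [this]
  exact (support_tensor _ _).trans Set.inter_subset_left

end MF

section K0

/-- Perturbing a differential by an operator that raises a weight does not change the classes of
direct summands. -/
lemma K0.mk_eq_of_raisesWeight {M M' R R' : MF Q f} {δ π : Module.End Q M.carrier}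
    {π' : Module.End Q M'.carrier} {ε : ℕ → Module.End Q M.carrier} {N : ℕ}
    (W : MF.RaisesWeight M δ ε N) (hR : MF.IsRetract R M π) (hR' : MF.IsRetract R' M' π')
    (hπδ : π * δ = δ * π) (hπε : ∀ j, π * ε j = ε j * π)
    {a : M'.carrier →ₗ[Q] M.carrier} {b : M.carrier →ₗ[Q] M'.carrier} (hba : ∀ x, b (a x) = x)
    (hab : ∀ x, a (b x) = x) (hae : MF.IsGraded a)
    (had : ∀ x, a (M'.d x) = M.d (a x) + δ (a x)) (haπ : ∀ x, a (π' x) = π (a x))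
    (hZ : R.support ⊆ Z) (hZ' : R'.support ⊆ Z) :
    (K0.mk ⟨R', hZ'⟩ : K0 Z f) = K0.mk ⟨R, hZ⟩ := by
  obtain ⟨i, r, hi, hr, hri, hir⟩ := hR
  obtain ⟨i', r', hi', hr', hri', hir'⟩ := hR'
  have W' := W.retract hi hr hri hir hπδ hπε
  obtain ⟨h0, hmk⟩ := W'.mk_total hZ
  refine Eq.trans ?_ hmk
  have hπi : ∀ x, π (i x) = i x := fun x => by rw [← hir, hri]
  have hπi' : ∀ x, π' (i' x) = i' x := fun x => by rw [← hir', hri']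
  have hbπ : ∀ x, b (π x) = π' (b x) := fun x => by
    rw [← hba (π' (b x)), haπ, hab]
  have hπδ' : ∀ x, π (δ x) = δ (π x) := fun x => LinearMap.congr_fun hπδ x
  -- Through `a`, the factorization `R'` is isomorphic to `R` with the perturbed differential `d + r
  -- δ i`. The class of the latter is that of `R`, by the weight argument applied to the direct
  -- summand `R`.
  refine K0.mk_eq_of_htpyEquiv (P := ⟨R', hZ'⟩) (P' := ⟨_, h0⟩) (MF.HtpyEquiv.of_inverse
    (P := R') (P' := R.withD _ W'.total_odd W'.total_sq)
    (g := r ∘ₗ a ∘ₗ i') (g' := r' ∘ₗ b ∘ₗ i)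
    (MF.IsHom.of_apply (fun x => ?_) fun x => ?_) ⟨?_, ?_⟩ ?_ ?_)
  · change r (a (i' (R'.even x))) = R.even (r (a (i' x)))
    rw [hi'.apply_even, hae, hr.apply_even]
  · change r (a (i' (R'.d x))) = R.d (r (a (i' x))) + r (δ (i (r (a (i' x)))))
    rw [hi'.apply_d, had, map_add, hr.apply_d, hir, ← haπ, hπi']
  · refine LinearMap.ext fun x : R.carrier => ?_
    change r' (b (i (R.even x))) = R'.even (r' (b (i x)))
    rw [hi.apply_even, ← hab (i x), ← hae, hba, hba, hr'.apply_even]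
  · refine LinearMap.ext fun x : R.carrier => ?_
    change r' (b (i (R.d x + r (δ (i x))))) = R'.d (r' (b (i x)))
    rw [map_add, hi.apply_d, hir, hπδ', hπi, ← hr'.apply_d]
    refine congrArg r' ?_
    rw [← hba (M'.d (b (i x))), had, hab]
  · refine LinearMap.ext fun x => ?_
    change r' (b (i (r (a (i' x))))) = x
    rw [hir, hbπ, hba, hπi', hri']
  · refine LinearMap.ext fun x : R.carrier => ?_
    change r (a (i' (r' (b (i x))))) = x
    rw [hir', haπ, hab, hπi, hri]

/-- Splitting an extension does not change the class of the eigenspaces of its tensor powers. -/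
lemma K0.mk_eigen_diag {p : ℕ} {u ζ : Q} {P P₀ : MF Q f} {e δ : Module.End Q P₀.carrier}
    (hee : ∀ x, e (e x) = e x) (he : MF.IsHom (P := P₀) (P' := P₀) e) (h1 : ∀ x, e (δ x) = δ x)
    (h2 : ∀ x, δ (e x) = 0) (hδ : MF.IsContr P₀.even P₀.d 0 δ)
    {a : P.carrier →ₗ[Q] P₀.carrier} {b : P₀.carrier →ₗ[Q] P.carrier} (hba : ∀ x, b (a x) = x)
    (hab : ∀ x, a (b x) = x) (hae : MF.IsGraded a)
    (had : ∀ x, a (P.d x) = P₀.d (a x) + δ (a x)) {R R₀ : MF Q (p * f)}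
    (hR : MF.IsRetract R (P.tpow p) (eigProj p u ζ (P.rot p)))
    (hR₀ : MF.IsRetract R₀ (P₀.tpow p) (eigProj p u ζ (P₀.rot p)))
    (hZ : R.support ⊆ Z) (hZ₀ : R₀.support ⊆ Z) :
    (K0.mk ⟨R, hZ⟩ : K0 Z (p * f)) = K0.mk ⟨R₀, hZ₀⟩ := by
  refine K0.mk_eq_of_raisesWeight (MF.raisesWeight_der hee he h1 h2 hδ p) hR₀ hR
    (eigProj_comm (P₀.rot_comm_der hδ.isOdd p).symm).symm
    (fun j => (eigProj_comm (LinearMap.ext fun x => (MF.rot_wt he.isGraded p j x).symm)).symm)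
    (a := MF.tmap (fun _ => a) p) (b := MF.tmap (fun _ => b) p) (fun x => ?_) (fun x => ?_)
    (MF.tmap_even (fun _ => hae) p) (fun x => ?_)
    (eigProj_intertwine fun x => (MF.rot_tmap_const hae p x).symm) hZ₀ hZ
  · refine (LinearMap.congr_fun (MF.tmap_comp (fun _ => a) (fun _ => b) p) x).trans ?_
    rw [show b ∘ₗ a = LinearMap.id from LinearMap.ext hba, MF.tmap_id]
    rfl
  · refine (LinearMap.congr_fun (MF.tmap_comp (fun _ => b) (fun _ => a) p) x).trans ?_
    rw [show a ∘ₗ b = LinearMap.id from LinearMap.ext hab, MF.tmap_id]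
    rfl
  · rw [MF.d_tpow, MF.d_tpow, ← LinearMap.add_apply, ← MF.der_add]
    exact MF.tmap_der (fun _ => hae) (fun _ => had) p x

end K0

end

end AdamsMF

namespace AdamsMF

noncomputable section

/-! ### Cyclic words in two letters -/

section Words

variable {p : ℕ} [Fact p.Prime]

/-- The number of letters `true`, modulo `p`. -/
def wordWt (c : ZMod p → Bool) : ZMod p := ∑ i, if c i then 1 else 0

/-- The sum of the positions of the letters `true`, modulo `p`. -/
def wordPos (c : ZMod p → Bool) : ZMod p := ∑ i, if c i then i else 0

lemma wordWt_shift (c : ZMod p → Bool) (k : ZMod p) : wordWt (fun i => c (i - k)) = wordWt c :=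
  (Equiv.subRight k).sum_comp (fun i => if c i then (1 : ZMod p) else 0)

/-- This selects representatives of the orbits of rotation: for a nonconstant word `wordWt c` is
invertible modulo `p`, so a rotation by `k` adds `k` to the quotient `wordPos c / wordWt c`. Each
orbit has exactly one word for each value of this quotient. -/
lemma wordPos_shift (c : ZMod p → Bool) (k : ZMod p) :
    wordPos (fun i => c (i - k)) = wordPos c + k * wordWt c := by
  have h := (Equiv.subRight k).sum_comp (fun i => if c i then i + k else (0 : ZMod p))
  have h1 : wordPos (fun i => c (i - k)) = ∑ i, if c i then i + k else (0 : ZMod p) := by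
    rw [← h]
    simp [wordPos]
  rw [h1, wordPos, wordWt, Finset.mul_sum, ← Finset.sum_add_distrib]
  exact Finset.sum_congr rfl fun i _ => by split_ifs <;> simp

/-- The number of letters `true` lies between `0` and `p`, so it is divisible by `p` only at the two
ends. -/
lemma eq_const_of_wordWt_eq_zero {c : ZMod p → Bool} (h : wordWt c = 0) :
    c = (fun _ => true) ∨ c = fun _ => false := by
  have h1 : wordWt c = ((Finset.univ.filter fun i => c i = true).card : ZMod p) := by
    rw [wordWt, Finset.sum_ite, Finset.sum_const_zero, add_zero, Finset.sum_const, nsmul_eq_mul,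
      mul_one]
  rw [h1, ZMod.natCast_eq_zero_iff] at h
  have h2 : (Finset.univ.filter fun i => c i = true).card ≤ p := by
    simpa [ZMod.card] using Finset.card_filter_le (Finset.univ : Finset (ZMod p)) fun i => c i = true
  rcases Nat.eq_zero_or_pos (Finset.univ.filter fun i => c i = true).card with h0 | h0
  · right
    funext i
    have := Finset.filter_eq_empty_iff.1 (Finset.card_eq_zero.1 h0) (Finset.mem_univ i)
    simpa using this
  · left
    have h3 : (Finset.univ.filter fun i => c i = true).card = (Finset.univ : Finset (ZMod p)).card := by
      rw [Finset.card_univ, ZMod.card]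
      exact le_antisymm h2 (Nat.le_of_dvd h0 h)
    funext i
    exact Finset.filter_eq_self.1 (Finset.eq_of_subset_of_card_le (Finset.filter_subset _ _) h3.ge)
      i (Finset.mem_univ i)

lemma wordWt_true : wordWt (fun _ : ZMod p => true) = 0 := by
  simp [wordWt, ZMod.card]

lemma wordWt_false : wordWt (fun _ : ZMod p => false) = 0 := by
  simp [wordWt]

variable {Q : Type u} [CommRing Q] {M : Type u} [AddCommGroup M] [Module Q M]

/-- A decomposition of the identity, indexed by cyclic words, that the operator `σ` rotates. -/
structure IsCyclicSystem (σ : Module.End Q M) (E : (ZMod p → Bool) → Module.End Q M) : Prop where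
  sum_eq : ∑ c, E c = 1
  orth : ∀ c c', c ≠ c' → E c * E c' = 0
  shift : ∀ c, σ * E c = E (fun i => c (i - 1)) * σ

/-- The nonconstant words `c` with `wordPos c = i * wordWt c`. -/
def sectorSet (i : ZMod p) : Finset (ZMod p → Bool) :=
  {c | wordWt c ≠ 0 ∧ wordPos c = i * wordWt c}

/-- The sum of the projections for the nonconstant words with `wordPos c = i * wordWt c`. -/
def sector (E : (ZMod p → Bool) → Module.End Q M) (i : ZMod p) : Module.End Q M :=
  ∑ c ∈ sectorSet i, E c

/-- The sum of the projections for the nonconstant words. -/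
def mixed (E : (ZMod p → Bool) → Module.End Q M) : Module.End Q M :=
  ∑ c with wordWt c ≠ 0, E c

namespace IsCyclicSystem

variable {σ : Module.End Q M} {E : (ZMod p → Bool) → Module.End Q M} {u ζ : Q}

lemma idem (h : IsCyclicSystem σ E) (c : ZMod p → Bool) : E c * E c = E c := by
  conv_rhs => rw [← mul_one (E c), ← h.sum_eq, Finset.mul_sum]
  rw [Finset.sum_eq_single c (fun c' _ hc => h.orth _ _ hc.symm)
    (fun h => absurd (Finset.mem_univ c) h)]

lemma sum_mul_sum (h : IsCyclicSystem σ E) (S T : Finset (ZMod p → Bool)) :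
    (∑ c ∈ S, E c) * ∑ c ∈ T, E c = ∑ c ∈ S ∩ T, E c := by
  rw [Finset.sum_mul_sum, ← Finset.filter_mem_eq_inter, Finset.sum_filter]
  refine Finset.sum_congr rfl fun c _ => ?_
  split_ifs with hc
  · rw [Finset.sum_eq_single c (fun c' _ hc => h.orth _ _ hc.symm) (fun h => absurd hc h), h.idem]
  · exact Finset.sum_eq_zero fun c' hc' => h.orth _ _ (by rintro rfl; exact hc hc')

lemma pow_shift (h : IsCyclicSystem σ E) (k : ℕ) (c : ZMod p → Bool) :
    σ ^ k * E c = E (fun i => c (i - k)) * σ ^ k := by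
  induction k with
  | zero => simp
  | succ k ih =>
    rw [pow_succ', mul_assoc, ih, ← mul_assoc, h.shift, mul_assoc]
    congr 2
    funext i
    congr 1
    push_cast
    ring

/-- The rotation permutes the `p` sectors simply transitively, so the mixed part looks like an
induced representation, with sector `0` as inducing space. -/
lemma pow_mul_sector (h : IsCyclicSystem σ E) (k : ℕ) (i : ZMod p) :
    σ ^ k * sector E i = sector E (i + k) * σ ^ k := by
  rw [sector, sector, Finset.mul_sum, Finset.sum_mul]
  refine Finset.sum_bij' (fun c _ => fun j => c (j - k)) (fun c _ => fun j => c (j + k)) ?_ ?_ ?_ ?_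
    fun c _ => h.pow_shift k c
  · intro c hc
    simp only [sectorSet, Finset.mem_filter, Finset.mem_univ, true_and] at hc ⊢
    rw [wordWt_shift, wordPos_shift, hc.2, add_mul]
    exact ⟨hc.1, rfl⟩
  · intro c hc
    simp only [sectorSet, Finset.mem_filter, Finset.mem_univ, true_and] at hc ⊢
    have h1 : (fun j => c (j + k)) = fun j => c (j - (-k : ZMod p)) := by simp
    rw [h1, wordWt_shift, wordPos_shift, hc.2]
    exact ⟨hc.1, by ring⟩
  · intro c _; simp
  · intro c _; simp

lemma sector_mul_sector (h : IsCyclicSystem σ E) {i j : ZMod p} (hij : i ≠ j) :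
    sector E i * sector E j = 0 := by
  rw [sector, sector, h.sum_mul_sum]
  refine Finset.sum_eq_zero fun c hc => ?_
  simp only [sectorSet, Finset.mem_inter, Finset.mem_filter, Finset.mem_univ, true_and] at hc
  exact absurd (mul_right_cancel₀ hc.1.1 (hc.1.2.symm.trans hc.2.2)) hij

lemma sector_idem (h : IsCyclicSystem σ E) (i : ZMod p) : sector E i * sector E i = sector E i := by
  rw [sector, h.sum_mul_sum, Finset.inter_self]

lemma mixed_mul_sector (h : IsCyclicSystem σ E) (i : ZMod p) :
    mixed E * sector E i = sector E i := by
  rw [sector, mixed, h.sum_mul_sum]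
  congr 1
  refine Finset.inter_eq_right.2 fun c hc => ?_
  simp only [sectorSet, Finset.mem_filter, Finset.mem_univ, true_and] at hc ⊢
  exact hc.1

lemma mixed_idem (h : IsCyclicSystem σ E) : mixed E * mixed E = mixed E := by
  rw [mixed, h.sum_mul_sum, Finset.inter_self]

lemma sum_sector : ∑ i, sector E i = mixed E := by
  have h1 : ∀ i, sector E i = ∑ c with wordWt c ≠ 0, if wordPos c = i * wordWt c then E c else 0 :=
    fun i => by rw [sector, sectorSet, ← Finset.filter_filter, Finset.sum_filter]
  simp only [h1]
  rw [Finset.sum_comm, mixed]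
  refine Finset.sum_congr rfl fun c hc => ?_
  simp only [Finset.mem_filter, Finset.mem_univ, true_and] at hc
  rw [Finset.sum_eq_single (wordPos c / wordWt c), if_pos (div_mul_cancel₀ _ hc).symm]
  · intro i _ hi
    exact if_neg fun h => hi (by rw [h, mul_div_cancel_right₀ _ hc])
  · exact fun h => absurd (Finset.mem_univ _) h

lemma mixed_comm (h : IsCyclicSystem σ E) : mixed E * σ = σ * mixed E := by
  have h1 : ∀ i, σ * sector E i = sector E (i + 1) * σ := fun i => by
    simpa using h.pow_mul_sector 1 i
  rw [← sum_sector, Finset.mul_sum, Finset.sum_mul]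
  simp only [h1]
  exact (Equiv.sum_comp (Equiv.addRight (1 : ZMod p)) fun i => sector E i * σ).symm

lemma add_mixed (h : IsCyclicSystem σ E) :
    mixed E + E (fun _ => true) + E (fun _ => false) = 1 := by
  have h0 : (fun _ : ZMod p => true) ≠ fun _ => false := fun h => by simpa using congrFun h 0
  have h1 : (Finset.univ.filter fun c : ZMod p → Bool => ¬ wordWt c ≠ 0) =
      {(fun _ => true), fun _ => false} := by
    ext c
    simp only [Finset.mem_filter, Finset.mem_univ, true_and, not_not, Finset.mem_insert,
      Finset.mem_singleton]
    refine ⟨eq_const_of_wordWt_eq_zero, ?_⟩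
    rintro (rfl | rfl)
    exacts [wordWt_true, wordWt_false]
  rw [← h.sum_eq, ← Finset.sum_filter_add_sum_filter_not _ (fun c => wordWt c ≠ 0), h1,
    Finset.sum_pair h0, mixed, add_assoc]

/-- Of the `p` terms of the eigenprojection only the identity maps sector `0` to itself; the others
move it to an orthogonal sector. The coefficient of the identity is `u`. -/
lemma sector_eigProj_sector (h : IsCyclicSystem σ E) :
    sector E 0 * eigProj p u ζ σ * sector E 0 = u • sector E 0 := by
  have hp : 0 < p := (Fact.out : p.Prime).pos
  rw [eigProj, mul_smul_comm, smul_mul_assoc, Finset.mul_sum, Finset.sum_mul]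
  congr 1
  rw [Finset.sum_eq_single 0]
  · rw [pow_zero, mul_one, h.sector_idem]
  · intro i hi hi0
    have h1 : (0 : ZMod p) ≠ 0 + (i : ZMod p) := by
      rw [zero_add, ne_comm, Ne, ZMod.natCast_eq_zero_iff]
      exact Nat.not_dvd_of_pos_of_lt (Nat.pos_of_ne_zero hi0) (Finset.mem_range.1 hi)
    rw [smul_pow, mul_smul_comm, smul_mul_assoc, mul_assoc, h.pow_mul_sector, ← mul_assoc,
      h.sector_mul_sector h1, zero_mul, smul_zero]
  · exact fun h => absurd (Finset.mem_range.2 hp) h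

/-- Powers of `σ` carry sector `0` to every other sector, and the eigenprojection absorbs powers of
`ζ⁻¹ σ`. So all `p` sectors have the same compression to the eigenspace, and their sum is the mixed
part. -/
lemma eigProj_sector_eigProj (h : IsCyclicSystem σ E) (hσ : σ ^ p = 1) (hu : u * p = 1)
    (hζ : ζ ^ p = 1) : (p : Q) • (eigProj p u ζ σ * sector E 0 * eigProj p u ζ σ) =
      eigProj p u ζ σ * mixed E := by
  have hp : 0 < p := (Fact.out : p.Prime).pos
  set π := eigProj p u ζ σ with hπ
  have h0 : ζ * ζ ^ (p - 1) = 1 := by rw [← pow_succ', Nat.sub_add_cancel hp, hζ]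
  have hτ : ∀ k : ℕ, (ζ ^ (p - 1) • σ) ^ k * π = π := fun k => by
    induction k with
    | zero => exact one_mul _
    | succ k ih =>
      rw [pow_succ, mul_assoc, smul_mul_assoc, mul_eigProj hp hσ hζ, smul_smul, mul_comm _ ζ, h0,
        one_smul, ih]
  have hτ' : ∀ k : ℕ, π * (ζ ^ (p - 1) • σ) ^ k = π := fun k => by
    induction k with
    | zero => exact mul_one _
    | succ k ih =>
      rw [pow_succ', ← mul_assoc, mul_smul_comm, eigProj_mul hp hσ hζ, smul_smul, mul_comm _ ζ, h0,
        one_smul, ih]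
  have h1 : ∀ i : ZMod p, π * sector E i * π = π * sector E 0 * π := fun i => by
    have h2 : (ζ ^ (p - 1) • σ) ^ i.val * sector E 0 = sector E i * (ζ ^ (p - 1) • σ) ^ i.val := by
      rw [smul_pow, smul_mul_assoc, h.pow_mul_sector, mul_smul_comm, zero_add, ZMod.natCast_zmod_val]
    have h3 : π * sector E i * π = π * sector E i * ((ζ ^ (p - 1) • σ) ^ i.val * π) := by rw [hτ]
    rw [h3, ← mul_assoc, mul_assoc π, ← h2, ← mul_assoc, hτ']
  have h3 : π * mixed E = π * mixed E * π := by
    rw [mul_assoc, ← (eigProj_comm h.mixed_comm).symm, ← mul_assoc, eigProj_idem hp hu hσ hζ]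
  rw [h3, ← sum_sector, Finset.mul_sum, Finset.sum_mul, Finset.sum_congr rfl fun i _ => h1 i,
    Finset.sum_const, Finset.card_univ, ZMod.card, Nat.cast_smul_eq_nsmul]

end IsCyclicSystem

/-- The mixed part of an eigenspace of the rotation is the part for a set of representatives of
the nonconstant cyclic words. -/
lemma K0.mk_eigProj_mixed {Z : Set (PrimeSpectrum Q)} {f : Q} {P R S : MF Q f}
    {σ : Module.End Q P.carrier} {E : (ZMod p → Bool) → Module.End Q P.carrier} {u ζ : Q}
    (h : IsCyclicSystem σ E) (hσ : σ ^ p = 1) (hu : u * p = 1) (hζ : ζ ^ p = 1)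
    (hR : MF.IsRetract R P (eigProj p u ζ σ * mixed E)) (hS : MF.IsRetract S P (sector E 0))
    (hZ : R.support ⊆ Z) (hZ' : S.support ⊆ Z) :
    (K0.mk ⟨R, hZ⟩ : K0 Z f) = K0.mk ⟨S, hZ'⟩ := by
  have hp : 0 < p := (Fact.out : p.Prime).pos
  have hcomm := eigProj_comm (p := p) (u := u) (ζ := ζ) h.mixed_comm
  -- Projecting the eigenspace to the sector and projecting back are inverse to each other up to the
  -- factor `u = 1/p`, whence the factor `p` in `b`.
  refine K0.mk_eq_of_isRetract hR hS (a := (1 : Module.End Q P.carrier))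
    (b := (p : Q) • (1 : Module.End Q P.carrier)) (MF.isHom_one P) ((MF.isHom_one P).smul _)
    (fun x => ?_) fun x => ?_
  · refine LinearMap.congr_fun (f := eigProj p u ζ σ * mixed E * ((p : Q) • (1 : Module.End Q P.carrier)
      * (sector E 0 * (1 * (eigProj p u ζ σ * mixed E))))) ?_ x
    have h1 : mixed E * (eigProj p u ζ σ * mixed E) = eigProj p u ζ σ * mixed E := by
      rw [← mul_assoc, hcomm, mul_assoc, h.mixed_idem]
    rw [one_mul, smul_mul_assoc, one_mul, mul_smul_comm, mul_assoc, ← mul_assoc (mixed E),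
      h.mixed_mul_sector, ← mul_assoc, ← mul_assoc, ← smul_mul_assoc,
      h.eigProj_sector_eigProj hσ hu hζ, mul_assoc, h.mixed_idem]
  · refine LinearMap.congr_fun (f := sector E 0 * (1 * (eigProj p u ζ σ * mixed E *
      ((p : Q) • (1 : Module.End Q P.carrier) * sector E 0)))) ?_ x
    rw [one_mul, smul_mul_assoc, one_mul, mul_smul_comm, mul_smul_comm, mul_assoc,
      h.mixed_mul_sector, ← mul_assoc, h.sector_eigProj_sector, smul_smul, mul_comm, hu, one_smul]

end Words

end

end AdamsMF

namespace AdamsMF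

noncomputable section

namespace MF

variable {Q : Type u} [CommRing Q] {f : Q}

/-! ### Words in the tensor powers of a direct sum -/

section Word

variable {P : MF Q f}

/-- The projection of `T^n P` onto the summand of the word `b` in the images of `e` and `1 - e`. -/
def word (e : Module.End Q P.carrier) (b : ℕ → Bool) (n : ℕ) : Module.End Q (P.tpow n).carrier :=
  tmap (fun i => if b i then e else 1 - e) n

variable {e : Module.End Q P.carrier}

lemma word_congr {n : ℕ} {b b' : ℕ → Bool} (h : ∀ i < n, b i = b' i) : word e b n = word e b' n :=
  tmap_congr n fun i hi => by rw [h i hi]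

lemma tmap_eq_zero {n : ℕ} {g : ℕ → Module.End Q P.carrier} {i : ℕ} (hi : i < n) (h : g i = 0) :
    tmap (P := P) (P' := P) g n = 0 := by
  induction n generalizing g i with
  | zero => omega
  | succ n ih =>
    cases i with
    | zero =>
      refine (congrArg (fun a => TensorProduct.map a (tmap (P := P) (P' := P) (fun i => g (i + 1)) n))
        h).trans ?_
      exact TensorProduct.map_zero_left _
    | succ i =>
      refine (congrArg (fun a => TensorProduct.map (g 0) a) (ih (g := fun i => g (i + 1))
        (Nat.lt_of_succ_lt_succ hi) h)).trans ?_
      exact TensorProduct.map_zero_right _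

lemma word_mul_word (hee : e * e = e) {b b' : ℕ → Bool} {n i : ℕ} (hi : i < n) (h : b i ≠ b' i) :
    word e b n * word e b' n = 0 := by
  refine (tmap_comp _ _ n).trans (tmap_eq_zero hi ?_)
  have h0 : e * (1 - e) = 0 := by rw [mul_sub, hee, mul_one, sub_self]
  have h0' : (1 - e) * e = 0 := by rw [sub_mul, hee, one_mul, sub_self]
  change (if b i then e else 1 - e) * (if b' i then e else 1 - e) = 0
  cases hb : b i <;> cases hb' : b' i <;> simp_all

/-- The expansion of the identity obtained by writing `1 = e + (1 - e)` in each of the `n` factors.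
-/
lemma sum_word : ∀ n : ℕ,
    ∑ c : Fin n → Bool, word e (fun i => if h : i < n then c ⟨i, h⟩ else false) n = 1
  | 0 => by
    rw [Fintype.sum_unique]
    rfl
  | n + 1 => by
    have ih := sum_word n
    rw [← (Fin.consEquiv fun _ => Bool).sum_comp, Fintype.sum_prod_type]
    have h1 : ∀ (a : Bool) (c : Fin n → Bool),
        word e (fun i => if h : i < n + 1 then Fin.consEquiv (fun _ => Bool) (a, c) ⟨i, h⟩ else false)
          (n + 1) =
        TensorProduct.mapBilinear (RingHom.id Q) P.carrier (P.tpow n).carrier P.carrier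
          (P.tpow n).carrier (if a then e else 1 - e)
          (word e (fun i => if h : i < n then c ⟨i, h⟩ else false) n) := by
      intro a c
      have h2 : word e (fun i => if h : i < n then c ⟨i, h⟩ else false) n =
          word e (fun i => if h : i + 1 < n + 1 then
            Fin.consEquiv (fun _ => Bool) (a, c) ⟨i + 1, h⟩ else false) n :=
        word_congr fun i hi => by
          rw [dif_pos hi, dif_pos (Nat.succ_lt_succ hi)]
          rfl
      rw [h2]
      rfl
    have h3 : ∀ a : Bool, ∑ c : Fin n → Bool,
        word e (fun i => if h : i < n + 1 then Fin.consEquiv (fun _ => Bool) (a, c) ⟨i, h⟩ else false)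
          (n + 1) =
        TensorProduct.mapBilinear (RingHom.id Q) P.carrier (P.tpow n).carrier P.carrier
          (P.tpow n).carrier (if a then e else 1 - e) 1 := by
      intro a
      refine (Finset.sum_congr rfl fun c _ => h1 a c).trans ?_
      rw [← ih]
      exact (map_sum (TensorProduct.mapBilinear (RingHom.id Q) P.carrier (P.tpow n).carrier P.carrier
          (P.tpow n).carrier (if a then e else 1 - e)) _ _).symm
    refine (Finset.sum_congr rfl fun a _ => h3 a).trans ?_
    have h4 : (TensorProduct.map e 1 + TensorProduct.map (1 - e) 1 :
        Module.End Q (P.carrier ⊗[Q] (P.tpow n).carrier)) = 1 := by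
      rw [← TensorProduct.map_add_left, add_sub_cancel]
      exact TensorProduct.map_id
    exact (Fintype.sum_bool _).trans h4

lemma isHom_word (he : IsHom (P := P) (P' := P) e) (b : ℕ → Bool) (n : ℕ) :
    IsHom (P := P.tpow n) (P' := P.tpow n) (word e b n) :=
  IsHom.tmap (fun i => by
    split_ifs
    exacts [he, (isHom_one P).sub he]) n

lemma isCyclicSystem_word {p : ℕ} [Fact p.Prime] (hee : e * e = e)
    (he : IsHom (P := P) (P' := P) e) :
    IsCyclicSystem (P.rot p) (fun c : ZMod p → Bool => word e (fun i : ℕ => c i) p) := by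
  obtain ⟨n, rfl⟩ : ∃ n, p = n + 1 :=
    ⟨p - 1, (Nat.sub_add_cancel (Fact.out : p.Prime).one_le).symm⟩
  refine ⟨?_, fun c c' hc => ?_, fun c => ?_⟩
  · rw [← sum_word (e := e) (n + 1)]
    -- For `p = n + 1` the type `ZMod p` unfolds to `Fin (n + 1)`, so words over either index set
    -- are the same functions.
    refine Fintype.sum_equiv (Equiv.refl _) _ _ fun c => word_congr fun i hi => ?_
    rw [dif_pos hi]
    exact congrArg c (Fin.ext (Nat.mod_eq_of_lt hi))
  · obtain ⟨i, hi⟩ := Function.ne_iff.1 hc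
    refine word_mul_word hee (ZMod.val_lt i) ?_
    rwa [ZMod.natCast_zmod_val]
  · refine rot_tmap (fun i x => ?_) n ?_ fun i _ => ?_
    · dsimp only
      split_ifs
      exacts [he.apply_even x, ((isHom_one P).sub he).apply_even x]
    · have : ((0 : ℕ) : ZMod (n + 1)) - 1 = (n : ZMod (n + 1)) := by
        rw [sub_eq_iff_eq_add, ← Nat.cast_succ, ZMod.natCast_self, Nat.cast_zero]
      exact congrArg (fun t => if c t then e else 1 - e) this
    · have : ((i + 1 : ℕ) : ZMod (n + 1)) - 1 = (i : ZMod (n + 1)) := by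
        push_cast
        ring
      exact congrArg (fun t => if c t then e else 1 - e) this

/-- The tensor product of the word `b` in the factorizations `A` and `B`. -/
def wordObj (A B : MF Q f) : (ℕ → Bool) → (n : ℕ) → MF Q ((n : Q) * f)
  | _, 0 => (unit Q).ofEq (by simp)
  | b, n + 1 => ((if b 0 then A else B).tensor (wordObj A B (fun i => b (i + 1)) n)).ofEq
      (by push_cast; ring)

lemma isRetract_wordObj {A B : MF Q f} (hA : IsRetract A P e)
    (hB : IsRetract B P (1 - e : Module.End Q P.carrier)) :
    ∀ (b : ℕ → Bool) (n : ℕ), IsRetract (A.wordObj B b n) (P.tpow n) (word e b n)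
  | _, 0 => isRetract_one _
  | b, n + 1 => by
    have h0 : IsRetract (if b 0 then A else B) P (if b 0 then e else 1 - e : Module.End Q P.carrier) := by
      split_ifs
      exacts [hA, hB]
    exact (h0.tensor (isRetract_wordObj hA hB (fun i => b (i + 1)) n)).ofEq _

end Word

end MF

/-! ### The classes of words -/

section K0

variable {Q : Type u} [CommRing Q] {Z : Set (PrimeSpectrum Q)} {f : Q}

/-- The class of a word, without support condition. -/
def K0.wordUniv (x y : K0 Z f) : (ℕ → Bool) → (n : ℕ) → K0 (Set.univ : Set (PrimeSpectrum Q)) (n * f)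
  | _, 0 => K0.mk ⟨(MF.unit Q).ofEq (by simp), Set.subset_univ _⟩
  | b, n + 1 => K0.cup (Set.subset_univ _) (by push_cast; ring) (if b 0 then x else y)
      (wordUniv x y (fun i => b (i + 1)) n)

/-- The class of a word of positive length. -/
def K0.word (x y : K0 Z f) (b : ℕ → Bool) : (n : ℕ) → K0 Z (n * f)
  | 0 => 0
  | n + 1 => K0.cup Set.inter_subset_left (by push_cast; ring) (if b 0 then x else y)
      (K0.wordUniv x y (fun i => b (i + 1)) n)

lemma K0.wordUniv_mk (A B : MFZ Z f) : ∀ (b : ℕ → Bool) (n : ℕ),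
    K0.wordUniv (K0.mk A) (K0.mk B) b n = K0.mk ⟨A.1.wordObj B.1 b n, Set.subset_univ _⟩
  | _, 0 => rfl
  | b, n + 1 => by
    have hf : f + n * f = ((n + 1 : ℕ) : Q) * f := by push_cast; ring
    refine (congrArg₂ (fun x y => K0.cup (Set.subset_univ _) hf x y)
      (apply_ite K0.mk (b 0 = true) A B).symm (K0.wordUniv_mk A B _ n)).trans
        ((K0.cup_mk _ _ _ _).trans (congrArg K0.mk (Subtype.ext ?_)))
    change (MF.tensor (if b 0 then A else B).1 _).ofEq hf =
      (MF.tensor (if b 0 then A.1 else B.1) _).ofEq hf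
    cases b 0 <;> rfl

/-- The support in `Z` comes from the first factor alone. The remaining product ends in the unit
object, whose support need not lie in `Z`, so it is formed in the group with full support. -/
lemma K0.word_mk (A B : MFZ Z f) (b : ℕ → Bool) {n : ℕ} (hn : 0 < n)
    (hZ : (A.1.wordObj B.1 b n).support ⊆ Z) :
    K0.word (K0.mk A) (K0.mk B) b n = K0.mk ⟨A.1.wordObj B.1 b n, hZ⟩ := by
  obtain ⟨n, rfl⟩ : ∃ m, n = m + 1 := ⟨n - 1, by omega⟩
  have hf : f + n * f = ((n + 1 : ℕ) : Q) * f := by push_cast; ring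
  refine (congrArg₂ (fun x y => K0.cup Set.inter_subset_left hf x y)
    (apply_ite K0.mk (b 0 = true) A B).symm (K0.wordUniv_mk A B _ n)).trans
      ((K0.cup_mk _ _ _ _).trans (congrArg K0.mk (Subtype.ext ?_)))
  change (MF.tensor (if b 0 then A else B).1 _).ofEq hf =
    (MF.tensor (if b 0 then A.1 else B.1) _).ofEq hf
  cases b 0 <;> rfl

variable {p : ℕ} [Fact p.Prime]

/-- The class of the mixed part of an eigenspace of the `p`-th tensor power of a direct sum. -/
def K0.cross (p : ℕ) [Fact p.Prime] (x y : K0 Z f) : K0 Z (p * f) :=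
  ∑ c ∈ sectorSet (p := p) 0, K0.word x y (fun i : ℕ => c i) p

/-- The contribution of a constant word. The inclusion and the retraction of `A`, applied in every
factor, commute with the cycles, hence with the projections onto their eigenspaces. -/
lemma K0.mk_eigen_pure {u ζ : Q} (hu : u * p = 1) (hζ : ζ ^ p = 1) {P A : MF Q f}
    {e : Module.End Q P.carrier} (hA : MF.IsRetract A P e) {R S : MF Q (p * f)}
    (hR : MF.IsRetract R (P.tpow p) (eigProj p u ζ (P.rot p) *
      MF.tmap (P := P) (P' := P) (fun _ => e) p))
    (hS : MF.IsRetract S (A.tpow p) (eigProj p u ζ (A.rot p)))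
    (hZ : R.support ⊆ Z) (hZ' : S.support ⊆ Z) :
    (K0.mk ⟨R, hZ⟩ : K0 Z (p * f)) = K0.mk ⟨S, hZ'⟩ := by
  have hp : 0 < p := (Fact.out : p.Prime).pos
  obtain ⟨i, r, hi, hr, hri, hir⟩ := hA
  have h1 : ∀ x, MF.tmap (fun _ => r) p (eigProj p u ζ (P.rot p) x) =
      eigProj p u ζ (A.rot p) (MF.tmap (fun _ => r) p x) :=
    eigProj_intertwine fun x => (MF.rot_tmap_const hr.isGraded p x).symm
  have h2 : ∀ x, MF.tmap (fun _ => i) p (eigProj p u ζ (A.rot p) x) =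
      eigProj p u ζ (P.rot p) (MF.tmap (fun _ => i) p x) :=
    eigProj_intertwine fun x => (MF.rot_tmap_const hi.isGraded p x).symm
  have h3 : ∀ x, MF.tmap (fun _ => i) p (MF.tmap (fun _ => r) p x) =
      MF.tmap (P := P) (P' := P) (fun _ => e) p x := fun x => by
    refine (LinearMap.congr_fun (MF.tmap_comp (fun _ => r) (fun _ => i) p) x).trans ?_
    rw [show i ∘ₗ r = e from LinearMap.ext hir]
  have h4 : ∀ x, MF.tmap (fun _ => r) p (MF.tmap (fun _ => i) p x) = x := fun x => by
    refine (LinearMap.congr_fun (MF.tmap_comp (fun _ => i) (fun _ => r) p) x).trans ?_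
    rw [show r ∘ₗ i = LinearMap.id from LinearMap.ext hri, MF.tmap_id]
    rfl
  have h5 : ∀ x, eigProj p u ζ (P.rot p) (eigProj p u ζ (P.rot p) x) =
      eigProj p u ζ (P.rot p) x :=
    LinearMap.congr_fun (eigProj_idem hp hu (P.rot_pow p) hζ)
  have h6 : ∀ x, eigProj p u ζ (A.rot p) (eigProj p u ζ (A.rot p) x) =
      eigProj p u ζ (A.rot p) x :=
    LinearMap.congr_fun (eigProj_idem hp hu (A.rot_pow p) hζ)
  refine K0.mk_eq_of_isRetract hR hS (a := MF.tmap (fun _ => r) p) (b := MF.tmap (fun _ => i) p)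
    (MF.IsHom.tmap (fun _ => hr) p) (MF.IsHom.tmap (fun _ => hi) p) (fun x => ?_) fun x => ?_
  · rw [Module.End.mul_apply, Module.End.mul_apply, ← h3, ← h3, h1, h4, h6, h4, h2, h5]
  · rw [Module.End.mul_apply, h1, ← h3, h4, h4, h6, h6]

/-- The eigenspaces of the tensor power of a direct sum. -/
lemma K0.mk_eigen_add {u ζ : Q} (hu : u * p = 1) (hζ : ζ ^ p = 1) {A B : MFZ Z f} {P : MF Q f}
    {e : Module.End Q P.carrier} (hA : MF.IsRetract A.1 P e)
    (hB : MF.IsRetract B.1 P (1 - e : Module.End Q P.carrier)) {R RA RB : MF Q (p * f)}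
    (hR : MF.IsRetract R (P.tpow p) (eigProj p u ζ (P.rot p)))
    (hRA : MF.IsRetract RA (A.1.tpow p) (eigProj p u ζ (A.1.rot p)))
    (hRB : MF.IsRetract RB (B.1.tpow p) (eigProj p u ζ (B.1.rot p)))
    (hP : P.support ⊆ Z) (hZ : R.support ⊆ Z) (hZA : RA.support ⊆ Z) (hZB : RB.support ⊆ Z) :
    (K0.mk ⟨R, hZ⟩ : K0 Z (p * f)) =
      K0.mk ⟨RA, hZA⟩ + K0.mk ⟨RB, hZB⟩ + K0.cross p (K0.mk A) (K0.mk B) := by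
  have hp : 0 < p := (Fact.out : p.Prime).pos
  have hT : (P.tpow p).support ⊆ Z := by
    obtain ⟨n, rfl⟩ : ∃ n, p = n + 1 := ⟨p - 1, by omega⟩
    exact (P.support_tpow_succ n).trans hP
  have hee : e * e = e := LinearMap.ext hA.idem
  have he := hA.isHom
  have H := MF.isCyclicSystem_word (p := p) hee he
  set E : (ZMod p → Bool) → Module.End Q (P.tpow p).carrier :=
    fun c => MF.word e (fun i : ℕ => c i) p with hE
  set π := eigProj p u ζ (P.rot p) with hπ
  have hππ : π * π = π := eigProj_idem hp hu (P.rot_pow p) hζ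
  have hπhom : MF.IsHom (P := P.tpow p) (P' := P.tpow p) π := isHom_eigProj (P.rot_isHom p)
  have hEhom : ∀ c, MF.IsHom (P := P.tpow p) (P' := P.tpow p) (E c) := fun c =>
    MF.isHom_word he _ p
  have hconst : ∀ b, (E fun _ => b) * P.rot p = P.rot p * E fun _ => b := fun b =>
    (H.shift fun _ => b).symm
  have cmixed := eigProj_comm (p := p) (u := u) (ζ := ζ) H.mixed_comm
  have cconst := fun b => eigProj_comm (p := p) (u := u) (ζ := ζ) (hconst b)
  -- The mixed part and the two constant words are orthogonal idempotents that commute with the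
  -- cycle. By `key`, their products with `π` multiply in the same way, so they cut the eigenspace
  -- into three summands: `R1`, `R2` and `R3` below, with `R4` the sum of the first two.
  have key : ∀ a b : Module.End Q (P.tpow p).carrier, a * π = π * a → π * a * (π * b) = π * (a * b) :=
    fun a b h => by rw [mul_assoc, ← mul_assoc a, h, mul_assoc, ← mul_assoc, hππ]
  have h0 : (fun _ : ZMod p => true) ≠ fun _ => false := fun h => by simpa using congrFun h 0
  have hmE : ∀ b, mixed E * (E fun _ => b) = 0 := fun b => by
    have := H.sum_mul_sum (Finset.univ.filter fun c => wordWt c ≠ 0) {fun _ => b}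
    rw [Finset.sum_singleton] at this
    refine this.trans (Finset.sum_eq_zero fun c hc => ?_)
    simp only [Finset.mem_inter, Finset.mem_filter, Finset.mem_univ, true_and,
      Finset.mem_singleton] at hc
    cases b
    exacts [absurd wordWt_false (hc.2 ▸ hc.1), absurd wordWt_true (hc.2 ▸ hc.1)]
  have hEm : ∀ b, (E fun _ => b) * mixed E = 0 := fun b => by
    have := H.sum_mul_sum {fun _ => b} (Finset.univ.filter fun c => wordWt c ≠ 0)
    rw [Finset.sum_singleton] at this
    refine this.trans (Finset.sum_eq_zero fun c hc => ?_)
    simp only [Finset.mem_inter, Finset.mem_filter, Finset.mem_univ, true_and,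
      Finset.mem_singleton] at hc
    cases b
    exacts [absurd wordWt_false (hc.1 ▸ hc.2), absurd wordWt_true (hc.1 ▸ hc.2)]
  have hmixhom : MF.IsHom (P := P.tpow p) (P' := P.tpow p) (mixed E) :=
    MF.IsHom.sum fun c _ => hEhom c
  obtain ⟨R1, hR1⟩ := MF.exists_isRetract (P := P.tpow p) (hπhom.mul hmixhom)
    ((key _ _ cmixed).trans (congrArg (π * ·) H.mixed_idem))
  have hRE : ∀ b, ∃ R2 : MF Q (p * f), MF.IsRetract R2 (P.tpow p) (π * E fun _ => b) := fun b =>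
    MF.exists_isRetract (P := P.tpow p) (hπhom.mul (hEhom fun _ => b))
    ((key _ _ (cconst b)).trans (congrArg (π * ·) (H.idem fun _ => b)))
  obtain ⟨R2, hR2⟩ := hRE true
  obtain ⟨R3, hR3⟩ := hRE false
  obtain ⟨R4, hR4⟩ := MF.exists_isRetract (P := P.tpow p)
    ((hπhom.mul hmixhom).add (hπhom.mul (hEhom fun _ => true))) (by
      rw [add_mul, mul_add, mul_add, key _ _ cmixed, key _ _ cmixed, key _ _ (cconst true),
        key _ _ (cconst true), hmE, hEm, H.mixed_idem, H.idem fun _ => true, mul_zero, add_zero, zero_add])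
  obtain ⟨S, hS⟩ := MF.exists_isRetract (P := P.tpow p) (ε := sector E 0)
    (MF.IsHom.sum fun c _ => hEhom c) (H.sector_idem 0)
  have e1 : (K0.mk ⟨R, hZ⟩ : K0 Z (p * f)) =
      K0.mk ⟨R4, hR4.support_subset.trans hT⟩ + K0.mk ⟨R3, hR3.support_subset.trans hT⟩ := by
    refine K0.mk_isRetract_add (hR.congr ?_) hR4 hR3 ?_ ?_
    · rw [← mul_add, ← mul_add, H.add_mixed, mul_one]
    · rw [add_mul, key _ _ cmixed, key _ _ (cconst true), hmE, H.orth _ _ h0, mul_zero, add_zero]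
    · rw [mul_add, key _ _ (cconst false), key _ _ (cconst false), hEm, H.orth _ _ h0.symm, mul_zero,
        add_zero]
  have e2 : (K0.mk ⟨R4, hR4.support_subset.trans hT⟩ : K0 Z (p * f)) =
      K0.mk ⟨R1, hR1.support_subset.trans hT⟩ + K0.mk ⟨R2, hR2.support_subset.trans hT⟩ := by
    refine K0.mk_isRetract_add hR4 hR1 hR2 ?_ ?_
    · rw [key _ _ cmixed, hmE, mul_zero]
    · rw [key _ _ (cconst true), hEm, mul_zero]
  -- Here the eigenvalue disappears: the sector of orbit representatives does not depend on `ζ`.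
  have e3 : (K0.mk ⟨R1, hR1.support_subset.trans hT⟩ : K0 Z (p * f)) =
      K0.mk ⟨S, hS.support_subset.trans hT⟩ :=
    K0.mk_eigProj_mixed H (P.rot_pow p) hu hζ hR1 hS _ _
  have hW : ∀ b : ℕ → Bool, MF.IsRetract (A.1.wordObj B.1 b p) (P.tpow p) (MF.word e b p) :=
    fun b => MF.isRetract_wordObj hA hB b p
  have e4 : (K0.mk ⟨S, hS.support_subset.trans hT⟩ : K0 Z (p * f)) =
      K0.cross p (K0.mk A) (K0.mk B) := by
    refine (K0.mk_isRetract_sum (sectorSet (p := p) 0)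
      (fun c => ⟨_, (hW fun i : ℕ => c i).support_subset.trans hT⟩) (fun c _ => hW fun i : ℕ => c i)
      (fun c _ c' _ hc => H.orth c c' hc) hS).trans ?_
    exact Finset.sum_congr rfl fun c _ => (K0.word_mk A B _ hp _).symm
  have e5 : (K0.mk ⟨R2, hR2.support_subset.trans hT⟩ : K0 Z (p * f)) = K0.mk ⟨RA, hZA⟩ :=
    K0.mk_eigen_pure hu hζ hA hR2 hRA _ _
  have e6 : (K0.mk ⟨R3, hR3.support_subset.trans hT⟩ : K0 Z (p * f)) = K0.mk ⟨RB, hZB⟩ :=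
    K0.mk_eigen_pure hu hζ hB hR3 hRB _ _
  rw [e1, e2, e3, e4, e5, e6]
  abel

end K0

end

end AdamsMF

namespace AdamsMF

noncomputable section

/-! ### Functions that are additive up to a cocycle -/

section Twisted

variable {K H : Type*} [AddCommGroup K] [AddCommGroup H]

/-- The set underlying the extension of `K` by `H` with cocycle `c`. -/
def Twisted (_ : K → K → H) : Type _ := K × H

/-- The extension of `K` by `H` with the symmetric cocycle `c`. -/
abbrev Twisted.addCommGroup {c : K → K → H} (h0 : ∀ x, c 0 x = 0) (hsymm : ∀ x y, c x y = c y x)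
    (hassoc : ∀ x y z, c x y + c (x + y) z = c y z + c x (y + z)) : AddCommGroup (Twisted c) :=
  letI : Add (Twisted c) := ⟨fun x y => (x.1 + y.1, x.2 + y.2 + c x.1 y.1)⟩
  letI : Zero (Twisted c) := ⟨(0, 0)⟩
  letI : Neg (Twisted c) := ⟨fun x => (-x.1, -x.2 - c (-x.1) x.1)⟩
  { AddGroup.ofLeftAxioms (G := Twisted c)
      (fun x y z => Prod.ext (add_assoc x.1 y.1 z.1) (by
        change x.2 + y.2 + c x.1 y.1 + z.2 + c (x.1 + y.1) z.1 =
          x.2 + (y.2 + z.2 + c y.1 z.1) + c x.1 (y.1 + z.1)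
        have := hassoc x.1 y.1 z.1
        have e : x.2 + y.2 + c x.1 y.1 + z.2 + c (x.1 + y.1) z.1 =
          x.2 + y.2 + z.2 + (c x.1 y.1 + c (x.1 + y.1) z.1) := by abel
        rw [e, this]
        abel))
      (fun x => Prod.ext (zero_add x.1) (by
        change 0 + x.2 + c 0 x.1 = x.2
        rw [h0, zero_add, add_zero]))
      (fun x => Prod.ext (neg_add_cancel x.1) (by
        change -x.2 - c (-x.1) x.1 + x.2 + c (-x.1) x.1 = 0
        abel)) with
    add_comm := fun x y => Prod.ext (add_comm x.1 y.1) (by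
      change x.2 + y.2 + c x.1 y.1 = y.2 + x.2 + c y.1 x.1
      rw [hsymm, add_comm x.2]) }

end Twisted

section K0

variable {Q : Type u} [CommRing Q] {Z : Set (PrimeSpectrum Q)} {f : Q}

/-- A function on matrix factorizations that is additive on short exact sequences up to a function
of the classes of the outer terms, and vanishes on contractible objects, is a function of the
class. -/
lemma K0.eq_of_mk_eq {H : Type*} [AddCommGroup H] {F : MFZ Z f → H} {c : K0 Z f → K0 Z f → H}
    (hs : ∀ (P' P P'' : MFZ Z f) (i : P'.1.carrier →ₗ[Q] P.1.carrier)
      (q : P.1.carrier →ₗ[Q] P''.1.carrier), MF.IsShortExact i q →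
        F P = F P' + F P'' + c (K0.mk P') (K0.mk P''))
    (hc : ∀ (P : MFZ Z f) (h : Module.End Q P.1.carrier), MF.IsContr P.1.even P.1.d 1 h → F P = 0)
    {P P' : MFZ Z f} (h : K0.mk P = K0.mk P') : F P = F P' := by
  have hF0 : F (MFZ.zero Z f) = 0 := hc _ 0 ⟨(zero_mul _).trans (mul_zero _).symm,
    LinearMap.ext fun x => Subsingleton.elim (α := PUnit) _ _⟩
  -- The hypothesis forces `c` to be a normalized symmetric cocycle. This follows by comparing
  -- extensions with the same middle term: `A ⊕ B` read in both directions, `A` as an extension of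
  -- `0` by `A`, and `(A ⊕ B) ⊕ C` bracketed in two ways.
  have hprod : ∀ A B : MFZ Z f, F (A.prod B) = F A + F B + c (K0.mk A) (K0.mk B) := fun A B =>
    hs A (A.prod B) B _ _ (MF.isShortExact_prod A.1 B.1)
  have hsymm : ∀ x y, c x y = c y x := fun x y => by
    obtain ⟨A, rfl⟩ := K0.mk_surjective x
    obtain ⟨B, rfl⟩ := K0.mk_surjective y
    have h1 := hs B (A.prod B) A _ _ (MF.isShortExact_prod' A.1 B.1)
    rw [hprod, add_comm (F B)] at h1
    exact add_left_cancel h1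
  have h0' : ∀ x, c x 0 = 0 := fun x => by
    obtain ⟨A, rfl⟩ := K0.mk_surjective x
    have h1 : F A = F A + F (MFZ.zero Z f) + c (K0.mk A) (K0.mk (MFZ.zero Z f)) := by
      refine hs A A (MFZ.zero Z f) LinearMap.id 0 ⟨MF.IsHom.id A.1, MF.IsHom.zero _ _,
        fun _ _ h => h, fun x => ⟨fun _ => ⟨x, rfl⟩, fun _ => rfl⟩, fun y =>
          ⟨0, Subsingleton.elim (α := PUnit) _ _⟩⟩
    rw [hF0, K0.mk_zero, add_zero] at h1
    exact (left_eq_add.1 h1)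
  have hassoc : ∀ x y z, c x y + c (x + y) z = c y z + c x (y + z) := fun x y z => by
    obtain ⟨A, rfl⟩ := K0.mk_surjective x
    obtain ⟨B, rfl⟩ := K0.mk_surjective y
    obtain ⟨C, rfl⟩ := K0.mk_surjective z
    have h1 := hprod (A.prod B) C
    have h2 := hs A ((A.prod B).prod C) (B.prod C)
      (LinearMap.inl Q (A.1.carrier × B.1.carrier) C.1.carrier ∘ₗ
        LinearMap.inl Q A.1.carrier B.1.carrier)
      (LinearMap.prodMap (LinearMap.snd Q A.1.carrier B.1.carrier) LinearMap.id)
      (MF.IsGradedSplitting.isShortExact (P' := A.1) (P := (A.1.prod B.1).prod C.1)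
        (P'' := B.1.prod C.1)
        (r := LinearMap.fst Q A.1.carrier B.1.carrier ∘ₗ
          LinearMap.fst Q (A.1.carrier × B.1.carrier) C.1.carrier)
        (s := LinearMap.prodMap (LinearMap.inr Q A.1.carrier B.1.carrier) LinearMap.id)
        ⟨fun _ => rfl, fun _ => rfl, fun _ => rfl, fun _ =>
          Prod.ext (Prod.ext (add_zero _) (zero_add _)) (zero_add _), fun _ => rfl,
          fun _ => Prod.ext (Prod.ext (map_zero A.1.even).symm rfl) rfl⟩
        (MF.IsHom.of_apply (fun _ => Prod.ext (Prod.ext rfl (map_zero B.1.even).symm)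
          (map_zero C.1.even).symm)
          fun _ => Prod.ext (Prod.ext rfl (map_zero B.1.d).symm) (map_zero C.1.d).symm)
        (MF.IsHom.of_apply (fun _ => rfl) fun _ => rfl))
    replace h2 := h1.symm.trans h2
    rw [hprod, hprod, K0.mk_prod, K0.mk_prod] at h2
    have h3 : F A + F B + F C + (c (K0.mk A) (K0.mk B) + c (K0.mk A + K0.mk B) (K0.mk C)) =
        F A + F B + F C + (c (K0.mk B) (K0.mk C) + c (K0.mk A) (K0.mk B + K0.mk C)) := by
      refine Eq.trans ?_ (h2.trans ?_) <;> abel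
    exact add_left_cancel h3
  -- With values in the extension of `K0 Z f` by `H` defined by `c`, the pair `([P], F P)` is
  -- additive on exact sequences and vanishes on contractible objects. So the pair, and with it its
  -- second component, is a function of the class.
  let _ : AddCommGroup (Twisted c) :=
    Twisted.addCommGroup (fun x => (hsymm _ _).trans (h0' x)) hsymm hassoc
  let G : MFZ Z f → Twisted c := fun P => (K0.mk P, F P)
  have hGs : ∀ (P' P P'' : MFZ Z f) (i : P'.1.carrier →ₗ[Q] P.1.carrier)
      (q : P.1.carrier →ₗ[Q] P''.1.carrier), MF.IsShortExact i q → G P = G P' + G P'' :=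
    fun P' P P'' i q h => Prod.ext (K0.mk_shortExact h) (hs P' P P'' i q h)
  have hGc : ∀ (P : MFZ Z f) (h : Module.End Q P.1.carrier),
      MF.IsContr P.1.even P.1.d 1 h → G P = 0 :=
    fun P h H => Prod.ext (K0.mk_eq_zero_of_contr H) (hc P h H)
  exact congrArg Prod.snd ((K0.lift_mk hGs hGc P).symm.trans
    ((congrArg (K0.lift hGs hGc) h).trans (K0.lift_mk hGs hGc P')))

lemma MF.isRetract_prod_left (A B : MF Q f) : MF.IsRetract A (A.prod B)
    (LinearMap.inl Q A.carrier B.carrier ∘ₗ LinearMap.fst Q A.carrier B.carrier) :=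
  ⟨LinearMap.inl Q A.carrier B.carrier, LinearMap.fst Q A.carrier B.carrier,
    (MF.isShortExact_prod A B).isHom_left, (MF.isShortExact_prod' A B).isHom_right, fun _ => rfl,
    fun _ => rfl⟩

lemma MF.isRetract_prod_right (A B : MF Q f) : MF.IsRetract B (A.prod B)
    (1 - LinearMap.inl Q A.carrier B.carrier ∘ₗ LinearMap.fst Q A.carrier B.carrier :
      Module.End Q (A.carrier × B.carrier)) :=
  ⟨LinearMap.inr Q A.carrier B.carrier, LinearMap.snd Q A.carrier B.carrier,
    (MF.isShortExact_prod' A B).isHom_left, (MF.isShortExact_prod A B).isHom_right, fun _ => rfl,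
    fun _ => Prod.ext (sub_self _).symm (sub_zero _).symm⟩

lemma MF.IsGradedSplitting.d_s {P' P P'' : MF Q f} {i : P'.carrier →ₗ[Q] P.carrier}
    {q : P.carrier →ₗ[Q] P''.carrier} {r : P.carrier →ₗ[Q] P'.carrier}
    {s : P''.carrier →ₗ[Q] P.carrier} (S : IsGradedSplitting i q r s) (hq : MF.IsHom q)
    (x : P''.carrier) : P.d (s x) = i (r (P.d (s x))) + s (P''.d x) := by
  conv_lhs => rw [← S.add_eq (P.d (s x)), hq.apply_d, S.q_s]

/-! ### The operations `t` on exact sequences and on classes. -/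

variable {p : ℕ} [Algebra (Ap p) Q]

/-- The eigenspaces of the tensor power of an extension. -/
lemma K0.mk_eig_shortExact [Fact p.Prime] (hp : p.Prime) (k : ℕ) {A P B : MFZ Z f}
    {i : A.1.carrier →ₗ[Q] P.1.carrier} {q : P.1.carrier →ₗ[Q] B.1.carrier}
    (h : MF.IsShortExact i q) : K0.mk (P.eig hp k) =
      K0.mk (A.eig hp k) + K0.mk (B.eig hp k) + K0.cross p (K0.mk A) (K0.mk B) := by
  obtain ⟨r, s, S⟩ := h.exists_splitting
  have hi := h.isHom_left
  have hq := h.isHom_right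
  have ds := S.d_s hq
  refine Eq.trans ?_ (K0.mk_eigen_add (invQ_mul Q hp) (zetaQ_pow Q hp k)
    (MF.isRetract_prod_left A.1 B.1) (MF.isRetract_prod_right A.1 B.1)
    ((A.prod B).isRetract_eig hp k) (A.isRetract_eig hp k) (B.isRetract_eig hp k) (A.prod B).2
    ((A.prod B).eig hp k).2 (A.eig hp k).2 (B.eig hp k).2)
  -- The map `(r, q)` identifies `P` with `A ⊕ B` as a graded module. It carries the differential of
  -- `P` to the diagonal one plus `δ = r d s`, which maps `B` to `A`.
  refine K0.mk_eigen_diag (P₀ := A.1.prod B.1)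
    (e := LinearMap.inl Q A.1.carrier B.1.carrier ∘ₗ LinearMap.fst Q A.1.carrier B.1.carrier)
    (δ := LinearMap.inl Q A.1.carrier B.1.carrier ∘ₗ (r ∘ₗ P.1.d ∘ₗ s) ∘ₗ
      LinearMap.snd Q A.1.carrier B.1.carrier) (fun _ => rfl)
    (MF.isRetract_prod_left A.1 B.1).isHom (fun _ => rfl) (fun _ => ?_)
    (MF.IsContr.of_apply (fun x => ?_) fun x => ?_) (a := LinearMap.prod r q)
    (b := LinearMap.coprod i s) (fun x => S.add_eq x) (fun x => ?_) (fun x => ?_) (fun x => ?_)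
    (P.isRetract_eig hp k) ((A.prod B).isRetract_eig hp k) _ _
  · refine Prod.ext ?_ rfl
    change r (P.1.d (s 0)) = 0
    simp
  · refine Prod.ext ?_ ?_
    · change r (P.1.d (s (B.1.even x.2))) = r (P.1.d (s x.2)) - A.1.even (r (P.1.d (s x.2)))
      rw [S.s_even, MF.d_apply_even, map_sub, S.r_even]
    · exact (sub_eq_zero.2 (map_zero B.1.even).symm).symm
  · refine Prod.ext ?_ ?_
    · change A.1.d (r (P.1.d (s x.2))) + r (P.1.d (s (B.1.d x.2))) = (0 : Q) • x.1
      -- `δ` anticommutes with the diagonal differential because `r d² s = f r s = 0`, where `d s`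
      -- is expanded into its components in `A` and `B`.
      have h1 := congrArg r (congrArg P.1.d (ds x.2))
      rw [MF.d_apply_d, map_smul, S.r_s, smul_zero, map_add, ← hi.apply_d, map_add, S.r_i] at h1
      rw [zero_smul, ← h1]
    · change B.1.d 0 + 0 = (0 : Q) • x.2
      simp
  · refine Prod.ext ?_ ?_
    · change r (i x.1 + s x.2) = x.1
      rw [map_add, S.r_i, S.r_s, add_zero]
    · change q (i x.1 + s x.2) = x.2
      rw [map_add, S.q_i, S.q_s, zero_add]
  · exact Prod.ext (S.r_even x) (hq.apply_even x)
  · refine Prod.ext ?_ ?_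
    · change r (P.1.d x) = A.1.d (r x) + r (P.1.d (s (q x)))
      conv_lhs => rw [← S.add_eq x, map_add, ← hi.apply_d, map_add, S.r_i]
    · change q (P.1.d x) = B.1.d (q x) + 0
      rw [hq.apply_d, add_zero]

/-- `mult_{1/p}` on Grothendieck groups. -/
def K0.multInv (hp : p.Prime) : K0 Z ((p : Q) * f) →+ K0 Z f :=
  K0.mult (isUnit_invQ Q hp) (invQ_mul_mul hp f)

lemma K0.mk_t_shortExact [Fact p.Prime] (hp : p.Prime) (k : ℕ) {A P B : MFZ Z f}
    {i : A.1.carrier →ₗ[Q] P.1.carrier} {q : P.1.carrier →ₗ[Q] B.1.carrier}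
    (h : MF.IsShortExact i q) : K0.mk (P.t hp k) = K0.mk (A.t hp k) + K0.mk (B.t hp k) +
      K0.multInv hp (K0.cross p (K0.mk A) (K0.mk B)) := by
  rw [K0.mk_t, K0.mk_t, K0.mk_t, K0.mk_eig_shortExact hp k h, map_add, map_add]
  rfl

/-- The derivation that extends a contraction of `P` commutes with the cycle and contracts the
tensor power up to the factor `p`, which is a unit. -/
lemma K0.mk_t_eq_zero (hp : p.Prime) (k : ℕ) {P : MFZ Z f} {h : Module.End Q P.1.carrier}
    (H : MF.IsContr P.1.even P.1.d 1 h) : K0.mk (P.t hp k) = 0 := by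
  have H1 := (P.1.contr_der H p (p * 1) rfl).restrict (ζ := zetaQ p Q ^ k) (P.1.rot_comm_even p)
    (P.1.rot_comm_d p) (P.1.rot_comm_der H.isOdd p)
  obtain ⟨h', H'⟩ := H1.of_isUnit (by
    rw [mul_one]
    exact IsUnit.of_mul_eq_one_right _ (invQ_mul Q hp))
  rw [K0.mk_t, K0.mk_eq_zero_of_contr (P := P.eig hp k) H', map_zero]

/-- The class of `t P` only depends on the class of `P`. -/
lemma t_mk (hp : p.Prime) (k : ℕ) (P : MFZ Z f) : t hp k (K0.mk P) = K0.mk (P.t hp k) := by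
  have : Fact p.Prime := ⟨hp⟩
  exact K0.eq_of_mk_eq (F := fun P : MFZ Z f => K0.mk (P.t hp k))
    (c := fun x y => K0.multInv hp (K0.cross p x y))
    (fun _ _ _ _ _ h => K0.mk_t_shortExact hp k h) (fun _ _ H => K0.mk_t_eq_zero hp k H)
    (Classical.epsilon_spec (p := fun P' : MFZ Z f => K0.mk P' = K0.mk P) ⟨P, rfl⟩)

/-- The defect of additivity is the same for every `k`, so differences of the operations `t` are
additive. -/
lemma t_add [Fact p.Prime] (hp : p.Prime) (k : ℕ) (x y : K0 Z f) :
    t hp k (x + y) = t hp k x + t hp k y + K0.multInv hp (K0.cross p x y) := by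
  obtain ⟨A, rfl⟩ := K0.mk_surjective x
  obtain ⟨B, rfl⟩ := K0.mk_surjective y
  rw [← K0.mk_prod, t_mk, t_mk, t_mk]
  exact K0.mk_t_shortExact hp k (MF.isShortExact_prod A.1 B.1)

end K0

end

end AdamsMF

/-! ### Conjugate powers of the cycle, and integrality of the operation. -/

namespace AdamsMF

noncomputable section

namespace MF

variable {Q : Type u} [CommRing Q] {f : Q}

/-! ### The action of the symmetric group on tensor powers -/

section Perm

/-- The Koszul sign of an inversion of the labels `a` and `c`. -/
def invSgn (Q : Type u) [CommRing Q] (b : ℕ → Bool) (a c : ℕ) : Q :=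
  if c < a then ksgn Q (b a) (b c) else 1

/-- The Koszul sign of the arrangement `w` of labels of degrees `b`. -/
def arrSgn (Q : Type u) [CommRing Q] (b : ℕ → Bool) : (ℕ → ℕ) → ℕ → Q
  | _, 0 => 1
  | w, n + 1 => (∏ i ∈ Finset.range n, invSgn Q b (w 0) (w (i + 1))) *
      arrSgn Q b (fun i => w (i + 1)) n

/-- The sign bookkeeping for one transposition: exchanging two neighbouring labels turns an
inversion into a noninversion or conversely, and so changes the sign of the arrangement by their
Koszul sign. -/
lemma invSgn_mul_ksgn (b : ℕ → Bool) {a c : ℕ} (h : a ≠ c) :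
    invSgn Q b a c * ksgn Q (b a) (b c) = invSgn Q b c a := by
  have hsq : ∀ x y : Bool, ksgn Q x y * ksgn Q x y = 1 := by
    intro x y; cases x <;> cases y <;> simp [ksgn]
  have hsymm : ∀ x y : Bool, ksgn Q x y = ksgn Q y x := fun x y => by rw [ksgn, mul_comm]; rfl
  rcases lt_or_gt_of_ne h with h1 | h1
  · rw [invSgn, invSgn, if_neg h1.not_gt, if_pos h1, one_mul, hsymm]
  · rw [invSgn, invSgn, if_pos h1, if_neg h1.not_gt, hsq]

/-- The recursion of `arrSgn` splits off the first label. This splits off the last one, which the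
cycle moves to the front. -/
lemma arrSgn_succ (b : ℕ → Bool) (w : ℕ → ℕ) (n : ℕ) :
    arrSgn Q b w (n + 1) = arrSgn Q b w n * ∏ i ∈ Finset.range n, invSgn Q b (w i) (w n) := by
  induction n generalizing w with
  | zero => simp [arrSgn]
  | succ n ih =>
    rw [arrSgn, ih, Finset.prod_range_succ' (fun i => invSgn Q b (w i) (w (n + 1))),
      Finset.prod_range_succ, arrSgn]
    ring

lemma arrSgn_congr (b : ℕ → Bool) : ∀ (n : ℕ) {w w' : ℕ → ℕ}, (∀ i < n, w i = w' i) →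
    arrSgn Q b w n = arrSgn Q b w' n
  | 0, _, _, _ => rfl
  | n + 1, w, w', h => by
    rw [arrSgn, arrSgn, arrSgn_congr b n fun i hi => h (i + 1) (by omega), h 0 n.succ_pos]
    congr 1
    exact Finset.prod_congr rfl fun i hi => by
      rw [h (i + 1) (by have := Finset.mem_range.1 hi; omega)]

lemma arrSgn_id (b : ℕ → Bool) (n k : ℕ) : arrSgn Q b (fun i => i + k) n = 1 := by
  induction n generalizing k with
  | zero => rfl
  | succ n ih =>
    have h1 := ih (k + 1)
    simp only [arrSgn, add_assoc, add_comm 1 k, h1, mul_one]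
    exact Finset.prod_eq_one fun i _ => if_neg (by omega)

variable (P : MF Q f)

/-- The arrangement `w` of the homogeneous elements `v i` of degrees `b i`, with its sign. -/
def arr (v : ℕ → P.carrier) (b : ℕ → Bool) (w : ℕ → ℕ) (n : ℕ) : (P.tpow n).carrier :=
  arrSgn Q b w n • P.tprod n (fun i => v (w i))

variable {P} {v : ℕ → P.carrier} {b : ℕ → Bool}

lemma arr_congr {n : ℕ} {w w' : ℕ → ℕ} (h : ∀ i < n, w i = w' i) : P.arr v b w n = P.arr v b w' n := by
  rw [arr, arr, arrSgn_congr b n h, P.tprod_congr n fun i hi => congrArg v (h i hi)]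

lemma arr_id (n : ℕ) : P.arr v b id n = P.tprod n v := by
  have := arrSgn_id (Q := Q) b n 0
  rw [arr, show (id : ℕ → ℕ) = fun i => i + 0 from rfl, this, one_smul]
  rfl

/-- The cycle acts on arrangements. -/
lemma rot_arr (h : P.Homog v b) {w w' : ℕ → ℕ} (hw : Function.Injective w) {n : ℕ}
    (h0 : w' 0 = w n) (hs : ∀ i < n, w' (i + 1) = w i) :
    P.rot (n + 1) (P.arr v b w (n + 1)) = P.arr v b w' (n + 1) := by
  have h1 : P.rot (n + 1) (P.tprod (n + 1) fun i => v (w i)) =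
      (∏ i ∈ Finset.range n, ksgn Q (b (w i)) (b (w n))) •
        (v (w n) ⊗ₜ[Q] P.tprod n fun i => v (w i)) :=
    P.cyc_tprod n (fun i => v (w i)) (fun i => b (w i)) fun i => h (w i)
  have h2 : P.tprod (n + 1) (fun i => v (w' i)) = v (w n) ⊗ₜ[Q] P.tprod n fun i => v (w i) := by
    change v (w' 0) ⊗ₜ[Q] P.tprod n (fun i => v (w' (i + 1))) = _
    rw [h0, P.tprod_congr n fun i hi => congrArg v (hs i hi)]
  have h3 : arrSgn Q b w (n + 1) * ∏ i ∈ Finset.range n, ksgn Q (b (w i)) (b (w n)) =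
      arrSgn Q b w' (n + 1) := by
    rw [arrSgn_succ, mul_assoc, ← Finset.prod_mul_distrib, arrSgn, h0, mul_comm,
      arrSgn_congr b n hs]
    congr 1
    refine Finset.prod_congr rfl fun i hi => ?_
    have hi' := Finset.mem_range.1 hi
    rw [hs i hi']
    exact invSgn_mul_ksgn b fun h => hi'.ne (hw h)
  refine (map_smul (P.rot (n + 1)) _ _).trans ?_
  rw [h1, arr, h2, ← h3]
  exact (mul_smul _ _ _).symm

/-- Since `arr` includes the Koszul sign of the arrangement, permutations act on arrangements
without signs. The operator is the signed transposition of the first two factors, moved to position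
`i` by tensoring with identities on the left. -/
lemma exists_adjacent (P : MF Q f) : ∀ (i n : ℕ), i + 1 < n → ∃ A : Module.End Q (P.tpow n).carrier,
    IsHom (P := P.tpow n) (P' := P.tpow n) A ∧ ∀ v b, P.Homog v b → ∀ w, Function.Injective w →
      A (P.arr v b w n) = P.arr v b (fun j => w (Equiv.swap i (i + 1) j)) n
  | 0, n + 2, _ => by
    refine ⟨P.swap (P.tpow n).carrier, ⟨swap_comm_even _, ?_⟩, fun v b h w hw => ?_⟩
    · rw [d_tpow]
      exact swap_comm_der P.d_mul_even _
    · have e0 : Equiv.swap 0 (0 + 1) 0 = 1 := Equiv.swap_apply_left 0 1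
      have e1 : Equiv.swap 0 (0 + 1) 1 = 0 := Equiv.swap_apply_right 0 1
      have e2 : ∀ i, Equiv.swap 0 (0 + 1) (i + 2) = i + 2 := fun i =>
        Equiv.swap_apply_of_ne_of_ne (by omega) (by omega)
      have e1' : Equiv.swap 0 (0 + 1) (0 + 1) = 0 := e1
      have e2' : ∀ i, Equiv.swap 0 (0 + 1) (i + 1 + 1) = i + 2 := e2
      have h1 : arrSgn Q b w (n + 2) * ksgn Q (b (w 0)) (b (w 1)) =
          arrSgn Q b (fun j => w (Equiv.swap 0 (0 + 1) j)) (n + 2) := by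
        simp only [arrSgn, Finset.prod_range_succ', e0, e1', e2']
        rw [← invSgn_mul_ksgn (a := w 0) (c := w 1) b fun h => zero_ne_one (hw h)]
        ring
      have h2 : P.swap (P.tpow n).carrier (P.tprod (n + 2) fun i => v (w i)) =
          ksgn Q (b (w 0)) (b (w 1)) •
            P.tprod (n + 2) (fun i => v (w (Equiv.swap 0 (0 + 1) i))) := by
        refine (swap_homog (h (w 0)) (h (w 1)) _).trans ?_
        refine congrArg (ksgn Q (b (w 0)) (b (w 1)) • ·) ?_
        change _ = v (w (Equiv.swap 0 (0 + 1) 0)) ⊗ₜ[Q] (v (w (Equiv.swap 0 (0 + 1) 1)) ⊗ₜ[Q]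
          P.tprod n fun i => v (w (Equiv.swap 0 (0 + 1) (i + 2))))
        simp only [e0, e1, e2]
      refine (map_smul (P.swap (P.tpow n).carrier) _ _).trans ?_
      rw [arr, ← h1, mul_smul]
      exact congrArg (arrSgn Q b w (n + 2) • ·) h2
  | i + 1, n + 1, hi => by
    obtain ⟨A, hA, hAw⟩ := exists_adjacent P i n (by omega)
    refine ⟨TensorProduct.map 1 A, ((IsHom.id P).tensor hA).ofEq _, fun v b h w hw => ?_⟩
    have hsw : ∀ j, Equiv.swap (i + 1) (i + 1 + 1) (j + 1) = Equiv.swap i (i + 1) j + 1 := fun j =>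
      (Function.Injective.map_swap (f := Nat.succ) Nat.succ_injective i (i + 1) j).symm
    have e0 : Equiv.swap (i + 1) (i + 1 + 1) 0 = 0 :=
      Equiv.swap_apply_of_ne_of_ne (by omega) (by omega)
    have h1 := hAw v b h (fun j => w (j + 1)) fun x y hxy => Nat.succ_injective (hw hxy)
    have h2 : ∏ j ∈ Finset.range n, invSgn Q b (w 0) (w (j + 1)) =
        ∏ j ∈ Finset.range n, invSgn Q b (w 0) (w (Equiv.swap i (i + 1) j + 1)) :=
      ((Equiv.swap i (i + 1)).prod_comp (Finset.range n)
        (fun j => invSgn Q b (w 0) (w (j + 1))) fun j hj => by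
        have hj' : Equiv.swap i (i + 1) j ≠ j := hj
        by_contra hn
        simp only [Finset.coe_range, Set.mem_Iio] at hn
        exact hj' (Equiv.swap_apply_of_ne_of_ne (by omega) (by omega))).symm
    have key : ∀ w : ℕ → ℕ, P.arr v b w (n + 1) =
        (∏ j ∈ Finset.range n, invSgn Q b (w 0) (w (j + 1))) •
          (v (w 0) ⊗ₜ[Q] P.arr v b (fun j => w (j + 1)) n) := fun w => by
      rw [arr, arr, arrSgn, mul_smul, TensorProduct.tmul_smul]
      rfl
    rw [key w]
    refine (map_smul (TensorProduct.map 1 A) _ _).trans ?_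
    rw [TensorProduct.map_tmul, h1, key fun j => w (Equiv.swap (i + 1) (i + 1 + 1) j), e0]
    simp only [hsw]
    rw [h2]
    rfl

/-- The extension by the identity of a permutation of `{0, …, n - 1}`. -/
def extNat {n : ℕ} (π : Equiv.Perm (Fin n)) (i : ℕ) : ℕ := if h : i < n then π ⟨i, h⟩ else i

lemma extNat_coe {n : ℕ} (π : Equiv.Perm (Fin n)) (i : Fin n) : extNat π i = π i := dif_pos i.2

lemma extNat_mul {n : ℕ} (π π' : Equiv.Perm (Fin n)) (i : ℕ) :
    extNat (π * π') i = extNat π (extNat π' i) := by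
  by_cases h : i < n
  · rw [extNat, extNat, extNat, dif_pos h, dif_pos h, dif_pos (π' ⟨i, h⟩).2]
    rfl
  · simp [extNat, h]

lemma extNat_one {n : ℕ} (i : ℕ) : extNat (1 : Equiv.Perm (Fin n)) i = i := by
  simp [extNat]

lemma extNat_injective {n : ℕ} (π : Equiv.Perm (Fin n)) : Function.Injective (extNat π) := by
  refine Function.LeftInverse.injective (g := extNat π⁻¹) fun i => ?_
  rw [← extNat_mul, inv_mul_cancel, extNat_one]

/-- Adjacent transpositions generate the symmetric group. The relations between them need no
verification, because an operator is determined by its values on arrangements (`ext_arr`). -/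
lemma exists_perm (P : MF Q f) (n : ℕ) (π : Equiv.Perm (Fin (n + 1))) :
    ∃ A : Module.End Q (P.tpow (n + 1)).carrier,
      IsHom (P := P.tpow (n + 1)) (P' := P.tpow (n + 1)) A ∧ ∀ v b, P.Homog v b →
        ∀ w, Function.Injective w →
          A (P.arr v b w (n + 1)) = P.arr v b (fun j => w (extNat π j)) (n + 1) := by
  have hπ : π ∈ Submonoid.closure (Set.range fun i : Fin n => Equiv.swap i.castSucc i.succ) := by
    rw [Equiv.Perm.mclosure_swap_castSucc_succ]
    trivial
  induction hπ using Submonoid.closure_induction with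
  | mem π h =>
    obtain ⟨i, rfl⟩ := h
    obtain ⟨A, hA, h⟩ := P.exists_adjacent i (n + 1) (by omega)
    refine ⟨A, hA, fun v b hv w hw => (h v b hv w hw).trans (arr_congr fun j hj => congrArg w ?_)⟩
    have := (extNat_coe (Equiv.swap i.castSucc i.succ) ⟨j, hj⟩)
    rw [this]
    exact (Function.Injective.map_swap Fin.val_injective i.castSucc i.succ ⟨j, hj⟩).symm
  | one => exact ⟨1, isHom_one _, fun v b _ w _ => by simp only [extNat_one]; rfl⟩
  | mul π π' _ _ h h' =>
    obtain ⟨A, hA, h⟩ := h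
    obtain ⟨A', hA', h'⟩ := h'
    -- Permutations act on positions, that is, on arrangements from the right; hence the reversed
    -- order of the product.
    refine ⟨A' * A, hA'.mul hA, fun v b hv w hw => ?_⟩
    rw [Module.End.mul_apply, h v b hv w hw,
      h' v b hv (fun j => w (extNat π j)) (hw.comp (extNat_injective π))]
    simp only [extNat_mul]

lemma ext_arr {n : ℕ} {A B : Module.End Q (P.tpow n).carrier}
    (h : ∀ v b, P.Homog v b → A (P.arr v b id n) = B (P.arr v b id n)) : A = B :=
  P.ext_tprod n fun v b hv => by simpa only [arr_id] using h v b hv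

/-- The powers `σ ^ k` of the cycle with `k` invertible modulo `p` are conjugate to `σ`. -/
lemma exists_conj_rot (P : MF Q f) {p : ℕ} [Fact p.Prime] {k : ℕ} (hk : (k : ZMod p) ≠ 0) :
    ∃ T T' : Module.End Q (P.tpow p).carrier, IsHom (P := P.tpow p) (P' := P.tpow p) T ∧
      IsHom (P := P.tpow p) (P' := P.tpow p) T' ∧ T' * T = 1 ∧ T * T' = 1 ∧
      P.rot p ^ k * T = T * P.rot p := by
  obtain ⟨n, rfl⟩ : ∃ n, p = n + 1 :=
    ⟨p - 1, (Nat.sub_add_cancel (Fact.out : p.Prime).one_le).symm⟩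
  -- On positions in `ℤ/p`, the cycle acts through the translation `ρ : x ↦ x - 1`, and `τ` is
  -- multiplication by `k⁻¹`. The conjugation comes from `k⁻¹ (x - k) = k⁻¹ x - 1`, that is, `τ ρ ^
  -- k = ρ τ`.
  let τ : Equiv.Perm (Fin (n + 1)) := (Equiv.mulLeft₀ (k : ZMod (n + 1))⁻¹ (inv_ne_zero hk) :
    Equiv.Perm (ZMod (n + 1)))
  let ρ : Equiv.Perm (Fin (n + 1)) := (Equiv.subRight (1 : ZMod (n + 1)) :
    Equiv.Perm (ZMod (n + 1)))
  obtain ⟨T, hT, hTw⟩ := P.exists_perm n τ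
  obtain ⟨T', hT', hTw'⟩ := P.exists_perm n τ⁻¹
  have hρ : ∀ v b, P.Homog v b → ∀ w, Function.Injective w →
      P.rot (n + 1) (P.arr v b w (n + 1)) = P.arr v b (fun j => w (extNat ρ j)) (n + 1) := by
    intro v b hv w hw
    refine rot_arr hv hw (congrArg w ?_) fun i hi => congrArg w ?_
    · have h1 : ρ 0 = (-1 : ZMod (n + 1)) := zero_sub (1 : ZMod (n + 1))
      have h2 : (ρ 0).val = n := (congrArg ZMod.val h1).trans (ZMod.val_neg_one n)
      exact (extNat_coe ρ 0).trans h2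
    · have h1 : (⟨i + 1, by omega⟩ : Fin (n + 1)) = ⟨i, by omega⟩ + 1 :=
        Fin.ext (Fin.val_add_one_of_lt (i := ⟨i, by omega⟩) hi).symm
      have h2 : ρ (⟨i, by omega⟩ + 1) = ⟨i, by omega⟩ :=
        add_sub_cancel_right (⟨i, by omega⟩ : ZMod (n + 1)) 1
      refine (extNat_coe ρ ⟨i + 1, by omega⟩).trans ?_
      rw [h1, h2]
  have hρk : ∀ m : ℕ, ∀ v b, P.Homog v b → ∀ w, Function.Injective w →
      (P.rot (n + 1) ^ m) (P.arr v b w (n + 1)) =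
        P.arr v b (fun j => w (extNat (ρ ^ m) j)) (n + 1) := by
    intro m
    induction m with
    | zero => exact fun v b _ w _ => by simp only [pow_zero, extNat_one]; rfl
    | succ m ih =>
      intro v b hv w hw
      rw [pow_succ, Module.End.mul_apply, hρ v b hv w hw,
        ih v b hv (fun j => w (extNat ρ j)) (hw.comp (extNat_injective ρ)), pow_succ']
      simp only [extNat_mul]
  have hρx : ∀ (m : ℕ) (x : ZMod (n + 1)), (ρ ^ m) x = (x - m : ZMod (n + 1)) := by
    intro m
    induction m with
    | zero => exact fun x => (by simp : x = x - ((0 : ℕ) : ZMod (n + 1)))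
    | succ m ih =>
      intro x
      rw [pow_succ']
      refine (congrArg ρ (ih x)).trans ?_
      change x - m - 1 = x - ((m + 1 : ℕ) : ZMod (n + 1))
      push_cast
      ring
  have hτρ : τ * ρ ^ k = ρ * τ := by
    refine Equiv.ext fun x : ZMod (n + 1) => ?_
    refine (congrArg τ (hρx k x)).trans ?_
    change (k : ZMod (n + 1))⁻¹ * (x - k) = (k : ZMod (n + 1))⁻¹ * x - 1
    rw [mul_sub, inv_mul_cancel₀ hk]
  refine ⟨T, T', hT, hT', ext_arr fun v b hv => ?_, ext_arr fun v b hv => ?_,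
    ext_arr fun v b hv => ?_⟩
  · rw [Module.End.mul_apply, hTw v b hv id Function.injective_id,
      hTw' v b hv (fun j => id (extNat τ j)) (extNat_injective τ)]
    simp only [← extNat_mul, mul_inv_cancel, extNat_one, id]
    rfl
  · rw [Module.End.mul_apply, hTw' v b hv id Function.injective_id,
      hTw v b hv (fun j => id (extNat τ⁻¹ j)) (extNat_injective τ⁻¹)]
    simp only [← extNat_mul, inv_mul_cancel, extNat_one, id]
    rfl
  · rw [Module.End.mul_apply, Module.End.mul_apply, hTw v b hv id Function.injective_id,
      hρk k v b hv (fun j => id (extNat τ j)) (extNat_injective τ),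
      hρ v b hv id Function.injective_id,
      hTw v b hv (fun j => id (extNat ρ j)) (extNat_injective ρ)]
    simp only [← extNat_mul, id, hτρ]

end Perm

end MF

/-! ### Equality of the classes of the nontrivial eigenspaces. -/

section K0

variable {Q : Type u} [CommRing Q] {Z : Set (PrimeSpectrum Q)} {f : Q} {p : ℕ}
  [Algebra (Ap p) Q]

/-- The nontrivial eigenspaces of the tensor power have the same class. -/
lemma K0.mk_eig_eq (hp : p.Prime) {k : ℕ} (hk : ¬ p ∣ k) (P : MFZ Z f) :
    K0.mk (P.eig hp k) = K0.mk (P.eig hp 1) := by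
  have : Fact p.Prime := ⟨hp⟩
  have hk' : (k : ZMod p) ≠ 0 := by rwa [Ne, ZMod.natCast_eq_zero_iff]
  obtain ⟨T, T', hT, hT', h1, h2, h3⟩ := P.1.exists_conj_rot hk'
  have hz := isStrongRoot_zetaQ Q hp
  set z := zetaQ p Q
  set σ := P.1.rot p
  have hσ : σ ^ p = 1 := P.1.rot_pow p
  -- `T` maps the `z ^ k`-eigenspace of `σ` to that of `σ ^ k`. With `m` inverse to `k` modulo `p`,
  -- the `m`-th power recovers `σ` from `σ ^ k` and `z` from `z ^ k`, so the latter vectors are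
  -- eigenvectors of `σ` for `z`.
  obtain ⟨m, hm⟩ : ∃ m : ℕ, (k * m) % p = 1 := by
    refine ⟨((k : ZMod p)⁻¹).val, ?_⟩
    have h4 : ((k * ((k : ZMod p)⁻¹).val : ℕ) : ZMod p) = (1 : ℕ) := by
      rw [Nat.cast_mul, ZMod.natCast_zmod_val, mul_inv_cancel₀ hk', Nat.cast_one]
    have h5 := (ZMod.natCast_eq_natCast_iff' _ _ _).1 h4
    rwa [Nat.mod_eq_of_lt hp.one_lt] at h5
  have hσm : σ ^ (k * m) = σ := by
    conv_lhs => rw [← Nat.mod_add_div (k * m) p, hm, pow_add, pow_mul, hσ, one_pow, mul_one, pow_one]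
  have hzm : z ^ (k * m) = z := by
    rw [← hz.pow_mod, hm, pow_one]
  have hpow : ∀ (A : Module.End Q (P.1.tpow p).carrier) (ζ : Q) (x : (P.1.tpow p).carrier),
      A x = ζ • x → ∀ j : ℕ, (A ^ j) x = ζ ^ j • x := by
    intro A ζ x hx j
    induction j with
    | zero => simp
    | succ j ih => rw [pow_succ, Module.End.mul_apply, hx, map_smul, ih, smul_smul, pow_succ']
  have hT1 : ∀ x, σ x = z ^ k • x → σ (T x) = z ^ 1 • T x := fun x hx => by
    have h4 : (σ ^ k) (T x) = z ^ k • T x := by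
      rw [← map_smul, ← hx]
      exact LinearMap.congr_fun h3 x
    have h5 := hpow _ _ _ h4 m
    rw [← pow_mul, ← pow_mul, hσm, hzm] at h5
    rw [pow_one, h5]
  have hT2 : ∀ x, σ x = z ^ 1 • x → σ (T' x) = z ^ k • T' x := fun x hx => by
    rw [pow_one] at hx
    have h4 : σ * T' = T' * σ ^ k := by
      rw [← one_mul (σ * T'), ← h1, mul_assoc, ← mul_assoc T, ← h3, mul_assoc _ T, h2, mul_one]
    have h5 : σ (T' x) = T' ((σ ^ k) x) := LinearMap.congr_fun h4 x
    rw [h5, hpow _ _ _ hx, map_smul]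
  refine K0.mk_eq_of_isRetract (P.isRetract_eig hp k) (P.isRetract_eig hp 1) hT hT' (fun x => ?_)
    fun x => ?_
  · have h4 := apply_eigProj (u := invQ p Q) hp.pos hσ (zetaQ_pow Q hp k) x
    rw [eigProj_apply_of_mem hp.pos (invQ_mul Q hp) (zetaQ_pow Q hp 1) (hT1 _ h4)]
    refine (congrArg (eigProj p (invQ p Q) (z ^ k) σ) (LinearMap.congr_fun h1 _)).trans ?_
    exact (P.isRetract_eig hp k).idem x
  · have h4 := apply_eigProj (u := invQ p Q) hp.pos hσ (zetaQ_pow Q hp 1) x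
    rw [eigProj_apply_of_mem hp.pos (invQ_mul Q hp) (zetaQ_pow Q hp k) (hT2 _ h4)]
    refine (congrArg (eigProj p (invQ p Q) (z ^ 1) σ) (LinearMap.congr_fun h2 _)).trans ?_
    exact (P.isRetract_eig hp 1).idem x

lemma t_eq (hp : p.Prime) {k : ℕ} (hk : ¬ p ∣ k) (x : K0 Z f) : t hp k x = t hp 1 x := by
  obtain ⟨P, rfl⟩ := K0.mk_surjective x
  rw [t_mk, t_mk, K0.mk_t, K0.mk_t, K0.mk_eig_eq hp hk]

end K0

end

end AdamsMF

namespace AdamsMF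

noncomputable section

/-! ### The cyclic Adams operation in terms of two eigenspaces -/

section Zeta

variable {p : ℕ}

lemma isPrimitiveRoot_zetaC (hp : p.Prime) : IsPrimitiveRoot (zetaC p) p :=
  Complex.isPrimitiveRoot_exp p hp.ne_zero

lemma sum_zetaZ (hp : p.Prime) : ∑ k ∈ Finset.range p, zetaZ p ^ k = 0 := by
  apply Subtype.ext
  push_cast
  exact (isPrimitiveRoot_zetaC hp).geom_sum_eq_zero hp.one_lt

/-- `e^{2πi/p}` is integral over `ℤ`, so its powers form a basis of `ℤ[e^{2πi/p}]` that begins with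
`1`. The retraction is the corresponding coordinate, and it makes `y ↦ 1 ⊗ y` a split injection. -/
lemma exists_retraction_zeta (hp : p.Prime) : ∃ ρ : Zzeta p →ₗ[ℤ] ℤ, ρ 1 = 1 := by
  have hint : IsIntegral ℤ (zetaC p) := (isPrimitiveRoot_zetaC hp).isIntegral hp.pos
  let B : PowerBasis ℤ (Zzeta p) := Algebra.adjoin.powerBasis' hint
  have hdim : 0 < B.dim := B.dim_pos
  refine ⟨B.basis.coord ⟨0, hdim⟩, ?_⟩
  have h1 : (1 : Zzeta p) = B.basis ⟨0, hdim⟩ := by simp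
  rw [h1, Module.Basis.coord_apply, Module.Basis.repr_self, Finsupp.single_eq_same]

lemma injective_one_tmul (hp : p.Prime) {K : Type*} [AddCommGroup K] :
    Function.Injective (fun y : K => (1 : Zzeta p) ⊗ₜ[ℤ] y) := by
  obtain ⟨ρ, hρ⟩ := exists_retraction_zeta hp
  refine Function.LeftInverse.injective
    (g := fun z => TensorProduct.lid ℤ K (LinearMap.rTensor K ρ z)) fun y => ?_
  simp [hρ]

end Zeta

section K0

variable {Q : Type u} [CommRing Q] {Z : Set (PrimeSpectrum Q)} {f : Q} {p : ℕ} [Algebra (Ap p) Q]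

/-- All terms with `k ≠ 0` involve the same class `t hp 1 x`, and the roots of unity sum to zero. So
completing the sum of the coefficients of `t hp 1 x` by the one for `k = 0` leaves only a multiple
of `1`. -/
lemma zetaSum_eq (hp : p.Prime) (x : K0 Z f) :
    zetaSum hp x = (1 : Zzeta p) ⊗ₜ[ℤ] (t hp 0 x - t hp 1 x) := by
  obtain ⟨n, hn⟩ : ∃ n, p = n + 1 := ⟨p - 1, (Nat.sub_add_cancel hp.one_le).symm⟩
  have h1 := sum_zetaZ hp
  rw [zetaSum]
  have h2 : ∑ k ∈ Finset.range p, (zetaZ p ^ k) ⊗ₜ[ℤ] t hp k x =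
      (∑ k ∈ Finset.range p, zetaZ p ^ k) ⊗ₜ[ℤ] t hp 1 x + 1 ⊗ₜ[ℤ] (t hp 0 x - t hp 1 x) := by
    rw [TensorProduct.sum_tmul, show Finset.range p = Finset.range (n + 1) by rw [hn],
      Finset.sum_range_succ', Finset.sum_range_succ', pow_zero, add_assoc, ← TensorProduct.tmul_add,
      add_sub_cancel]
    congr 1
    refine Finset.sum_congr rfl fun k hk => ?_
    rw [t_eq hp (Nat.not_dvd_of_pos_of_lt k.succ_pos (by have := Finset.mem_range.1 hk; omega))]
  rw [h2, h1, TensorProduct.zero_tmul, zero_add]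

lemma cPsi_eq (hp : p.Prime) (x : K0 Z f) : cPsi hp x = t hp 0 x - t hp 1 x := by
  have h : (1 : Zzeta p) ⊗ₜ[ℤ] cPsi hp x = zetaSum hp x :=
    Classical.epsilon_spec (p := fun y : K0 Z f => (1 : Zzeta p) ⊗ₜ[ℤ] y = zetaSum hp x)
      ⟨_, (zetaSum_eq hp x).symm⟩
  rw [zetaSum_eq] at h
  exact injective_one_tmul hp h

lemma one_tmul_cPsi (hp : p.Prime) (x : K0 Z f) : (1 : Zzeta p) ⊗ₜ[ℤ] cPsi hp x = zetaSum hp x := by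
  rw [cPsi_eq, zetaSum_eq]

lemma cPsi_add (hp : p.Prime) (x y : K0 Z f) : cPsi hp (x + y) = cPsi hp x + cPsi hp y := by
  have : Fact p.Prime := ⟨hp⟩
  rw [cPsi_eq, cPsi_eq, cPsi_eq, t_add, t_add]
  abel

end K0

end

end AdamsMF

/-! ### Compatibility of the operation with tensor products. -/

namespace AdamsMF

noncomputable section

namespace MF

variable {Q : Type u} [CommRing Q] {f f₁ f₂ f₃ f₄ : Q}

/-! ### Homogeneous elements -/

/-- `x` is homogeneous of degree `a`. -/
def HasDeg (P : MF Q f) (x : P.carrier) (a : Bool) : Prop := P.odd x = if a then x else 0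

/-- The sign `(-1)^a`. -/
def sg (Q : Type u) [CommRing Q] (a : Bool) : Q := if a then -1 else 1

lemma HasDeg.even_eq {P : MF Q f} {x : P.carrier} {a : Bool} (h : P.HasDeg x a) :
    P.even x = if a then 0 else x := by
  have h1 : P.even x = x - P.odd x := by rw [odd_apply]; abel
  rw [h1, h]
  cases a <;> simp

lemma HasDeg.sgn_eq {P : MF Q f} {x : P.carrier} {a : Bool} (h : P.HasDeg x a) :
    P.sgn x = sg Q a • x := by
  rw [sgn_apply, h.even_eq]
  cases a <;> simp [sg]

lemma HasDeg.d {P : MF Q f} {x : P.carrier} {a : Bool} (h : P.HasDeg x a) :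
    P.HasDeg (P.d x) (!a) := by
  change P.odd (P.d x) = _
  rw [odd_apply, even_apply_d, h.even_eq]
  cases a <;> simp

lemma HasDeg.smul {P : MF Q f} {x : P.carrier} {a : Bool} (h : P.HasDeg x a) (c : Q) :
    P.HasDeg (c • x) a := by
  have h' : P.odd x = _ := h
  change P.odd (c • x) = _
  rw [map_smul, h']
  cases a <;> simp

lemma HasDeg.tmul {P : MF Q f₁} {P' : MF Q f₂} {x : P.carrier} {y : P'.carrier} {a b : Bool}
    (hx : P.HasDeg x a) (hy : P'.HasDeg y b) : (P.tensor P').HasDeg (x ⊗ₜ[Q] y) (xor a b) := by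
  change x ⊗ₜ[Q] y - (P.even x ⊗ₜ[Q] P'.even y + P.odd x ⊗ₜ[Q] P'.odd y) = _
  rw [hx.even_eq, hy.even_eq, show P.odd x = _ from hx, show P'.odd y = _ from hy]
  cases a <;> cases b <;> simp <;> rfl

lemma tensor_d_tmul {P : MF Q f₁} {P' : MF Q f₂} {x : P.carrier} {a : Bool} (hx : P.HasDeg x a)
    (y : P'.carrier) :
    (P.tensor P').d (x ⊗ₜ[Q] y) = P.d x ⊗ₜ[Q] y + sg Q a • (x ⊗ₜ[Q] P'.d y) := by
  change P.d x ⊗ₜ[Q] y + P.sgn x ⊗ₜ[Q] P'.d y = _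
  rw [hx.sgn_eq, TensorProduct.smul_tmul']

lemma hasDeg_even (P : MF Q f) (x : P.carrier) : P.HasDeg (P.even x) false := by
  change P.even x - P.even (P.even x) = _
  rw [even_apply_even, sub_self]; rfl

lemma hasDeg_odd (P : MF Q f) (x : P.carrier) : P.HasDeg (P.odd x) true := by
  change P.odd x - P.even (x - P.even x) = _
  rw [map_sub, even_apply_even, sub_self, sub_zero]; rfl

lemma even_add_odd (P : MF Q f) (x : P.carrier) : P.even x + P.odd x = x := by
  rw [odd_apply]; abel

lemma ext_homog (P : MF Q f) {M : Type u} [AddCommGroup M] [Module Q M] {A B : P.carrier →ₗ[Q] M}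
    (h : ∀ x a, P.HasDeg x a → A x = B x) : A = B := by
  ext x
  rw [← P.even_add_odd x, map_add, map_add, h _ _ (P.hasDeg_even x), h _ _ (P.hasDeg_odd x)]

lemma ext_homog_tmul (P : MF Q f) {N M : Type u} [AddCommGroup N] [Module Q N] [AddCommGroup M]
    [Module Q M] {A B : P.carrier ⊗[Q] N →ₗ[Q] M}
    (h : ∀ x a, P.HasDeg x a → ∀ y, A (x ⊗ₜ[Q] y) = B (x ⊗ₜ[Q] y)) : A = B := by
  refine TensorProduct.ext (P.ext_homog fun x a hx => LinearMap.ext fun y => h x a hx y)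

/-! ### The signed exchange of the inner factors -/

section Exchange

variable (A : MF Q f₁) (B : MF Q f₂) (C : MF Q f₃) (D : MF Q f₄)

/-- The map `(x ⊗ y) ⊗ (z ⊗ w) ↦ (-1)^{|y||z|} (x ⊗ z) ⊗ (y ⊗ w)`. -/
def exch : (A.carrier ⊗[Q] B.carrier) ⊗[Q] (C.carrier ⊗[Q] D.carrier) →ₗ[Q]
    (A.carrier ⊗[Q] C.carrier) ⊗[Q] (B.carrier ⊗[Q] D.carrier) :=
  (TensorProduct.tensorTensorTensorComm Q A.carrier B.carrier C.carrier D.carrier).toLinearMap ∘ₗ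
    (LinearMap.id - (2 : Q) • TensorProduct.map (TensorProduct.map LinearMap.id B.odd)
      (TensorProduct.map C.odd LinearMap.id))

variable {A B C D}

lemma exch_tmul {y : B.carrier} {z : C.carrier} {b c : Bool} (hy : B.HasDeg y b)
    (hz : C.HasDeg z c) (x : A.carrier) (w : D.carrier) :
    exch A B C D ((x ⊗ₜ[Q] y) ⊗ₜ[Q] (z ⊗ₜ[Q] w)) = ksgn Q b c • ((x ⊗ₜ[Q] z) ⊗ₜ[Q] (y ⊗ₜ[Q] w)) := by
  have hy' : B.odd y = _ := hy
  have hz' : C.odd z = _ := hz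
  have h : exch A B C D ((x ⊗ₜ[Q] y) ⊗ₜ[Q] (z ⊗ₜ[Q] w)) = (x ⊗ₜ[Q] z) ⊗ₜ[Q] (y ⊗ₜ[Q] w) -
      (2 : Q) • ((x ⊗ₜ[Q] C.odd z) ⊗ₜ[Q] (B.odd y ⊗ₜ[Q] w)) := by
    simp [exch]
  rw [h, hy', hz']
  cases b <;> cases c <;> simp [ksgn]
  module

lemma ext_homog₄ {M : Type u} [AddCommGroup M] [Module Q M]
    {F G : (A.carrier ⊗[Q] B.carrier) ⊗[Q] (C.carrier ⊗[Q] D.carrier) →ₗ[Q] M}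
    (h : ∀ x a, A.HasDeg x a → ∀ y b, B.HasDeg y b → ∀ z c, C.HasDeg z c → ∀ w e, D.HasDeg w e →
      F ((x ⊗ₜ[Q] y) ⊗ₜ[Q] (z ⊗ₜ[Q] w)) = G ((x ⊗ₜ[Q] y) ⊗ₜ[Q] (z ⊗ₜ[Q] w))) : F = G := by
  refine TensorProduct.ext (A.ext_homog_tmul fun x a hx y => ?_)
  refine LinearMap.congr_fun (f := (TensorProduct.mk Q _ _).compr₂ F ∘ₗ TensorProduct.mk Q _ _ x)
    (g := (TensorProduct.mk Q _ _).compr₂ G ∘ₗ TensorProduct.mk Q _ _ x)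
    (B.ext_homog fun y b hy => C.ext_homog_tmul fun z c hz w => ?_) y
  refine LinearMap.congr_fun (f := F ∘ₗ TensorProduct.mk Q _ _ (x ⊗ₜ[Q] y) ∘ₗ
    TensorProduct.mk Q _ _ z) (g := G ∘ₗ TensorProduct.mk Q _ _ (x ⊗ₜ[Q] y) ∘ₗ
    TensorProduct.mk Q _ _ z) (D.ext_homog fun w e hw => h x a hx y b hy z c hz w e hw) w

lemma exch_exch (t : (A.carrier ⊗[Q] B.carrier) ⊗[Q] (C.carrier ⊗[Q] D.carrier)) :
    exch A C B D (exch A B C D t) = t := by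
  refine LinearMap.congr_fun (f := exch A C B D ∘ₗ exch A B C D) (g := LinearMap.id)
    (ext_homog₄ fun x a hx y b hy z c hz w e hw => ?_) t
  rw [LinearMap.comp_apply, exch_tmul hy hz, map_smul, exch_tmul hz hy, smul_smul]
  cases b <;> cases c <;> simp [ksgn]

/-- On homogeneous elements this is the consistency of the Koszul signs: applying `d` to `y` or `z`
changes the exchange sign by `(-1)^|z|` or `(-1)^|y|`, exactly as it changes the sign with which `d`
passes the preceding factors. -/
lemma isHom_exch (h : f₁ + f₃ + (f₂ + f₄) = f₁ + f₂ + (f₃ + f₄)) :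
    IsHom (P := (A.tensor B).tensor (C.tensor D)) (P' := ((A.tensor C).tensor (B.tensor D)).ofEq h)
      (exch A B C D) := by
  refine ⟨ext_homog₄ fun x a hx y b hy z c hz w e hw => ?_,
    ext_homog₄ fun x a hx y b hy z c hz w e hw => ?_⟩
  · have h1 := (((hx.tmul hy).tmul (hz.tmul hw))).even_eq
    have h2 := (((hx.tmul hz).tmul (hy.tmul hw)).smul (ksgn Q b c)).even_eq
    refine (congrArg (exch A B C D) h1).trans ?_
    refine Eq.trans ?_ ((congrArg ((A.tensor C).tensor (B.tensor D)).even
      (exch_tmul hy hz x w)).trans h2).symm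
    have key : ∀ q q' : Bool, q = q' →
        exch A B C D (if q then 0 else (x ⊗ₜ[Q] y) ⊗ₜ[Q] (z ⊗ₜ[Q] w)) =
          if q' then 0 else ksgn Q b c • ((x ⊗ₜ[Q] z) ⊗ₜ[Q] (y ⊗ₜ[Q] w)) := by
      rintro q _ rfl
      cases q
      · exact exch_tmul hy hz x w
      · exact map_zero _
    exact key _ _ (by cases a <;> cases b <;> cases c <;> cases e <;> rfl)
  · have h1 := tensor_d_tmul (P' := C.tensor D) (hx.tmul hy) (z ⊗ₜ[Q] w)
    have h2 := tensor_d_tmul (P' := B.tensor D) (hx.tmul hz) (y ⊗ₜ[Q] w)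
    rw [tensor_d_tmul hx, tensor_d_tmul hz] at h1
    rw [tensor_d_tmul hx, tensor_d_tmul hy] at h2
    refine (congrArg (exch A B C D) h1).trans ?_
    refine Eq.trans ?_ (congrArg ((A.tensor C).tensor (B.tensor D)).d (exch_tmul hy hz x w)).symm
    refine Eq.trans ?_ ((map_smul _ _ _).trans (congrArg (ksgn Q b c • ·) h2)).symm
    have key : exch A B C D ((A.d x ⊗ₜ[Q] y + sg Q a • (x ⊗ₜ[Q] B.d y)) ⊗ₜ[Q] (z ⊗ₜ[Q] w) +
        sg Q (xor a b) • ((x ⊗ₜ[Q] y) ⊗ₜ[Q] (C.d z ⊗ₜ[Q] w + sg Q c • (z ⊗ₜ[Q] D.d w)))) =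
        ksgn Q b c • ((A.d x ⊗ₜ[Q] z + sg Q a • (x ⊗ₜ[Q] C.d z)) ⊗ₜ[Q] (y ⊗ₜ[Q] w) +
        sg Q (xor a c) • ((x ⊗ₜ[Q] z) ⊗ₜ[Q] (B.d y ⊗ₜ[Q] w + sg Q b • (y ⊗ₜ[Q] D.d w)))) := by
      simp only [TensorProduct.add_tmul, TensorProduct.tmul_add, map_add, smul_add,
        TensorProduct.tmul_smul, ← TensorProduct.smul_tmul', map_smul, exch_tmul hy hz,
        exch_tmul hy.d hz, exch_tmul hy hz.d]
      cases a <;> cases b <;> cases c <;> simp [ksgn, sg] <;> module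
    exact key

end Exchange

/-! ### The tensor powers of a tensor product -/

section Shuffle

variable (P : MF Q f₁) (P' : MF Q f₂)

/-- The signed shuffle `T^n (P ⊗ P') → T^n P ⊗ T^n P'`. -/
def shuffle : (n : ℕ) → ((P.tensor P').tpow n).carrier →ₗ[Q]
    (P.tpow n).carrier ⊗[Q] (P'.tpow n).carrier
  | 0 => (TensorProduct.mk Q Q Q 1 : Q →ₗ[Q] Q ⊗[Q] Q)
  | n + 1 => exch P P' (P.tpow n) (P'.tpow n) ∘ₗ TensorProduct.map LinearMap.id (shuffle n)

/-- The inverse of the signed shuffle. -/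
def unshuffle : (n : ℕ) → (P.tpow n).carrier ⊗[Q] (P'.tpow n).carrier →ₗ[Q]
    ((P.tensor P').tpow n).carrier
  | 0 => (TensorProduct.lid Q Q : Q ⊗[Q] Q →ₗ[Q] Q)
  | n + 1 => TensorProduct.map LinearMap.id (unshuffle n) ∘ₗ exch P (P.tpow n) P' (P'.tpow n)

lemma unshuffle_shuffle : ∀ (n : ℕ) (t : ((P.tensor P').tpow n).carrier),
    P.unshuffle P' n (P.shuffle P' n t) = t
  | 0, t => TensorProduct.lid_tmul t (1 : Q) |>.trans (one_smul Q t)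
  | n + 1, t => by
    refine (congrArg (TensorProduct.map LinearMap.id (P.unshuffle P' n)) (exch_exch _)).trans ?_
    refine LinearMap.congr_fun (f := TensorProduct.map LinearMap.id (P.unshuffle P' n) ∘ₗ
      TensorProduct.map LinearMap.id (P.shuffle P' n)) (g := LinearMap.id) ?_ t
    rw [← TensorProduct.map_comp, show P.unshuffle P' n ∘ₗ P.shuffle P' n = LinearMap.id from
      LinearMap.ext (unshuffle_shuffle n)]
    exact TensorProduct.map_id

lemma shuffle_unshuffle : ∀ (n : ℕ) (t : (P.tpow n).carrier ⊗[Q] (P'.tpow n).carrier),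
    P.shuffle P' n (P.unshuffle P' n t) = t
  | 0, t => by
    refine LinearMap.congr_fun (f := (TensorProduct.mk Q Q Q 1) ∘ₗ
      (TensorProduct.lid Q Q : Q ⊗[Q] Q →ₗ[Q] Q)) (g := LinearMap.id) ?_ t
    ext; simp
  | n + 1, t => by
    have h : TensorProduct.map LinearMap.id (P.shuffle P' n) ∘ₗ
      TensorProduct.map LinearMap.id (P.unshuffle P' n) =
        (LinearMap.id : (P.tensor P').carrier ⊗[Q] _ →ₗ[Q] _) := by
      rw [← TensorProduct.map_comp, show P.shuffle P' n ∘ₗ P.unshuffle P' n = LinearMap.id from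
        LinearMap.ext (shuffle_unshuffle n)]
      exact TensorProduct.map_id
    exact (congrArg (exch P P' (P.tpow n) (P'.tpow n))
      (LinearMap.congr_fun h _)).trans (exch_exch t)

lemma isHom_shuffle : ∀ (n : ℕ) (h : n * f₁ + n * f₂ = n * (f₁ + f₂)),
    IsHom (P := (P.tensor P').tpow n) (P' := ((P.tpow n).tensor (P'.tpow n)).ofEq h)
      (P.shuffle P' n)
  | 0, h => by
    refine ⟨LinearMap.ext fun x : Q => ?_, LinearMap.ext fun x : Q => ?_⟩
    · change (1 : Q) ⊗ₜ[Q] x = (1 : Q) ⊗ₜ[Q] x + (1 - (1 : Module.End Q Q)) 1 ⊗ₜ[Q]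
        (1 - (1 : Module.End Q Q)) x
      simp
    · change (1 : Q) ⊗ₜ[Q] (0 : Q) = (0 : Q) ⊗ₜ[Q] x + (1 - (1 - (1 : Module.End Q Q)))
        (1 : Q) ⊗ₜ[Q] (0 : Q)
      simp
  | n + 1, h => by
    have h0 : n * f₁ + n * f₂ = n * (f₁ + f₂) := by ring
    have h1 := (IsHom.id (P.tensor P')).tensor (isHom_shuffle n h0)
    have h2 := isHom_exch (A := P) (B := P') (C := P.tpow n) (D := P'.tpow n) (by ring)
    have e1 := h2.comm_even
    have e2 := h2.comm_d
    refine ⟨?_, ?_⟩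
    · refine (congrArg (exch P P' (P.tpow n) (P'.tpow n) ∘ₗ ·) h1.comm_even).trans ?_
      exact congrArg (· ∘ₗ TensorProduct.map LinearMap.id (P.shuffle P' n)) e1
    · refine (congrArg (exch P P' (P.tpow n) (P'.tpow n) ∘ₗ ·) h1.comm_d).trans ?_
      exact congrArg (· ∘ₗ TensorProduct.map LinearMap.id (P.shuffle P' n)) e2

/-- The degree of a product of elements of degrees `b i`. -/
def totalDeg : (ℕ → Bool) → ℕ → Bool
  | _, 0 => false
  | b, n + 1 => xor (b 0) (totalDeg (fun i => b (i + 1)) n)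

lemma ksgn_xor (a b c : Bool) : ksgn Q a (xor b c) = ksgn Q a b * ksgn Q a c := by
  cases a <;> cases b <;> cases c <;> simp [ksgn]

lemma ksgn_totalDeg (a : Bool) (b : ℕ → Bool) (n : ℕ) :
    ksgn Q a (totalDeg b n) = ∏ i ∈ Finset.range n, ksgn Q a (b i) := by
  induction n generalizing b with
  | zero => simp [totalDeg, ksgn]
  | succ n ih => rw [totalDeg, ksgn_xor, ih, Finset.prod_range_succ', mul_comm]

variable {P P'}

lemma hasDeg_tprod : ∀ (n : ℕ) {v : ℕ → P.carrier} {b : ℕ → Bool}, P.Homog v b →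
    (P.tpow n).HasDeg (P.tprod n v) (totalDeg b n)
  | 0, _, _, _ => sub_self (1 : Q)
  | n + 1, _, _, h =>
    HasDeg.tmul (P := P) (P' := P.tpow n) (h 0) (hasDeg_tprod n fun i => h (i + 1))

/-- The sign of the shuffle. -/
def shufSgn (Q : Type u) [CommRing Q] : (ℕ → Bool) → (ℕ → Bool) → ℕ → Q
  | _, _, 0 => 1
  | b, c, n + 1 => (∏ i ∈ Finset.range n, ksgn Q (c 0) (b (i + 1))) *
      shufSgn Q (fun i => b (i + 1)) (fun i => c (i + 1)) n

/-- The recursion of `shufSgn` removes the first pair of factors. This removes the last pair, the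
one that the cycle moves. -/
lemma shufSgn_succ (b c : ℕ → Bool) (n : ℕ) :
    shufSgn Q b c (n + 1) = shufSgn Q b c n * ∏ i ∈ Finset.range n, ksgn Q (c i) (b n) := by
  induction n generalizing b c with
  | zero => simp [shufSgn]
  | succ n ih =>
    rw [shufSgn, ih, Finset.prod_range_succ' (fun i => ksgn Q (c i) (b (n + 1))),
      Finset.prod_range_succ, shufSgn]
    ring

lemma shuffle_tprod (n : ℕ) {v : ℕ → P.carrier} {w : ℕ → P'.carrier} {b c : ℕ → Bool}
    (hv : P.Homog v b) (hw : P'.Homog w c) :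
    P.shuffle P' n ((P.tensor P').tprod n fun i => v i ⊗ₜ[Q] w i) =
      shufSgn Q b c n • (P.tprod n v ⊗ₜ[Q] P'.tprod n w) := by
  induction n generalizing v w b c with
  | zero => exact (one_smul Q _).symm
  | succ n ih =>
    have h1 := ih (fun i => hv (i + 1)) (fun i => hw (i + 1))
    refine (congrArg (exch P P' (P.tpow n) (P'.tpow n))
      (congrArg ((v 0 ⊗ₜ[Q] w 0) ⊗ₜ[Q] ·) h1)).trans ?_
    rw [TensorProduct.tmul_smul, map_smul]
    refine (congrArg (shufSgn Q (fun i => b (i + 1)) (fun i => c (i + 1)) n • ·)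
      (exch_tmul (A := P) (D := P'.tpow n) (hw 0) (hasDeg_tprod n fun i => hv (i + 1))
        (v 0) (P'.tprod n fun i => w (i + 1)))).trans ?_
    rw [smul_smul, ksgn_totalDeg, mul_comm (shufSgn Q _ _ n)]
    rfl

lemma ext_tprod_tmul {M : Type u} [AddCommGroup M] [Module Q M] :
    ∀ (n : ℕ) {F G : ((P.tensor P').tpow n).carrier →ₗ[Q] M},
      (∀ v b, P.Homog v b → ∀ w c, P'.Homog w c → F ((P.tensor P').tprod n fun i => v i ⊗ₜ[Q] w i) =
        G ((P.tensor P').tprod n fun i => v i ⊗ₜ[Q] w i)) → F = G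
  | 0, F, G, h => (P.tensor P').ext_tprod 0 fun v b hv =>
      h (fun _ => 0) (fun _ => false) (fun _ => map_zero _) (fun _ => 0) (fun _ => false)
        (fun _ => map_zero _)
  | n + 1, F, G, h => by
    refine TensorProduct.ext (P.ext_homog_tmul fun x a hx y => ?_)
    refine LinearMap.congr_fun
      (f := (TensorProduct.mk Q (P.tensor P').carrier _).compr₂ F ∘ₗ TensorProduct.mk Q _ _ x)
      (g := (TensorProduct.mk Q (P.tensor P').carrier _).compr₂ G ∘ₗ TensorProduct.mk Q _ _ x)
      (P'.ext_homog fun y a' hy => ?_) y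
    refine ext_tprod_tmul n fun v b hv w c hw => ?_
    exact h (fun i => i.casesOn x v) (fun i => i.casesOn a b) (fun i => i.casesOn hx hv)
      (fun i => i.casesOn y w) (fun i => i.casesOn a' c) (fun i => i.casesOn hy hw)

lemma Homog.tmul {v : ℕ → P.carrier} {w : ℕ → P'.carrier} {b c : ℕ → Bool}
    (hv : P.Homog v b) (hw : P'.Homog w c) :
    (P.tensor P').Homog (fun i => v i ⊗ₜ[Q] w i) fun i => xor (b i) (c i) :=
  fun i => HasDeg.tmul (hv i) (hw i)

/-- The shuffle is compatible with the cycles. -/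
lemma shuffle_rot : ∀ (n : ℕ) (t : ((P.tensor P').tpow n).carrier),
    P.shuffle P' n ((P.tensor P').rot n t) =
      TensorProduct.map (P.rot n) (P'.rot n) (P.shuffle P' n t)
  | 0, t => rfl
  | n + 1, t => by
    refine LinearMap.congr_fun (f := P.shuffle P' (n + 1) ∘ₗ (P.tensor P').rot (n + 1))
      (g := TensorProduct.map (P.rot (n + 1)) (P'.rot (n + 1)) ∘ₗ P.shuffle P' (n + 1))
      (ext_tprod_tmul (n + 1) fun v b hv w c hw => ?_) t
    -- The sequence with entry `n` moved to the front. Only the first `n + 1` entries enter the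
    -- tensors.
    let pre : {M : Type u} → (ℕ → M) → ℕ → M := fun s i => i.casesOn (s n) s
    let bre : (ℕ → Bool) → ℕ → Bool := fun s i => i.casesOn (s n) s
    have hv' : P.Homog (pre v) (bre b) := fun i => i.casesOn (hv n) hv
    have hw' : P'.Homog (pre w) (bre c) := fun i => i.casesOn (hw n) hw
    have e1 : P.rot (n + 1) (P.tprod (n + 1) v) =
        (∏ i ∈ Finset.range n, ksgn Q (b i) (b n)) • P.tprod (n + 1) (pre v) := P.cyc_tprod n v b hv
    have e2 : P'.rot (n + 1) (P'.tprod (n + 1) w) =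
        (∏ i ∈ Finset.range n, ksgn Q (c i) (c n)) • P'.tprod (n + 1) (pre w) :=
      P'.cyc_tprod n w c hw
    have e3 : (P.tensor P').rot (n + 1) ((P.tensor P').tprod (n + 1) fun i => v i ⊗ₜ[Q] w i) =
        (∏ i ∈ Finset.range n, ksgn Q (xor (b i) (c i)) (xor (b n) (c n))) •
          (P.tensor P').tprod (n + 1) fun i => pre v i ⊗ₜ[Q] pre w i :=
      (P.tensor P').cyc_tprod n _ _ (hv.tmul hw)
    rw [LinearMap.comp_apply, LinearMap.comp_apply, shuffle_tprod (n + 1) hv hw, e3]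
    refine (map_smul (P.shuffle P' (n + 1)) _ _).trans ?_
    rw [shuffle_tprod (n + 1) hv' hw']
    refine Eq.trans ?_ (map_smul (TensorProduct.map (P.rot (n + 1)) (P'.rot (n + 1))) _ _).symm
    rw [TensorProduct.map_tmul, e1, e2]
    have h1 : shufSgn Q (bre b) (bre c) (n + 1) =
        (∏ i ∈ Finset.range n, ksgn Q (c n) (b i)) * shufSgn Q b c n := rfl
    -- For each `i < n`, with `b` and `c` read as degrees, this is the congruence `(bᵢ + cᵢ)(bₙ +
    -- cₙ) + cₙ bᵢ ≡ cᵢ bₙ + bᵢ bₙ + cᵢ cₙ` modulo `2`.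
    have h2 : (∏ i ∈ Finset.range n, ksgn Q (xor (b i) (c i)) (xor (b n) (c n))) *
        shufSgn Q (bre b) (bre c) (n + 1) = shufSgn Q b c (n + 1) *
          ((∏ i ∈ Finset.range n, ksgn Q (b i) (b n)) * ∏ i ∈ Finset.range n, ksgn Q (c i) (c n)) := by
      rw [h1, shufSgn_succ, ← mul_assoc, ← Finset.prod_mul_distrib, mul_comm, mul_assoc,
        ← Finset.prod_mul_distrib, ← Finset.prod_mul_distrib]
      congr 1
      refine Finset.prod_congr rfl fun i _ => ?_
      cases b i <;> cases c i <;> cases b n <;> cases c n <;> simp [ksgn]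
    rw [smul_smul, h2, mul_smul, TensorProduct.smul_tmul_smul]

end Shuffle

end MF

end

end AdamsMF

namespace AdamsMF

noncomputable section

/-! ### Multiplicativity -/

lemma MF.IsHom.of_inverse {Q : Type u} [CommRing Q] {f : Q} {P P' : MF Q f}
    {a : P.carrier →ₗ[Q] P'.carrier} {b : P'.carrier →ₗ[Q] P.carrier} (ha : IsHom a)
    (hba : ∀ x, b (a x) = x) (hab : ∀ x, a (b x) = x) : IsHom b := by
  refine ⟨LinearMap.ext fun x => ?_, LinearMap.ext fun x => ?_⟩
  · refine Eq.trans ?_ (hba _)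
    exact congrArg b ((congrArg P'.even (hab x).symm).trans (ha.apply_even _).symm)
  · refine Eq.trans ?_ (hba _)
    exact congrArg b ((congrArg P'.d (hab x).symm).trans (ha.apply_d _).symm)

section MultTensor

variable {Q : Type u} [CommRing Q] {f f₁ f₂ : Q}

/-- The element `c` or `1`. -/
def cond₁ (c : Q) (a : Bool) : Q := if a then c else 1

lemma MF.HasDeg.mult_d {P : MF Q f} {x : P.carrier} {a : Bool} (h : P.HasDeg x a) (c : Q) :
    (P.mult c).d x = cond₁ c (!a) • P.d x := by
  change P.d (P.odd x + c • P.even x) = _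
  rw [h.even_eq, show P.odd x = _ from h]
  cases a <;> simp [cond₁]

/-- Multiplication by `c` on the product of the odd parts. -/
def MF.oddScale (A : MF Q f₁) (B : MF Q f₂) (c : Q) : Module.End Q (A.carrier ⊗[Q] B.carrier) :=
  1 + (c - 1) • TensorProduct.map A.odd B.odd

namespace MF

variable {A : MF Q f₁} {B : MF Q f₂}

lemma oddScale_tmul {x : A.carrier} {y : B.carrier} {a b : Bool} (hx : A.HasDeg x a)
    (hy : B.HasDeg y b) (c : Q) :
    A.oddScale B c (x ⊗ₜ[Q] y) = cond₁ c (a && b) • (x ⊗ₜ[Q] y) := by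
  have h : A.oddScale B c (x ⊗ₜ[Q] y) = x ⊗ₜ[Q] y + (c - 1) • (A.odd x ⊗ₜ[Q] B.odd y) := rfl
  rw [h, show A.odd x = _ from hx, show B.odd y = _ from hy]
  cases a <;> cases b <;> simp [cond₁]
  module

lemma ext_homog₂ {M : Type u} [AddCommGroup M] [Module Q M]
    {F G : A.carrier ⊗[Q] B.carrier →ₗ[Q] M}
    (h : ∀ x a, A.HasDeg x a → ∀ y b, B.HasDeg y b → F (x ⊗ₜ[Q] y) = G (x ⊗ₜ[Q] y)) : F = G :=
  TensorProduct.ext (A.ext_homog fun x a hx => B.ext_homog fun y b hy => h x a hx y b hy)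

lemma oddScale_oddScale {c c' : Q} (hc : c * c' = 1) (t : A.carrier ⊗[Q] B.carrier) :
    A.oddScale B c (A.oddScale B c' t) = t := by
  refine LinearMap.congr_fun (f := A.oddScale B c ∘ₗ A.oddScale B c') (g := LinearMap.id)
    (ext_homog₂ fun x a hx y b hy => ?_) t
  rw [LinearMap.comp_apply, oddScale_tmul hx hy, map_smul, oddScale_tmul hx hy, smul_smul]
  cases a <;> cases b <;> simp [cond₁, mul_comm c', hc]

/-- The two differentials differ only around the product of the odd parts: leaving it, only the
first carries a factor `c`; entering it from the mixed parts, only the second does. Rescaling that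
part by `c` compensates both. -/
lemma isHom_oddScale {c : Q} (h₁ : c * (f₁ + f₂) = f) (h₂ : c * f₁ + c * f₂ = f) :
    IsHom (P := ((A.tensor B).mult c).ofEq h₁) (P' := ((A.mult c).tensor (B.mult c)).ofEq h₂)
      (A.oddScale B c) := by
  refine ⟨ext_homog₂ fun x a hx y b hy => ?_, ext_homog₂ fun x a hx y b hy => ?_⟩
  · have h1 := (hx.tmul hy).even_eq
    refine (congrArg (A.oddScale B c) h1).trans ?_
    refine Eq.trans ?_ ((congrArg (A.tensor B).even (oddScale_tmul hx hy c)).trans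
      ((hx.tmul hy).smul (cond₁ c (a && b))).even_eq).symm
    cases hab : xor a b
    · exact oddScale_tmul hx hy c
    · exact map_zero _
  · have h1 := (hx.tmul hy).mult_d c
    rw [tensor_d_tmul hx] at h1
    have h2 := tensor_d_tmul (P := A.mult c) (P' := B.mult c) hx y
    rw [hx.mult_d, hy.mult_d] at h2
    refine (congrArg (A.oddScale B c) h1).trans ?_
    refine Eq.trans ?_ ((congrArg ((A.mult c).tensor (B.mult c)).d
      (oddScale_tmul hx hy c)).trans ((map_smul _ _ _).trans (congrArg (_ • ·) h2))).symm
    have key : A.oddScale B c (cond₁ c (!xor a b) • (A.d x ⊗ₜ[Q] y + sg Q a • (x ⊗ₜ[Q] B.d y))) =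
        cond₁ c (a && b) • ((cond₁ c (!a) • A.d x) ⊗ₜ[Q] y +
          sg Q a • (x ⊗ₜ[Q] (cond₁ c (!b) • B.d y))) := by
      rw [map_smul, map_add, map_smul, oddScale_tmul hx.d hy, oddScale_tmul hx hy.d]
      cases a <;> cases b <;> simp [cond₁, sg, TensorProduct.smul_tmul']
    exact key

end MF

variable {Z W V : Set (PrimeSpectrum Q)} {f' f₁' f₂' : Q}

lemma K0.mult_cup {c : Q} (hc : IsUnit c) (hV : Z ∩ W ⊆ V) (h : f₁ + f₂ = f) (h₁ : c * f₁ = f₁')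
    (h₂ : c * f₂ = f₂') (h' : c * f = f') (h'' : f₁' + f₂' = f') (x : K0 Z f₁) (y : K0 W f₂) :
    K0.mult hc h' (K0.cup hV h x y) = K0.cup hV h'' (K0.mult hc h₁ x) (K0.mult hc h₂ y) := by
  obtain ⟨P, rfl⟩ := K0.mk_surjective x
  obtain ⟨P', rfl⟩ := K0.mk_surjective y
  rw [K0.cup_mk, K0.mult_mk, K0.mult_mk, K0.mult_mk, K0.cup_mk]
  obtain ⟨c', hc'⟩ := hc.exists_right_inv
  subst h h₁ h₂ h'
  have hom := MF.isHom_oddScale (A := P.1) (B := P'.1) (c := c) rfl h''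
  have e1 := MF.oddScale_oddScale (A := P.1) (B := P'.1) hc'
  have e2 := MF.oddScale_oddScale (A := P.1) (B := P'.1) ((mul_comm _ _).trans hc')
  exact K0.mk_eq_of_iso (a := P.1.oddScale P'.1 c) (b := P.1.oddScale P'.1 c') hom
    (hom.of_inverse e2 e1) e2 e1

end MultTensor

section EigTensor

variable {Q : Type u} [CommRing Q] {p : ℕ} {u z : Q} {M N : Type u} [AddCommGroup M] [Module Q M]
  [AddCommGroup N] [Module Q N] {σ : Module.End Q M} {σ' : Module.End Q N}

/-- On the `z ^ a`-eigenspace of `σ`, the operator `σ ⊗ σ'` has the eigenvalue `z ^ k` exactly where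
`σ'` has the eigenvalue `z ^ (k - a)`. The exponent `k + (p - a)` represents `k - a` by a natural
number. -/
lemma IsStrongRoot.eigProj_map (h : IsStrongRoot p u z) (hσ : σ ^ p = 1) (k : ℕ) :
    eigProj p u (z ^ k) (TensorProduct.map σ σ') = ∑ a ∈ Finset.range p,
      TensorProduct.map (eigProj p u (z ^ a) σ) (eigProj p u (z ^ (k + (p - a))) σ') := by
  -- The spectral decomposition of the powers of `σ`. It is applied to the first tensor factor only;
  -- the sum over `i` that remains is the eigenprojection of `σ'`.
  have h1 : ∀ i, σ ^ i = ∑ a ∈ Finset.range p, (z ^ a) ^ i • eigProj p u (z ^ a) σ := by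
    intro i
    induction i with
    | zero => simp [h.sum_eigProj]
    | succ i ih =>
      rw [pow_succ', ih, Finset.mul_sum]
      refine Finset.sum_congr rfl fun a _ => ?_
      rw [mul_smul_comm, mul_eigProj h.pos hσ (h.pow_pow_eq_one a), smul_smul, pow_succ]
  have h2 : ∀ a ∈ Finset.range p, (z ^ k) ^ (p - 1) * z ^ a = (z ^ (k + (p - a))) ^ (p - 1) := by
    intro a ha
    have ha' := (Finset.mem_range.1 ha).le
    have e1 : z ^ (p - a) * z ^ a = 1 := by
      rw [← pow_add, Nat.sub_add_cancel ha', h.pow_eq_one]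
    have e2 : (z ^ (p - a)) ^ (p - 1) * z ^ (p - a) = 1 := by
      rw [← pow_succ, Nat.sub_add_cancel h.pos, h.pow_pow_eq_one]
    rw [pow_add, mul_pow]
    congr 1
    calc z ^ a = (z ^ (p - a)) ^ (p - 1) * z ^ (p - a) * z ^ a := by rw [e2, one_mul]
      _ = _ := by rw [mul_assoc, e1, mul_one]
  refine TensorProduct.ext' fun x y => ?_
  have h3 : ∀ i, ((σ ^ i) x) ⊗ₜ[Q] ((σ' ^ i) y) = ∑ a ∈ Finset.range p,
      (z ^ a) ^ i • (eigProj p u (z ^ a) σ x ⊗ₜ[Q] ((σ' ^ i) y)) := by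
    intro i
    rw [h1, LinearMap.sum_apply, TensorProduct.sum_tmul]
    rfl
  rw [LinearMap.sum_apply]
  have h4 : ∀ a ∈ Finset.range p, TensorProduct.map (eigProj p u (z ^ a) σ)
      (eigProj p u (z ^ (k + (p - a))) σ') (x ⊗ₜ[Q] y) = u • ∑ i ∈ Finset.range p,
        ((z ^ k) ^ (p - 1)) ^ i • (z ^ a) ^ i • (eigProj p u (z ^ a) σ x ⊗ₜ[Q] ((σ' ^ i) y)) := by
    intro a ha
    have h5 : eigProj p u (z ^ (k + (p - a))) σ' y = u • ∑ i ∈ Finset.range p,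
        (((z ^ k) ^ (p - 1)) ^ i * (z ^ a) ^ i) • (σ' ^ i) y := by
      simp only [eigProj, ← h2 a ha, smul_pow, LinearMap.smul_apply, LinearMap.sum_apply, mul_pow]
    rw [TensorProduct.map_tmul, h5, TensorProduct.tmul_smul, TensorProduct.tmul_sum]
    simp only [TensorProduct.tmul_smul, mul_smul]
  rw [Finset.sum_congr rfl h4, ← Finset.smul_sum, Finset.sum_comm]
  simp only [← Finset.smul_sum, ← h3]
  simp only [eigProj, LinearMap.smul_apply, LinearMap.sum_apply, smul_pow, TensorProduct.map_pow,
    TensorProduct.map_tmul]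

end EigTensor

/-! ### The product formula. -/

section K0

variable {Q : Type u} [CommRing Q] {p : ℕ} [Algebra (Ap p) Q] {Z W V : Set (PrimeSpectrum Q)}
  {f f₁ f₂ : Q}

/-- The shuffle carries the cycle of the product to the tensor product of the two cycles, whose
eigenprojection is a sum over `a`. Its summands are orthogonal already in the first factor. -/
lemma K0.mk_eig_tensorTo (hp : p.Prime) (k : ℕ) (hV : Z ∩ W ⊆ V) (h : f₁ + f₂ = f)
    (h' : p * f₁ + p * f₂ = p * f) (P : MFZ Z f₁) (P' : MFZ W f₂) :
    K0.mk ((MFZ.tensorTo hV h P P').eig hp k) = ∑ a ∈ Finset.range p,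
      K0.cup hV h' (K0.mk (P.eig hp a)) (K0.mk (P'.eig hp (k + (p - a)))) := by
  subst h
  have hz := isStrongRoot_zetaQ Q hp
  have hσ := P.1.rot_pow p
  have hom := MF.isHom_shuffle P.1 P'.1 p h'
  have e1 := MF.unshuffle_shuffle P.1 P'.1 p
  have e2 := MF.shuffle_unshuffle P.1 P'.1 p
  have hE := hz.eigProj_map (σ' := P'.1.rot p) hσ k
  have hr : MF.IsRetract ((MFZ.tensorTo hV rfl P P').eig hp k).1 ((P.1.tensor P'.1).tpow p)
    (eigProj p (invQ p Q) (zetaQ p Q ^ k) ((P.1.tensor P'.1).rot p)) :=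
    (MFZ.tensorTo hV rfl P P').isRetract_eig hp k
  have hr' : MF.IsRetract ((MFZ.tensorTo hV rfl P P').eig hp k).1
      (((P.1.tpow p).tensor (P'.1.tpow p)).ofEq h') (∑ a ∈ Finset.range p, TensorProduct.map
        (eigProj p (invQ p Q) (zetaQ p Q ^ a) (P.1.rot p))
        (eigProj p (invQ p Q) (zetaQ p Q ^ (k + (p - a))) (P'.1.rot p))) := by
    obtain ⟨i, r, hi, hr, h1, h2⟩ := hr
    refine ⟨P.1.shuffle P'.1 p ∘ₗ i, r ∘ₗ P.1.unshuffle P'.1 p, hom.comp hi,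
      hr.comp (hom.of_inverse e1 e2), fun x => ?_, fun x => ?_⟩
    · exact (congrArg r (e1 (i x))).trans (h1 x)
    · refine (congrArg (P.1.shuffle P'.1 p) (h2 _)).trans ?_
      refine (eigProj_intertwine (MF.shuffle_rot (P := P.1) (P' := P'.1) p) _).trans ?_
      exact (congrArg _ (e2 x)).trans (LinearMap.congr_fun hE x)
  rw [K0.mk_isRetract_sum _ (fun a => MFZ.tensorTo hV h' (P.eig hp a) (P'.eig hp (k + (p - a))))
    (fun a _ => ((P.isRetract_eig hp a).tensor (P'.isRetract_eig hp _)).ofEq h') ?_ hr']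
  · exact Finset.sum_congr rfl fun a _ => (K0.cup_mk _ _ _ _).symm
  · intro a ha b hb hab
    refine (TensorProduct.map_comp _ _ _ _).symm.trans ?_
    refine (congrArg (fun g => TensorProduct.map g _) (hz.eigProj_mul_eigProj hσ ?_)).trans
      (TensorProduct.map_zero_left _)
    rwa [Nat.mod_eq_of_lt (Finset.mem_range.1 ha), Nat.mod_eq_of_lt (Finset.mem_range.1 hb)]

lemma t_cup (hp : p.Prime) (k : ℕ) (hV : Z ∩ W ⊆ V) (h : f₁ + f₂ = f) (x : K0 Z f₁)
    (y : K0 W f₂) : t hp k (K0.cup hV h x y) =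
      ∑ a ∈ Finset.range p, K0.cup hV h (t hp a x) (t hp (k + (p - a)) y) := by
  obtain ⟨P, rfl⟩ := K0.mk_surjective x
  obtain ⟨P', rfl⟩ := K0.mk_surjective y
  have h' : p * f₁ + p * f₂ = p * f := by rw [← h, mul_add]
  rw [K0.cup_mk, t_mk, K0.mk_t, K0.mk_eig_tensorTo hp k hV h h', map_sum]
  refine Finset.sum_congr rfl fun a _ => ?_
  rw [K0.mult_cup _ hV h' (invQ_mul_mul hp f₁) (invQ_mul_mul hp f₂) _ h, t_mk, t_mk, K0.mk_t,
    K0.mk_t]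

lemma t_of_dvd (hp : p.Prime) {k : ℕ} (hk : p ∣ k) (x : K0 Z f) : t hp k x = t hp 0 x := by
  obtain ⟨P, rfl⟩ := K0.mk_surjective x
  have hz : zetaQ p Q ^ k = zetaQ p Q ^ 0 := by
    obtain ⟨m, rfl⟩ := hk
    rw [pow_mul, (isStrongRoot_zetaQ Q hp).pow_eq_one, one_pow, pow_zero]
  have h := P.isRetract_eig hp k
  rw [hz] at h
  rw [t_mk, t_mk, K0.mk_t, K0.mk_t, K0.mk_eq_of_isRetract_same h (P.isRetract_eig hp 0)]

/-- Write `x₀, x₁` for `t 0 x, t 1 x`, and likewise for `y`. As all `t k` with `p ∤ k` agree, the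
product formula reads `t 0 (x y) = x₀ y₀ + (p - 1) x₁ y₁` and `t 1 (x y) = x₀ y₁ + x₁ y₀ + (p - 2)
x₁ y₁`. In the second sum the indices `a = 0` and `a = 1` are exceptional, since there one of the
two eigenvalues is `1`. The difference is `(x₀ - x₁)(y₀ - y₁)`. -/
lemma cPsi_cup (hp : p.Prime) (hV : Z ∩ W ⊆ V) (h : f₁ + f₂ = f) (x : K0 Z f₁) (y : K0 W f₂) :
    cPsi hp (K0.cup hV h x y) = K0.cup hV h (cPsi hp x) (cPsi hp y) := by
  have h0 : t hp 0 (K0.cup hV h x y) = K0.cup hV h (t hp 0 x) (t hp 0 y) +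
      (p - 1) • K0.cup hV h (t hp 1 x) (t hp 1 y) := by
    rw [t_cup, ← Finset.add_sum_erase _ _ (Finset.mem_range.2 hp.pos),
      Finset.sum_congr rfl (g := fun _ => K0.cup hV h (t hp 1 x) (t hp 1 y)), Finset.sum_const,
      Finset.card_erase_of_mem (Finset.mem_range.2 hp.pos), Finset.card_range,
      t_of_dvd hp (k := 0 + (p - 0)) (by simp)]
    intro a ha
    obtain ⟨ha0, ha⟩ := Finset.mem_erase.1 ha
    have ha := Finset.mem_range.1 ha
    rw [t_eq hp (Nat.not_dvd_of_pos_of_lt (Nat.pos_of_ne_zero ha0) ha),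
      t_eq hp (k := 0 + (p - a)) (Nat.not_dvd_of_pos_of_lt (by omega) (by omega))]
  have h1 : t hp 1 (K0.cup hV h x y) = K0.cup hV h (t hp 0 x) (t hp 1 y) +
      (K0.cup hV h (t hp 1 x) (t hp 0 y) + (p - 2) • K0.cup hV h (t hp 1 x) (t hp 1 y)) := by
    have h01 : 1 ∈ (Finset.range p).erase 0 :=
      Finset.mem_erase.2 ⟨one_ne_zero, Finset.mem_range.2 hp.one_lt⟩
    rw [t_cup, ← Finset.add_sum_erase _ _ (Finset.mem_range.2 hp.pos),
      ← Finset.add_sum_erase _ _ h01,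
      Finset.sum_congr rfl (g := fun _ => K0.cup hV h (t hp 1 x) (t hp 1 y)), Finset.sum_const,
      Finset.card_erase_of_mem h01, Finset.card_erase_of_mem (Finset.mem_range.2 hp.pos),
      Finset.card_range, t_of_dvd hp (k := 1 + (p - 1)) (by rw [Nat.add_sub_cancel' hp.one_le]),
      t_eq hp (k := 1 + (p - 0)), Nat.sub_sub]
    · rw [Nat.sub_zero, ← Nat.dvd_add_iff_left dvd_rfl]
      exact Nat.not_dvd_of_pos_of_lt one_pos hp.one_lt
    intro a ha
    obtain ⟨ha1, ha⟩ := Finset.mem_erase.1 ha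
    obtain ⟨ha0, ha⟩ := Finset.mem_erase.1 ha
    have ha := Finset.mem_range.1 ha
    rw [t_eq hp (Nat.not_dvd_of_pos_of_lt (Nat.pos_of_ne_zero ha0) ha),
      t_eq hp (k := 1 + (p - a)) (Nat.not_dvd_of_pos_of_lt (by omega) (by omega))]
  have h2 : p - 1 = (p - 2) + 1 := by have := hp.two_le; omega
  rw [cPsi_eq, cPsi_eq, cPsi_eq, h0, h1, h2, succ_nsmul]
  simp only [map_sub, AddMonoidHom.sub_apply]
  abel

end K0

end

end AdamsMF

namespace AdamsMF

noncomputable section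

/-! ### Extension of scalars -/

namespace MF

variable {Q : Type u} [CommRing Q] {f f₁ f₂ : Q} (Q' : Type u) [CommRing Q'] [Algebra Q Q']

open TensorProduct.AlgebraTensorModule in
lemma isHom_distribBaseChange (A : MF Q f₁) (B : MF Q f₂)
    (h : algebraMap Q Q' (f₁ + f₂) = algebraMap Q Q' f₁ + algebraMap Q Q' f₂) :
    IsHom (P := ((A.tensor B).baseChange Q').ofEq h)
      (P' := (A.baseChange Q').tensor (B.baseChange Q'))
      (distribBaseChange Q Q' A.carrier B.carrier).toLinearMap := by
  refine ⟨?_, ?_⟩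
  · have key : (distribBaseChange Q Q' A.carrier B.carrier).toLinearMap ∘ₗ
        (TensorProduct.map A.even B.even + TensorProduct.map A.odd B.odd).baseChange Q' =
        (TensorProduct.map (A.even.baseChange Q') (B.even.baseChange Q') +
          TensorProduct.map (1 - A.even.baseChange Q') (1 - B.even.baseChange Q')) ∘ₗ
          (distribBaseChange Q Q' A.carrier B.carrier).toLinearMap := by
      ext x y
      simp [odd_apply, TensorProduct.tmul_sub, TensorProduct.sub_tmul]
    exact key
  · have key : (distribBaseChange Q Q' A.carrier B.carrier).toLinearMap ∘ₗ
        (TensorProduct.map A.d 1 + TensorProduct.map A.sgn B.d).baseChange Q' =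
        (TensorProduct.map (A.d.baseChange Q') 1 +
          TensorProduct.map (A.even.baseChange Q' - (1 - A.even.baseChange Q'))
            (B.d.baseChange Q')) ∘ₗ
          (distribBaseChange Q Q' A.carrier B.carrier).toLinearMap := by
      ext x y
      simp [sgn_apply, TensorProduct.tmul_sub, TensorProduct.sub_tmul]
    exact key

/-- The comparison `Q' ⊗ T^n P ≃ T^n (Q' ⊗ P)`. -/
def tpowBaseChange (P : MF Q f) : (n : ℕ) → Q' ⊗[Q] (P.tpow n).carrier ≃ₗ[Q']
    ((P.baseChange Q').tpow n).carrier
  | 0 => (TensorProduct.AlgebraTensorModule.rid Q Q' Q' : Q' ⊗[Q] Q ≃ₗ[Q'] Q')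
  | n + 1 => (TensorProduct.AlgebraTensorModule.distribBaseChange Q Q' P.carrier
      (P.tpow n).carrier).trans
        (TensorProduct.congr (LinearEquiv.refl Q' _) (P.tpowBaseChange n))

lemma tpowBaseChange_tprod (P : MF Q f) : ∀ (n : ℕ) (v : ℕ → P.carrier),
    P.tpowBaseChange Q' n (1 ⊗ₜ[Q] P.tprod n v) =
      (P.baseChange Q').tprod n fun i => (1 : Q') ⊗ₜ[Q] v i
  | 0, v => by
    change TensorProduct.AlgebraTensorModule.rid Q Q' Q' ((1 : Q') ⊗ₜ[Q] (1 : Q)) = (1 : Q')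
    simp
  | n + 1, v => by
    refine Eq.trans ?_ (congrArg (((1 : Q') ⊗ₜ[Q] v 0) ⊗ₜ[Q'] ·)
      (tpowBaseChange_tprod P n fun i => v (i + 1)))
    change TensorProduct.congr (LinearEquiv.refl Q' _) (P.tpowBaseChange Q' n)
      (TensorProduct.AlgebraTensorModule.distribBaseChange Q Q' P.carrier (P.tpow n).carrier
        ((1 : Q') ⊗ₜ[Q] (v 0 ⊗ₜ[Q] P.tprod n fun i => v (i + 1)))) = _
    simp

lemma isHom_tpowBaseChange (P : MF Q f) : ∀ (n : ℕ)
    (h : algebraMap Q Q' (n * f) = n * algebraMap Q Q' f),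
    IsHom (P := ((P.tpow n).baseChange Q').ofEq h) (P' := (P.baseChange Q').tpow n)
      (P.tpowBaseChange Q' n).toLinearMap
  | 0, h => by
    refine ⟨?_, ?_⟩
    · have key : (TensorProduct.AlgebraTensorModule.rid Q Q' Q').toLinearMap ∘ₗ
        (1 : Module.End Q Q).baseChange Q' = (1 : Module.End Q' Q') ∘ₗ
          (TensorProduct.AlgebraTensorModule.rid Q Q' Q').toLinearMap := by
        ext; simp
      exact key
    · have key : (TensorProduct.AlgebraTensorModule.rid Q Q' Q').toLinearMap ∘ₗ
        (0 : Module.End Q Q).baseChange Q' = (0 : Module.End Q' Q') ∘ₗ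
          (TensorProduct.AlgebraTensorModule.rid Q Q' Q').toLinearMap := by
        ext; simp
      exact key
  | n + 1, h => by
    have h0 : algebraMap Q Q' (n * f) = n * algebraMap Q Q' f := by simp
    have h1 := isHom_distribBaseChange Q' P (P.tpow n) (map_add _ _ _)
    have h2 := (IsHom.id (P.baseChange Q')).tensor (isHom_tpowBaseChange P n h0)
    refine ⟨?_, ?_⟩
    · refine (congrArg ((TensorProduct.map LinearMap.id
        (P.tpowBaseChange Q' n).toLinearMap) ∘ₗ ·) h1.comm_even).trans ?_
      exact congrArg (· ∘ₗ (TensorProduct.AlgebraTensorModule.distribBaseChange Q Q' P.carrier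
        (P.tpow n).carrier).toLinearMap) h2.comm_even
    · refine (congrArg ((TensorProduct.map LinearMap.id
        (P.tpowBaseChange Q' n).toLinearMap) ∘ₗ ·) h1.comm_d).trans ?_
      exact congrArg (· ∘ₗ (TensorProduct.AlgebraTensorModule.distribBaseChange Q Q' P.carrier
        (P.tpow n).carrier).toLinearMap) h2.comm_d

lemma algebraMap_ksgn (a b : Bool) : algebraMap Q Q' (ksgn Q a b) = ksgn Q' a b := by
  simp [ksgn]

/-- Both sides are linear over `Q'`, so it suffices to compare them on `1 ⊗ v` for a pure tensor `v`
of homogeneous elements. There both cycles act by the same permutation and the same sign. -/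
lemma tpowBaseChange_rot (P : MF Q f) : ∀ (n : ℕ) (t : Q' ⊗[Q] (P.tpow n).carrier),
    P.tpowBaseChange Q' n ((P.rot n).baseChange Q' t) =
      (P.baseChange Q').rot n (P.tpowBaseChange Q' n t)
  | 0, t => congrArg _ (LinearMap.congr_fun (LinearMap.baseChange_id) t)
  | n + 1, t => by
    have key : (P.rot (n + 1)).baseChange Q' = (P.tpowBaseChange Q' (n + 1)).symm.toLinearMap ∘ₗ
        (P.baseChange Q').rot (n + 1) ∘ₗ (P.tpowBaseChange Q' (n + 1)).toLinearMap := by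
      refine TensorProduct.AlgebraTensorModule.curry_injective (LinearMap.ext_ring ?_)
      refine P.ext_tprod (n + 1) fun v b hv => ?_
      have hv' : (P.baseChange Q').Homog (fun i => (1 : Q') ⊗ₜ[Q] v i) b := fun i => by
        change (1 : Q') ⊗ₜ[Q] v i - (1 : Q') ⊗ₜ[Q] P.even (v i) = _
        rw [← TensorProduct.tmul_sub, ← odd_apply, hv i]
        cases b i
        · exact TensorProduct.tmul_zero _ _
        · rfl
      have e1 : P.rot (n + 1) (P.tprod (n + 1) v) = _ := P.cyc_tprod n v b hv
      have e2 : (P.baseChange Q').rot (n + 1) ((P.baseChange Q').tprod (n + 1) _) = _ :=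
        (P.baseChange Q').cyc_tprod n _ b hv'
      change (1 : Q') ⊗ₜ[Q] P.rot (n + 1) (P.tprod (n + 1) v) =
        (P.tpowBaseChange Q' (n + 1)).symm ((P.baseChange Q').rot (n + 1)
          (P.tpowBaseChange Q' (n + 1) ((1 : Q') ⊗ₜ[Q] P.tprod (n + 1) v)))
      rw [LinearEquiv.eq_symm_apply, tpowBaseChange_tprod, e2, e1]
      let w : ℕ → P.carrier := fun i => i.casesOn (v n) v
      refine (congrArg (P.tpowBaseChange Q' (n + 1)) (TensorProduct.tmul_smul _ _ _)).trans ?_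
      rw [algebra_compatible_smul Q', map_smul, map_prod]
      simp only [algebraMap_ksgn]
      exact congrArg _ (P.tpowBaseChange_tprod Q' (n + 1) w)
    have h1 := congrArg (P.tpowBaseChange Q' (n + 1)) (LinearMap.congr_fun key t)
    exact h1.trans (LinearEquiv.apply_symm_apply _ _)

lemma IsHom.mult_baseChange {A : MF Q f₁} {g : Q'} {B : MF Q' g} {h : algebraMap Q Q' f₁ = g}
    {β : Q' ⊗[Q] A.carrier →ₗ[Q'] B.carrier}
    (hβ : IsHom (P := (A.baseChange Q').ofEq h) (P' := B) β) {c f : Q} {c' f' : Q'}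
    (hc : algebraMap Q Q' c = c') (h₁ : c * f₁ = f) (h₂ : algebraMap Q Q' f = f')
    (h₃ : c' * g = f') :
    IsHom (P := (((A.mult c).ofEq h₁).baseChange Q').ofEq h₂) (P' := (B.mult c').ofEq h₃) β := by
  refine ⟨hβ.comm_even, ?_⟩
  have e1 : ∀ t, β (A.even.baseChange Q' t) = B.even (β t) := hβ.apply_even
  have e2 : ∀ t, β (A.d.baseChange Q' t) = B.d (β t) := hβ.apply_d
  have e3 : (A.d * (A.odd + c • A.even)).baseChange Q' = A.d.baseChange Q' *
      ((1 - A.even.baseChange Q') + c' • A.even.baseChange Q') := by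
    subst hc
    ext x
    simp [odd_apply, TensorProduct.tmul_sub, TensorProduct.tmul_add]
  have key : β ∘ₗ (A.d * (A.odd + c • A.even)).baseChange Q' =
      (B.d * (B.odd + c' • B.even)) ∘ₗ β := by
    rw [e3]
    refine LinearMap.ext fun t => ?_
    change β (A.d.baseChange Q' (t - A.even.baseChange Q' t + c' • A.even.baseChange Q' t)) =
      B.d (β t - B.even (β t) + c' • B.even (β t))
    rw [e2, map_add, map_sub, map_smul, e1]
  exact key

end MF

lemma eigProj_baseChange {Q : Type u} [CommRing Q] (Q' : Type u) [CommRing Q'] [Algebra Q Q']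
    {M : Type u} [AddCommGroup M] [Module Q M] (p : ℕ) (c ζ : Q) (σ : Module.End Q M) :
    (eigProj p c ζ σ).baseChange Q' =
      eigProj p (algebraMap Q Q' c) (algebraMap Q Q' ζ) (σ.baseChange Q') := by
  have h : ∀ i, (σ ^ i).baseChange Q' = (σ.baseChange Q') ^ i := fun i => by
    induction i with
    | zero => exact LinearMap.baseChange_id
    | succ i ih =>
      rw [pow_succ, pow_succ, ← ih]
      exact LinearMap.baseChange_comp _ _
  ext x
  simp [eigProj, smul_pow, TensorProduct.tmul_sum, ← h]
  refine congrArg _ (Finset.sum_congr rfl fun i _ => ?_)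
  rw [← map_pow, ← map_pow, algebraMap_smul]

section K0

variable {p : ℕ} {Q : Type u} [CommRing Q] [Algebra (Ap p) Q] {f : Q} {Z : Set (PrimeSpectrum Q)}
  (Q' : Type u) [CommRing Q'] [Algebra (Ap p) Q'] [Algebra Q Q'] [IsScalarTower (Ap p) Q Q']
  {Z' : Set (PrimeSpectrum Q')}

/-- The eigenprojection is a polynomial in the cycle with coefficients in the image of `A_p`. Since
`Q → Q'` is compatible with the structures of `A_p`-algebra, extension of scalars carries it to the
eigenprojection over `Q'`. -/
lemma K0.baseChange_t (hp : p.Prime) (k : ℕ)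
    (hZ : PrimeSpectrum.comap (algebraMap Q Q') ⁻¹' Z ⊆ Z') (x : K0 Z f) :
    K0.baseChange Q' hZ (t hp k x) = t hp k (K0.baseChange Q' hZ x) := by
  obtain ⟨P, rfl⟩ := K0.mk_surjective x
  rw [t_mk, K0.baseChange_mk, K0.baseChange_mk, t_mk]
  have hu : algebraMap Q Q' (invQ p Q) = invQ p Q' := (IsScalarTower.algebraMap_apply _ _ _ _).symm
  have hζ : algebraMap Q Q' (zetaQ p Q) = zetaQ p Q' :=
    (IsScalarTower.algebraMap_apply _ _ _ _).symm
  have h1 := (((P.isRetract_eig hp k).mult (invQ p Q)).ofEq (invQ_mul_mul hp f)).baseChange Q'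
  have h2 := (((P.baseChange Q' hZ).isRetract_eig hp k).mult (invQ p Q')).ofEq
    (invQ_mul_mul hp (algebraMap Q Q' f))
  have hβ := (P.1.isHom_tpowBaseChange Q' p (by simp)).mult_baseChange Q' hu (invQ_mul_mul hp f)
    rfl (invQ_mul_mul hp _)
  have e1 : ∀ x, (P.1.tpowBaseChange Q' p).symm (P.1.tpowBaseChange Q' p x) = x :=
    LinearEquiv.symm_apply_apply _
  have e2 : ∀ x, P.1.tpowBaseChange Q' p ((P.1.tpowBaseChange Q' p).symm x) = x :=
    LinearEquiv.apply_symm_apply _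
  have e3 : ∀ x, P.1.tpowBaseChange Q' p
      ((eigProj p (invQ p Q) (zetaQ p Q ^ k) (P.1.rot p)).baseChange Q' x) =
      eigProj p (invQ p Q') (zetaQ p Q' ^ k) ((P.1.baseChange Q').rot p)
        (P.1.tpowBaseChange Q' p x) := by
    intro x
    rw [eigProj_baseChange, map_pow, hu, hζ]
    exact eigProj_intertwine (a := (P.1.tpowBaseChange Q' p).toLinearMap)
      (P.1.tpowBaseChange_rot Q' p) x
  refine K0.mk_eq_of_isRetract (R := (P.t hp k).baseChange Q' hZ)
    (R' := (P.baseChange Q' hZ).t hp k) h1 h2 hβ (hβ.of_inverse e1 e2) (fun x => ?_) fun x => ?_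
  · refine (congrArg (fun y => (eigProj p (invQ p Q) (zetaQ p Q ^ k) (P.1.rot p)).baseChange Q'
      ((P.1.tpowBaseChange Q' p).symm y)) (e3 _).symm).trans ?_
    refine (congrArg ((eigProj p (invQ p Q) (zetaQ p Q ^ k) (P.1.rot p)).baseChange Q')
      (e1 _)).trans ?_
    exact (congrArg _ (h1.idem x)).trans (h1.idem x)
  · refine (congrArg (eigProj p (invQ p Q') (zetaQ p Q' ^ k) ((P.1.baseChange Q').rot p))
      ((e3 _).trans (congrArg _ (e2 _)))).trans ?_
    exact (congrArg _ (h2.idem x)).trans (h2.idem x)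

lemma K0.baseChange_cPsi (hp : p.Prime) (hZ : PrimeSpectrum.comap (algebraMap Q Q') ⁻¹' Z ⊆ Z')
    (x : K0 Z f) : K0.baseChange Q' hZ (cPsi hp x) = cPsi hp (K0.baseChange Q' hZ x) := by
  rw [cPsi_eq, cPsi_eq, map_sub, K0.baseChange_t, K0.baseChange_t]

end K0

end

end AdamsMF

/-! ### Rank-one factorizations: Clifford operators on the tensor power. -/

namespace AdamsMF

noncomputable section

/-! ### Clifford operators -/

section Clifford

variable {A : Type*} [Ring A]

/-- Creation operators `v i` and annihilation operators `w i`, for `i < N`. -/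
structure IsClifford (N : ℕ) (v w : ℕ → A) : Prop where
  v_v : ∀ i < N, ∀ j < N, i ≠ j → v i * v j = -(v j * v i)
  w_w : ∀ i < N, ∀ j < N, i ≠ j → w i * w j = -(w j * w i)
  v_w : ∀ i < N, ∀ j < N, i ≠ j → v i * w j = -(w j * v i)
  w_sq : ∀ i < N, w i * w i = 0
  w_v : ∀ i < N, w i * v i + v i * w i = 1

/-- The projection onto the joint kernel of `w i`, `i < m`. -/
def vacProj (v w : ℕ → A) : ℕ → A
  | 0 => 1
  | m + 1 => vacProj v w m * (w m * v m)

namespace IsClifford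

variable {N : ℕ} {v w : ℕ → A}

lemma w_comm (h : IsClifford N v w) {i j : ℕ} (hi : i < N) (hj : j < N) (hij : i ≠ j) :
    Commute (w i) (w j * v j) := by
  change w i * (w j * v j) = w j * v j * w i
  rw [← mul_assoc, h.w_w i hi j hj hij, neg_mul, mul_assoc, mul_assoc, h.v_w j hj i hi hij.symm,
    mul_neg]

lemma v_comm (h : IsClifford N v w) {i j : ℕ} (hi : i < N) (hj : j < N) (hij : i ≠ j) :
    Commute (v i) (w j * v j) := by
  change v i * (w j * v j) = w j * v j * v i
  rw [← mul_assoc, h.v_w i hi j hj hij, neg_mul, mul_assoc, mul_assoc, h.v_v i hi j hj hij,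
    mul_neg, neg_neg]

lemma w_comm_vacProj (h : IsClifford N v w) {m k : ℕ} (hmk : m ≤ k) (hk : k < N) :
    Commute (w k) (vacProj v w m) := by
  induction m with
  | zero => exact Commute.one_right _
  | succ m ih =>
    exact (ih (by omega)).mul_right (h.w_comm hk (by omega) (by omega))

lemma v_comm_vacProj (h : IsClifford N v w) {m k : ℕ} (hmk : m ≤ k) (hk : k < N) :
    Commute (v k) (vacProj v w m) := by
  induction m with
  | zero => exact Commute.one_right _
  | succ m ih =>
    exact (ih (by omega)).mul_right (h.v_comm hk (by omega) (by omega))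

lemma w_v_idem (h : IsClifford N v w) {i : ℕ} (hi : i < N) :
    (w i * v i) * (w i * v i) = w i * v i := by
  have h1 : v i * w i = 1 - w i * v i := eq_sub_of_add_eq' (h.w_v i hi)
  have h2 : (w i * v i) * (w i * v i) = w i * (v i * w i) * v i := by noncomm_ring
  rw [h2, h1, mul_sub, ← mul_assoc, h.w_sq i hi, mul_one, zero_mul, sub_zero]

lemma vacProj_idem (h : IsClifford N v w) {m : ℕ} (hm : m ≤ N) :
    vacProj v w m * vacProj v w m = vacProj v w m := by
  induction m with
  | zero => exact mul_one _
  | succ m ih =>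
    have hc : Commute (w m * v m) (vacProj v w m) :=
      (h.w_comm_vacProj le_rfl hm).mul_left (h.v_comm_vacProj le_rfl hm)
    change vacProj v w m * (w m * v m) * (vacProj v w m * (w m * v m)) = _
    rw [mul_assoc, ← mul_assoc (w m * v m), hc.eq, mul_assoc, h.w_v_idem hm, ← mul_assoc,
      ih (by omega)]
    rfl

lemma w_mul_vacProj (h : IsClifford N v w) {m j : ℕ} (hj : j < m) (hm : m ≤ N) :
    w j * vacProj v w m = 0 := by
  induction m with
  | zero => omega
  | succ m ih =>
    change w j * (vacProj v w m * (w m * v m)) = 0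
    rw [← mul_assoc]
    rcases Nat.lt_succ_iff_lt_or_eq.1 hj with hj | rfl
    · rw [ih hj (by omega), zero_mul]
    · rw [(h.w_comm_vacProj le_rfl hm).eq, mul_assoc, ← mul_assoc (w j), h.w_sq j hm, zero_mul,
        mul_zero]

end IsClifford

end Clifford

namespace MF

variable {Q : Type u} [CommRing Q] {f : Q} {T : MF Q f}

/-- An odd operator that anticommutes with the differential. -/
def IsOddHom (a : Module.End Q T.carrier) : Prop := IsHom (P := T) (P' := T.shift) a

lemma IsOddHom.symm {a : Module.End Q T.carrier} (h : IsOddHom a) :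
    IsHom (P := T.shift) (P' := T) a := by
  have h1 : ∀ x, a (T.even x) = a x - T.even (a x) → a (x - T.even x) = T.even (a x) := by
    intro x hx
    rw [map_sub, hx, sub_sub_cancel]
  refine ⟨LinearMap.ext fun x : T.carrier => ?_, LinearMap.ext fun x : T.carrier => ?_⟩
  · have h2 : a (T.even x) = T.even (a x) - T.even (a x) + (a x - T.even (a x)) :=
      (h.apply_even x).trans (by rw [sub_self, zero_add]; rfl)
    change a (x - T.even x) = T.even (a x)
    rw [map_sub, h2]
    abel
  · have h2 : a (T.d x) = -T.d (a x) := h.apply_d x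
    change a (-T.d x) = T.d (a x)
    rw [map_neg, h2, neg_neg]

lemma IsOddHom.smul {a : Module.End Q T.carrier} (h : IsOddHom a) (c : Q) : IsOddHom (c • a) := by
  refine ⟨LinearMap.ext fun x : T.carrier => ?_, LinearMap.ext fun x : T.carrier => ?_⟩
  · exact (congrArg (c • ·) (h.apply_even x)).trans (map_smul T.shift.even c (a x)).symm
  · exact (congrArg (c • ·) (h.apply_d x)).trans (map_smul T.shift.d c (a x)).symm

lemma IsOddHom.mul {a b : Module.End Q T.carrier} (ha : IsOddHom a) (hb : IsOddHom b) :
    IsHom (P := T) (P' := T) (a * b) := ha.symm.comp hb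

lemma IsHom.shift {P R : MF Q f} {g : P.carrier →ₗ[Q] R.carrier} (h : IsHom g) :
    IsHom (P := P.shift) (P' := R.shift) g := by
  refine ⟨LinearMap.ext fun x : P.carrier => ?_, LinearMap.ext fun x : P.carrier => ?_⟩
  · change g (x - P.even x) = g x - R.even (g x)
    rw [map_sub, h.apply_even]
  · change g (-P.d x) = -R.d (g x)
    rw [map_neg, h.apply_d]

lemma IsRetract.shift {R P : MF Q f} {ε : Module.End Q P.carrier} (h : IsRetract R P ε) :
    IsRetract R.shift P.shift ε := by
  obtain ⟨i, r, hi, hr, h1, h2⟩ := h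
  exact ⟨i, r, hi.shift, hr.shift, h1, h2⟩

end MF

/-! ### Removal of Clifford operators in the Grothendieck group -/

/-- The relation `ha` says that `a` multiplies eigenvalues of `σ` by `z ^ c`. -/
lemma eigProj_shift {Q : Type u} [CommRing Q] {M : Type u} [AddCommGroup M] [Module Q M]
    {p : ℕ} {u z : Q} {σ a : Module.End Q M} {c : ℕ} (hz : z ^ p = 1) (hp : 0 < p)
    (ha : σ * a = z ^ c • (a * σ)) (k : ℕ) :
    a * eigProj p u (z ^ k) σ = eigProj p u (z ^ (k + c)) σ * a := by
  have h1 : ∀ x, a (σ x) = (z ^ (c * (p - 1)) • σ) (a x) := by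
    intro x
    have h2 : σ (a x) = z ^ c • a (σ x) := LinearMap.congr_fun ha x
    rw [LinearMap.smul_apply, h2, smul_smul, ← pow_add]
    have h3 : c * (p - 1) + c = p * c := by
      rw [← Nat.mul_succ, Nat.succ_eq_add_one, Nat.sub_add_cancel hp, mul_comm]
    rw [h3, pow_mul, hz, one_pow, one_smul]
  refine LinearMap.ext fun x => (eigProj_intertwine h1 x).trans ?_
  rw [eigProj, smul_smul, ← pow_mul, ← pow_add, ← add_mul, pow_mul]
  rfl

section Strip

variable {Q : Type u} [CommRing Q] {f : Q} {Z : Set (PrimeSpectrum Q)}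

/-- Clifford operators on a matrix factorization with an operator `σ` of order `p`, of weights
`z ^ (i + 1)` and `z ^ -(i + 1)`. -/
structure IsCliffordSystem (T : MF Q f) (p : ℕ) (z : Q) (σ : Module.End Q T.carrier) (N : ℕ)
    (v w : ℕ → Module.End Q T.carrier) : Prop extends IsClifford N v w where
  v_hom : ∀ i < N, MF.IsOddHom (v i)
  w_hom : ∀ i < N, MF.IsOddHom (w i)
  σ_v : ∀ i < N, σ * v i = z ^ (i + 1) • (v i * σ)
  σ_w : ∀ i < N, σ * w i = z ^ ((i + 1) * (p - 1)) • (w i * σ)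

variable {T : MF Q f} {p : ℕ} {u z : Q} {σ : Module.End Q T.carrier} {N : ℕ}
  {v w : ℕ → Module.End Q T.carrier}

namespace IsCliffordSystem

lemma isHom_vacProj (h : IsCliffordSystem T p z σ N v w) {m : ℕ} (hm : m ≤ N) :
    MF.IsHom (P := T) (P' := T) (vacProj v w m) := by
  induction m with
  | zero => exact MF.isHom_one T
  | succ m ih => exact (ih (by omega)).mul ((h.w_hom m hm).mul (h.v_hom m hm))

lemma pow_succ_mul (hz : IsStrongRoot p u z) (m : ℕ) : z ^ ((m + 1) * (p - 1)) * z ^ (m + 1) = 1 := by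
  rw [← pow_add, ← Nat.mul_succ, Nat.succ_eq_add_one, Nat.sub_add_cancel hz.pos, mul_comm, pow_mul,
    hz.pow_eq_one, one_pow]

lemma σ_vacProj (h : IsCliffordSystem T p z σ N v w) (hz : IsStrongRoot p u z) {m : ℕ}
    (hm : m ≤ N) : Commute σ (vacProj v w m) := by
  induction m with
  | zero => exact Commute.one_right _
  | succ m ih =>
    refine (ih (by omega)).mul_right ?_
    change σ * (w m * v m) = w m * v m * σ
    rw [← mul_assoc, h.σ_w m hm, smul_mul_assoc, mul_assoc, h.σ_v m hm, mul_smul_comm, smul_smul,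
      pow_succ_mul hz, one_smul, mul_assoc]

lemma vacProj_eigProj (h : IsCliffordSystem T p z σ N v w) (hz : IsStrongRoot p u z) {m : ℕ}
    (hm : m ≤ N) (k : ℕ) : vacProj v w m * eigProj p u (z ^ k) σ =
      eigProj p u (z ^ k) σ * vacProj v w m :=
  eigProj_comm (h.σ_vacProj hz hm).eq.symm

/-- The joint kernel of `w i`, `i < m`, in the eigenspaces. -/
lemma exists_isRetract (h : IsCliffordSystem T p z σ N v w) (hz : IsStrongRoot p u z)
    (hσ : MF.IsHom (P := T) (P' := T) σ) (hσp : σ ^ p = 1) (hT : T.support ⊆ Z) :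
    ∃ R : ℕ → ℕ → MFZ Z f, ∀ m ≤ N, ∀ k,
      MF.IsRetract (R m k).1 T (vacProj v w m * eigProj p u (z ^ k) σ) := by
  have key : ∀ m k, ∃ R : MFZ Z f, m ≤ N →
      MF.IsRetract R.1 T (vacProj v w m * eigProj p u (z ^ k) σ) := by
    intro m k
    by_cases hm : m ≤ N
    · obtain ⟨R, hR⟩ := MF.exists_isRetract (P := T)
        (ε := vacProj v w m * eigProj p u (z ^ k) σ)
        ((h.isHom_vacProj hm).mul (isHom_eigProj hσ)) (by
          rw [mul_assoc, ← mul_assoc (eigProj _ _ _ _), ← h.vacProj_eigProj hz hm, mul_assoc,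
            eigProj_idem hz.pos hz.inv_mul hσp (hz.pow_pow_eq_one k), ← mul_assoc,
            h.vacProj_idem hm])
      exact ⟨⟨R, hR.support_subset.trans hT⟩, fun _ => hR⟩
    · exact ⟨Classical.arbitrary _, fun h => absurd h hm⟩
  choose R hR using key
  exact ⟨R, fun m hm k => hR m k hm⟩

/-- On the summand `R` the operators `w m * v m` and `v m * w m` are complementary idempotents. The
first cuts out `R₁`. The image of the second is carried isomorphically by `w m` into the kernel of
`w m` in the eigenspace of weight lowered by `m + 1`, which is `R₂`. As `w m` is odd, the
isomorphism is with the shift of `R₂`, and this gives the minus sign. -/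
lemma mk_step (h : IsCliffordSystem T p z σ N v w) (hz : IsStrongRoot p u z)
    (hσ : MF.IsHom (P := T) (P' := T) σ) (hσp : σ ^ p = 1) (hT : T.support ⊆ Z) {m : ℕ}
    (hm : m < N) (k : ℕ) {R R₁ R₂ : MFZ Z f}
    (hR : MF.IsRetract R.1 T (vacProj v w m * eigProj p u (z ^ k) σ))
    (hR₁ : MF.IsRetract R₁.1 T (vacProj v w (m + 1) * eigProj p u (z ^ k) σ))
    (hR₂ : MF.IsRetract R₂.1 T
      (vacProj v w (m + 1) * eigProj p u (z ^ (k + (m + 1) * (p - 1))) σ)) :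
    K0.mk R = K0.mk R₁ - K0.mk R₂ := by
  set q := vacProj v w m with hq
  have hq' : vacProj v w (m + 1) = q * (w m * v m) := rfl
  rw [hq'] at hR₁ hR₂
  set π := eigProj p u (z ^ k) σ with hπ
  set π' := eigProj p u (z ^ (k + (m + 1) * (p - 1))) σ with hπ'
  have hqπ : q * π = π * q := h.vacProj_eigProj hz hm.le k
  have hqπ' : q * π' = π' * q := h.vacProj_eigProj hz hm.le _
  have hππ : π * π = π := eigProj_idem hz.pos hz.inv_mul hσp (hz.pow_pow_eq_one k)
  have hqq : q * q = q := h.vacProj_idem hm.le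
  have hwq : w m * q = q * w m := h.w_comm_vacProj le_rfl hm
  have hvq : v m * q = q * v m := h.v_comm_vacProj le_rfl hm
  have hw : w m * π = π' * w m := eigProj_shift hz.pow_eq_one hz.pos (h.σ_w m hm) k
  have hv : v m * π' = π * v m := by
    rw [hπ', eigProj_shift hz.pow_eq_one hz.pos (h.σ_v m hm), hπ]
    congr 2
    rw [pow_add, pow_add, mul_assoc, pow_succ_mul hz, mul_one]
  have hwv : w m * v m + v m * w m = 1 := h.w_v m hm
  have hww : w m * w m = 0 := h.w_sq m hm
  have hvw1 : v m * w m = 1 - w m * v m := eq_sub_of_add_eq' hwv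
  have hwvw : w m * v m * w m = w m := by
    rw [mul_assoc, hvw1, mul_sub, ← mul_assoc, hww, zero_mul, sub_zero, mul_one]
  have hvwvw : v m * w m * (v m * w m) = v m * w m := by
    rw [mul_assoc, ← mul_assoc (w m), hwvw]
  have hvwπ : v m * w m * π = π * (v m * w m) := by
    rw [mul_assoc, hw, ← mul_assoc, hv, mul_assoc]
  have hvwq : v m * w m * q = q * (v m * w m) := by
    rw [mul_assoc, hwq, ← mul_assoc, hvq, mul_assoc]
  have hwvπ : w m * v m * π = π * (w m * v m) := by
    have : w m * v m = 1 - v m * w m := eq_sub_of_add_eq hwv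
    rw [this, sub_mul, hvwπ, mul_sub, one_mul, mul_one]
  have hwvq : w m * v m * q = q * (w m * v m) := by
    rw [mul_assoc, hvq, ← mul_assoc, hwq, mul_assoc]
  -- `q`, `v m * w m` and `π` are commuting idempotents, so their product is idempotent.
  have hb : q * (v m * w m) * π * (q * (v m * w m) * π) = q * (v m * w m) * π := by
    calc q * (v m * w m) * π * (q * (v m * w m) * π)
        = q * (v m * w m) * (π * q) * (v m * w m) * π := by noncomm_ring
      _ = q * (v m * w m) * q * (π * (v m * w m)) * π := by rw [← hqπ]; noncomm_ring
      _ = q * (v m * w m * q) * (v m * w m) * (π * π) := by rw [← hvwπ]; noncomm_ring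
      _ = (q * q) * (v m * w m * (v m * w m)) * (π * π) := by rw [hvwq]; noncomm_ring
      _ = _ := by rw [hqq, hππ, hvwvw]
  have hom₂ : MF.IsHom (P := T) (P' := T) (q * (v m * w m) * π) :=
    ((h.isHom_vacProj hm.le).mul ((h.v_hom m hm).mul (h.w_hom m hm))).mul (isHom_eigProj hσ)
  obtain ⟨S, hS⟩ := MF.exists_isRetract hom₂ hb
  let S' : MFZ Z f := ⟨S, hS.support_subset.trans hT⟩
  have h0 : w m * v m * (v m * w m) = 0 := by
    rw [hvw1, mul_sub, mul_one, h.w_v_idem hm, sub_self]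
  have h0' : v m * w m * (w m * v m) = 0 := by
    rw [mul_assoc, ← mul_assoc (w m), hww, zero_mul, mul_zero]
  have hadd : K0.mk R = K0.mk R₁ + K0.mk S' := by
    refine K0.mk_isRetract_add (hR.congr ?_) hR₁ (R₂ := S') hS ?_ ?_
    · rw [← add_mul, ← mul_add, hwv, mul_one]
    · calc q * (w m * v m) * π * (q * (v m * w m) * π)
          = q * (w m * v m) * (π * q) * (v m * w m) * π := by noncomm_ring
        _ = q * (w m * v m) * q * (π * (v m * w m)) * π := by rw [← hqπ]; noncomm_ring
        _ = q * (w m * v m * q) * (v m * w m) * (π * π) := by rw [← hvwπ]; noncomm_ring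
        _ = (q * q) * (w m * v m * (v m * w m)) * (π * π) := by rw [hwvq]; noncomm_ring
        _ = 0 := by rw [h0, mul_zero, zero_mul]
    · calc q * (v m * w m) * π * (q * (w m * v m) * π)
          = q * (v m * w m) * (π * q) * (w m * v m) * π := by noncomm_ring
        _ = q * (v m * w m) * q * (π * (w m * v m)) * π := by rw [← hqπ]; noncomm_ring
        _ = q * (v m * w m * q) * (w m * v m) * (π * π) := by rw [← hwvπ]; noncomm_ring
        _ = (q * q) * (v m * w m * (w m * v m)) * (π * π) := by rw [hvwq]; noncomm_ring
        _ = 0 := by rw [h0', mul_zero, zero_mul]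
  have hS'' : K0.mk S' = K0.mk R₂.shift := by
    have e1 := hb
    have e2 : v m * (q * (w m * v m) * π') * w m = q * (v m * w m) * π := by
      calc v m * (q * (w m * v m) * π') * w m
          = (v m * q) * (w m * v m) * (π' * w m) := by noncomm_ring
        _ = q * v m * (w m * v m * w m) * π := by rw [hvq, ← hw]; noncomm_ring
        _ = _ := by rw [hwvw]; noncomm_ring
    have e3 : w m * (q * (v m * w m) * π) * v m = q * (w m * v m) * π' := by
      calc w m * (q * (v m * w m) * π) * v m
          = (w m * q) * (v m * w m) * (π * v m) := by noncomm_ring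
        _ = q * (w m * v m * w m) * v m * π' := by rw [hwq, ← hv]; noncomm_ring
        _ = _ := by rw [hwvw]; noncomm_ring
    refine K0.mk_eq_of_isRetract (R := S') hS hR₂.shift (h.w_hom m hm) (h.v_hom m hm).symm
      (fun x => ?_) fun x => ?_
    · have e4 : (q * (v m * w m) * π) * (v m * (q * (w m * v m) * π') * w m) *
          (q * (v m * w m) * π) = q * (v m * w m) * π := by rw [e2, hb, hb]
      exact LinearMap.congr_fun e4 x
    · have e4 : (q * (w m * v m) * π') * (w m * (q * (v m * w m) * π) * v m) *
          (q * (w m * v m) * π') = q * (w m * v m) * π' := by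
        have e5 : (q * (w m * v m) * π') * (q * (w m * v m) * π') = q * (w m * v m) * π' :=
          LinearMap.ext hR₂.idem
        rw [e3, e5, e5]
      exact LinearMap.congr_fun e4 x
  rw [hadd, hS'', K0.mk_shift, sub_eq_add_neg]

end IsCliffordSystem

end Strip

/-! ### The alternating sum over the eigenvalues -/

section ZetaStrip

variable {G : Type*} [AddCommGroup G] {p : ℕ}

lemma zetaZ_pow (hp : p.Prime) : zetaZ p ^ p = 1 :=
  Subtype.ext (isPrimitiveRoot_zetaC hp).pow_eq_one

/-- Both `k ↦ ζ ^ k` and `F` have period `p`, so the sum runs over `ℤ/p` and may be reindexed. -/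
lemma sum_zetaZ_shift (hp : p.Prime) {F : ℕ → G} (hF : ∀ k, F (k + p) = F k) (c : ℕ) :
    zetaZ p ^ c • ∑ k ∈ Finset.range p, (zetaZ p ^ k) ⊗ₜ[ℤ] F (k + c) =
      ∑ k ∈ Finset.range p, (zetaZ p ^ k) ⊗ₜ[ℤ] F k := by
  have h := MF.prod_periodic (R := Multiplicative (Zzeta p ⊗[ℤ] G)) (m := p)
    (g := fun k => Multiplicative.ofAdd ((zetaZ p ^ k) ⊗ₜ[ℤ] F k))
    (fun k => by rw [pow_add, zetaZ_pow hp, mul_one, hF]) c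
  refine Eq.trans ?_ h
  rw [Finset.smul_sum]
  refine Finset.sum_congr rfl fun k _ => ?_
  rw [TensorProduct.smul_tmul', smul_eq_mul, ← pow_add, add_comm c]
  rfl

/-- The index shift by `(m + 1) (p - 1)`, which is `-(m + 1)` modulo `p`, multiplies the sum by `ζ ^
(m + 1)`. -/
lemma sum_zetaZ_step (hp : p.Prime) {F F' : ℕ → G} {m : ℕ} (hF' : ∀ k, F' (k + p) = F' k)
    (h : ∀ k, F k = F' k - F' (k + (m + 1) * (p - 1))) :
    ∑ k ∈ Finset.range p, (zetaZ p ^ k) ⊗ₜ[ℤ] F k =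
      (1 - zetaZ p ^ (m + 1)) • ∑ k ∈ Finset.range p, (zetaZ p ^ k) ⊗ₜ[ℤ] F' k := by
  have h1 := sum_zetaZ_shift hp hF' ((m + 1) * (p - 1))
  have h2 : zetaZ p ^ (m + 1) * zetaZ p ^ ((m + 1) * (p - 1)) = 1 := by
    rw [← pow_add, add_comm, ← Nat.mul_succ, Nat.succ_eq_add_one, Nat.sub_add_cancel hp.one_le,
      mul_comm, pow_mul, zetaZ_pow hp, one_pow]
  rw [sub_smul, one_smul]
  conv_rhs => rw [← h1]
  rw [smul_smul, h2, one_smul, h1, ← Finset.sum_sub_distrib]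
  exact Finset.sum_congr rfl fun k _ => by rw [h, TensorProduct.tmul_sub]

/-- Each of the `p - 1` steps contributes a factor `1 - ζ ^ (m + 1)`, and these factors multiply to
`p`. -/
lemma sum_zetaZ_strip (hp : p.Prime) {F : ℕ → ℕ → G} (hF : ∀ m ≤ p - 1, ∀ k, F m (k + p) = F m k)
    (h : ∀ m < p - 1, ∀ k, F m k = F (m + 1) k - F (m + 1) (k + (m + 1) * (p - 1))) :
    ∑ k ∈ Finset.range p, (zetaZ p ^ k) ⊗ₜ[ℤ] F 0 k =
      p • ∑ k ∈ Finset.range p, (zetaZ p ^ k) ⊗ₜ[ℤ] F (p - 1) k := by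
  have key : ∀ m ≤ p - 1, ∑ k ∈ Finset.range p, (zetaZ p ^ k) ⊗ₜ[ℤ] F 0 k =
      (∏ j ∈ Finset.range m, (1 - zetaZ p ^ (j + 1))) •
        ∑ k ∈ Finset.range p, (zetaZ p ^ k) ⊗ₜ[ℤ] F m k := by
    intro m
    induction m with
    | zero => intro; simp
    | succ m ih =>
      intro hm
      rw [ih (by omega), sum_zetaZ_step hp (hF (m + 1) hm) (h m hm), Finset.prod_range_succ,
        smul_smul]
  have h1 : ∏ j ∈ Finset.range (p - 1), (1 - zetaZ p ^ (j + 1)) = p := by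
    apply Subtype.ext
    push_cast
    exact prod_one_sub_zetaC hp
  rw [key _ le_rfl, h1, Nat.cast_smul_eq_nsmul]

end ZetaStrip

end

end AdamsMF

namespace AdamsMF

noncomputable section

/-! ### Weighted derivations of the tensor powers -/

namespace MF

variable {Q : Type u} [CommRing Q] {f : Q} {P : MF Q f}

section TDer

variable {N : Type u} [AddCommGroup N] [Module Q N] {x y : Module.End Q P.carrier}
  {X Y : Module.End Q N}

lemma even_apply_of_odd (hx : x * P.even = (1 - P.even) * x) (t : P.carrier) :
    P.even (x t) = x t - x (P.even t) := by
  have h1 : x (P.even t) = x t - P.even (x t) := LinearMap.congr_fun hx t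
  rw [h1]; abel

lemma smul_odd (hx : x * P.even = (1 - P.even) * x) (c : Q) :
    (c • x) * P.even = (1 - P.even) * (c • x) := by
  rw [smul_mul_assoc, hx, mul_smul_comm]

/-- The supercommutator of two odd derivations is the derivation that extends the supercommutators
on the factors; the cross terms cancel by the Koszul sign. -/
lemma tDer_anticomm (hx : x * P.even = (1 - P.even) * x) (hy : y * P.even = (1 - P.even) * y)
    {s t : Q} (h : x * y + y * x = s • 1) (h' : X * Y + Y * X = t • 1) :
    P.tDer x X * P.tDer y Y + P.tDer y Y * P.tDer x X = (s + t) • 1 := by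
  have e1 := even_apply_of_odd hx
  have e2 := even_apply_of_odd hy
  have e3 : ∀ a, x (y a) = s • a - y (x a) := fun a => eq_sub_of_add_eq (LinearMap.congr_fun h a)
  have e4 : ∀ a, X (Y a) = t • a - Y (X a) := fun a => eq_sub_of_add_eq (LinearMap.congr_fun h' a)
  ext a b
  simp [tDer_tmul, even_apply_even, e1, e2, e3, e4, TensorProduct.sub_tmul, TensorProduct.tmul_sub,
    ← TensorProduct.smul_tmul']
  module

lemma tDer_sq (hx : x * P.even = (1 - P.even) * x) (h : x * x = 0) (h' : X * X = 0) :
    P.tDer x X * P.tDer x X = 0 := by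
  have e1 := even_apply_of_odd hx
  have e3 : ∀ a, x (x a) = 0 := fun a => LinearMap.congr_fun h a
  have e4 : ∀ a, X (X a) = 0 := fun a => LinearMap.congr_fun h' a
  ext a b
  simp [tDer_tmul, even_apply_even, e1, e3, e4, TensorProduct.sub_tmul]

lemma tDer_odd (hx : x * P.even = (1 - P.even) * x) {e : Module.End Q N}
    (hX : X * e = (1 - e) * X) : P.tDer x X * P.tEven e = (1 - P.tEven e) * P.tDer x X := by
  have e1 := even_apply_of_odd hx
  have e2 : ∀ t, e (X t) = X t - X (e t) := fun t => by
    have h1 : X (e t) = X t - e (X t) := LinearMap.congr_fun hX t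
    rw [h1]; abel
  ext a b
  simp [tDer_tmul, tEven_tmul, even_apply_even, e1, e2, TensorProduct.sub_tmul,
    TensorProduct.tmul_sub]
  abel

lemma swap_tDer (hx : x * P.even = (1 - P.even) * x) (hy : y * P.even = (1 - P.even) * y)
    (b : Module.End Q N) :
    P.swap N * P.tDer x (P.tDer y b) = P.tDer y (P.tDer x b) * P.swap N := by
  have e1 := even_apply_of_odd hx
  have e2 := even_apply_of_odd hy
  ext a c t
  simp [swap_tmul, tDer_tmul, odd_apply, even_apply_even, e1, e2, TensorProduct.sub_tmul,
    TensorProduct.tmul_sub, TensorProduct.tmul_add]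
  module

lemma map_one_tDer {c c' : Module.End Q N} {k : Module.End Q N} (h : k * c = c' * k) :
    TensorProduct.map 1 k * P.tDer x c = P.tDer x c' * TensorProduct.map 1 k := by
  have h2 : ∀ y, k (c y) = c' (k y) := fun y => LinearMap.congr_fun h y
  refine TensorProduct.ext' fun a b => ?_
  simp [tDer_tmul, h2]

lemma swap_map_tDer {x' : Module.End Q P.carrier} (hx : x * P.even = (1 - P.even) * x)
    (hy : y * P.even = (1 - P.even) * y) {k : Module.End Q (P.carrier ⊗[Q] N)}
    (h : k * P.tDer x' X = P.tDer y Y * k) :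
    (P.swap N * TensorProduct.map 1 k) * P.tDer x (P.tDer x' X) =
      P.tDer y (P.tDer x Y) * (P.swap N * TensorProduct.map 1 k) := by
  rw [mul_assoc, map_one_tDer h, ← mul_assoc, ← mul_assoc, swap_tDer hx hy]

lemma tDer_smul (k : Q) (x : Module.End Q P.carrier) (X : Module.End Q N) :
    P.tDer (k • x) (k • X) = k • P.tDer x X := by
  rw [tDer, tDer, smul_add, TensorProduct.map_smul_left, TensorProduct.map_smul_right]

lemma tDer_add (x y : Module.End Q P.carrier) (X Y : Module.End Q N) :
    P.tDer (x + y) (X + Y) = P.tDer x X + P.tDer y Y := by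
  rw [tDer, tDer, tDer, TensorProduct.map_add_left, TensorProduct.map_add_right]
  abel

end TDer

/-- The derivation of the tensor power that acts by `c i • x` on the factor `i`. -/
def wDer (x : Module.End Q P.carrier) : (n : ℕ) → (ℕ → Q) → Module.End Q (P.tpow n).carrier
  | 0, _ => 0
  | n + 1, c => P.tDer (c 0 • x) (wDer x n fun i => c (i + 1))

variable {x y : Module.End Q P.carrier}

lemma der_eq_wDer (x : Module.End Q P.carrier) : ∀ n, P.der x n = wDer x n fun _ => 1
  | 0 => rfl
  | n + 1 => by
    have h := der_eq_wDer x n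
    change P.tDer x (P.der x n) = P.tDer ((1 : Q) • x) (wDer x n fun _ => 1)
    rw [one_smul, h]

/-- Different factors contribute nothing to the anticommutator, and the factor `i` contributes `c i
* c' i * s`. So operators on one factor in duality make the weight sequences dual under the standard
bilinear form. -/
lemma wDer_anticomm (hx : x * P.even = (1 - P.even) * x) (hy : y * P.even = (1 - P.even) * y)
    {s : Q} (h : x * y + y * x = s • 1) : ∀ (n : ℕ) (c c' : ℕ → Q),
    wDer x n c * wDer y n c' + wDer y n c' * wDer x n c =
      ((∑ i ∈ Finset.range n, c i * c' i) * s) • 1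
  | 0, c, c' => by
    rw [Finset.sum_range_zero, zero_mul, zero_smul]
    exact (congrArg₂ (· + ·) (mul_zero _) (mul_zero _)).trans (add_zero _)
  | n + 1, c, c' => by
    have ih := wDer_anticomm hx hy h n (fun i => c (i + 1)) (fun i => c' (i + 1))
    have h1 : (c 0 • x) * (c' 0 • y) + (c' 0 • y) * (c 0 • x) = (c 0 * c' 0 * s) • 1 := by
      rw [smul_mul_smul_comm, smul_mul_smul_comm, mul_comm (c' 0), ← smul_add, h, smul_smul]
    have h2 := tDer_anticomm (smul_odd hx (c 0)) (smul_odd hy (c' 0)) h1 ih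
    rw [Finset.sum_range_succ', add_comm (∑ i ∈ _, _), add_mul]
    exact h2

lemma wDer_sq (hx : x * P.even = (1 - P.even) * x) (h : x * x = 0) : ∀ (n : ℕ) (c : ℕ → Q),
    wDer x n c * wDer x n c = 0
  | 0, _ => mul_zero _
  | n + 1, _ => tDer_sq (smul_odd hx _) (by rw [smul_mul_smul_comm, h, smul_zero])
    (wDer_sq hx h n _)

lemma wDer_odd (hx : x * P.even = (1 - P.even) * x) : ∀ (n : ℕ) (c : ℕ → Q),
    wDer x n c * (P.tpow n).even = (1 - (P.tpow n).even) * wDer x n c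
  | 0, _ => (zero_mul _).trans (mul_zero _).symm
  | n + 1, _ => tDer_odd (smul_odd hx _) (wDer_odd hx n _)

lemma d_wDer (hx : x * P.even = (1 - P.even) * x) {s : Q} (h : P.d * x + x * P.d = s • 1) (n : ℕ)
    (c : ℕ → Q) : (P.tpow n).d * wDer x n c + wDer x n c * (P.tpow n).d =
      ((∑ i ∈ Finset.range n, c i) * s) • 1 := by
  rw [d_tpow, der_eq_wDer, wDer_anticomm P.d_mul_even hx h]
  simp

/-- The differential is the derivation of `d` with all weights `1`, so the anticommutator with it is
`s` times the sum of the weights. For the weights `i ↦ ζ ^ i` of a nontrivial character that sum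
vanishes. -/
lemma isOddHom_wDer (hx : x * P.even = (1 - P.even) * x) {s : Q}
    (h : P.d * x + x * P.d = s • 1) {n : ℕ} {c : ℕ → Q} (hc : ∑ i ∈ Finset.range n, c i = 0) :
    IsOddHom (T := P.tpow n) (wDer x n c) := by
  refine ⟨wDer_odd hx n c, ?_⟩
  have h1 := d_wDer hx h n c
  rw [hc, zero_mul, zero_smul] at h1
  exact (eq_neg_of_add_eq_zero_right h1).trans (neg_mul _ _).symm

lemma wDer_smul (k : Q) : ∀ (n : ℕ) (c : ℕ → Q), wDer x n (k • c) = k • wDer x n c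
  | 0, _ => (smul_zero _).symm
  | n + 1, c => by
    have ih := wDer_smul k n fun i => c (i + 1)
    refine (congrArg (P.tDer ((k * c 0) • x)) ih).trans ?_
    rw [mul_smul]
    exact tDer_smul k _ _

lemma wDer_add : ∀ (n : ℕ) (c c' : ℕ → Q), wDer x n (c + c') = wDer x n c + wDer x n c'
  | 0, _, _ => (add_zero _).symm
  | n + 1, c, c' => by
    have ih := wDer_add n (fun i => c (i + 1)) fun i => c' (i + 1)
    refine (congrArg (P.tDer ((c 0 + c' 0) • x)) ih).trans ?_
    rw [add_smul]
    exact tDer_add _ _ _ _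

/-- `wDer` as a linear map in the weights. -/
def wDerₗ (x : Module.End Q P.carrier) (n : ℕ) :
    (ℕ → Q) →ₗ[Q] Module.End Q (P.tpow n).carrier where
  toFun := wDer x n
  map_add' := wDer_add n
  map_smul' k c := wDer_smul k n c

lemma wDer_congr : ∀ {n : ℕ} {c c' : ℕ → Q}, (∀ i < n, c i = c' i) → wDer x n c = wDer x n c'
  | 0, _, _, _ => rfl
  | n + 1, c, c', h => by
    have ih := wDer_congr (n := n) (c := fun i => c (i + 1)) (c' := fun i => c' (i + 1))
      fun i hi => h (i + 1) (Nat.succ_lt_succ hi)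
    change P.tDer (c 0 • x) _ = P.tDer (c' 0 • x) _
    rw [ih, h 0 n.succ_pos]

/-- The cycle permutes the weights. -/
lemma cyc_wDer (hx : x * P.even = (1 - P.even) * x) : ∀ (n : ℕ) (c : ℕ → Q),
    P.cyc n * P.tDer (c 0 • x) (wDer x n fun i => c (i + 1)) =
      P.tDer (c n • x) (wDer x n c) * P.cyc n
  | 0, _ => (one_mul _).trans (mul_one _).symm
  | n + 1, c => swap_map_tDer (smul_odd hx (c 0)) (smul_odd hx (c (n + 1)))
      (cyc_wDer hx n fun i => c (i + 1))

/-- The cycle shifts the sequence of weights by one place, and a cyclic shift multiplies `i ↦ ζ ^ i`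
by `ζ⁻¹ = ζ ^ (p - 1)`. -/
lemma rot_wDer (hx : x * P.even = (1 - P.even) * x) {p : ℕ} (hp : 0 < p) {ζ : Q} (hζ : ζ ^ p = 1) :
    P.rot p * wDer x p (fun i => ζ ^ i) = ζ ^ (p - 1) • (wDer x p (fun i => ζ ^ i) * P.rot p) := by
  obtain ⟨n, rfl⟩ : ∃ n, p = n + 1 := ⟨p - 1, (Nat.sub_add_cancel hp).symm⟩
  have h1 : (fun i : ℕ => (i.casesOn (ζ ^ n) fun i => ζ ^ i : Q)) =
      ζ ^ (n + 1 - 1) • fun i => ζ ^ i := by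
    funext i
    cases i with
    | zero => simp
    | succ i =>
      change ζ ^ i = ζ ^ n * ζ ^ (i + 1)
      rw [← pow_add, show n + (i + 1) = (n + 1) + i by ring, pow_add, hζ, one_mul]
  refine (cyc_wDer hx n _).trans ?_
  have h2 : wDer x (n + 1) (fun i : ℕ => (i.casesOn (ζ ^ n) fun i => ζ ^ i : Q)) =
      ζ ^ (n + 1 - 1) • wDer x (n + 1) fun i => ζ ^ i := by
    rw [h1, wDer_smul]
  exact congrArg (· * P.rot (n + 1)) h2

end MF

end

end AdamsMF

namespace AdamsMF

noncomputable section

/-! ### The tensor powers of a rank-one factorization -/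

namespace MF

variable {Q : Type u} [CommRing Q] (g h : Q)

/-- The odd operator that maps the even generator to the odd one. -/
def create : Module.End Q (rankOne g h).carrier := LinearMap.inr Q Q Q ∘ₗ LinearMap.fst Q Q Q

/-- The odd operator that maps the odd generator to the even one. -/
def annih : Module.End Q (rankOne g h).carrier := LinearMap.inl Q Q Q ∘ₗ LinearMap.snd Q Q Q

/-- The even generator. -/
def gen₀ : (rankOne g h).carrier := ((1, 0) : Q × Q)

lemma create_odd : create g h * (rankOne g h).even = (1 - (rankOne g h).even) * create g h :=
  LinearMap.ext fun _ : Q × Q => Prod.ext (sub_self _).symm (sub_zero _).symm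

lemma annih_odd : annih g h * (rankOne g h).even = (1 - (rankOne g h).even) * annih g h :=
  LinearMap.ext fun _ : Q × Q => Prod.ext (sub_self _).symm (sub_zero _).symm

lemma create_sq : create g h * create g h = 0 := LinearMap.ext fun _ : Q × Q => rfl

lemma annih_sq : annih g h * annih g h = 0 := LinearMap.ext fun _ : Q × Q => rfl

lemma create_create : create g h * create g h + create g h * create g h = (0 : Q) • 1 := by
  rw [create_sq, zero_smul, add_zero]

lemma annih_annih : annih g h * annih g h + annih g h * annih g h = (0 : Q) • 1 := by
  rw [annih_sq, zero_smul, add_zero]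

lemma annih_create : annih g h * create g h + create g h * annih g h = (1 : Q) • 1 :=
  LinearMap.ext fun x : Q × Q => Prod.ext
    (by change x.1 + 0 = (1 : Q) • x.1; simp) (by change 0 + x.2 = (1 : Q) • x.2; simp)

lemma d_create : (rankOne g h).d * create g h + create g h * (rankOne g h).d = g • 1 :=
  LinearMap.ext fun x : Q × Q => Prod.ext
    (by change g • x.1 + 0 + 0 = g • x.1; simp)
    (by change 0 + h • 0 + (g • x.2 + 0) = g • x.2; simp)

lemma d_annih : (rankOne g h).d * annih g h + annih g h * (rankOne g h).d = h • 1 :=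
  LinearMap.ext fun x : Q × Q => Prod.ext
    (by change g • 0 + 0 + (0 + h • x.1) = h • x.1; simp)
    (by change 0 + h • x.2 + 0 = h • x.2; simp)

section Reduce

variable {g h} {N : Type u} [AddCommGroup N] [Module Q N]

/-- The coefficient of the even generator in the first factor. -/
def coeff₀ : (rankOne g h).carrier ⊗[Q] N →ₗ[Q] N :=
  (TensorProduct.lid Q N).toLinearMap ∘ₗ
    TensorProduct.map (LinearMap.fst Q Q Q : (rankOne g h).carrier →ₗ[Q] Q) LinearMap.id

lemma coeff₀_tmul (x : (rankOne g h).carrier) (y : N) :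
    coeff₀ (x ⊗ₜ[Q] y) = (show Q × Q from x).1 • y := rfl

lemma coeff₀_tDer (x : Module.End Q (rankOne g h).carrier) (X : Module.End Q N)
    (t : (rankOne g h).carrier ⊗[Q] N) : coeff₀ ((rankOne g h).tDer x X t) =
      coeff₀ (TensorProduct.map x 1 t) + X (coeff₀ t) := by
  refine LinearMap.congr_fun (f := coeff₀ ∘ₗ (rankOne g h).tDer x X)
    (g := coeff₀ ∘ₗ TensorProduct.map x 1 + X ∘ₗ coeff₀) (TensorProduct.ext' fun a b => ?_) t
  change coeff₀ (x a ⊗ₜ[Q] b + (rankOne g h).sgn a ⊗ₜ[Q] X b) =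
    coeff₀ (x a ⊗ₜ[Q] b) + X (coeff₀ (a ⊗ₜ[Q] b))
  rw [map_add, coeff₀_tmul, coeff₀_tmul, coeff₀_tmul, map_smul]
  have h1 : (show Q × Q from (rankOne g h).sgn a).1 = (show Q × Q from a).1 := by
    change (show Q × Q from a).1 - ((show Q × Q from a).1 - (show Q × Q from a).1) = _
    rw [sub_self, sub_zero]
  rw [h1]

lemma coeff₀_create (c : Q) (t : (rankOne g h).carrier ⊗[Q] N) :
    coeff₀ (TensorProduct.map (c • create g h) (1 : Module.End Q N) t) = 0 := by
  refine LinearMap.congr_fun (f := coeff₀ ∘ₗ TensorProduct.map (c • create g h) (1 : Module.End Q N)) (g := 0)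
    (TensorProduct.ext' fun a b => ?_) t
  change (c • (0 : Q)) • b = 0
  rw [smul_zero, zero_smul]

lemma coeff₀_tDer_create (c : Q) (X : Module.End Q N) (t : (rankOne g h).carrier ⊗[Q] N) :
    coeff₀ ((rankOne g h).tDer (c • create g h) X t) = X (coeff₀ t) := by
  rw [coeff₀_tDer, coeff₀_create, zero_add]

lemma coeff₀_tDer_zero (x : Module.End Q (rankOne g h).carrier) (X : Module.End Q N)
    (t : (rankOne g h).carrier ⊗[Q] N) :
    coeff₀ ((rankOne g h).tDer ((0 : Q) • x) X t) = X (coeff₀ t) := by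
  rw [coeff₀_tDer, zero_smul, TensorProduct.map_zero_left, LinearMap.zero_apply, map_zero, zero_add]

/-- On the first factor, `create * annih` plus the projection to the even generator is the identity;
the first term vanishes on `t`. -/
lemma eq_gen₀_tmul {t : (rankOne g h).carrier ⊗[Q] N}
    (ht : (rankOne g h).tDer ((1 : Q) • annih g h) (0 : Module.End Q N) t = 0) : t = gen₀ g h ⊗ₜ[Q] coeff₀ t := by
  rw [one_smul, tDer, TensorProduct.map_zero_right, add_zero] at ht
  have h1 : TensorProduct.map (create g h) (1 : Module.End Q N)
      (TensorProduct.map (annih g h) 1 t) +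
      gen₀ g h ⊗ₜ[Q] coeff₀ t = t := by
    refine LinearMap.congr_fun (f := TensorProduct.map (create g h) (1 : Module.End Q N) ∘ₗ
      TensorProduct.map (annih g h) 1 + TensorProduct.mk Q _ _ (gen₀ g h) ∘ₗ coeff₀)
      (g := LinearMap.id) (TensorProduct.ext' fun a b => ?_) t
    change create g h (annih g h a) ⊗ₜ[Q] b + gen₀ g h ⊗ₜ[Q] ((show Q × Q from a).1 • b) =
      a ⊗ₜ[Q] b
    rw [TensorProduct.tmul_smul, TensorProduct.smul_tmul', ← TensorProduct.add_tmul]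
    congr 1
    refine Prod.ext ?_ ?_
    · change 0 + (show Q × Q from a).1 • (1 : Q) = (show Q × Q from a).1
      simp
    · change (show Q × Q from a).2 + (show Q × Q from a).1 • (0 : Q) = (show Q × Q from a).2
      simp
  rw [ht, map_zero, zero_add] at h1
  exact h1.symm

end Reduce

/-- The product of the even generators. -/
def vac (n : ℕ) : ((rankOne g h).tpow n).carrier := (rankOne g h).tprod n fun _ => gen₀ g h

/-- The coefficient of the product of the even generators. -/
def coeffVac : (n : ℕ) → ((rankOne g h).tpow n).carrier →ₗ[Q] Q
  | 0 => (LinearMap.id : Q →ₗ[Q] Q)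
  | n + 1 => coeffVac n ∘ₗ coeff₀

variable {g h}

lemma coeffVac_vac : ∀ n, coeffVac g h n (vac g h n) = 1
  | 0 => rfl
  | n + 1 => (congrArg (coeffVac g h n) (one_smul Q (vac g h n))).trans (coeffVac_vac n)

lemma coeffVac_create : ∀ (n : ℕ) (c : ℕ → Q) (t : ((rankOne g h).tpow n).carrier),
    coeffVac g h n (wDer (create g h) n c t) = 0
  | 0, _, _ => rfl
  | n + 1, c, t => (congrArg (coeffVac g h n) (coeff₀_tDer_create (c 0)
      (wDer (create g h) n fun i => c (i + 1)) t)).trans (coeffVac_create n _ _)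

lemma annih_vac : ∀ (n : ℕ) (c : ℕ → Q), wDer (annih g h) n c (vac g h n) = 0
  | 0, _ => rfl
  | n + 1, c => by
    have h1 := annih_vac n fun i => c (i + 1)
    change (c 0 • annih g h (gen₀ g h)) ⊗ₜ[Q] vac g h n +
      (rankOne g h).sgn (gen₀ g h) ⊗ₜ[Q] wDer (annih g h) n (fun i => c (i + 1)) (vac g h n) = 0
    have h2 : annih g h (gen₀ g h) = 0 := rfl
    rw [h1, h2, smul_zero, TensorProduct.zero_tmul, TensorProduct.tmul_zero, add_zero]

/-- On the even generator the differential of `(g, h)` agrees with `h • create`, and both sides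
extend to the tensor power as derivations. -/
lemma d_vac : ∀ n : ℕ, ((rankOne g h).tpow n).d (vac g h n) =
    h • wDer (create g h) n (fun _ => 1) (vac g h n)
  | 0 => (mul_zero h).symm
  | n + 1 => by
    have h1 := d_vac n
    change (rankOne g h).d (gen₀ g h) ⊗ₜ[Q] vac g h n +
        (rankOne g h).sgn (gen₀ g h) ⊗ₜ[Q] ((rankOne g h).tpow n).d (vac g h n) =
      h • (((1 : Q) • create g h (gen₀ g h)) ⊗ₜ[Q] vac g h n +
        (rankOne g h).sgn (gen₀ g h) ⊗ₜ[Q] wDer (create g h) n (fun _ => 1) (vac g h n))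
    have h2 : (rankOne g h).d (gen₀ g h) = h • create g h (gen₀ g h) := by
      refine Prod.ext ?_ ?_
      · change g • (0 : Q) + 0 = h • 0
        simp
      · change (0 : Q) + h • 1 = h • 1
        simp
    rw [h1, h2, one_smul, smul_add, TensorProduct.smul_tmul', TensorProduct.tmul_smul]

lemma homog_gen₀ : (rankOne g h).Homog (fun _ => gen₀ g h) fun _ => false := fun _ =>
  Prod.ext (sub_self (1 : Q)) (sub_self (0 : Q))

lemma hasDeg_vac (n : ℕ) : ((rankOne g h).tpow n).HasDeg (vac g h n) false := by
  have h1 : ∀ n, totalDeg (fun _ => false) n = false := fun n => by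
    induction n with
    | zero => rfl
    | succ n ih => rw [totalDeg, ih]; rfl
  have h2 := hasDeg_tprod n (homog_gen₀ (g := g) (h := h))
  rwa [h1] at h2

lemma rot_vac : ∀ n, (rankOne g h).rot n (vac g h n) = vac g h n
  | 0 => rfl
  | n + 1 => by
    refine ((rankOne g h).cyc_tprod n _ _ homog_gen₀).trans ?_
    rw [Finset.prod_eq_one fun i _ => by simp [ksgn], one_smul]
    rfl

lemma wDer_zero {f : Q} {P : MF Q f} (x : Module.End Q P.carrier) (n : ℕ) :
    wDer x n (fun _ => 0) = 0 := (wDerₗ x n).map_zero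

/-- The sequence `a, c 0, c 1, …`. -/
def consSeq (a : Q) (c : ℕ → Q) : ℕ → Q
  | 0 => a
  | i + 1 => c i

/-- The product of the even generators spans the joint kernel of the annihilation operators. -/
lemma eq_smul_vac : ∀ {n : ℕ} {t : ((rankOne g h).tpow n).carrier},
    (∀ c, wDer (annih g h) n c t = 0) → t = coeffVac g h n t • vac g h n
  | 0, t, _ => (mul_one (show Q from t)).symm
  | n + 1, t, ht => by
    -- The weights `1, 0, 0, …` isolate the annihilation operator of the first factor. Below, a
    -- leading weight `0` restricts to the remaining factors for the induction.
    have h2 : (rankOne g h).tDer ((1 : Q) • annih g h) (wDer (annih g h) n fun _ => 0) t = 0 :=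
      ht (consSeq 1 fun _ => 0)
    rw [wDer_zero] at h2
    have h4 : ∀ c, wDer (annih g h) n c (coeff₀ t) = 0 := fun c =>
      (coeff₀_tDer_zero (annih g h) (wDer (annih g h) n c) t).symm.trans
        ((congrArg coeff₀ (ht (consSeq 0 c))).trans (map_zero _))
    refine (eq_gen₀_tmul h2).trans ((congrArg (gen₀ g h ⊗ₜ[Q] ·) (eq_smul_vac h4)).trans ?_)
    exact TensorProduct.tmul_smul _ _ _

end MF

end

end AdamsMF

namespace AdamsMF

noncomputable section

/-- Modulo `p` the factor `p - 1` is `-1`, so the left side encodes `p ∣ a - b` within the natural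
numbers. Negative exponents of roots of unity are written in this way. -/
lemma dvd_add_mul_pred_iff {p : ℕ} (hp : 0 < p) (a b : ℕ) : p ∣ a + b * (p - 1) ↔ a ≡ b [MOD p] := by
  have h1 : (a + b * (p - 1)) + b = a + p * b := by
    rw [add_assoc, ← Nat.mul_succ, Nat.succ_eq_add_one, Nat.sub_add_cancel hp, mul_comm]
  have h2 : (a + b * (p - 1)) + b ≡ a [MOD p] := by
    rw [h1]
    exact (Nat.modEq_iff_dvd' (Nat.le_add_right _ _)).2 (by simp) |>.symm
  rw [← Nat.modEq_zero_iff_dvd]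
  constructor
  · intro h3
    exact h2.symm.trans ((h3.add_right b).trans (by rw [zero_add]))
  · intro h3
    refine Nat.ModEq.add_right_cancel' b ?_
    rw [zero_add]
    exact h2.trans h3

namespace MF

/-- That `r` is a morphism need not be assumed: `i r = ε` and `i` are morphisms, and `i` is
injective. -/
lemma IsRetract.of_section {Q : Type u} [CommRing Q] {f : Q} {R P : MF Q f}
    {ε : Module.End Q P.carrier} {i : R.carrier →ₗ[Q] P.carrier} {r : P.carrier →ₗ[Q] R.carrier}
    (hi : IsHom i) (hε : IsHom (P := P) (P' := P) ε) (h1 : ∀ x, r (i x) = x)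
    (h2 : ∀ x, i (r x) = ε x) : IsRetract R P ε := by
  refine ⟨i, r, hi, ⟨LinearMap.ext fun x => ?_, LinearMap.ext fun x => ?_⟩, h1, h2⟩
  · refine (h1 _).symm.trans ((congrArg r ?_).trans (h1 _))
    exact (h2 _).trans ((hε.apply_even x).trans
      ((congrArg P.even (h2 x).symm).trans (hi.apply_even _).symm))
  · refine (h1 _).symm.trans ((congrArg r ?_).trans (h1 _))
    exact (h2 _).trans ((hε.apply_d x).trans
      ((congrArg P.d (h2 x).symm).trans (hi.apply_d _).symm))

section CharDer

variable {Q : Type u} [CommRing Q] {f : Q} {P : MF Q f} {p : ℕ} {u z : Q}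
  {x y : Module.End Q P.carrier}

/-- The derivation of the tensor power with weights `z ^ (k l)`. -/
def charDer (x : Module.End Q P.carrier) (p : ℕ) (z : Q) (k : ℕ) :
    Module.End Q (P.tpow p).carrier := wDer x p fun l => (z ^ k) ^ l

lemma charDer_zero (x : Module.End Q P.carrier) (p : ℕ) (z : Q) :
    charDer x p z 0 = wDer x p fun _ => 1 := by
  simp [charDer]

lemma _root_.AdamsMF.IsStrongRoot.sum_pow_of_dvd (hz : IsStrongRoot p u z) {k : ℕ} (hk : p ∣ k) :
    ∑ l ∈ Finset.range p, (z ^ k) ^ l = p := by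
  obtain ⟨m, rfl⟩ := hk
  simp [pow_mul, hz.pow_eq_one]

lemma _root_.AdamsMF.IsStrongRoot.sum_pow_of_not_dvd (hz : IsStrongRoot p u z) {k : ℕ}
    (hk : ¬ p ∣ k) : ∑ l ∈ Finset.range p, (z ^ k) ^ l = 0 :=
  hz.sum_pow fun h => hk (Nat.dvd_of_mod_eq_zero h)

lemma charDer_anticomm (hx : x * P.even = (1 - P.even) * x) (hy : y * P.even = (1 - P.even) * y)
    {s : Q} (h : x * y + y * x = s • 1) (j k : ℕ) :
    charDer x p z j * charDer y p z k + charDer y p z k * charDer x p z j =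
      ((∑ l ∈ Finset.range p, (z ^ (j + k)) ^ l) * s) • 1 := by
  rw [charDer, charDer, wDer_anticomm hx hy h]
  simp only [pow_add, mul_pow]

lemma charDer_anticomm_of_not_dvd (hz : IsStrongRoot p u z) (hx : x * P.even = (1 - P.even) * x)
    (hy : y * P.even = (1 - P.even) * y) {s : Q} (h : x * y + y * x = s • 1) {j k : ℕ}
    (hjk : ¬ p ∣ j + k) :
    charDer x p z j * charDer y p z k = -(charDer y p z k * charDer x p z j) := by
  have h1 := charDer_anticomm (p := p) (z := z) hx hy h j k
  rw [hz.sum_pow_of_not_dvd hjk, zero_mul, zero_smul] at h1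
  exact eq_neg_of_add_eq_zero_left h1

lemma charDer_anticomm_self (hx : x * P.even = (1 - P.even) * x)
    (hy : y * P.even = (1 - P.even) * y) (h : x * y + y * x = (0 : Q) • 1) (j k : ℕ) :
    charDer x p z j * charDer y p z k = -(charDer y p z k * charDer x p z j) := by
  have h1 := charDer_anticomm (p := p) (z := z) hx hy h j k
  rw [mul_zero, zero_smul] at h1
  exact eq_neg_of_add_eq_zero_left h1

lemma rot_charDer (hz : IsStrongRoot p u z) (hx : x * P.even = (1 - P.even) * x) (k : ℕ) :
    P.rot p * charDer x p z k = z ^ (k * (p - 1)) • (charDer x p z k * P.rot p) := by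
  rw [pow_mul]
  exact rot_wDer hx hz.pos (hz.pow_pow_eq_one k)

/-- The derivations with weights given by characters determine all the others. -/
lemma wDer_apply_eq_zero (hz : IsStrongRoot p u z) {t : (P.tpow p).carrier}
    (ht : ∀ k < p, charDer x p z k t = 0) (c : ℕ → Q) : wDer x p c t = 0 := by
  -- The discrete Fourier transform of `c`, with `z ^ (m * (p - 1) * k)` for `z ^ (-m k)`. By
  -- Fourier inversion `c` agrees, on the indices below `p`, with a combination of characters.
  let c' : ℕ → Q := fun k => u * ∑ m ∈ Finset.range p, c m * z ^ (m * (p - 1) * k)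
  have h1 : ∀ l < p, c l = (∑ k ∈ Finset.range p, c' k • fun l : ℕ => (z ^ k) ^ l) l := by
    intro l hl
    have h2 : ∀ m ∈ Finset.range p, ∑ k ∈ Finset.range p, z ^ (m * (p - 1) * k) * (z ^ k) ^ l =
        if m = l then (p : Q) else 0 := by
      intro m hm
      have h3 : ∑ k ∈ Finset.range p, z ^ (m * (p - 1) * k) * (z ^ k) ^ l =
          ∑ k ∈ Finset.range p, (z ^ (l + m * (p - 1))) ^ k :=
        Finset.sum_congr rfl fun k _ => by rw [← pow_mul, ← pow_mul, ← pow_add]; ring_nf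
      rw [h3]
      split_ifs with hml
      · exact hz.sum_pow_of_dvd ((dvd_add_mul_pred_iff hz.pos _ _).2 (by rw [hml]))
      · refine hz.sum_pow_of_not_dvd fun h4 => hml ?_
        exact (((dvd_add_mul_pred_iff hz.pos _ _).1 h4).eq_of_lt_of_lt hl
          (Finset.mem_range.1 hm)).symm
    rw [Finset.sum_apply]
    simp only [Pi.smul_apply, smul_eq_mul, c']
    calc c l = u * p * c l := by rw [hz.inv_mul, one_mul]
      _ = u * ∑ m ∈ Finset.range p, c m * if m = l then (p : Q) else 0 := by
        rw [Finset.sum_eq_single_of_mem l (Finset.mem_range.2 hl) fun m _ hm => by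
          rw [if_neg hm, mul_zero], if_pos rfl]
        ring
      _ = u * ∑ m ∈ Finset.range p, ∑ k ∈ Finset.range p,
          c m * z ^ (m * (p - 1) * k) * (z ^ k) ^ l := by
        congr 1
        refine Finset.sum_congr rfl fun m hm => ?_
        rw [← h2 m hm, Finset.mul_sum]
        exact Finset.sum_congr rfl fun k _ => (mul_assoc _ _ _).symm
      _ = _ := by
        rw [Finset.sum_comm, Finset.mul_sum]
        refine Finset.sum_congr rfl fun k _ => ?_
        rw [Finset.mul_sum, Finset.mul_sum, Finset.sum_mul]
        exact Finset.sum_congr rfl fun m _ => by ring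
  have h5 : wDer x p c = ∑ k ∈ Finset.range p, c' k • charDer x p z k := by
    rw [wDer_congr h1]
    refine (map_sum (wDerₗ x p) _ _).trans (Finset.sum_congr rfl fun k _ => ?_)
    exact wDer_smul _ _ _
  rw [h5, LinearMap.sum_apply]
  exact Finset.sum_eq_zero fun k hk => by
    rw [LinearMap.smul_apply, ht k (Finset.mem_range.1 hk), smul_zero]

end CharDer

section RankOne

variable {Q : Type u} [CommRing Q] (g h : Q) (p : ℕ) (u z : Q)

/-- The creation operators of weight `z ^ (i + 1)`. -/
def creation (i : ℕ) : Module.End Q ((rankOne g h).tpow p).carrier :=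
  charDer (create g h) p z ((i + 1) * (p - 1))

/-- The annihilation operators of weight `z ^ -(i + 1)`. -/
def annihilation (i : ℕ) : Module.End Q ((rankOne g h).tpow p).carrier :=
  u • charDer (annih g h) p z (i + 1)

variable {p u z}

/-- Orthogonality of characters makes the derivations attached to opposite characters dual up to the
factor `p`, which `u` in the annihilation operators removes; all other pairs anticommute. Only
nontrivial characters occur, because their weights sum to zero and the operators therefore
anticommute with the differential. -/
lemma isCliffordSystem_rankOne (hz : IsStrongRoot p u z) :
    IsCliffordSystem ((rankOne g h).tpow p) p z ((rankOne g h).rot p) (p - 1)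
      (creation g h p z) (annihilation g h p u z) where
  v_v i _ j _ _ := charDer_anticomm_self (create_odd g h) (create_odd g h) (create_create g h) _ _
  w_w i _ j _ _ := by
    rw [annihilation, annihilation, smul_mul_smul_comm, smul_mul_smul_comm,
      charDer_anticomm_self (annih_odd g h) (annih_odd g h) (annih_annih g h), smul_neg]
  v_w i hi j hj hij := by
    have h1 : ¬ p ∣ (j + 1) + (i + 1) * (p - 1) := fun h1 => hij <| by
      have := ((dvd_add_mul_pred_iff hz.pos _ _).1 h1).eq_of_lt_of_lt (by omega) (by omega)
      omega
    rw [creation, annihilation, mul_smul_comm, smul_mul_assoc,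
      charDer_anticomm_of_not_dvd hz (annih_odd g h) (create_odd g h) (annih_create g h) h1,
      smul_neg, neg_neg]
  w_sq i _ := by
    rw [annihilation, smul_mul_smul_comm, charDer, wDer_sq (annih_odd g h) (annih_sq g h),
      smul_zero]
  w_v i hi := by
    have h1 := charDer_anticomm (p := p) (z := z) (annih_odd g h) (create_odd g h)
      (annih_create g h) (i + 1) ((i + 1) * (p - 1))
    rw [hz.sum_pow_of_dvd ((dvd_add_mul_pred_iff hz.pos _ _).2 rfl), mul_one] at h1
    rw [creation, annihilation, mul_smul_comm, smul_mul_assoc, ← smul_add, h1, smul_smul,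
      hz.inv_mul, one_smul]
  v_hom i hi := isOddHom_wDer (create_odd g h) (d_create g h) (hz.sum_pow_of_not_dvd fun h1 => by
    rw [← zero_add (_ * _), dvd_add_mul_pred_iff hz.pos] at h1
    have := h1.eq_of_lt_of_lt hz.pos (by omega)
    omega)
  w_hom i hi := by
    have h1 : IsOddHom (T := (rankOne g h).tpow p) (charDer (annih g h) p z (i + 1)) :=
      isOddHom_wDer (annih_odd g h) (d_annih g h) (hz.sum_pow_of_not_dvd
        (Nat.not_dvd_of_pos_of_lt i.succ_pos (by omega)))
    exact h1.smul u
  σ_v i _ := by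
    rw [creation, rot_charDer hz (create_odd g h)]
    congr 1
    -- The creation operator belongs to the character of index `-(i + 1)`, and the cycle inverts the
    -- weight of the character, so the operator has weight `z ^ (i + 1)`. In exponents, `(i + 1) (p
    -- - 1) (p - 1)` and `i + 1` agree modulo `p`.
    have h1 := IsCliffordSystem.pow_succ_mul hz i
    have h2 : z ^ ((i + 1) * (p - 1) * (p - 1)) * z ^ ((i + 1) * (p - 1)) = 1 := by
      rw [pow_mul, ← pow_succ, Nat.sub_add_cancel hz.pos, hz.pow_pow_eq_one]
    rw [← mul_one (z ^ _), ← h1, ← mul_assoc, h2, one_mul]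
  σ_w i _ := by
    rw [annihilation, mul_smul_comm, rot_charDer hz (annih_odd g h), smul_mul_assoc, smul_comm]

/-- The projection onto the joint kernel of the annihilation operators. -/
def vacuumProj (p : ℕ) (u z : Q) : Module.End Q ((rankOne g h).tpow p).carrier :=
  vacProj (creation g h p z) (annihilation g h p u z) (p - 1)

/-- The invariant creation operator, divided by `p`. -/
def invCreate (p : ℕ) (u : Q) : Module.End Q ((rankOne g h).tpow p).carrier :=
  u • wDer (create g h) p fun _ => 1

/-- The invariant annihilation operator. -/
def invAnnih (p : ℕ) : Module.End Q ((rankOne g h).tpow p).carrier :=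
  wDer (annih g h) p fun _ => 1

variable {g h}

lemma invAnnih_create (hz : IsStrongRoot p u z) :
    invAnnih g h p * invCreate g h p u + invCreate g h p u * invAnnih g h p = 1 := by
  have h1 := wDer_anticomm (annih_odd g h) (create_odd g h) (annih_create g h) p (fun _ => 1)
    fun _ => 1
  rw [invAnnih, invCreate, mul_smul_comm, smul_mul_assoc, ← smul_add, h1, smul_smul]
  simp [hz.inv_mul]

lemma invAnnih_annihilation (i : ℕ) : invAnnih g h p * annihilation g h p u z i =
    -(annihilation g h p u z i * invAnnih g h p) := by
  have h1 := charDer_anticomm_self (p := p) (z := z) (annih_odd g h) (annih_odd g h)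
    (annih_annih g h) 0 (i + 1)
  rw [charDer_zero] at h1
  rw [invAnnih, annihilation, mul_smul_comm, h1, smul_mul_assoc, smul_neg]

lemma invCreate_creation (i : ℕ) : invCreate g h p u * creation g h p z i =
    -(creation g h p z i * invCreate g h p u) := by
  have h1 := charDer_anticomm_self (p := p) (z := z) (create_odd g h) (create_odd g h)
    (create_create g h) 0 ((i + 1) * (p - 1))
  rw [charDer_zero] at h1
  rw [invCreate, creation, smul_mul_assoc, h1, mul_smul_comm, smul_neg]

lemma invCreate_annihilation (hz : IsStrongRoot p u z) {i : ℕ} (hi : i < p - 1) :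
    invCreate g h p u * annihilation g h p u z i =
      -(annihilation g h p u z i * invCreate g h p u) := by
  have h1 := charDer_anticomm_of_not_dvd hz (annih_odd g h) (create_odd g h) (annih_create g h)
    (j := i + 1) (k := 0) (Nat.not_dvd_of_pos_of_lt (by omega) (by omega))
  rw [charDer_zero] at h1
  rw [invCreate, annihilation, smul_mul_smul_comm, smul_mul_smul_comm, h1, smul_neg, neg_neg]

lemma invAnnih_creation (hz : IsStrongRoot p u z) {i : ℕ} (hi : i < p - 1) :
    invAnnih g h p * creation g h p z i = -(creation g h p z i * invAnnih g h p) := by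
  have h1 := charDer_anticomm_of_not_dvd hz (annih_odd g h) (create_odd g h) (annih_create g h)
    (j := 0) (k := (i + 1) * (p - 1)) fun h1 => by
      have := ((dvd_add_mul_pred_iff hz.pos _ _).1 h1).eq_of_lt_of_lt hz.pos (by omega)
      omega
  rwa [charDer_zero] at h1

/-- Anticommuting with both factors of `w i * v i` amounts to commuting with their product. This
applies to the operators of the trivial character, which are not among the `v i` and `w i`. -/
lemma commute_vacProj {A : Type*} [Ring A] {a : A} {v w : ℕ → A} {m : ℕ}
    (hv : ∀ i < m, a * v i = -(v i * a)) (hw : ∀ i < m, a * w i = -(w i * a)) :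
    Commute a (vacProj v w m) := by
  induction m with
  | zero => exact Commute.one_right _
  | succ m ih =>
    refine (ih (fun i hi => hv i (by omega)) fun i hi => hw i (by omega)).mul_right ?_
    change a * (w m * v m) = w m * v m * a
    rw [← mul_assoc, hw m m.lt_succ_self, neg_mul, mul_assoc, hv m m.lt_succ_self, mul_neg, neg_neg,
      mul_assoc]

lemma commute_invAnnih (hz : IsStrongRoot p u z) :
    Commute (invAnnih g h p) (vacuumProj g h p u z) :=
  commute_vacProj (fun _ hi => invAnnih_creation hz hi) fun i _ => invAnnih_annihilation i

lemma commute_invCreate (hz : IsStrongRoot p u z) :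
    Commute (invCreate g h p u) (vacuumProj g h p u z) :=
  commute_vacProj (fun i _ => invCreate_creation i) fun _ hi => invCreate_annihilation hz hi

lemma vacuumProj_vac (hz : IsStrongRoot p u z) : vacuumProj g h p u z (vac g h p) = vac g h p := by
  have hC := isCliffordSystem_rankOne g h hz
  have key : ∀ m ≤ p - 1, vacProj (creation g h p z) (annihilation g h p u z) m (vac g h p) =
      vac g h p := by
    intro m
    induction m with
    | zero => intro; rfl
    | succ m ih =>
      intro hm
      have h1 : annihilation g h p u z m (vac g h p) = 0 := by
        change u • wDer (annih g h) p _ (vac g h p) = 0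
        rw [annih_vac, smul_zero]
      have h2 : (annihilation g h p u z m * creation g h p z m) (vac g h p) = vac g h p := by
        rw [eq_sub_of_add_eq (hC.w_v m hm), LinearMap.sub_apply, Module.End.mul_apply, h1, map_zero,
          sub_zero]
        rfl
      change vacProj (creation g h p z) (annihilation g h p u z) m
        ((annihilation g h p u z m * creation g h p z m) (vac g h p)) = _
      rw [h2, ih (by omega)]
  exact key _ le_rfl

lemma invAnnih_vac : invAnnih g h p (vac g h p) = 0 := annih_vac p _

lemma coeffVac_invCreate (t : ((rankOne g h).tpow p).carrier) :
    coeffVac g h p (invCreate g h p u t) = 0 := by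
  rw [invCreate, LinearMap.smul_apply, map_smul, coeffVac_create, smul_zero]

/-- A vector in the kernel of all annihilation operators is a multiple of the vacuum. -/
lemma eq_smul_vac_of_vacuumProj (hz : IsStrongRoot p u z) {t : ((rankOne g h).tpow p).carrier}
    (ht : vacuumProj g h p u z t = t) (ht' : invAnnih g h p t = 0) :
    t = coeffVac g h p t • vac g h p := by
  refine eq_smul_vac (wDer_apply_eq_zero hz fun k hk => ?_)
  rcases k with - | k
  · rw [charDer_zero]
    exact ht'
  · have h1 : annihilation g h p u z k t = 0 := by
      rw [← ht]
      exact LinearMap.congr_fun ((isCliffordSystem_rankOne g h hz).w_mul_vacProj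
        (Nat.lt_sub_of_add_lt hk) le_rfl) t
    have h2 : u • charDer (annih g h) p z (k + 1) t = 0 := h1
    exact ((IsUnit.of_mul_eq_one _ hz.inv_mul).smul_eq_zero).1 h2

/-- The trivial character leaves one more pair of operators, which preserves the image of
`vacuumProj`. It splits `t` into `invAnnih (invCreate t)` and `invCreate (invAnnih t)`. Both
`invAnnih (invCreate t)` and `invAnnih t` are killed by all annihilation operators, hence are
multiples of the vacuum. -/
lemma eq_add_of_vacuumProj (hz : IsStrongRoot p u z) {t : ((rankOne g h).tpow p).carrier}
    (ht : vacuumProj g h p u z t = t) : t = coeffVac g h p t • vac g h p +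
      coeffVac g h p (invAnnih g h p t) • invCreate g h p u (vac g h p) := by
  have hc : ∀ s, vacuumProj g h p u z (invAnnih g h p s) =
      invAnnih g h p (vacuumProj g h p u z s) :=
    fun s => LinearMap.congr_fun (commute_invAnnih hz).eq.symm s
  have hc' : ∀ s, vacuumProj g h p u z (invCreate g h p u s) =
      invCreate g h p u (vacuumProj g h p u z s) :=
    fun s => LinearMap.congr_fun (commute_invCreate hz).eq.symm s
  have hsq : ∀ s, invAnnih g h p (invAnnih g h p s) = 0 := fun s =>
    LinearMap.congr_fun (wDer_sq (annih_odd g h) (annih_sq g h) p _) s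
  have h1 : ∀ s, invAnnih g h p (invCreate g h p u s) =
      s - invCreate g h p u (invAnnih g h p s) := fun s =>
    eq_sub_of_add_eq (LinearMap.congr_fun (invAnnih_create hz) s)
  have h2 := eq_smul_vac_of_vacuumProj hz (t := invAnnih g h p t) (by rw [hc, ht]) (hsq t)
  have h3 := eq_smul_vac_of_vacuumProj hz (t := invAnnih g h p (invCreate g h p u t))
    (by rw [hc, hc', ht]) (hsq _)
  rw [h1, map_sub, coeffVac_invCreate, sub_zero, sub_eq_iff_eq_add] at h3
  conv_lhs => rw [h3, h2, map_smul]

end RankOne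

end MF

end

end AdamsMF

namespace AdamsMF

noncomputable section

/-! ### The Adams operation on a rank-one factorization -/

namespace MF

variable {Q : Type u} [CommRing Q] {g h : Q} {p : ℕ} {u z : Q}

/-- The joint kernel is spanned by the vacuum and its image under `invCreate`. The cycle fixes the
vacuum, a product of equal even vectors, and commutes with `invCreate`, whose weights are constant.
-/
lemma rot_vacuum (hz : IsStrongRoot p u z) {t : ((rankOne g h).tpow p).carrier}
    (ht : vacuumProj g h p u z t = t) : (rankOne g h).rot p t = t := by
  have h1 : (rankOne g h).rot p * invCreate g h p u = invCreate g h p u * (rankOne g h).rot p := by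
    have h2 := rot_charDer hz (create_odd g h) 0
    rw [charDer_zero, zero_mul, pow_zero, one_smul] at h2
    rw [invCreate, mul_smul_comm, h2, smul_mul_assoc]
  have h3 : (rankOne g h).rot p (invCreate g h p u (vac g h p)) =
      invCreate g h p u (vac g h p) := by
    refine (LinearMap.congr_fun h1 (vac g h p)).trans ?_
    exact congrArg (invCreate g h p u) (rot_vac p)
  have h4 := eq_add_of_vacuumProj hz ht
  conv_lhs => rw [h4, map_add, map_smul, map_smul, h3, rot_vac, ← h4]

/-- The inclusion of the rank-one factorization into its tensor power. -/
def vacuumIncl (g h : Q) (p : ℕ) (u : Q) :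
    (rankOne g h).carrier →ₗ[Q] ((rankOne g h).tpow p).carrier :=
  (LinearMap.toSpanSingleton Q _ (vac g h p)).coprod
    (LinearMap.toSpanSingleton Q _ (invCreate g h p u (vac g h p)))

/-- The coordinates of the vacuum vectors. -/
def vacuumCoord (g h : Q) (p : ℕ) :
    ((rankOne g h).tpow p).carrier →ₗ[Q] (rankOne g h).carrier :=
  (coeffVac g h p).prod (coeffVac g h p ∘ₗ invAnnih g h p)

lemma vacuumIncl_apply (x : (rankOne g h).carrier) : vacuumIncl g h p u x =
    (show Q × Q from x).1 • vac g h p +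
      (show Q × Q from x).2 • invCreate g h p u (vac g h p) := rfl

lemma vacuumIncl_coord (hz : IsStrongRoot p u z) {t : ((rankOne g h).tpow p).carrier}
    (ht : vacuumProj g h p u z t = t) : vacuumIncl g h p u (vacuumCoord g h p t) = t :=
  (eq_add_of_vacuumProj hz ht).symm

lemma vacuumProj_incl (hz : IsStrongRoot p u z) (x : (rankOne g h).carrier) :
    vacuumProj g h p u z (vacuumIncl g h p u x) = vacuumIncl g h p u x := by
  have h1 : vacuumProj g h p u z (invCreate g h p u (vac g h p)) =
      invCreate g h p u (vac g h p) := by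
    refine (LinearMap.congr_fun (commute_invCreate hz).eq.symm (vac g h p)).trans ?_
    exact congrArg (invCreate g h p u) (vacuumProj_vac hz)
  rw [vacuumIncl_apply, map_add, map_smul, map_smul, vacuumProj_vac hz, h1]

lemma vacuumCoord_incl (hz : IsStrongRoot p u z) (x : (rankOne g h).carrier) :
    vacuumCoord g h p (vacuumIncl g h p u x) = x := by
  have h1 : invAnnih g h p (invCreate g h p u (vac g h p)) = vac g h p := by
    refine (eq_sub_of_add_eq (LinearMap.congr_fun (invAnnih_create hz) (vac g h p))).trans ?_
    change vac g h p - invCreate g h p u (invAnnih g h p (vac g h p)) = _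
    rw [invAnnih_vac, map_zero, sub_zero]
  rw [vacuumIncl_apply]
  refine Prod.ext ?_ ?_
  · change coeffVac g h p (_ + _) = (show Q × Q from x).1
    rw [map_add, map_smul, map_smul, coeffVac_invCreate, coeffVac_vac, smul_zero, add_zero,
      smul_eq_mul, mul_one]
  · change coeffVac g h p (invAnnih g h p (_ + _)) = (show Q × Q from x).2
    rw [map_add, map_smul, map_smul, invAnnih_vac, smul_zero, zero_add, h1, map_smul, coeffVac_vac,
      smul_eq_mul, mul_one]

/-- With `e = invCreate vac`, the differential of the tensor power maps the vacuum to `h p e` and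
`e` to `g vac`. The functor `mult u` divides the component from even to odd by `p`, which leaves
`(g, h)`. -/
lemma isHom_vacuumIncl (hz : IsStrongRoot p u z) (hu : u * (p * (g * h)) = g * h) :
    IsHom (P := rankOne g h) (P' := (((rankOne g h).tpow p).mult u).ofEq hu)
      (vacuumIncl g h p u) := by
  have h0 := hasDeg_vac (g := g) (h := h) p
  have h1 : ((rankOne g h).tpow p).HasDeg (invCreate g h p u (vac g h p)) true := by
    have h2 := even_apply_of_odd (P := (rankOne g h).tpow p)
      (smul_odd (wDer_odd (create_odd g h) p fun _ => 1) u) (vac g h p)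
    rw [h0.even_eq] at h2
    have h3 : ((rankOne g h).tpow p).even (invCreate g h p u (vac g h p)) = 0 :=
      h2.trans (sub_self _)
    refine (odd_apply _ _).trans ?_
    rw [h3, sub_zero]
    rfl
  have hd : ((rankOne g h).tpow p).d (vac g h p) = (h * p) • invCreate g h p u (vac g h p) := by
    rw [d_vac, invCreate, LinearMap.smul_apply, smul_smul, mul_assoc, mul_comm (p : Q) u, hz.inv_mul,
      mul_one]
  have hsq : ∀ s, invCreate g h p u (invCreate g h p u s) = 0 := fun s => by
    have h3 : invCreate g h p u * invCreate g h p u = 0 := by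
      rw [invCreate, smul_mul_smul_comm, wDer_sq (create_odd g h) (create_sq g h), smul_zero]
    exact LinearMap.congr_fun h3 s
  have hd' : ((rankOne g h).tpow p).d (invCreate g h p u (vac g h p)) = g • vac g h p := by
    have h3 := d_wDer (create_odd g h) (d_create g h) p fun _ => 1
    have h4 : ((rankOne g h).tpow p).d * invCreate g h p u +
        invCreate g h p u * ((rankOne g h).tpow p).d = g • 1 := by
      rw [invCreate, mul_smul_comm, smul_mul_assoc, ← smul_add, h3, smul_smul]
      simp [← mul_assoc, hz.inv_mul]
    refine (eq_sub_of_add_eq (LinearMap.congr_fun h4 (vac g h p))).trans ?_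
    change g • vac g h p - invCreate g h p u (((rankOne g h).tpow p).d (vac g h p)) = _
    rw [hd, map_smul, hsq, smul_zero, sub_zero]
  have e1 := h0.mult_d u
  have e2 := h1.mult_d u
  rw [hd, smul_smul] at e1
  rw [hd', smul_smul] at e2
  have e3 : cond₁ u (!false) * (h * p) = h := by
    change u * (h * p) = h
    rw [mul_comm h, ← mul_assoc, hz.inv_mul, one_mul]
  have e4 : cond₁ u (!true) * g = g := one_mul g
  rw [e3] at e1
  rw [e4] at e2
  refine ⟨LinearMap.ext fun x : Q × Q => ?_, LinearMap.ext fun x : Q × Q => ?_⟩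
  · change x.1 • vac g h p + (0 : Q) • _ = ((rankOne g h).tpow p).even (x.1 • _ + x.2 • _)
    rw [map_add, map_smul, map_smul, h0.even_eq, h1.even_eq]
    simp
  · change (g • x.2 + 0) • vac g h p + (0 + h • x.1) • invCreate g h p u (vac g h p) =
      (((rankOne g h).tpow p).mult u).d (x.1 • vac g h p + x.2 • invCreate g h p u (vac g h p))
    refine Eq.trans ?_ (map_add _ _ _).symm
    refine Eq.trans ?_ (congrArg₂ (· + ·) ((map_smul _ _ _).trans (congrArg (x.1 • ·) e1))
      ((map_smul _ _ _).trans (congrArg (x.2 • ·) e2))).symm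
    change _ = x.1 • h • invCreate g h p u (vac g h p) + x.2 • g • vac g h p
    simp only [smul_eq_mul]
    module

lemma isRetract_rankOne (hz : IsStrongRoot p u z) (hu : u * (p * (g * h)) = g * h) :
    IsRetract (rankOne g h) ((((rankOne g h).tpow p).mult u).ofEq hu) (vacuumProj g h p u z) := by
  have hC := isCliffordSystem_rankOne g h hz
  refine IsRetract.of_section (i := vacuumIncl g h p u)
    (r := vacuumCoord g h p ∘ₗ vacuumProj g h p u z) (isHom_vacuumIncl hz hu)
    (((hC.isHom_vacProj le_rfl).mult u).ofEq hu) (fun x => ?_) fun x => ?_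
  · exact (congrArg (vacuumCoord g h p) (vacuumProj_incl hz x)).trans (vacuumCoord_incl hz x)
  · exact vacuumIncl_coord hz (LinearMap.congr_fun (hC.vacProj_idem le_rfl) x)

end MF

section K0

variable {Q : Type u} [CommRing Q] {p : ℕ} [Algebra (Ap p) Q]

/-- Restricting successively to the kernels of the `p - 1` annihilation operators multiplies the sum
over eigenvalues by `p`. In the joint kernel the cycle acts as the identity, so only the term with
eigenvalue `1` survives there, and its class is that of `(g, h)`. -/
lemma cPsi_rankOne (hp : p.Prime) (g h : Q) :
    cPsi hp (K0.mk (MFZ.rankOne g h)) = p • K0.mk (MFZ.rankOne g h) := by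
  have hz := isStrongRoot_zetaQ Q hp
  have hC := MF.isCliffordSystem_rankOne g h hz
  have hσ := (MF.rankOne g h).rot_isHom p
  have hσp := (MF.rankOne g h).rot_pow p
  have hT : ((MF.rankOne g h).tpow p).support ⊆ PrimeSpectrum.zeroLocus {g, h} := by
    obtain ⟨n, hn⟩ : ∃ n, p = n + 1 := ⟨p - 1, (Nat.sub_add_cancel hp.one_le).symm⟩
    rw [hn]
    exact (MF.support_tpow_succ _ n).trans (MF.support_rankOne g h)
  obtain ⟨R, hR⟩ := hC.exists_isRetract hz hσ hσp hT
  have hπ : ∀ t, eigProj p (invQ p Q) (zetaQ p Q ^ 0) ((MF.rankOne g h).rot p)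
      (MF.vacuumProj g h p (invQ p Q) (zetaQ p Q) t) =
        MF.vacuumProj g h p (invQ p Q) (zetaQ p Q) t := fun t =>
    eigProj_apply_of_mem hp.pos (invQ_mul Q hp) (hz.pow_pow_eq_one 0) (by
      rw [pow_zero, one_smul]
      exact MF.rot_vacuum hz (LinearMap.congr_fun (hC.vacProj_idem le_rfl) t))
  have h0 : ∀ k, K0.mk (R 0 k) = K0.mk ((MFZ.rankOne g h).eig hp k) := fun k =>
    K0.mk_eq_of_isRetract_same ((hR 0 (Nat.zero_le _) k).congr (one_mul _))
      ((MFZ.rankOne g h).isRetract_eig hp k)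
  have hper : ∀ m ≤ p - 1, ∀ k, K0.mk (R m (k + p)) = K0.mk (R m k) := fun m hm k => by
    have h1 := hR m hm (k + p)
    rw [pow_add, hz.pow_eq_one, mul_one] at h1
    exact K0.mk_eq_of_isRetract_same h1 (hR m hm k)
  have hzero : ∀ k ∈ Finset.range p, k ≠ 0 → K0.mk (R (p - 1) k) = 0 := fun k hk hk0 => by
    refine K0.mk_eq_zero_of_isRetract ((hR (p - 1) le_rfl k).congr ?_)
    rw [hC.vacProj_eigProj hz le_rfl]
    refine LinearMap.ext fun t => eigProj_apply_eq_zero (ζ' := zetaQ p Q ^ 0) hp.pos hσp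
      (hz.pow_pow_eq_one k) ?_ (hz.isUnit_pow_sub_pow ?_)
    · rw [pow_zero, one_smul]
      exact MF.rot_vacuum hz (LinearMap.congr_fun (hC.vacProj_idem le_rfl) t)
    · rw [Nat.zero_mod, Nat.mod_eq_of_lt (Finset.mem_range.1 hk)]
      exact hk0.symm
  have hone : K0.multInv hp (K0.mk (R (p - 1) 0)) = K0.mk (MFZ.rankOne g h) := by
    have h1 := ((hR (p - 1) le_rfl 0).congr (η := MF.vacuumProj g h p (invQ p Q) (zetaQ p Q)) (by
      rw [hC.vacProj_eigProj hz le_rfl]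
      exact LinearMap.ext hπ)).mult (invQ p Q)
    refine (K0.mult_mk _ _ _).trans ?_
    exact K0.mk_eq_of_isRetract_same (h1.ofEq (invQ_mul_mul hp (g * h)))
      (MF.isRetract_rankOne hz (invQ_mul_mul hp (g * h)))
  -- Stage `m` consists of the eigenspaces in the joint kernel of the first `m` annihilation
  -- operators: stage `0` is the sum that defines `ψ`, and stage `p - 1` is the image of
  -- `vacuumProj`.
  have hsum := sum_zetaZ_strip hp (F := fun m k => K0.multInv hp (K0.mk (R m k)))
    (fun m hm k => congrArg (K0.multInv hp) (hper m hm k)) fun m hm k => by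
      rw [← map_sub]
      exact congrArg (K0.multInv hp) (hC.mk_step hz hσ hσp hT hm k (hR m hm.le k) (hR (m + 1) hm k)
        (hR (m + 1) hm _))
  refine injective_one_tmul hp ?_
  change (1 : Zzeta p) ⊗ₜ[ℤ] _ = (1 : Zzeta p) ⊗ₜ[ℤ] _
  rw [one_tmul_cPsi, zetaSum]
  refine Eq.trans (Finset.sum_congr rfl fun k _ => ?_) (hsum.trans ?_)
  · rw [t_mk, K0.mk_t, h0]
    rfl
  · rw [Finset.sum_eq_single_of_mem 0 (Finset.mem_range.2 hp.pos) fun k hk hk0 => by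
      rw [hzero k hk hk0, map_zero, TensorProduct.tmul_zero], hone, pow_zero,
      TensorProduct.tmul_smul]

end K0

end

end AdamsMF

theorem theorem2p3 {p : ℕ} (hp : p.Prime) {Q : Type u} [CommRing Q] [IsNoetherianRing Q]
    [Algebra (Ap p) Q] :
    -- `ψ` is well defined: every class is the class of an object, `t_ζ [P]` does not depend on the
    -- choice of `P`, and `∑ ζ t_ζ` takes values in the subgroup `K₀` of `ℤ[e^{2πi/p}] ⊗ K₀`
    (∀ (f : Q) (Z : Set (PrimeSpectrum Q)), IsClosed Z →
      Function.Surjective (K0.mk : MFZ Z f → K0 Z f) ∧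
      (∀ (k : ℕ) (P : MFZ Z f), t hp k (K0.mk P) = K0.mk (MFZ.t hp k P)) ∧
      Function.Injective (fun y : K0 Z f => (1 : Zzeta p) ⊗ₜ[ℤ] y) ∧
      ∀ x : K0 Z f, (1 : Zzeta p) ⊗ₜ[ℤ] cPsi hp x = zetaSum hp x) ∧
    -- (1) `ψ` is a group endomorphism
    (∀ (f : Q) (Z : Set (PrimeSpectrum Q)), IsClosed Z →
      ∀ x y : K0 Z f, cPsi hp (x + y) = cPsi hp x + cPsi hp y) ∧
    -- (2) the tensor product induces a product on Grothendieck groups, and `ψ` respects it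
    (∀ (f₁ f₂ : Q) (Z W : Set (PrimeSpectrum Q)), IsClosed Z → IsClosed W →
      ∃ cup : K0 Z f₁ →+ K0 W f₂ →+ K0 (Z ∩ W) (f₁ + f₂),
        (∀ (P : MFZ Z f₁) (P' : MFZ W f₂),
          cup (K0.mk P) (K0.mk P') = K0.mk (P.tensor P')) ∧
        ∀ (x : K0 Z f₁) (y : K0 W f₂), cPsi hp (cup x y) = cup (cPsi hp x) (cPsi hp y)) ∧
    -- (3) extension of scalars induces a map on Grothendieck groups that commutes with `ψ`
    (∀ (Q' : Type u) [CommRing Q'] [IsNoetherianRing Q'] [Algebra (Ap p) Q'] [Algebra Q Q']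
      [IsScalarTower (Ap p) Q Q'] (f : Q) (Z : Set (PrimeSpectrum Q))
      (Z' : Set (PrimeSpectrum Q')), IsClosed Z → IsClosed Z' →
      ∀ hZ : PrimeSpectrum.comap (algebraMap Q Q') ⁻¹' Z ⊆ Z',
      ∃ φ : K0 Z f →+ K0 Z' (algebraMap Q Q' f),
        (∀ P : MFZ Z f, φ (K0.mk P) = K0.mk (P.baseChange Q' hZ)) ∧
        ∀ x : K0 Z f, φ (cPsi hp x) = cPsi hp (φ x)) ∧
    -- (4) the value on a rank-one factorization
    (∀ g h : Q, cPsi hp (K0.mk (MFZ.rankOne g h)) = p • K0.mk (MFZ.rankOne g h)) := by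
  refine ⟨fun f Z _ => ⟨K0.mk_surjective, fun k P => t_mk hp k P, injective_one_tmul hp,
    fun x => one_tmul_cPsi hp x⟩, fun f Z _ x y => cPsi_add hp x y,
    fun f₁ f₂ Z W _ _ => ⟨K0.cup subset_rfl rfl, fun P P' => K0.cup_mk _ _ P P',
      fun x y => cPsi_cup hp _ _ x y⟩, ?_, fun g h => cPsi_rankOne hp g h⟩
  intro Q' _ _ _ _ _ f Z Z' _ _ hZ
  exact ⟨K0.baseChange Q' hZ, fun P => K0.baseChange_mk Q' hZ P,
    fun x => K0.baseChange_cPsi Q' hp hZ x⟩
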